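/- **Conventions.** Let $\mathbb F$ be $\mathbb R$ or $\mathbb C$. A *graded C\*-category* is a small, not necessarily unital category $\mathcal A$ whose morphism sets are Banach spaces over $\mathbb F$, with bilinear composition, $\|xy\|\le\|x\|\|y\|$, a conjugate-linear involution $x\mapsto x^\star$ reversing composition, $\|x^\star x\|=\|x\|^2$, $x^\star x$ positive (spectrum in $[0,\infty)$), and a decomposition $\mathrm{Hom}(A,B)=\mathrm{Hom}(A,B)_0\oplus\mathrm{Hom}(A,B)_1$ into closed subspaces, preserved by the involution, with $\deg(xy)=\deg x+\deg y$ mod $2$. It is *$\sigma$-unital* if every endomorphism algebra has a countable approximate unit. Graded C\*-functors are $\mathbb F$-linear functors (not necessarily unital) preserving the involution and the degree. A graded Hilbert $\mathcal B$-module $\mathcal E$ consists of graded Banach spaces $\mathcal E(B)$, $B\in\mathrm{Ob}(\mathcal B)$, with a right action of the morphisms of $\mathcal B$ and a compatible positive $\mathcal B$-valued inner product $\langle\eta,\xi\rangle\in\mathrm{Hom}(A,B)$ ($\eta\in\mathcal E(B)$, $\xi\in\mathcal E(A)$) inducing the norm; all Hilbert modules are assumed to be countably generated. Bounded operators $T\colon\mathcal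 E\to\mathcal F$ are adjointable families $T_B\colon\mathcal E(B)\to\mathcal F(B)$ with $\sup_B\|T_B\|<\infty$; they form a graded C\*-category $\mathcal L(\mathcal B)$. An operator is *compact* if it is a norm limit of linear combinations of the operators $\zeta\mapsto\eta\langle\xi,\zeta\rangle$. A *graded Hilbert $(\mathcal A,\mathcal B)$-bimodule* is a graded C\*-functor $\mathcal E\colon\mathcal A\to\mathcal L(\mathcal B)$, $A\mapsto\mathcal E(-,A)$. An *operator* $T\colon\mathcal E\to\mathcal F$ of bimodules is a (not necessarily natural) family of bounded operators $T_A\colon\mathcal E(-,A)\to\mathcal F(-,A)$ with $\|T\|=\sup_A\|T_A\|<\infty$. (To avoid set-theoretic problems, Hilbert $\mathcal B$-modules are taken in the universe of $\mathcal B$.) **The dual category.** $\mathcal D(\mathcal A,\mathcal B)$ has as objects the graded Hilbert $(\mathcal A,\mathcal B)$-bimodules and as morphisms the operators $T\colon\mathcal E\to\mathcal F$ whose graded commutators $xT_A-(-1)^{\deg x\deg T}T_{A'}x$ are compact for all $x\in\mathrm{Hom}(A,A')_{\mathcal A}$. $\mathcal{KD}(\mathcal A,\mathcal B)$ is the ideal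 of those $T$ for which all $T_{A'}x$ and $xT_A$ are compact, and $\mathcal{QD}(\mathcal A,\mathcal B)=\mathcal D(\mathcal A,\mathcal B)/\mathcal{KD}(\mathcal A,\mathcal B)$, with the quotient norm. **$K_1$.** For a unital graded C\*-category $\mathcal C$ and a finite formal sum $P$ of objects (an object of the additive completion $\mathcal C_\oplus$, whose morphisms are matrices), let $SS(P)=\{x\in\mathrm{Hom}(P,P)_1: x=x^\star,\ x^2=1\}$, with the norm topology. Let $G_1(\mathcal C)$ be the abelian group generated by the path components $\langle x\rangle$ of all the spaces $SS(P)$ subject to $\langle x\oplus y\rangle=\langle x\rangle+\langle y\rangle$, and let $$K_1(\mathcal C)=\{\langle x\rangle-\langle y\rangle\in G_1(\mathcal C): x,y\in SS(P),\ P\in\mathrm{Ob}(\mathcal C_\oplus)\}.$$ **$KK$.** A *Kasparov $(\mathcal A,\mathcal B)$-cycle* $(\mathcal E,F)$ is a bimodule with an operator $F\colon\mathcal E\to\mathcal E$ of degree $1$ such that $x(F_A-F_A^\star)$, $x(F_A^2-1)$ and $xF_A-(-1)^{\deg x}F_{A'}x$ are compact for all $x\in\mathrm{Hom}(A,A')_{\mathcal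 A}$; it is *degenerate* if these operators all vanish. Two cycles are *equivalent* if, after adding degenerate cycles, they become operator homotopic, i.e. (up to a degree $0$ unitary isomorphism of bimodules intertwining the action of $\mathcal A$) joined by a norm continuous path of cycles $(\mathcal E,F_t)$ on one bimodule. $KK(\mathcal A,\mathcal B)$ is the set of equivalence classes. **Theorem.** Any two Kasparov $(\mathcal A,\mathcal B)$-cycles have a direct sum, and direct sum makes $KK(\mathcal A,\mathcal B)$ an abelian group. For all small $\sigma$-unital graded C\*-categories $\mathcal A,\mathcal B$ over $\mathbb F$ there is an isomorphism of abelian groups $$\Phi_{\mathcal A,\mathcal B}\colon K_1\,\mathcal{QD}(\mathcal A,\mathcal B)\ \xrightarrow{\ \cong\ }\ KK(\mathcal A,\mathcal B),$$ natural in both variables: * for every graded C\*-functor $H\colon\mathcal A'\to\mathcal A$ between small $\sigma$-unital graded C\*-categories, $\Phi$ intertwines the maps induced by $\mathcal E\mapsto\mathcal E\circ H$, $T\mapsto(T_{H(A)})_A$ on $K_1\mathcal{QD}(\mathcal A,\mathcal B)\to K_1\mathcal{QD}(\mathcal A',\mathcal B)$ and on $KK(\mathcal A,\mathcal B)\to KK(\mathcal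 A',\mathcal B)$; * for every graded C\*-functor $G\colon\mathcal B\to\mathcal B'$ between small $\sigma$-unital graded C\*-categories, the inner tensor products $\mathcal E\hat\otimes_G\mathcal B'$ exist, $\mathcal E\mapsto\mathcal E\hat\otimes_G\mathcal B'$, $T\mapsto T\otimes1$ induces well-defined maps $K_1\mathcal{QD}(\mathcal A,\mathcal B)\to K_1\mathcal{QD}(\mathcal A,\mathcal B')$ (a homomorphism) and $KK(\mathcal A,\mathcal B)\to KK(\mathcal A,\mathcal B')$, and $\Phi$ intertwines them. -/

import Mathlib

open scoped ENNReal

universe u v u' v'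

noncomputable section

/-! ## Graded C*-categories -/

/-- A (not necessarily unital) graded `⋆`-category over `𝕜` with normed morphism spaces.
`comp x y` is the composite `x ∘ y`. The grading is recorded by its grading automorphism `gr`:
morphisms of degree `0` are those with `gr x = x`, morphisms of degree `1` those with
`gr x = -x`, so that every morphism is uniquely the sum of a morphism of degree `0` and one of
degree `1`, and `gr x = (-1) ^ deg x • x` on homogeneous morphisms. -/
structure GradedStarCategory (𝕜 : Type) [RCLike 𝕜] : Type (max (u + 1) (v + 1)) where
  Obj : Type u
  Hom : Obj → Obj → Type v
  [normed : ∀ a b, NormedAddCommGroup (Hom a b)]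
  [space : ∀ a b, NormedSpace 𝕜 (Hom a b)]
  comp : ∀ {a b c : Obj}, Hom b c → Hom a b → Hom a c
  adj : ∀ {a b : Obj}, Hom a b → Hom b a
  gr : ∀ {a b : Obj}, Hom a b → Hom a b
  add_comp : ∀ {a b c : Obj} (x y : Hom b c) (z : Hom a b),
    comp (x + y) z = comp x z + comp y z
  comp_add : ∀ {a b c : Obj} (x : Hom b c) (y z : Hom a b),
    comp x (y + z) = comp x y + comp x z
  smul_comp : ∀ {a b c : Obj} (r : 𝕜) (x : Hom b c) (y : Hom a b),
    comp (r • x) y = r • comp x y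
  comp_smul : ∀ {a b c : Obj} (r : 𝕜) (x : Hom b c) (y : Hom a b),
    comp x (r • y) = r • comp x y
  assoc : ∀ {a b c d : Obj} (x : Hom c d) (y : Hom b c) (z : Hom a b),
    comp (comp x y) z = comp x (comp y z)
  adj_add : ∀ {a b : Obj} (x y : Hom a b), adj (x + y) = adj x + adj y
  adj_smul : ∀ {a b : Obj} (r : 𝕜) (x : Hom a b), adj (r • x) = (starRingEnd 𝕜 r) • adj x
  adj_comp : ∀ {a b c : Obj} (x : Hom b c) (y : Hom a b),
    adj (comp x y) = comp (adj y) (adj x)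
  adj_adj : ∀ {a b : Obj} (x : Hom a b), adj (adj x) = x
  gr_add : ∀ {a b : Obj} (x y : Hom a b), gr (x + y) = gr x + gr y
  gr_smul : ∀ {a b : Obj} (r : 𝕜) (x : Hom a b), gr (r • x) = r • gr x
  gr_gr : ∀ {a b : Obj} (x : Hom a b), gr (gr x) = x
  gr_comp : ∀ {a b c : Obj} (x : Hom b c) (y : Hom a b), gr (comp x y) = comp (gr x) (gr y)
  gr_adj : ∀ {a b : Obj} (x : Hom a b), gr (adj x) = adj (gr x)

attribute [instance] GradedStarCategory.normed GradedStarCategory.space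

namespace GradedStarCategory

variable {𝕜 : Type} [RCLike 𝕜]

/-- Positivity of an endomorphism: it is self-adjoint and its spectrum is contained in `[0, ∞)`.
The spectrum is that of the unitization: `t + h` is invertible there, with inverse
`t⁻¹ (1 - k)`, for every real `t > 0`. -/
def IsPositive (C : GradedStarCategory.{u, v} 𝕜) {a : C.Obj} (h : C.Hom a a) : Prop :=
  C.adj h = h ∧ ∀ t : ℝ, 0 < t → ∃ k : C.Hom a a,
    (t : 𝕜) • k + C.comp h k = h ∧ (t : 𝕜) • k + C.comp k h = h

end GradedStarCategory

/-- A small graded C*-category over `𝕜` (that is, over the real or the complex numbers), not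
necessarily unital. -/
structure GradedCStarCategory (𝕜 : Type) [RCLike 𝕜] : Type (u + 1) extends
    GradedStarCategory.{u, u} 𝕜 where
  [complete : ∀ a b, CompleteSpace (Hom a b)]
  norm_comp_le : ∀ {a b c : Obj} (x : Hom b c) (y : Hom a b), ‖comp x y‖ ≤ ‖x‖ * ‖y‖
  norm_adj_comp_self : ∀ {a b : Obj} (x : Hom a b), ‖comp (adj x) x‖ = ‖x‖ ^ 2
  positive_adj_comp_self : ∀ {a b : Obj} (x : Hom a b),
    toGradedStarCategory.IsPositive (comp (adj x) x)
  continuous_gr : ∀ {a b : Obj}, Continuous (gr : Hom a b → Hom a b)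

attribute [instance] GradedCStarCategory.complete

/-- Each endomorphism algebra has a countable approximate unit. -/
def GradedCStarCategory.SigmaUnital {𝕜 : Type} [RCLike 𝕜]
    (C : GradedCStarCategory.{u} 𝕜) : Prop :=
  ∀ a : C.Obj, ∃ e : ℕ → C.Hom a a, ∀ (x : C.Hom a a) (ε : ℝ), 0 < ε →
    (∃ n, ‖C.comp x (e n) - x‖ < ε) ∧ (∃ n, ‖C.comp (e n) x - x‖ < ε)

/-- A graded C*-functor (units, if there are any, need not be preserved). -/
structure GradedFunctor {𝕜 : Type} [RCLike 𝕜] (C : GradedStarCategory.{u, v} 𝕜)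
    (D : GradedStarCategory.{u', v'} 𝕜) : Type (max u v u' v') where
  obj : C.Obj → D.Obj
  map : ∀ {a b : C.Obj}, C.Hom a b → D.Hom (obj a) (obj b)
  map_add : ∀ {a b : C.Obj} (x y : C.Hom a b), map (x + y) = map x + map y
  map_smul : ∀ {a b : C.Obj} (r : 𝕜) (x : C.Hom a b), map (r • x) = r • map x
  map_comp : ∀ {a b c : C.Obj} (x : C.Hom b c) (y : C.Hom a b),
    map (C.comp x y) = D.comp (map x) (map y)
  map_adj : ∀ {a b : C.Obj} (x : C.Hom a b), map (C.adj x) = D.adj (map x)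
  map_gr : ∀ {a b : C.Obj} (x : C.Hom a b), map (C.gr x) = D.gr (map x)

namespace GradedCStarCategory

variable {𝕜 : Type} [RCLike 𝕜] (C : GradedCStarCategory.{u} 𝕜)

theorem norm_adj {a b : C.Obj} (x : C.Hom a b) : ‖C.adj x‖ = ‖x‖ := by
  have key : ∀ {a b : C.Obj} (x : C.Hom a b), ‖x‖ ≤ ‖C.adj x‖ := by
    intro a b x
    have h1 := C.norm_adj_comp_self x
    have h2 := C.norm_comp_le (C.adj x) x
    by_contra hlt
    push Not at hlt
    have h3 : 0 ≤ ‖C.adj x‖ := norm_nonneg _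
    nlinarith
  refine le_antisymm ?_ (key x)
  simpa [C.adj_adj] using key (C.adj x)

theorem adj_zero {a b : C.Obj} : C.adj (0 : C.Hom a b) = 0 := by
  have := C.norm_adj (0 : C.Hom a b)
  simpa using this

theorem norm_gr_le {a b : C.Obj} (x : C.Hom a b) : ‖C.gr x‖ ≤ ‖x‖ := by
  -- it suffices to treat self-adjoint endomorphisms
  have main : ∀ (a : C.Obj) (h : C.Hom a a), C.adj h = h → ‖C.gr h‖ ≤ ‖h‖ := by
    intro a
    let g : C.Hom a a →L[𝕜] C.Hom a a :=
      { toFun := C.gr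
        map_add' := C.gr_add
        map_smul' := C.gr_smul
        cont := C.continuous_gr }
    have sq : ∀ h : C.Hom a a, C.adj h = h → ‖C.comp h h‖ = ‖h‖ ^ 2 := by
      intro h hh
      have := C.norm_adj_comp_self h
      rwa [hh] at this
    have pow : ∀ (n : ℕ) (h : C.Hom a a), C.adj h = h →
        ‖C.gr h‖ ^ (2 ^ n) ≤ ‖g‖ * ‖h‖ ^ (2 ^ n) := by
      intro n
      induction n with
      | zero =>
        intro h _
        simpa using (show ‖C.gr h‖ ≤ ‖g‖ * ‖h‖ from g.le_opNorm h)
      | succ n ih =>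
        intro h hh
        have h1 : C.adj (C.comp h h) = C.comp h h := by rw [C.adj_comp, hh]
        have h2 : C.adj (C.gr h) = C.gr h := by rw [← C.gr_adj, hh]
        have := ih _ h1
        rw [C.gr_comp, sq _ h2, sq _ hh, ← pow_mul, ← pow_mul] at this
        rwa [pow_succ' 2 n]
    intro h hh
    by_contra hlt
    push Not at hlt
    have hpos : 0 < ‖C.gr h‖ := lt_of_le_of_lt (norm_nonneg _) hlt
    rcases eq_or_lt_of_le (norm_nonneg h) with h0 | h0
    · have : ‖C.gr h‖ ≤ ‖g‖ * ‖h‖ := g.le_opNorm h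
      rw [← h0, mul_zero] at this
      exact absurd this (not_le.mpr hpos)
    · have hr : 1 < ‖C.gr h‖ / ‖h‖ := (one_lt_div h0).2 hlt
      obtain ⟨n, hn⟩ := pow_unbounded_of_one_lt ‖g‖ hr
      have h3 : ‖g‖ < (‖C.gr h‖ / ‖h‖) ^ (2 ^ n) :=
        lt_of_lt_of_le hn (pow_le_pow_right₀ hr.le (Nat.lt_two_pow_self).le)
      rw [div_pow, lt_div_iff₀ (pow_pos h0 _)] at h3
      exact absurd (pow n h hh) (not_le.mpr h3)
  have h1 := main a (C.comp (C.adj x) x) (by rw [C.adj_comp, C.adj_adj])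
  rw [C.gr_comp, C.gr_adj, C.norm_adj_comp_self, C.norm_adj_comp_self] at h1
  exact (sq_le_sq₀ (norm_nonneg _) (norm_nonneg _)).1 h1

theorem norm_gr {a b : C.Obj} (x : C.Hom a b) : ‖C.gr x‖ = ‖x‖ := by
  refine le_antisymm (C.norm_gr_le x) ?_
  simpa [C.gr_gr] using C.norm_gr_le (C.gr x)

end GradedCStarCategory

/-! ## Graded Hilbert modules and operators -/

/-- A countably generated graded Hilbert module over a graded C*-category `B`. The vector
`act η x` is `η x`; the inner product is linear in the second variable. The grading is recorded
by the operator `gr` which is `(-1) ^ i` on vectors of degree `i`. -/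
structure HilbertModule {𝕜 : Type} [RCLike 𝕜] (B : GradedCStarCategory.{u} 𝕜) :
    Type (u + 1) where
  X : B.Obj → Type u
  [normed : ∀ b, NormedAddCommGroup (X b)]
  [space : ∀ b, NormedSpace 𝕜 (X b)]
  [complete : ∀ b, CompleteSpace (X b)]
  act : ∀ {a b : B.Obj}, X b → B.Hom a b → X a
  inner : ∀ {a b : B.Obj}, X b → X a → B.Hom a b
  gr : ∀ {b : B.Obj}, X b → X b
  add_act : ∀ {a b : B.Obj} (η ξ : X b) (x : B.Hom a b), act (η + ξ) x = act η x + act ξ x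
  act_add : ∀ {a b : B.Obj} (η : X b) (x y : B.Hom a b), act η (x + y) = act η x + act η y
  smul_act : ∀ {a b : B.Obj} (r : 𝕜) (η : X b) (x : B.Hom a b), act (r • η) x = r • act η x
  act_smul : ∀ {a b : B.Obj} (r : 𝕜) (η : X b) (x : B.Hom a b), act η (r • x) = r • act η x
  act_act : ∀ {a b c : B.Obj} (η : X c) (x : B.Hom b c) (y : B.Hom a b),
    act (act η x) y = act η (B.comp x y)
  inner_add : ∀ {a b : B.Obj} (η : X b) (ξ ζ : X a), inner η (ξ + ζ) = inner η ξ + inner η ζ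
  inner_smul : ∀ {a b : B.Obj} (r : 𝕜) (η : X b) (ξ : X a), inner η (r • ξ) = r • inner η ξ
  inner_act : ∀ {a b c : B.Obj} (η : X c) (ξ : X b) (x : B.Hom a b),
    inner η (act ξ x) = B.comp (inner η ξ) x
  adj_inner : ∀ {a b : B.Obj} (η : X b) (ξ : X a), B.adj (inner η ξ) = inner ξ η
  inner_self_positive : ∀ {b : B.Obj} (η : X b), B.IsPositive (inner η η)
  norm_sq : ∀ {b : B.Obj} (η : X b), ‖η‖ ^ 2 = ‖inner η η‖
  gr_add : ∀ {b : B.Obj} (η ξ : X b), gr (η + ξ) = gr η + gr ξ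
  gr_smul : ∀ {b : B.Obj} (r : 𝕜) (η : X b), gr (r • η) = r • gr η
  gr_gr : ∀ {b : B.Obj} (η : X b), gr (gr η) = η
  gr_act : ∀ {a b : B.Obj} (η : X b) (x : B.Hom a b), gr (act η x) = act (gr η) (B.gr x)
  inner_gr : ∀ {a b : B.Obj} (η : X b) (ξ : X a), inner (gr η) (gr ξ) = B.gr (inner η ξ)
  countably_generated : ∃ Ω : Set (Σ b, X b), Ω.Countable ∧ ∀ a : B.Obj,
    Dense (Submodule.span 𝕜 {ζ : X a | ∃ p ∈ Ω, ∃ x : B.Hom a p.1, ζ = act p.2 x} : Set (X a))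

attribute [instance] HilbertModule.normed HilbertModule.space HilbertModule.complete

namespace HilbertModule

variable {𝕜 : Type} [RCLike 𝕜] {B : GradedCStarCategory.{u} 𝕜} (E : HilbertModule B)

theorem inner_zero {a b : B.Obj} (η : E.X b) : E.inner η (0 : E.X a) = 0 := by
  have := E.inner_add η (0 : E.X a) 0
  simpa using this

theorem zero_inner {a b : B.Obj} (η : E.X a) : E.inner (0 : E.X b) η = 0 := by
  rw [← E.adj_inner, E.inner_zero, B.adj_zero]

theorem inner_neg {a b : B.Obj} (η : E.X b) (ξ : E.X a) : E.inner η (-ξ) = -E.inner η ξ := by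
  rw [← neg_one_smul 𝕜 ξ, E.inner_smul, neg_one_smul]

theorem inner_sub {a b : B.Obj} (η : E.X b) (ξ ζ : E.X a) :
    E.inner η (ξ - ζ) = E.inner η ξ - E.inner η ζ := by
  rw [sub_eq_add_neg, E.inner_add, E.inner_neg, ← sub_eq_add_neg]

theorem add_inner {a b : B.Obj} (η ξ : E.X b) (ζ : E.X a) :
    E.inner (η + ξ) ζ = E.inner η ζ + E.inner ξ ζ := by
  rw [← E.adj_inner, E.inner_add, B.adj_add, E.adj_inner, E.adj_inner]

theorem smul_inner {a b : B.Obj} (r : 𝕜) (η : E.X b) (ζ : E.X a) :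
    E.inner (r • η) ζ = (starRingEnd 𝕜 r) • E.inner η ζ := by
  rw [← E.adj_inner, E.inner_smul, B.adj_smul, E.adj_inner]

theorem neg_inner {a b : B.Obj} (η : E.X b) (ξ : E.X a) : E.inner (-η) ξ = -E.inner η ξ := by
  rw [← neg_one_smul 𝕜 η, E.smul_inner]
  simp

theorem sub_inner {a b : B.Obj} (η ξ : E.X b) (ζ : E.X a) :
    E.inner (η - ξ) ζ = E.inner η ζ - E.inner ξ ζ := by
  rw [sub_eq_add_neg, E.add_inner, E.neg_inner, ← sub_eq_add_neg]

theorem eq_zero_of_inner_self {b : B.Obj} (η : E.X b) (h : E.inner η η = 0) : η = 0 := by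
  have := E.norm_sq η
  rw [h, norm_zero] at this
  exact norm_eq_zero.1 (pow_eq_zero_iff (two_ne_zero)|>.1 this)

theorem ext_inner {b : B.Obj} {η ξ : E.X b} (h : ∀ ζ : E.X b, E.inner ζ η = E.inner ζ ξ) :
    η = ξ := by
  rw [← sub_eq_zero]
  apply E.eq_zero_of_inner_self
  rw [E.inner_sub, h, sub_self]

theorem norm_act_le {a b : B.Obj} (η : E.X b) (x : B.Hom a b) :
    ‖E.act η x‖ ≤ ‖η‖ * ‖x‖ := by
  have h1 : E.inner (E.act η x) (E.act η x) = B.comp (B.adj x) (B.comp (E.inner η η) x) := by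
    rw [E.inner_act, ← E.adj_inner, E.inner_act, B.adj_comp, E.adj_inner, B.assoc]
  have h2 : ‖E.act η x‖ ^ 2 ≤ (‖η‖ * ‖x‖) ^ 2 := by
    rw [E.norm_sq, h1]
    calc _ ≤ ‖B.adj x‖ * ‖B.comp (E.inner η η) x‖ := B.norm_comp_le _ _
      _ ≤ ‖B.adj x‖ * (‖E.inner η η‖ * ‖x‖) := by
          gcongr
          exact B.norm_comp_le _ _
      _ = _ := by rw [B.norm_adj, ← E.norm_sq]; ring
  exact (sq_le_sq₀ (norm_nonneg _) (by positivity)).1 h2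

theorem norm_gr {b : B.Obj} (η : E.X b) : ‖E.gr η‖ = ‖η‖ := by
  have h : ‖E.gr η‖ ^ 2 = ‖η‖ ^ 2 := by
    rw [E.norm_sq, E.norm_sq, E.inner_gr, B.norm_gr]
  exact (sq_eq_sq₀ (norm_nonneg _) (norm_nonneg _)).1 h

/-- A weak form of the Cauchy-Schwarz inequality, which is all that is needed here. -/
theorem norm_inner_le {a b : B.Obj} (η : E.X b) (ξ : E.X a) :
    ‖E.inner η ξ‖ ≤ 3 * ‖η‖ * ‖ξ‖ := by
  set x := E.inner η ξ with hx
  set p := B.comp x (B.adj x) with hp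
  have hpn : ‖p‖ = ‖x‖ ^ 2 := by
    have := B.norm_adj_comp_self (B.adj x)
    rwa [B.adj_adj, B.norm_adj] at this
  have hpa : B.adj p = p := by rw [hp, B.adj_comp, B.adj_adj]
  set ζ := E.act ξ (B.adj x) with hζ
  have hζn : ‖ζ‖ ≤ ‖ξ‖ * ‖x‖ := by
    have := E.norm_act_le ξ (B.adj x)
    rwa [B.norm_adj] at this
  have h1 : E.inner η ζ = p := E.inner_act _ _ _
  have h2 : E.inner ζ η = p := by rw [← E.adj_inner, h1, hpa]
  have key : ∀ s : ℝ, 0 ≤ s →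
      2 * s * ‖x‖ ^ 2 ≤ (s * ‖η‖ + ‖ξ‖ * ‖x‖) ^ 2 + (s * ‖η‖) ^ 2 + (‖ξ‖ * ‖x‖) ^ 2 := by
    intro s hs
    set θ := (s : 𝕜) • η with hθ
    have hθn : ‖θ‖ = s * ‖η‖ := by
      rw [hθ, norm_smul, RCLike.norm_ofReal, abs_of_nonneg hs]
    have h3 : E.inner (θ + ζ) (θ + ζ) = E.inner θ θ + ((2 * s : ℝ) : 𝕜) • p + E.inner ζ ζ := by
      have e1 : E.inner θ ζ = (s : 𝕜) • p := by rw [hθ, E.smul_inner, h1, RCLike.conj_ofReal]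
      have e2 : E.inner ζ θ = (s : 𝕜) • p := by rw [hθ, E.inner_smul, h2]
      rw [E.inner_add, E.add_inner, E.add_inner, e1, e2]
      push_cast
      rw [mul_smul, two_smul]
      abel
    have h4 : ((2 * s : ℝ) : 𝕜) • p
        = E.inner (θ + ζ) (θ + ζ) - E.inner θ θ - E.inner ζ ζ := by
      rw [h3]; abel
    have h5 : 2 * s * ‖x‖ ^ 2 = ‖((2 * s : ℝ) : 𝕜) • p‖ := by
      rw [norm_smul, RCLike.norm_ofReal, abs_of_nonneg (by positivity), hpn]
    rw [h5, h4]
    calc _ ≤ ‖E.inner (θ + ζ) (θ + ζ)‖ + ‖E.inner θ θ‖ + ‖E.inner ζ ζ‖ :=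
          (norm_sub_le _ _).trans (by gcongr; exact norm_sub_le _ _)
      _ = ‖θ + ζ‖ ^ 2 + ‖θ‖ ^ 2 + ‖ζ‖ ^ 2 := by simp only [E.norm_sq]
      _ ≤ _ := by
          have := norm_add_le θ ζ
          rw [hθn] at *
          gcongr
          exact this.trans (by gcongr)
  rcases eq_or_lt_of_le (norm_nonneg x) with hm | hm
  · rw [← hm]; positivity
  rcases eq_or_lt_of_le (norm_nonneg η) with ha | ha
  · have : η = 0 := norm_eq_zero.1 ha.symm
    rw [hx, this, E.zero_inner, norm_zero]
    simp
  rcases eq_or_lt_of_le (norm_nonneg ξ) with hb | hb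
  · have : ξ = 0 := norm_eq_zero.1 hb.symm
    rw [hx, this, E.inner_zero, norm_zero]
    simp
  have h6 := key (‖ξ‖ * ‖x‖ / ‖η‖) (by positivity)
  rw [div_mul_cancel₀ _ ha.ne'] at h6
  have h7 : ‖ξ‖ * ‖x‖ ^ 2 * ‖x‖ ≤ ‖ξ‖ * ‖x‖ ^ 2 * (3 * ‖η‖ * ‖ξ‖) := by
    have h8 : 2 * (‖ξ‖ * ‖x‖ / ‖η‖) * ‖x‖ ^ 2 * ‖η‖ = 2 * (‖ξ‖ * ‖x‖ ^ 2 * ‖x‖) := by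
      field_simp
    have h9 := mul_le_mul_of_nonneg_right h6 ha.le
    rw [h8] at h9
    nlinarith
  exact le_of_mul_le_mul_left h7 (by positivity)

end HilbertModule

/-- The bounded operators `E → F`: families of maps `T b : E(b) → F(b)` that have an adjoint and
whose norm `sup_b ‖T b‖` is finite. -/
def opSubmodule {𝕜 : Type} [RCLike 𝕜] {B : GradedCStarCategory.{u} 𝕜} (E F : HilbertModule B) :
    Submodule 𝕜 (lp (fun b => E.X b →L[𝕜] F.X b) ∞) where
  carrier := {T | ∃ S : ∀ b, F.X b → E.X b, ∀ (a b : B.Obj) (η : F.X b) (ξ : E.X a),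
    F.inner η (T a ξ) = E.inner (S b η) ξ}
  zero_mem' := ⟨fun _ _ => 0, fun a b η ξ => by
    rw [E.zero_inner]
    exact F.inner_zero η⟩
  add_mem' := by
    rintro T T' ⟨S, hS⟩ ⟨S', hS'⟩
    refine ⟨fun b η => S b η + S' b η, fun a b η ξ => ?_⟩
    rw [E.add_inner, ← hS, ← hS', ← F.inner_add]
    rfl
  smul_mem' := by
    rintro r T ⟨S, hS⟩
    refine ⟨fun b η => (starRingEnd 𝕜 r) • S b η, fun a b η ξ => ?_⟩
    rw [E.smul_inner, RCLike.conj_conj, ← hS, ← F.inner_smul]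
    rfl

/-- The type of bounded operators `E → F`, with the norm `sup_b ‖T b‖`. -/
def Op {𝕜 : Type} [RCLike 𝕜] {B : GradedCStarCategory.{u} 𝕜} (E F : HilbertModule B) : Type u :=
  opSubmodule E F

instance {𝕜 : Type} [RCLike 𝕜] {B : GradedCStarCategory.{u} 𝕜} (E F : HilbertModule B) :
    NormedAddCommGroup (Op E F) := inferInstanceAs (NormedAddCommGroup (opSubmodule E F))

instance {𝕜 : Type} [RCLike 𝕜] {B : GradedCStarCategory.{u} 𝕜} (E F : HilbertModule B) :
    NormedSpace 𝕜 (Op E F) := inferInstanceAs (NormedSpace 𝕜 (opSubmodule E F))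

namespace Op

variable {𝕜 : Type} [RCLike 𝕜] {B : GradedCStarCategory.{u} 𝕜} {E F G H : HilbertModule B}

/-- The component `E(b) → F(b)` of an operator. -/
def app (T : Op E F) (b : B.Obj) : E.X b →L[𝕜] F.X b := T.1 b

@[simp] theorem add_app (S T : Op E F) (b : B.Obj) (ξ : E.X b) :
    (S + T).app b ξ = S.app b ξ + T.app b ξ := rfl

@[simp] theorem sub_app (S T : Op E F) (b : B.Obj) (ξ : E.X b) :
    (S - T).app b ξ = S.app b ξ - T.app b ξ := rfl

@[simp] theorem neg_app (T : Op E F) (b : B.Obj) (ξ : E.X b) :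
    (-T).app b ξ = -T.app b ξ := rfl

@[simp] theorem zero_app (b : B.Obj) (ξ : E.X b) : (0 : Op E F).app b ξ = 0 := rfl

@[simp] theorem smul_app (r : 𝕜) (T : Op E F) (b : B.Obj) (ξ : E.X b) :
    (r • T).app b ξ = r • T.app b ξ := rfl

theorem ext {S T : Op E F} (h : ∀ b ξ, S.app b ξ = T.app b ξ) : S = T := by
  apply Subtype.ext
  apply lp.ext
  funext b
  exact ContinuousLinearMap.ext (h b)

theorem norm_app_le (T : Op E F) (b : B.Obj) (ξ : E.X b) : ‖T.app b ξ‖ ≤ ‖T‖ * ‖ξ‖ :=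
  ((T.app b).le_opNorm ξ).trans
    (mul_le_mul_of_nonneg_right (lp.norm_apply_le_norm ENNReal.top_ne_zero T.1 b) (norm_nonneg _))

theorem norm_le (T : Op E F) {C : ℝ} (hC : 0 ≤ C) (h : ∀ b ξ, ‖T.app b ξ‖ ≤ C * ‖ξ‖) :
    ‖T‖ ≤ C :=
  lp.norm_le_of_forall_le (f := T.1) hC fun b =>
    ContinuousLinearMap.opNorm_le_bound _ hC (h b)

/-- An operator from a bounded adjointable family of maps. -/
def mk' (f : ∀ b, E.X b → F.X b) (g : ∀ b, F.X b → E.X b)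
    (hfg : ∀ (a b : B.Obj) (η : F.X b) (ξ : E.X a), F.inner η (f a ξ) = E.inner (g b η) ξ)
    (C : ℝ) (hC : 0 ≤ C) (hb : ∀ b ξ, ‖f b ξ‖ ≤ C * ‖ξ‖) : Op E F :=
  let f' : ∀ b, E.X b →L[𝕜] F.X b := fun b => LinearMap.mkContinuous
    { toFun := f b
      map_add' := fun ξ ζ => F.ext_inner fun η => by
        rw [F.inner_add, hfg, hfg, hfg, E.inner_add]
      map_smul' := fun r ξ => F.ext_inner fun η => by
        rw [RingHom.id_apply, F.inner_smul, hfg, hfg, E.inner_smul] } C (hb b)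
  ⟨⟨f', memℓp_infty ⟨C, by
    rintro _ ⟨b, rfl⟩
    exact LinearMap.mkContinuous_norm_le _ hC _⟩⟩, g, hfg⟩

@[simp] theorem mk'_app (f : ∀ b, E.X b → F.X b) (g : ∀ b, F.X b → E.X b) (hfg) (C : ℝ)
    (hC : 0 ≤ C) (hb : ∀ b ξ, ‖f b ξ‖ ≤ C * ‖ξ‖) (b : B.Obj) (ξ : E.X b) :
    (mk' f g hfg C hC hb).app b ξ = f b ξ := rfl

theorem norm_adjoint_le (T : Op E F) (S : ∀ b, F.X b → E.X b)
    (hS : ∀ (a b : B.Obj) (η : F.X b) (ξ : E.X a),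
      F.inner η (T.app a ξ) = E.inner (S b η) ξ) (b : B.Obj) (η : F.X b) :
    ‖S b η‖ ≤ 3 * ‖T‖ * ‖η‖ := by
  rcases eq_or_lt_of_le (norm_nonneg (S b η)) with h | h
  · rw [← h]; positivity
  · have h1 : ‖S b η‖ ^ 2 ≤ 3 * ‖η‖ * (‖T‖ * ‖S b η‖) := by
      rw [E.norm_sq, ← hS]
      exact (F.norm_inner_le _ _).trans (by gcongr; exact T.norm_app_le b _)
    have h2 : ‖S b η‖ * ‖S b η‖ ≤ ‖S b η‖ * (3 * ‖T‖ * ‖η‖) := by nlinarith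
    exact le_of_mul_le_mul_left h2 h

/-- The adjoint operator. -/
def adj (T : Op E F) : Op F E :=
  mk' (Classical.choose T.2) (fun b => T.app b)
    (fun a b η ξ => by
      rw [← E.adj_inner, ← Classical.choose_spec T.2 b a ξ η, F.adj_inner]
      rfl)
    (3 * ‖T‖) (by positivity) (norm_adjoint_le T _ (Classical.choose_spec T.2))

theorem inner_app (T : Op E F) {a b : B.Obj} (η : F.X b) (ξ : E.X a) :
    F.inner η (T.app a ξ) = E.inner (T.adj.app b η) ξ := Classical.choose_spec T.2 a b η ξ

theorem inner_adj_app (T : Op E F) {a b : B.Obj} (ξ : E.X b) (η : F.X a) :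
    E.inner ξ (T.adj.app a η) = F.inner (T.app b ξ) η := by
  rw [← E.adj_inner, ← inner_app, F.adj_inner]

theorem adj_unique {S : Op F E} {T : Op E F}
    (h : ∀ (b : B.Obj) (ξ : E.X b) (η : F.X b),
      E.inner ξ (S.app b η) = F.inner (T.app b ξ) η) : T.adj = S :=
  ext fun b η => E.ext_inner fun ξ => by rw [h, inner_adj_app]

theorem norm_adj_le (T : Op E F) : ‖T.adj‖ ≤ 3 * ‖T‖ :=
  norm_le _ (by positivity) (norm_adjoint_le T _ fun _ _ η ξ => T.inner_app η ξ)

/-- The identity operator. -/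
def one (E : HilbertModule B) : Op E E :=
  mk' (fun _ ξ => ξ) (fun _ ξ => ξ) (fun _ _ _ _ => rfl) 1 zero_le_one
    fun _ ξ => (one_mul ‖ξ‖).ge

/-- The composite `S ∘ T`. -/
def comp (S : Op F G) (T : Op E F) : Op E G :=
  mk' (fun b ξ => S.app b (T.app b ξ)) (fun b η => T.adj.app b (S.adj.app b η))
    (fun a b η ξ => by rw [inner_app, inner_app]) (‖S‖ * ‖T‖) (by positivity)
    fun b ξ => (S.norm_app_le b _).trans (by
      rw [mul_assoc]
      exact mul_le_mul_of_nonneg_left (T.norm_app_le b ξ) (norm_nonneg _))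

/-- The grading automorphism of the operators: `T` has degree `i` if `gr T = (-1) ^ i • T`. -/
def gr (T : Op E F) : Op E F :=
  mk' (fun b ξ => F.gr (T.app b (E.gr ξ))) (fun b η => E.gr (T.adj.app b (F.gr η)))
    (fun a b η ξ => by
      have h := F.inner_gr (F.gr η) (T.app a (E.gr ξ))
      rw [F.gr_gr] at h
      rw [h, inner_app, ← E.inner_gr, E.gr_gr])
    ‖T‖ (norm_nonneg _) fun b ξ => by
      rw [F.norm_gr]
      simpa [E.norm_gr] using T.norm_app_le b (E.gr ξ)

@[simp] theorem one_app (b : B.Obj) (ξ : E.X b) : (one E).app b ξ = ξ := rfl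

@[simp] theorem comp_app (S : Op F G) (T : Op E F) (b : B.Obj) (ξ : E.X b) :
    (comp S T).app b ξ = S.app b (T.app b ξ) := rfl

@[simp] theorem gr_app (T : Op E F) (b : B.Obj) (ξ : E.X b) :
    T.gr.app b ξ = F.gr (T.app b (E.gr ξ)) := rfl

theorem norm_comp_le (S : Op F G) (T : Op E F) : ‖comp S T‖ ≤ ‖S‖ * ‖T‖ :=
  norm_le _ (by positivity) fun b ξ => (S.norm_app_le b _).trans (by
    rw [mul_assoc]
    exact mul_le_mul_of_nonneg_left (T.norm_app_le b ξ) (norm_nonneg _))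

theorem norm_gr_le (T : Op E F) : ‖T.gr‖ ≤ ‖T‖ :=
  norm_le _ (norm_nonneg _) fun b ξ => by
    rw [gr_app, F.norm_gr]
    simpa [E.norm_gr] using T.norm_app_le b (E.gr ξ)

theorem add_comp (S S' : Op F G) (T : Op E F) : comp (S + S') T = comp S T + comp S' T :=
  ext fun b ξ => by simp

theorem comp_add (S : Op F G) (T T' : Op E F) : comp S (T + T') = comp S T + comp S T' :=
  ext fun b ξ => by simp

theorem smul_comp (r : 𝕜) (S : Op F G) (T : Op E F) : comp (r • S) T = r • comp S T :=
  ext fun b ξ => by simp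

theorem comp_smul (r : 𝕜) (S : Op F G) (T : Op E F) : comp S (r • T) = r • comp S T :=
  ext fun b ξ => by simp

theorem comp_assoc (R : Op G H) (S : Op F G) (T : Op E F) :
    comp (comp R S) T = comp R (comp S T) :=
  ext fun b ξ => by simp

theorem one_comp (T : Op E F) : comp (one F) T = T :=
  ext fun b ξ => by simp

theorem comp_one (T : Op E F) : comp T (one E) = T :=
  ext fun b ξ => by simp

theorem adj_add (S T : Op E F) : (S + T).adj = S.adj + T.adj :=
  adj_unique fun b ξ η => by
    rw [add_app, add_app, E.inner_add, F.add_inner, inner_adj_app, inner_adj_app]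

theorem adj_smul (r : 𝕜) (T : Op E F) : (r • T).adj = (starRingEnd 𝕜 r) • T.adj :=
  adj_unique fun b ξ η => by
    rw [smul_app, smul_app, E.inner_smul, F.smul_inner, inner_adj_app]

theorem adj_adj (T : Op E F) : T.adj.adj = T :=
  adj_unique fun b ξ η => by rw [inner_app]

theorem adj_comp (S : Op F G) (T : Op E F) : (comp S T).adj = comp T.adj S.adj :=
  adj_unique fun b ξ η => by rw [comp_app, comp_app, inner_adj_app, inner_adj_app]

theorem adj_one : (one E).adj = one E := adj_unique fun _ _ _ => rfl

theorem gr_add (S T : Op E F) : (S + T).gr = S.gr + T.gr :=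
  ext fun b ξ => by simp [F.gr_add]

theorem gr_smul (r : 𝕜) (T : Op E F) : (r • T).gr = r • T.gr :=
  ext fun b ξ => by simp [F.gr_smul]

theorem gr_gr (T : Op E F) : T.gr.gr = T :=
  ext fun b ξ => by simp [F.gr_gr, E.gr_gr]

theorem gr_comp (S : Op F G) (T : Op E F) : (comp S T).gr = comp S.gr T.gr :=
  ext fun b ξ => by simp [F.gr_gr]

theorem gr_adj (T : Op E F) : T.adj.gr = T.gr.adj := by
  symm
  apply adj_unique
  intro b ξ η
  rw [gr_app, gr_app, ← E.gr_gr ξ, E.inner_gr, inner_adj_app, E.gr_gr, ← F.inner_gr, F.gr_gr]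

theorem gr_one : (one E).gr = one E := ext fun b ξ => by simp [E.gr_gr]

/-- The finite linear combinations of rank one operators `ζ ↦ η ⟨ξ, ζ⟩`. -/
def finiteRank (E F : HilbertModule B) : Submodule 𝕜 (∀ b, E.X b → F.X b) :=
  Submodule.span 𝕜 {S | ∃ (c : B.Obj) (η : F.X c) (ξ : E.X c),
    S = fun _ ζ => F.act η (E.inner ξ ζ)}

/-- The compact operators: norm limits of finite linear combinations of rank one operators. -/
def compact (E F : HilbertModule B) : Submodule 𝕜 (Op E F) where
  carrier := {T | ∀ ε : ℝ, 0 < ε → ∃ S ∈ finiteRank E F,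
    ∀ (b : B.Obj) (ζ : E.X b), ‖T.app b ζ - S b ζ‖ ≤ ε * ‖ζ‖}
  zero_mem' := fun ε hε => ⟨0, Submodule.zero_mem _, fun b ζ => by
    simpa using mul_nonneg hε.le (norm_nonneg ζ)⟩
  add_mem' := by
    intro T T' hT hT' ε hε
    obtain ⟨S, hS, h⟩ := hT (ε / 2) (by positivity)
    obtain ⟨S', hS', h'⟩ := hT' (ε / 2) (by positivity)
    refine ⟨S + S', Submodule.add_mem _ hS hS', fun b ζ => ?_⟩
    have e : (T + T').app b ζ - (S + S') b ζ
        = (T.app b ζ - S b ζ) + (T'.app b ζ - S' b ζ) := by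
      simp only [add_app, Pi.add_apply]; abel
    rw [e]
    refine (norm_add_le _ _).trans ?_
    have := h b ζ
    have := h' b ζ
    linarith
  smul_mem' := by
    intro r T hT ε hε
    obtain ⟨S, hS, h⟩ := hT (ε / (‖r‖ + 1)) (by positivity)
    refine ⟨r • S, Submodule.smul_mem _ _ hS, fun b ζ => ?_⟩
    have e : (r • T).app b ζ - (r • S) b ζ = r • (T.app b ζ - S b ζ) := by
      simp only [smul_app, Pi.smul_apply, smul_sub]
    rw [e, norm_smul]
    calc _ ≤ ‖r‖ * (ε / (‖r‖ + 1) * ‖ζ‖) := by gcongr; exact h b ζ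
      _ = (‖r‖ / (‖r‖ + 1)) * (ε * ‖ζ‖) := by ring
      _ ≤ 1 * (ε * ‖ζ‖) := by
          gcongr
          rw [div_le_one (by positivity)]
          linarith
      _ = _ := one_mul _

theorem comp_compact (R : Op F G) {T : Op E F} (hT : T ∈ compact E F) :
    comp R T ∈ compact E G := by
  intro ε hε
  obtain ⟨S, hS, h⟩ := hT (ε / (‖R‖ + 1)) (by positivity)
  refine ⟨fun b ζ => R.app b (S b ζ), ?_, fun b ζ => ?_⟩
  · clear h
    induction hS using Submodule.span_induction with
    | mem S hS =>
      obtain ⟨c, η, ξ, rfl⟩ := hS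
      refine Submodule.subset_span ⟨c, R.app c η, ξ, ?_⟩
      funext b ζ
      apply G.ext_inner
      intro θ
      rw [inner_app, F.inner_act, G.inner_act, inner_app]
    | zero =>
      have : (fun b (ζ : E.X b) => R.app b ((0 : ∀ b, E.X b → F.X b) b ζ)) = 0 := by
        funext b ζ; simp
      rw [this]; exact Submodule.zero_mem _
    | add S S' _ _ h h' =>
      have : (fun b (ζ : E.X b) => R.app b ((S + S') b ζ))
          = (fun b ζ => R.app b (S b ζ)) + fun b ζ => R.app b (S' b ζ) := by
        funext b ζ; simp
      rw [this]; exact Submodule.add_mem _ h h'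
    | smul r S _ h =>
      have : (fun b (ζ : E.X b) => R.app b ((r • S) b ζ)) = r • fun b ζ => R.app b (S b ζ) := by
        funext b ζ; simp
      rw [this]; exact Submodule.smul_mem _ _ h
  · rw [comp_app, ← map_sub]
    calc _ ≤ ‖R‖ * (ε / (‖R‖ + 1) * ‖ζ‖) :=
          (R.norm_app_le b _).trans (by gcongr; exact h b ζ)
      _ = (‖R‖ / (‖R‖ + 1)) * (ε * ‖ζ‖) := by ring
      _ ≤ 1 * (ε * ‖ζ‖) := by
          gcongr
          rw [div_le_one (by positivity)]
          linarith
      _ = _ := one_mul _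

theorem adj_compact {T : Op E F} (hT : T ∈ compact E F) : T.adj ∈ compact F E := by
  intro ε hε
  obtain ⟨S, hS, h⟩ := hT (ε / 3) (by positivity)
  obtain ⟨S', hS', hadj⟩ : ∃ S' ∈ finiteRank F E, ∀ (a b : B.Obj) (η : F.X b) (ξ : E.X a),
      F.inner η (S a ξ) = E.inner (S' b η) ξ := by
    clear h
    induction hS using Submodule.span_induction with
    | mem S hS =>
      obtain ⟨c, θ, κ, rfl⟩ := hS
      refine ⟨_, Submodule.subset_span ⟨c, κ, θ, rfl⟩, fun a b η ξ => ?_⟩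
      rw [F.inner_act, ← E.adj_inner ξ (E.act _ _), E.inner_act, B.adj_comp, F.adj_inner,
        E.adj_inner]
    | zero =>
      exact ⟨0, Submodule.zero_mem _, fun a b η ξ => by
        rw [Pi.zero_apply, Pi.zero_apply, Pi.zero_apply, Pi.zero_apply, F.inner_zero,
          E.zero_inner]⟩
    | add S T _ _ h h' =>
      obtain ⟨S', hS', e⟩ := h
      obtain ⟨T', hT', e'⟩ := h'
      exact ⟨S' + T', Submodule.add_mem _ hS' hT', fun a b η ξ => by
        simp only [Pi.add_apply, F.inner_add, E.add_inner, e, e']⟩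
    | smul r S _ h =>
      obtain ⟨S', hS', e⟩ := h
      exact ⟨(starRingEnd 𝕜 r) • S', Submodule.smul_mem _ _ hS', fun a b η ξ => by
        simp only [Pi.smul_apply, F.inner_smul, E.smul_inner, e, RCLike.conj_conj]⟩
  refine ⟨S', hS', fun b η => ?_⟩
  set v := T.adj.app b η - S' b η with hv
  rcases eq_or_lt_of_le (norm_nonneg v) with h0 | h0
  · rw [← h0]; positivity
  have h1 : ‖v‖ ^ 2 ≤ 3 * (ε / 3 * ‖v‖) * ‖η‖ := by
    have e : E.inner v v = F.inner (T.app b v - S b v) η := by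
      have e1 : E.inner v (T.adj.app b η) = F.inner (T.app b v) η := inner_adj_app _ _ _
      have e2 : E.inner v (S' b η) = F.inner (S b v) η := by
        rw [← E.adj_inner, ← hadj, F.adj_inner]
      rw [F.sub_inner, ← e1, ← e2, ← E.inner_sub]
    rw [E.norm_sq, e]
    refine (F.norm_inner_le _ _).trans ?_
    gcongr
    exact h b v
  have h2 : ‖v‖ * ‖v‖ ≤ ‖v‖ * (ε * ‖η‖) := by nlinarith
  exact le_of_mul_le_mul_left h2 h0

theorem compact_comp {T : Op F G} (hT : T ∈ compact F G) (R : Op E F) :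
    comp T R ∈ compact E G := by
  have := adj_compact (comp_compact R.adj (adj_compact hT))
  rwa [adj_comp, adj_adj, adj_adj] at this

theorem gr_compact {T : Op E F} (hT : T ∈ compact E F) : T.gr ∈ compact E F := by
  intro ε hε
  obtain ⟨S, hS, h⟩ := hT ε hε
  refine ⟨fun b ζ => F.gr (S b (E.gr ζ)), ?_, fun b ζ => ?_⟩
  · clear h
    induction hS using Submodule.span_induction with
    | mem S hS =>
      obtain ⟨c, η, ξ, rfl⟩ := hS
      refine Submodule.subset_span ⟨c, F.gr η, E.gr ξ, ?_⟩
      funext b ζ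
      rw [F.gr_act, ← E.inner_gr, E.gr_gr]
    | zero =>
      have : (fun b (ζ : E.X b) => F.gr ((0 : ∀ b, E.X b → F.X b) b (E.gr ζ))) = 0 := by
        funext b ζ
        have := F.gr_smul (0 : 𝕜) (0 : F.X b)
        simpa using this
      rw [this]; exact Submodule.zero_mem _
    | add S S' _ _ h h' =>
      have : (fun b (ζ : E.X b) => F.gr ((S + S') b (E.gr ζ)))
          = (fun b ζ => F.gr (S b (E.gr ζ))) + fun b ζ => F.gr (S' b (E.gr ζ)) := by
        funext b ζ; simp [F.gr_add]
      rw [this]; exact Submodule.add_mem _ h h'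
    | smul r S _ h =>
      have : (fun b (ζ : E.X b) => F.gr ((r • S) b (E.gr ζ)))
          = r • fun b ζ => F.gr (S b (E.gr ζ)) := by
        funext b ζ; simp [F.gr_smul]
      rw [this]; exact Submodule.smul_mem _ _ h
  · have e : T.gr.app b ζ - F.gr (S b (E.gr ζ)) = F.gr (T.app b (E.gr ζ) - S b (E.gr ζ)) := by
      rw [gr_app, sub_eq_add_neg _ (S b _), F.gr_add, ← neg_one_smul 𝕜 (S b _), F.gr_smul,
        neg_one_smul, ← sub_eq_add_neg]
    rw [e, F.norm_gr]
    simpa [E.norm_gr] using h b (E.gr ζ)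

theorem isClosed_compact : IsClosed (compact E F : Set (Op E F)) := by
  refine isClosed_of_closure_subset fun T hT => ?_
  intro ε hε
  obtain ⟨T', hT', hd⟩ := Metric.mem_closure_iff.1 hT (ε / 2) (by positivity)
  obtain ⟨S, hS, h⟩ := hT' (ε / 2) (by positivity)
  refine ⟨S, hS, fun b ζ => ?_⟩
  have e : T.app b ζ - S b ζ = (T - T').app b ζ + (T'.app b ζ - S b ζ) := by
    rw [sub_app]; abel
  rw [e]
  refine (norm_add_le _ _).trans ?_
  have h1 := (T - T').norm_app_le b ζ
  have h2 : ‖T - T'‖ * ‖ζ‖ ≤ ε / 2 * ‖ζ‖ := by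
    gcongr
    rw [← dist_eq_norm]
    exact hd.le
  have h3 := h b ζ
  linarith

end Op

/-! ## Bimodules -/

/-- A graded Hilbert `(A, B)`-bimodule: a graded C*-functor from `A` to the C*-category of
countably generated graded Hilbert `B`-modules and bounded operators. -/
structure Bimodule {𝕜 : Type} [RCLike 𝕜] (A : GradedCStarCategory.{v} 𝕜)
    (B : GradedCStarCategory.{u} 𝕜) : Type (max v (u + 1)) where
  obj : A.Obj → HilbertModule B
  map : ∀ {a a' : A.Obj}, A.Hom a a' → Op (obj a) (obj a')
  map_add : ∀ {a a' : A.Obj} (x y : A.Hom a a'), map (x + y) = map x + map y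
  map_smul : ∀ {a a' : A.Obj} (r : 𝕜) (x : A.Hom a a'), map (r • x) = r • map x
  map_comp : ∀ {a a' a'' : A.Obj} (x : A.Hom a' a'') (y : A.Hom a a'),
    map (A.comp x y) = Op.comp (map x) (map y)
  map_adj : ∀ {a a' : A.Obj} (x : A.Hom a a'), map (A.adj x) = (map x).adj
  map_gr : ∀ {a a' : A.Obj} (x : A.Hom a a'), map (A.gr x) = (map x).gr

/-- The operators between bimodules: families of bounded operators `T a : E(-, a) → F(-, a)`,
not necessarily natural in `a`, whose norm `sup_a ‖T a‖` is finite. -/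
def BiOp {𝕜 : Type} [RCLike 𝕜] {A : GradedCStarCategory.{v} 𝕜} {B : GradedCStarCategory.{u} 𝕜}
    (E F : Bimodule A B) : Type (max u v) :=
  lp (fun a => Op (E.obj a) (F.obj a)) ∞

instance {𝕜 : Type} [RCLike 𝕜] {A : GradedCStarCategory.{v} 𝕜} {B : GradedCStarCategory.{u} 𝕜}
    (E F : Bimodule A B) : NormedAddCommGroup (BiOp E F) :=
  inferInstanceAs (NormedAddCommGroup (lp (fun a => Op (E.obj a) (F.obj a)) ∞))

instance {𝕜 : Type} [RCLike 𝕜] {A : GradedCStarCategory.{v} 𝕜} {B : GradedCStarCategory.{u} 𝕜}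
    (E F : Bimodule A B) : NormedSpace 𝕜 (BiOp E F) :=
  inferInstanceAs (NormedSpace 𝕜 (lp (fun a => Op (E.obj a) (F.obj a)) ∞))

namespace BiOp

variable {𝕜 : Type} [RCLike 𝕜] {A : GradedCStarCategory.{v} 𝕜} {B : GradedCStarCategory.{u} 𝕜}
  {E F G H : Bimodule A B}

/-- The component at `a` of an operator of bimodules. -/
def at' (T : BiOp E F) (a : A.Obj) : Op (E.obj a) (F.obj a) := T.1 a

@[simp] theorem add_at (S T : BiOp E F) (a : A.Obj) : (S + T).at' a = S.at' a + T.at' a := rfl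

@[simp] theorem sub_at (S T : BiOp E F) (a : A.Obj) : (S - T).at' a = S.at' a - T.at' a := rfl

@[simp] theorem neg_at (T : BiOp E F) (a : A.Obj) : (-T).at' a = -T.at' a := rfl

@[simp] theorem zero_at (a : A.Obj) : (0 : BiOp E F).at' a = 0 := rfl

@[simp] theorem smul_at (r : 𝕜) (T : BiOp E F) (a : A.Obj) : (r • T).at' a = r • T.at' a := rfl

theorem ext {S T : BiOp E F} (h : ∀ a, S.at' a = T.at' a) : S = T := by
  apply lp.ext
  funext a
  exact h a

theorem norm_at_le (T : BiOp E F) (a : A.Obj) : ‖T.at' a‖ ≤ ‖T‖ :=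
  lp.norm_apply_le_norm ENNReal.top_ne_zero T a

theorem norm_le (T : BiOp E F) {C : ℝ} (hC : 0 ≤ C) (h : ∀ a, ‖T.at' a‖ ≤ C) : ‖T‖ ≤ C :=
  lp.norm_le_of_forall_le hC h

/-- An operator of bimodules from a uniformly bounded family. -/
def mk' (T : ∀ a, Op (E.obj a) (F.obj a)) (C : ℝ) (hC : ∀ a, ‖T a‖ ≤ C) : BiOp E F :=
  ⟨T, memℓp_infty ⟨C, by
    rintro _ ⟨a, rfl⟩
    exact hC a⟩⟩

@[simp] theorem mk'_at (T : ∀ a, Op (E.obj a) (F.obj a)) (C : ℝ) (hC : ∀ a, ‖T a‖ ≤ C)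
    (a : A.Obj) : (mk' T C hC).at' a = T a := rfl

/-- The identity operator. -/
def one (E : Bimodule A B) : BiOp E E :=
  mk' (fun a => Op.one (E.obj a)) 1 fun _ => Op.norm_le _ zero_le_one fun _ ξ => (one_mul ‖ξ‖).ge

/-- The composite `S ∘ T`. -/
def comp (S : BiOp F G) (T : BiOp E F) : BiOp E G :=
  mk' (fun a => Op.comp (S.at' a) (T.at' a)) (‖S‖ * ‖T‖) fun a =>
    (Op.norm_comp_le _ _).trans
      (mul_le_mul (S.norm_at_le a) (T.norm_at_le a) (norm_nonneg _) (norm_nonneg _))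

/-- The adjoint. -/
def adj (T : BiOp E F) : BiOp F E :=
  mk' (fun a => (T.at' a).adj) (3 * ‖T‖) fun a =>
    (Op.norm_adj_le _).trans (mul_le_mul_of_nonneg_left (T.norm_at_le a) (by norm_num))

/-- The grading automorphism: `T` has degree `i` if `gr T = (-1) ^ i • T`. -/
def gr (T : BiOp E F) : BiOp E F :=
  mk' (fun a => (T.at' a).gr) ‖T‖ fun a => (Op.norm_gr_le _).trans (T.norm_at_le a)

@[simp] theorem one_at (a : A.Obj) : (one E).at' a = Op.one (E.obj a) := rfl

@[simp] theorem comp_at (S : BiOp F G) (T : BiOp E F) (a : A.Obj) :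
    (comp S T).at' a = Op.comp (S.at' a) (T.at' a) := rfl

@[simp] theorem adj_at (T : BiOp E F) (a : A.Obj) : T.adj.at' a = (T.at' a).adj := rfl

@[simp] theorem gr_at (T : BiOp E F) (a : A.Obj) : T.gr.at' a = (T.at' a).gr := rfl

/-- The component of degree `0`. -/
def even (T : BiOp E F) : BiOp E F := (2⁻¹ : 𝕜) • (T + T.gr)

/-- The component of degree `1`. -/
def odd (T : BiOp E F) : BiOp E F := (2⁻¹ : 𝕜) • (T - T.gr)

/-- The graded commutators of `T` with all morphisms of `A` are compact. Here `x T - T x` is the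
graded commutator of `x` with an operator of degree `0`, and `x T - T (gr x)`, which is
`x T - (-1) ^ deg x • T x` for homogeneous `x`, the one with an operator of degree `1`. -/
def IsDual (T : BiOp E F) : Prop :=
  ∀ (a a' : A.Obj) (x : A.Hom a a'),
    (Op.comp (F.map x) (T.even.at' a) - Op.comp (T.even.at' a') (E.map x)
      ∈ Op.compact (E.obj a) (F.obj a')) ∧
    (Op.comp (F.map x) (T.odd.at' a) - Op.comp (T.odd.at' a') (E.map (A.gr x))
      ∈ Op.compact (E.obj a) (F.obj a'))

/-- `T` is locally compact: `T x` and `x T` are compact for all morphisms `x` of `A`. -/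
def IsLocallyCompact (T : BiOp E F) : Prop :=
  ∀ (a a' : A.Obj) (x : A.Hom a a'),
    Op.comp (T.at' a') (E.map x) ∈ Op.compact (E.obj a) (F.obj a') ∧
    Op.comp (F.map x) (T.at' a) ∈ Op.compact (E.obj a) (F.obj a')

end BiOp

namespace Op

variable {𝕜 : Type} [RCLike 𝕜] {B : GradedCStarCategory.{u} 𝕜} {E F G H : HilbertModule B}

theorem sub_comp (S S' : Op F G) (T : Op E F) : comp (S - S') T = comp S T - comp S' T :=
  ext fun b ξ => by simp

theorem comp_sub (S : Op F G) (T T' : Op E F) : comp S (T - T') = comp S T - comp S T' :=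
  ext fun b ξ => by simp

theorem gr_sub (S T : Op E F) : (S - T).gr = S.gr - T.gr := by
  rw [sub_eq_add_neg, gr_add, ← neg_one_smul 𝕜 T, gr_smul, neg_one_smul, ← sub_eq_add_neg]

theorem adj_sub (S T : Op E F) : (S - T).adj = S.adj - T.adj := by
  rw [sub_eq_add_neg, adj_add, ← neg_one_smul 𝕜 T, adj_smul]
  simp [sub_eq_add_neg]

end Op

namespace BiOp

variable {𝕜 : Type} [RCLike 𝕜] {A : GradedCStarCategory.{v} 𝕜} {B : GradedCStarCategory.{u} 𝕜}
  {E F G H : Bimodule A B}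

theorem add_comp (S S' : BiOp F G) (T : BiOp E F) : comp (S + S') T = comp S T + comp S' T :=
  ext fun a => by rw [comp_at, add_at, Op.add_comp]; rfl

theorem comp_add (S : BiOp F G) (T T' : BiOp E F) : comp S (T + T') = comp S T + comp S T' :=
  ext fun a => by rw [comp_at, add_at, Op.comp_add]; rfl

theorem sub_comp (S S' : BiOp F G) (T : BiOp E F) : comp (S - S') T = comp S T - comp S' T :=
  ext fun a => by rw [comp_at, sub_at, Op.sub_comp]; rfl

theorem comp_sub (S : BiOp F G) (T T' : BiOp E F) : comp S (T - T') = comp S T - comp S T' :=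
  ext fun a => by rw [comp_at, sub_at, Op.comp_sub]; rfl

theorem smul_comp (r : 𝕜) (S : BiOp F G) (T : BiOp E F) : comp (r • S) T = r • comp S T :=
  ext fun a => by rw [comp_at, smul_at, Op.smul_comp]; rfl

theorem comp_smul (r : 𝕜) (S : BiOp F G) (T : BiOp E F) : comp S (r • T) = r • comp S T :=
  ext fun a => by rw [comp_at, smul_at, Op.comp_smul]; rfl

theorem comp_assoc (R : BiOp G H) (S : BiOp F G) (T : BiOp E F) :
    comp (comp R S) T = comp R (comp S T) := ext fun _ => Op.comp_assoc _ _ _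

theorem one_comp (T : BiOp E F) : comp (one F) T = T := ext fun _ => Op.one_comp _

theorem comp_one (T : BiOp E F) : comp T (one E) = T := ext fun _ => Op.comp_one _

theorem adj_add (S T : BiOp E F) : (S + T).adj = S.adj + T.adj := ext fun _ => Op.adj_add _ _

theorem adj_sub (S T : BiOp E F) : (S - T).adj = S.adj - T.adj := ext fun _ => Op.adj_sub _ _

theorem adj_smul (r : 𝕜) (T : BiOp E F) : (r • T).adj = (starRingEnd 𝕜 r) • T.adj :=
  ext fun _ => Op.adj_smul _ _

theorem adj_comp (S : BiOp F G) (T : BiOp E F) : (comp S T).adj = comp T.adj S.adj :=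
  ext fun _ => Op.adj_comp _ _

theorem adj_adj (T : BiOp E F) : T.adj.adj = T := ext fun _ => Op.adj_adj _

theorem gr_add (S T : BiOp E F) : (S + T).gr = S.gr + T.gr := ext fun _ => Op.gr_add _ _

theorem gr_sub (S T : BiOp E F) : (S - T).gr = S.gr - T.gr := ext fun _ => Op.gr_sub _ _

theorem gr_smul (r : 𝕜) (T : BiOp E F) : (r • T).gr = r • T.gr := ext fun _ => Op.gr_smul _ _

theorem gr_gr (T : BiOp E F) : T.gr.gr = T := ext fun _ => Op.gr_gr _

theorem gr_comp (S : BiOp F G) (T : BiOp E F) : (comp S T).gr = comp S.gr T.gr :=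
  ext fun _ => Op.gr_comp _ _

theorem gr_adj (T : BiOp E F) : T.adj.gr = T.gr.adj := ext fun _ => Op.gr_adj _

theorem even_add_odd (T : BiOp E F) : T.even + T.odd = T := by
  unfold even odd; module

theorem even_add (S T : BiOp E F) : (S + T).even = S.even + T.even := by
  refine ext fun a => ?_
  simp only [even, smul_at, add_at, gr_at, Op.gr_add]; module

theorem odd_add (S T : BiOp E F) : (S + T).odd = S.odd + T.odd := by
  refine ext fun a => ?_
  simp only [odd, smul_at, add_at, sub_at, gr_at, Op.gr_add]; module

theorem even_smul (r : 𝕜) (T : BiOp E F) : (r • T).even = r • T.even := by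
  refine ext fun a => ?_
  simp only [even, smul_at, add_at, gr_at, Op.gr_smul]; module

theorem odd_smul (r : 𝕜) (T : BiOp E F) : (r • T).odd = r • T.odd := by
  refine ext fun a => ?_
  simp only [odd, smul_at, sub_at, gr_at, Op.gr_smul]; module

theorem even_gr (T : BiOp E F) : T.gr.even = T.even := by
  refine ext fun a => ?_
  simp only [even, smul_at, add_at, gr_at, Op.gr_gr]; module

theorem odd_gr (T : BiOp E F) : T.gr.odd = -T.odd := by
  refine ext fun a => ?_
  simp only [odd, smul_at, sub_at, neg_at, gr_at, Op.gr_gr]; module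

theorem even_adj (T : BiOp E F) : T.adj.even = T.even.adj := by
  refine ext fun a => ?_
  simp [even, Op.gr_adj, Op.adj_smul, Op.adj_add, map_ofNat (starRingEnd 𝕜) 2]

theorem odd_adj (T : BiOp E F) : T.adj.odd = T.odd.adj := by
  refine ext fun a => ?_
  simp [odd, Op.gr_adj, Op.adj_smul, Op.adj_sub, map_ofNat (starRingEnd 𝕜) 2]

theorem gr_one : (one E).gr = one E := ext fun _ => Op.gr_one

theorem even_one : (one E).even = one E := by
  unfold even; rw [gr_one]; module

theorem odd_one : (one E).odd = 0 := by
  unfold odd; rw [gr_one]; module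

theorem even_comp (S : BiOp F G) (T : BiOp E F) :
    (comp S T).even = comp S.even T.even + comp S.odd T.odd := by
  refine ext fun a => ?_
  simp only [even, odd, smul_at, add_at, sub_at, gr_at, comp_at, Op.gr_comp, Op.add_comp,
    Op.comp_add, Op.sub_comp, Op.comp_sub, Op.smul_comp, Op.comp_smul]
  module

theorem odd_comp (S : BiOp F G) (T : BiOp E F) :
    (comp S T).odd = comp S.even T.odd + comp S.odd T.even := by
  refine ext fun a => ?_
  simp only [even, odd, smul_at, add_at, sub_at, gr_at, comp_at, Op.gr_comp, Op.add_comp,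
    Op.comp_add, Op.sub_comp, Op.comp_sub, Op.smul_comp, Op.comp_smul]
  module

theorem IsDual.comp {S : BiOp F G} {T : BiOp E F} (hS : S.IsDual) (hT : T.IsDual) :
    (comp S T).IsDual := by
  intro a a' x
  obtain ⟨hS0, hS1⟩ := hS a a' x
  obtain ⟨hT0, hT1⟩ := hT a a' x
  obtain ⟨-, hS1'⟩ := hS a a' (A.gr x)
  obtain ⟨hT0', hT1'⟩ := hT a a' (A.gr x)
  rw [A.gr_gr] at hS1' hT1'
  constructor
  · rw [even_comp]
    have e : Op.comp (G.map x) ((BiOp.comp S.even T.even + BiOp.comp S.odd T.odd).at' a)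
        - Op.comp ((BiOp.comp S.even T.even + BiOp.comp S.odd T.odd).at' a') (E.map x)
        = Op.comp (Op.comp (G.map x) (S.even.at' a) - Op.comp (S.even.at' a') (F.map x))
            (T.even.at' a)
          + Op.comp (S.even.at' a')
            (Op.comp (F.map x) (T.even.at' a) - Op.comp (T.even.at' a') (E.map x))
          + Op.comp (Op.comp (G.map x) (S.odd.at' a) - Op.comp (S.odd.at' a') (F.map (A.gr x)))
            (T.odd.at' a)
          + Op.comp (S.odd.at' a')
            (Op.comp (F.map (A.gr x)) (T.odd.at' a) - Op.comp (T.odd.at' a') (E.map x)) := by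
      simp only [add_at, comp_at, Op.add_comp, Op.comp_add, Op.sub_comp, Op.comp_sub,
        Op.comp_assoc]
      abel
    rw [e]
    exact add_mem (add_mem (add_mem (Op.compact_comp hS0 _) (Op.comp_compact _ hT0))
      (Op.compact_comp hS1 _)) (Op.comp_compact _ hT1')
  · rw [odd_comp]
    have e : Op.comp (G.map x) ((BiOp.comp S.even T.odd + BiOp.comp S.odd T.even).at' a)
        - Op.comp ((BiOp.comp S.even T.odd + BiOp.comp S.odd T.even).at' a') (E.map (A.gr x))
        = Op.comp (Op.comp (G.map x) (S.even.at' a) - Op.comp (S.even.at' a') (F.map x))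
            (T.odd.at' a)
          + Op.comp (S.even.at' a')
            (Op.comp (F.map x) (T.odd.at' a) - Op.comp (T.odd.at' a') (E.map (A.gr x)))
          + Op.comp (Op.comp (G.map x) (S.odd.at' a) - Op.comp (S.odd.at' a') (F.map (A.gr x)))
            (T.even.at' a)
          + Op.comp (S.odd.at' a')
            (Op.comp (F.map (A.gr x)) (T.even.at' a)
              - Op.comp (T.even.at' a') (E.map (A.gr x))) := by
      simp only [add_at, comp_at, Op.add_comp, Op.comp_add, Op.sub_comp, Op.comp_sub,
        Op.comp_assoc]
      abel
    rw [e]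
    exact add_mem (add_mem (add_mem (Op.compact_comp hS0 _) (Op.comp_compact _ hT1))
      (Op.compact_comp hS1 _)) (Op.comp_compact _ hT0')

theorem IsDual.adj {T : BiOp E F} (hT : T.IsDual) : T.adj.IsDual := by
  intro a a' x
  have h0 := Op.adj_compact (hT a' a (A.adj x)).1
  have h1 := Op.adj_compact (hT a' a (A.adj (A.gr x))).2
  rw [Op.adj_sub, Op.adj_comp, Op.adj_comp, ← F.map_adj, ← E.map_adj] at h0 h1
  rw [A.adj_adj] at h0
  rw [A.gr_adj, A.gr_gr, A.adj_adj, A.adj_adj] at h1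
  rw [even_adj, odd_adj]
  constructor
  · rw [← neg_sub]; exact neg_mem h0
  · rw [← neg_sub]; exact neg_mem h1

theorem IsDual.gr {T : BiOp E F} (hT : T.IsDual) : T.gr.IsDual := by
  intro a a' x
  obtain ⟨h0, h1⟩ := hT a a' x
  rw [even_gr, odd_gr]
  refine ⟨h0, ?_⟩
  have e : Op.comp (F.map x) ((-T.odd).at' a) - Op.comp ((-T.odd).at' a') (E.map (A.gr x))
      = -(Op.comp (F.map x) (T.odd.at' a) - Op.comp (T.odd.at' a') (E.map (A.gr x))) := by
    refine Op.ext fun b ξ => ?_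
    simp
    abel
  rw [e]
  exact neg_mem h1

theorem IsDual.one (E : Bimodule A B) : (one E).IsDual := by
  intro a a' x
  rw [even_one, odd_one]
  constructor
  · have e : Op.comp (E.map x) ((BiOp.one E).at' a) - Op.comp ((BiOp.one E).at' a') (E.map x)
        = 0 := Op.ext fun b ξ => by simp
    rw [e]; exact zero_mem _
  · have e : Op.comp (E.map x) ((0 : BiOp E E).at' a)
        - Op.comp ((0 : BiOp E E).at' a') (E.map (A.gr x)) = 0 := Op.ext fun b ξ => by simp
    rw [e]; exact zero_mem _

theorem IsLocallyCompact.comp_left {S : BiOp F G} {T : BiOp E F} (hS : S.IsDual)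
    (hT : T.IsLocallyCompact) : (comp S T).IsLocallyCompact := by
  intro a a' x
  obtain ⟨h0, h1⟩ := hS a a' x
  refine ⟨?_, ?_⟩
  · rw [comp_at, Op.comp_assoc]
    exact Op.comp_compact _ (hT a a' x).1
  · have e : Op.comp (G.map x) ((BiOp.comp S T).at' a)
        = Op.comp (Op.comp (G.map x) (S.even.at' a) - Op.comp (S.even.at' a') (F.map x)) (T.at' a)
          + Op.comp (S.even.at' a') (Op.comp (F.map x) (T.at' a))
          + Op.comp (Op.comp (G.map x) (S.odd.at' a) - Op.comp (S.odd.at' a') (F.map (A.gr x)))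
              (T.at' a)
          + Op.comp (S.odd.at' a') (Op.comp (F.map (A.gr x)) (T.at' a)) := by
      conv_lhs => rw [← even_add_odd S]
      simp only [add_at, comp_at, Op.add_comp, Op.comp_add, Op.sub_comp, Op.comp_assoc]
      abel
    rw [e]
    exact add_mem (add_mem (add_mem (Op.compact_comp h0 _) (Op.comp_compact _ (hT a a' x).2))
      (Op.compact_comp h1 _)) (Op.comp_compact _ (hT a a' (A.gr x)).2)

theorem IsLocallyCompact.comp_right {S : BiOp F G} {T : BiOp E F} (hS : S.IsLocallyCompact)
    (hT : T.IsDual) : (comp S T).IsLocallyCompact := by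
  intro a a' x
  obtain ⟨h0, -⟩ := hT a a' x
  obtain ⟨-, h1⟩ := hT a a' (A.gr x)
  rw [A.gr_gr] at h1
  refine ⟨?_, ?_⟩
  · have e : Op.comp ((BiOp.comp S T).at' a') (E.map x)
        = Op.comp (Op.comp (S.at' a') (F.map x)) (T.even.at' a)
          + Op.comp (Op.comp (S.at' a') (F.map (A.gr x))) (T.odd.at' a)
          - Op.comp (S.at' a')
            (Op.comp (F.map x) (T.even.at' a) - Op.comp (T.even.at' a') (E.map x))
          - Op.comp (S.at' a')
            (Op.comp (F.map (A.gr x)) (T.odd.at' a) - Op.comp (T.odd.at' a') (E.map x)) := by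
      conv_lhs => rw [← even_add_odd T]
      simp only [add_at, comp_at, Op.add_comp, Op.comp_add, Op.comp_sub, Op.comp_assoc]
      abel
    rw [e]
    exact sub_mem (sub_mem (add_mem (Op.compact_comp (hS a a' x).1 _)
      (Op.compact_comp (hS a a' (A.gr x)).1 _)) (Op.comp_compact _ h0)) (Op.comp_compact _ h1)
  · rw [comp_at, ← Op.comp_assoc]
    exact Op.compact_comp (hS a a' x).2 _

theorem IsLocallyCompact.adj {T : BiOp E F} (hT : T.IsLocallyCompact) :
    T.adj.IsLocallyCompact := by
  intro a a' x
  obtain ⟨h0, h1⟩ := hT a' a (A.adj x)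
  have h0 := Op.adj_compact h0
  have h1 := Op.adj_compact h1
  rw [Op.adj_comp, ← E.map_adj, A.adj_adj] at h0
  rw [Op.adj_comp, ← F.map_adj, A.adj_adj] at h1
  exact ⟨h1, h0⟩

theorem IsLocallyCompact.gr {T : BiOp E F} (hT : T.IsLocallyCompact) :
    T.gr.IsLocallyCompact := by
  intro a a' x
  obtain ⟨h0, h1⟩ := hT a a' (A.gr x)
  have h0 := Op.gr_compact h0
  have h1 := Op.gr_compact h1
  rw [Op.gr_comp, ← E.map_gr, A.gr_gr] at h0
  rw [Op.gr_comp, ← F.map_gr, A.gr_gr] at h1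
  exact ⟨h0, h1⟩

end BiOp

section Dual

variable {𝕜 : Type} [RCLike 𝕜] {A : GradedCStarCategory.{v} 𝕜} {B : GradedCStarCategory.{u} 𝕜}

/-- The morphisms `E → F` of the dual C*-category `D(A, B)`. -/
def dualHom (E F : Bimodule A B) : Submodule 𝕜 (BiOp E F) where
  carrier := {T | T.IsDual}
  zero_mem' := by
    intro a a' x
    have e0 : (0 : BiOp E F).even = 0 := by simpa using BiOp.even_smul (0 : 𝕜) (0 : BiOp E F)
    have e1 : (0 : BiOp E F).odd = 0 := by simpa using BiOp.odd_smul (0 : 𝕜) (0 : BiOp E F)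
    rw [e0, e1]
    constructor
    · convert zero_mem (Op.compact (E.obj a) (F.obj a')) using 1
      exact Op.ext fun b ξ => by simp
    · convert zero_mem (Op.compact (E.obj a) (F.obj a')) using 1
      exact Op.ext fun b ξ => by simp
  add_mem' := by
    intro S T hS hT a a' x
    rw [BiOp.even_add, BiOp.odd_add]
    constructor
    · convert add_mem (hS a a' x).1 (hT a a' x).1 using 1
      simp only [BiOp.add_at, Op.add_comp, Op.comp_add]; abel
    · convert add_mem (hS a a' x).2 (hT a a' x).2 using 1
      simp only [BiOp.add_at, Op.add_comp, Op.comp_add]; abel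
  smul_mem' := by
    intro r T hT a a' x
    rw [BiOp.even_smul, BiOp.odd_smul]
    constructor
    · convert Submodule.smul_mem _ r (hT a a' x).1 using 1
      simp only [BiOp.smul_at, Op.smul_comp, Op.comp_smul, smul_sub]
    · convert Submodule.smul_mem _ r (hT a a' x).2 using 1
      simp only [BiOp.smul_at, Op.smul_comp, Op.comp_smul, smul_sub]

/-- The morphisms `E → F` of the ideal `KD(A, B)` of `D(A, B)`. -/
def locallyCompactHom (E F : Bimodule A B) : Submodule 𝕜 (dualHom E F) where
  carrier := {T | T.1.IsLocallyCompact}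
  zero_mem' := by
    intro a a' x
    constructor
    · convert zero_mem (Op.compact (E.obj a) (F.obj a')) using 1
      exact Op.ext fun b ξ => by simp
    · convert zero_mem (Op.compact (E.obj a) (F.obj a')) using 1
      exact Op.ext fun b ξ => by simp
  add_mem' := by
    intro S T hS hT a a' x
    refine ⟨add_mem (hS a a' x).1 (hT a a' x).1, ?_⟩
    convert add_mem (hS a a' x).2 (hT a a' x).2 using 1
    exact Op.comp_add _ _ _
  smul_mem' := by
    intro r T hT a a' x
    refine ⟨Submodule.smul_mem _ r (hT a a' x).1, ?_⟩
    convert Submodule.smul_mem _ r (hT a a' x).2 using 1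
    exact Op.comp_smul _ _ _

instance isClosed_locallyCompactHom (E F : Bimodule A B) :
    IsClosed (locallyCompactHom E F : Set (dualHom E F)) := by
  have h1 : ∀ (a a' : A.Obj) (x : A.Hom a a'),
      Continuous fun T : dualHom E F => Op.comp (T.1.at' a') (E.map x) := by
    intro a a' x
    let φ : dualHom E F →+ Op (E.obj a) (F.obj a') :=
      { toFun := fun T => Op.comp (T.1.at' a') (E.map x)
        map_zero' := Op.ext fun b ξ => by simp
        map_add' := fun S T => Op.add_comp _ _ _ }
    refine AddMonoidHomClass.continuous_of_bound φ ‖E.map x‖ fun T => ?_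
    rw [mul_comm]
    exact (Op.norm_comp_le _ _).trans
      (mul_le_mul_of_nonneg_right (T.1.norm_at_le a') (norm_nonneg _))
  have h2 : ∀ (a a' : A.Obj) (x : A.Hom a a'),
      Continuous fun T : dualHom E F => Op.comp (F.map x) (T.1.at' a) := by
    intro a a' x
    let φ : dualHom E F →+ Op (E.obj a) (F.obj a') :=
      { toFun := fun T => Op.comp (F.map x) (T.1.at' a)
        map_zero' := Op.ext fun b ξ => by simp
        map_add' := fun S T => Op.comp_add _ _ _ }
    refine AddMonoidHomClass.continuous_of_bound φ ‖F.map x‖ fun T => ?_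
    exact (Op.norm_comp_le _ _).trans
      (mul_le_mul_of_nonneg_left (T.1.norm_at_le a) (norm_nonneg _))
  have e : (locallyCompactHom E F : Set (dualHom E F))
      = ⋂ (a : A.Obj) (a' : A.Obj) (x : A.Hom a a'),
        {T | Op.comp (T.1.at' a') (E.map x) ∈ Op.compact (E.obj a) (F.obj a')} ∩
        {T | Op.comp (F.map x) (T.1.at' a) ∈ Op.compact (E.obj a) (F.obj a')} := by
    ext T
    simp only [Set.mem_iInter]
    rfl
  rw [e]
  exact isClosed_iInter fun a => isClosed_iInter fun a' => isClosed_iInter fun x =>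
    (Op.isClosed_compact.preimage (h1 a a' x)).inter (Op.isClosed_compact.preimage (h2 a a' x))

end Dual

/-- A unital graded `⋆`-category with normed morphism spaces. -/
structure UnitalGradedStarCategory (𝕜 : Type) [RCLike 𝕜] : Type (max (u + 1) (v + 1)) extends
    GradedStarCategory.{u, v} 𝕜 where
  one : ∀ a : Obj, Hom a a
  one_comp : ∀ {a b : Obj} (x : Hom a b), comp (one b) x = x
  comp_one : ∀ {a b : Obj} (x : Hom a b), comp x (one a) = x

/-! ## The dual category -/

section QD

variable {𝕜 : Type} [RCLike 𝕜] (A : GradedCStarCategory.{v} 𝕜) (B : GradedCStarCategory.{u} 𝕜)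

/-- The dual C*-category `D(A, B)`. -/
def dualCategory : UnitalGradedStarCategory.{max v (u + 1), max u v} 𝕜 where
  Obj := Bimodule A B
  Hom E F := dualHom E F
  comp S T := ⟨BiOp.comp S.1 T.1, BiOp.IsDual.comp S.2 T.2⟩
  adj T := ⟨T.1.adj, BiOp.IsDual.adj T.2⟩
  gr T := ⟨T.1.gr, BiOp.IsDual.gr T.2⟩
  one E := ⟨BiOp.one E, BiOp.IsDual.one E⟩
  add_comp _ _ _ := Subtype.ext (BiOp.add_comp _ _ _)
  comp_add _ _ _ := Subtype.ext (BiOp.comp_add _ _ _)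
  smul_comp _ _ _ := Subtype.ext (BiOp.smul_comp _ _ _)
  comp_smul _ _ _ := Subtype.ext (BiOp.comp_smul _ _ _)
  assoc _ _ _ := Subtype.ext (BiOp.comp_assoc _ _ _)
  adj_add _ _ := Subtype.ext (BiOp.adj_add _ _)
  adj_smul _ _ := Subtype.ext (BiOp.adj_smul _ _)
  adj_comp _ _ := Subtype.ext (BiOp.adj_comp _ _)
  adj_adj _ := Subtype.ext (BiOp.adj_adj _)
  gr_add _ _ := Subtype.ext (BiOp.gr_add _ _)
  gr_smul _ _ := Subtype.ext (BiOp.gr_smul _ _)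
  gr_gr _ := Subtype.ext (BiOp.gr_gr _)
  gr_comp _ _ := Subtype.ext (BiOp.gr_comp _ _)
  gr_adj _ := Subtype.ext (BiOp.gr_adj _)
  one_comp _ := Subtype.ext (BiOp.one_comp _)
  comp_one _ := Subtype.ext (BiOp.comp_one _)

variable {A B}

/-- The morphisms `E → F` of `QD(A, B) = D(A, B) / KD(A, B)`, with the quotient norm. -/
abbrev QDHom (E F : Bimodule A B) : Type (max u v) := dualHom E F ⧸ locallyCompactHom E F

namespace QDHom

variable {E F G : Bimodule A B}

/-- The class of an operator of the dual category. -/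
def mk (T : BiOp E F) (hT : T.IsDual) : QDHom E F :=
  Submodule.Quotient.mk ⟨T, hT⟩

theorem mk_eq_mk {S T : BiOp E F} {hS : S.IsDual} {hT : T.IsDual} :
    mk S hS = mk T hT ↔ (S - T).IsLocallyCompact :=
  Submodule.Quotient.eq _

theorem ind {p : QDHom E F → Prop} (h : ∀ T hT, p (mk T hT)) (x : QDHom E F) : p x := by
  induction x using Submodule.Quotient.induction_on with
  | H T => exact h T.1 T.2

/-- Composition. -/
def comp (x : QDHom F G) (y : QDHom E F) : QDHom E G :=
  Quotient.liftOn₂' x y (fun S T => mk (BiOp.comp S.1 T.1) (BiOp.IsDual.comp S.2 T.2)) (by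
    intro S T S' T' hS hT
    rw [Submodule.quotientRel_def] at hS hT
    refine mk_eq_mk.2 ?_
    have e : BiOp.comp S.1 T.1 - BiOp.comp S'.1 T'.1
        = BiOp.comp (S.1 - S'.1) T.1 + BiOp.comp S'.1 (T.1 - T'.1) := by
      rw [BiOp.sub_comp, BiOp.comp_sub]
      abel
    rw [e]
    have h1 := BiOp.IsLocallyCompact.comp_right hS T.2
    have h2 := BiOp.IsLocallyCompact.comp_left S'.2 hT
    exact (locallyCompactHom E G).add_mem (x := ⟨_, BiOp.IsDual.comp (S - S').2 T.2⟩)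
      (y := ⟨_, BiOp.IsDual.comp S'.2 (T - T').2⟩) h1 h2)

/-- The adjoint. -/
def adj (x : QDHom E F) : QDHom F E :=
  Quotient.liftOn' x (fun T => mk T.1.adj (BiOp.IsDual.adj T.2)) (by
    intro T T' hT
    rw [Submodule.quotientRel_def] at hT
    refine mk_eq_mk.2 ?_
    have h := BiOp.IsLocallyCompact.adj hT
    have e : (T - T').1.adj = T.1.adj - T'.1.adj := BiOp.adj_sub _ _
    rwa [e] at h)

/-- The grading. -/
def gr (x : QDHom E F) : QDHom E F :=
  Quotient.liftOn' x (fun T => mk T.1.gr (BiOp.IsDual.gr T.2)) (by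
    intro T T' hT
    rw [Submodule.quotientRel_def] at hT
    refine mk_eq_mk.2 ?_
    have h := BiOp.IsLocallyCompact.gr hT
    have e : (T - T').1.gr = T.1.gr - T'.1.gr := BiOp.gr_sub _ _
    rwa [e] at h)

end QDHom

variable (A B)

/-- The quotient `QD(A, B)` of the dual C*-category by the ideal of locally compact operators. -/
def QD : UnitalGradedStarCategory.{max v (u + 1), max u v} 𝕜 where
  Obj := Bimodule A B
  Hom E F := QDHom E F
  comp x y := QDHom.comp x y
  adj x := QDHom.adj x
  gr x := QDHom.gr x
  one E := QDHom.mk (BiOp.one E) (BiOp.IsDual.one E)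
  add_comp := by
    intro E F G x y z
    induction x using QDHom.ind; induction y using QDHom.ind; induction z using QDHom.ind
    exact congrArg Submodule.Quotient.mk (Subtype.ext (BiOp.add_comp _ _ _))
  comp_add := by
    intro E F G x y z
    induction x using QDHom.ind; induction y using QDHom.ind; induction z using QDHom.ind
    exact congrArg Submodule.Quotient.mk (Subtype.ext (BiOp.comp_add _ _ _))
  smul_comp := by
    intro E F G r x y
    induction x using QDHom.ind; induction y using QDHom.ind
    exact congrArg Submodule.Quotient.mk (Subtype.ext (BiOp.smul_comp _ _ _))
  comp_smul := by
    intro E F G r x y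
    induction x using QDHom.ind; induction y using QDHom.ind
    exact congrArg Submodule.Quotient.mk (Subtype.ext (BiOp.comp_smul _ _ _))
  assoc := by
    intro E F G H x y z
    induction x using QDHom.ind; induction y using QDHom.ind; induction z using QDHom.ind
    exact congrArg Submodule.Quotient.mk (Subtype.ext (BiOp.comp_assoc _ _ _))
  adj_add := by
    intro E F x y
    induction x using QDHom.ind; induction y using QDHom.ind
    exact congrArg Submodule.Quotient.mk (Subtype.ext (BiOp.adj_add _ _))
  adj_smul := by
    intro E F r x
    induction x using QDHom.ind
    exact congrArg Submodule.Quotient.mk (Subtype.ext (BiOp.adj_smul _ _))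
  adj_comp := by
    intro E F G x y
    induction x using QDHom.ind; induction y using QDHom.ind
    exact congrArg Submodule.Quotient.mk (Subtype.ext (BiOp.adj_comp _ _))
  adj_adj := by
    intro E F x
    induction x using QDHom.ind
    exact congrArg Submodule.Quotient.mk (Subtype.ext (BiOp.adj_adj _))
  gr_add := by
    intro E F x y
    induction x using QDHom.ind; induction y using QDHom.ind
    exact congrArg Submodule.Quotient.mk (Subtype.ext (BiOp.gr_add _ _))
  gr_smul := by
    intro E F r x
    induction x using QDHom.ind
    exact congrArg Submodule.Quotient.mk (Subtype.ext (BiOp.gr_smul _ _))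
  gr_gr := by
    intro E F x
    induction x using QDHom.ind
    exact congrArg Submodule.Quotient.mk (Subtype.ext (BiOp.gr_gr _))
  gr_comp := by
    intro E F G x y
    induction x using QDHom.ind; induction y using QDHom.ind
    exact congrArg Submodule.Quotient.mk (Subtype.ext (BiOp.gr_comp _ _))
  gr_adj := by
    intro E F x
    induction x using QDHom.ind
    exact congrArg Submodule.Quotient.mk (Subtype.ext (BiOp.gr_adj _))
  one_comp := by
    intro E F x
    induction x using QDHom.ind
    exact congrArg Submodule.Quotient.mk (Subtype.ext (BiOp.one_comp _))
  comp_one := by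
    intro E F x
    induction x using QDHom.ind
    exact congrArg Submodule.Quotient.mk (Subtype.ext (BiOp.comp_one _))

end QD

/-! ## The group `K₁` -/

section KOne

variable {𝕜 : Type} [RCLike 𝕜]

/-- The matrix of the identity morphism of a formal sum. -/
def UnitalGradedStarCategory.oneMatrix (C : UnitalGradedStarCategory.{u, v} 𝕜) {n : ℕ}
    (P : Fin n → C.Obj) (i j : Fin n) : C.Hom (P j) (P i) :=
  if h : j = i then h ▸ C.one (P j) else 0

/-- The supersymmetries of the formal sum `P 0 ⊕ ⋯ ⊕ P (n - 1)` in the additive completion of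
`C`: the matrices `x`, with `x i j` a morphism from `P j` to `P i`, of degree `1` such that
`x⋆ = x` and `x² = 1`. -/
def SS (C : UnitalGradedStarCategory.{u, v} 𝕜) {n : ℕ} (P : Fin n → C.Obj) : Type v :=
  {x : ∀ i j, C.Hom (P j) (P i) //
    (∀ i j, C.gr (x i j) = -x i j) ∧ (∀ i j, C.adj (x j i) = x i j) ∧
      ∀ i j, ∑ k, C.comp (x i k) (x k j) = C.oneMatrix P i j}

/-- The topology of the norm: a finite matrix varies continuously when its entries do. -/
instance (C : UnitalGradedStarCategory.{u, v} 𝕜) {n : ℕ} (P : Fin n → C.Obj) :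
    TopologicalSpace (SS C P) :=
  TopologicalSpace.induced (fun x => x.1) inferInstance

/-- The supersymmetry `z` of `P 0 ⊕ ⋯ ⊕ P (m + n - 1)` is the block matrix `x ⊕ y`, where `x`
is a supersymmetry of the sum of the first `m` objects and `y` one of the sum of the last `n`
objects. -/
def IsBlockSum (C : UnitalGradedStarCategory.{u, v} 𝕜) {m n : ℕ} (P : Fin (m + n) → C.Obj)
    (x : SS C fun i => P (Fin.castAdd n i)) (y : SS C fun i => P (Fin.natAdd m i))
    (z : SS C P) : Prop :=
  (∀ i j, z.1 (Fin.castAdd n i) (Fin.castAdd n j) = x.1 i j) ∧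
  (∀ i j, z.1 (Fin.natAdd m i) (Fin.natAdd m j) = y.1 i j) ∧
  (∀ i j, z.1 (Fin.castAdd n i) (Fin.natAdd m j) = 0) ∧
  (∀ i j, z.1 (Fin.natAdd m i) (Fin.castAdd n j) = 0)

/-- All supersymmetries of all formal sums of objects of `C`. -/
structure AllSS (C : UnitalGradedStarCategory.{u, v} 𝕜) : Type (max u v) where
  n : ℕ
  P : Fin n → C.Obj
  x : SS C P

/-- The relations of the group `G₁`: a supersymmetry is identified with those in the same path
component, and `⟨x ⊕ y⟩ = ⟨x⟩ + ⟨y⟩`. -/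
inductive GOneRel (C : UnitalGradedStarCategory.{u, v} 𝕜) : FreeAbelianGroup (AllSS C) → Prop
  | path {n : ℕ} (P : Fin n → C.Obj) (x y : SS C P) (h : Joined x y) :
    GOneRel C (FreeAbelianGroup.of ⟨n, P, x⟩ - FreeAbelianGroup.of ⟨n, P, y⟩)
  | sum {m n : ℕ} (P : Fin (m + n) → C.Obj) (x : SS C fun i => P (Fin.castAdd n i))
    (y : SS C fun i => P (Fin.natAdd m i)) (z : SS C P) (h : IsBlockSum C P x y z) :
    GOneRel C (FreeAbelianGroup.of ⟨m + n, P, z⟩ - FreeAbelianGroup.of ⟨m, _, x⟩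
      - FreeAbelianGroup.of ⟨n, _, y⟩)

/-- The group `G₁(C)`: the Grothendieck group of the abelian semigroup, with addition `⊕`, of
the path components of supersymmetries, modulo `⟨x ⊕ y⟩ ∼ ⟨y ⊕ x⟩`. It is given by generators
and relations. -/
abbrev GOne (C : UnitalGradedStarCategory.{u, v} 𝕜) : Type (max u v) :=
  FreeAbelianGroup (AllSS C) ⧸ AddSubgroup.closure {r | GOneRel C r}

/-- The class `⟨x⟩`. -/
def GOne.mk (C : UnitalGradedStarCategory.{u, v} 𝕜) {n : ℕ} {P : Fin n → C.Obj}
    (x : SS C P) : GOne C :=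
  QuotientAddGroup.mk (FreeAbelianGroup.of ⟨n, P, x⟩)

theorem GOne.mk_sum {C : UnitalGradedStarCategory.{u, v} 𝕜} {m n : ℕ} {P : Fin (m + n) → C.Obj}
    {x : SS C fun i => P (Fin.castAdd n i)} {y : SS C fun i => P (Fin.natAdd m i)} {z : SS C P}
    (h : IsBlockSum C P x y z) : GOne.mk C z = GOne.mk C x + GOne.mk C y := by
  have h1 : (QuotientAddGroup.mk (FreeAbelianGroup.of ⟨m + n, P, z⟩
      - FreeAbelianGroup.of ⟨m, _, x⟩ - FreeAbelianGroup.of ⟨n, _, y⟩) : GOne C) = 0 :=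
    (QuotientAddGroup.eq_zero_iff _).2 (AddSubgroup.subset_closure (GOneRel.sum P x y z h))
  rw [QuotientAddGroup.mk_sub, QuotientAddGroup.mk_sub, sub_sub, sub_eq_zero] at h1
  exact h1

theorem GradedStarCategory.zero_comp (C : GradedStarCategory.{u, v} 𝕜) {a b c : C.Obj}
    (x : C.Hom a b) : C.comp (0 : C.Hom b c) x = 0 := by
  simpa using C.smul_comp (0 : 𝕜) (0 : C.Hom b c) x

theorem GradedStarCategory.comp_zero (C : GradedStarCategory.{u, v} 𝕜) {a b c : C.Obj}
    (x : C.Hom b c) : C.comp x (0 : C.Hom a b) = 0 := by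
  simpa using C.comp_smul (0 : 𝕜) x (0 : C.Hom a b)

theorem GradedStarCategory.adj_zero (C : GradedStarCategory.{u, v} 𝕜) {a b : C.Obj} :
    C.adj (0 : C.Hom a b) = 0 := by
  simpa using C.adj_smul (0 : 𝕜) (0 : C.Hom a b)

theorem GradedStarCategory.gr_zero (C : GradedStarCategory.{u, v} 𝕜) {a b : C.Obj} :
    C.gr (0 : C.Hom a b) = 0 := by
  simpa using C.gr_smul (0 : 𝕜) (0 : C.Hom a b)

theorem UnitalGradedStarCategory.oneMatrix_of_injective (C : UnitalGradedStarCategory.{u, v} 𝕜)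
    {m n : ℕ} (P : Fin n → C.Obj) (f : Fin m → Fin n) (hf : Function.Injective f)
    (i j : Fin m) : C.oneMatrix P (f i) (f j) = C.oneMatrix (fun i => P (f i)) i j := by
  unfold UnitalGradedStarCategory.oneMatrix
  by_cases h : j = i
  · subst h
    simp
  · rw [dif_neg h, dif_neg fun h' => h (hf h')]

theorem UnitalGradedStarCategory.oneMatrix_of_ne (C : UnitalGradedStarCategory.{u, v} 𝕜)
    {n : ℕ} (P : Fin n → C.Obj) {i j : Fin n} (h : j ≠ i) : C.oneMatrix P i j = 0 :=
  dif_neg h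

theorem exists_isBlockSum (C : UnitalGradedStarCategory.{u, v} 𝕜) {m n : ℕ}
    (P : Fin (m + n) → C.Obj) (x : SS C fun i => P (Fin.castAdd n i))
    (y : SS C fun i => P (Fin.natAdd m i)) : ∃ z, IsBlockSum C P x y z := by
  obtain ⟨x, hx1, hx2, hx3⟩ := x
  obtain ⟨y, hy1, hy2, hy3⟩ := y
  have hinj1 : Function.Injective (Fin.castAdd n : Fin m → Fin (m + n)) :=
    Fin.castAdd_injective m n
  have hinj2 : Function.Injective (Fin.natAdd m : Fin n → Fin (m + n)) :=
    Fin.natAdd_injective n m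
  have hne : ∀ (i : Fin m) (j : Fin n), Fin.castAdd n i ≠ Fin.natAdd m j := by
    intro i j h
    have := congrArg Fin.val h
    simp at this
    omega
  obtain ⟨z, h11, h22, h12, h21⟩ : ∃ z : ∀ i j, C.Hom (P j) (P i),
      (∀ i j, z (Fin.castAdd n i) (Fin.castAdd n j) = x i j) ∧
      (∀ i j, z (Fin.natAdd m i) (Fin.natAdd m j) = y i j) ∧
      (∀ i j, z (Fin.castAdd n i) (Fin.natAdd m j) = 0) ∧
      (∀ i j, z (Fin.natAdd m i) (Fin.castAdd n j) = 0) := by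
    refine ⟨fun i j => Fin.addCases (motive := fun i => C.Hom (P j) (P i))
      (fun i => Fin.addCases (motive := fun j => C.Hom (P j) (P (Fin.castAdd n i)))
        (fun j => x i j) (fun j => 0) j)
      (fun i => Fin.addCases (motive := fun j => C.Hom (P j) (P (Fin.natAdd m i)))
        (fun j => 0) (fun j => y i j) j) i, ?_, ?_, ?_, ?_⟩ <;>
    · intro i j
      simp
  refine ⟨⟨z, ?_, ?_, ?_⟩, h11, h22, h12, h21⟩
  · intro i j
    induction i using Fin.addCases <;> induction j using Fin.addCases <;>
      simp [h11, h22, h12, h21, hx1, hy1, C.gr_zero]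
  · intro i j
    induction i using Fin.addCases <;> induction j using Fin.addCases <;>
      simp [h11, h22, h12, h21, hx2, hy2, C.adj_zero]
  · intro i j
    rw [Fin.sum_univ_add]
    induction i using Fin.addCases with
    | left i =>
      induction j using Fin.addCases with
      | left j =>
        simp only [h11, h12, h21, C.zero_comp, Finset.sum_const_zero, add_zero]
        rw [C.oneMatrix_of_injective P _ hinj1]
        exact hx3 i j
      | right j =>
        simp only [h12, h22, C.zero_comp, C.comp_zero, Finset.sum_const_zero, add_zero]
        rw [C.oneMatrix_of_ne P (hne _ _).symm]
    | right i =>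
      induction j using Fin.addCases with
      | left j =>
        simp only [h11, h21, C.zero_comp, C.comp_zero, Finset.sum_const_zero, add_zero]
        rw [C.oneMatrix_of_ne P (hne _ _)]
      | right j =>
        simp only [h12, h21, h22, C.zero_comp, Finset.sum_const_zero, zero_add]
        rw [C.oneMatrix_of_injective P _ hinj2]
        exact hy3 i j

/-- The group `K₁(C)`: the formal differences `⟨x⟩ - ⟨y⟩` of supersymmetries `x` and `y` of the
same formal sum of objects. -/
def KOne (C : UnitalGradedStarCategory.{u, v} 𝕜) : AddSubgroup (GOne C) where
  carrier := {g | ∃ (n : ℕ) (P : Fin n → C.Obj) (x y : SS C P), g = GOne.mk C x - GOne.mk C y}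
  zero_mem' := ⟨0, Fin.elim0, ⟨fun i => i.elim0, fun i => i.elim0, fun i => i.elim0,
    fun i => i.elim0⟩, _, (sub_self _).symm⟩
  neg_mem' := by
    rintro _ ⟨n, P, x, y, rfl⟩
    exact ⟨n, P, y, x, neg_sub _ _⟩
  add_mem' := by
    rintro _ _ ⟨m, P, x, y, rfl⟩ ⟨n, Q, x', y', rfl⟩
    obtain ⟨R, hP, hQ⟩ : ∃ R : Fin (m + n) → C.Obj,
        P = (fun i => R (Fin.castAdd n i)) ∧ Q = fun i => R (Fin.natAdd m i) :=
      ⟨Fin.append P Q, by funext i; simp, by funext i; simp⟩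
    subst hP hQ
    obtain ⟨z, hz⟩ := exists_isBlockSum C R x x'
    obtain ⟨w, hw⟩ := exists_isBlockSum C R y y'
    refine ⟨m + n, R, z, w, ?_⟩
    rw [GOne.mk_sum hz, GOne.mk_sum hw]
    abel

/-- The formal difference `⟨x⟩ - ⟨y⟩` as an element of `K₁(C)`. -/
def KOne.diff (C : UnitalGradedStarCategory.{u, v} 𝕜) {n : ℕ} {P : Fin n → C.Obj}
    (x y : SS C P) : KOne C :=
  ⟨GOne.mk C x - GOne.mk C y, n, P, x, y, rfl⟩

/-- A unital graded C*-functor. (Continuity is automatic between C*-categories.) -/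
structure UnitalGradedFunctor (C : UnitalGradedStarCategory.{u, v} 𝕜)
    (D : UnitalGradedStarCategory.{u', v'} 𝕜) : Type (max u v u' v') extends
    GradedFunctor C.toGradedStarCategory D.toGradedStarCategory where
  map_one : ∀ a : C.Obj, map (C.one a) = D.one (obj a)
  continuous_map : ∀ {a b : C.Obj}, Continuous (map : C.Hom a b → D.Hom (obj a) (obj b))

namespace UnitalGradedFunctor

variable {C : UnitalGradedStarCategory.{u, v} 𝕜} {D : UnitalGradedStarCategory.{u', v'} 𝕜}
  (F : UnitalGradedFunctor C D)

theorem map_zero {a b : C.Obj} : F.map (0 : C.Hom a b) = 0 := by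
  simpa using F.map_smul (0 : 𝕜) (0 : C.Hom a b)

theorem map_neg {a b : C.Obj} (x : C.Hom a b) : F.map (-x) = -F.map x := by
  rw [← neg_one_smul 𝕜 x, F.map_smul, neg_one_smul]

theorem map_sum {ι : Type} (s : Finset ι) {a b : C.Obj} (f : ι → C.Hom a b) :
    F.map (∑ i ∈ s, f i) = ∑ i ∈ s, F.map (f i) :=
  _root_.map_sum (⟨⟨F.map, F.map_zero⟩, F.map_add⟩ : C.Hom a b →+ D.Hom (F.obj a) (F.obj b)) f s

theorem map_oneMatrix {n : ℕ} (P : Fin n → C.Obj) (i j : Fin n) :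
    F.map (C.oneMatrix P i j) = D.oneMatrix (fun i => F.obj (P i)) i j := by
  unfold UnitalGradedStarCategory.oneMatrix
  by_cases h : j = i
  · subst h
    simpa using F.map_one _
  · rw [dif_neg h, dif_neg h, F.map_zero]

/-- The image of a supersymmetry, entry by entry. -/
def mapSS {n : ℕ} {P : Fin n → C.Obj} (x : SS C P) : SS D fun i => F.obj (P i) :=
  ⟨fun i j => F.map (x.1 i j),
    fun i j => by rw [← F.map_gr, x.2.1, F.map_neg],
    fun i j => by rw [← F.map_adj, x.2.2.1],
    fun i j => by
      rw [← F.map_oneMatrix, ← x.2.2.2 i j, F.map_sum]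
      exact Finset.sum_congr rfl fun k _ => (F.map_comp _ _).symm⟩

theorem continuous_mapSS {n : ℕ} {P : Fin n → C.Obj} :
    Continuous (F.mapSS : SS C P → SS D fun i => F.obj (P i)) := by
  refine continuous_induced_rng.2 ?_
  refine continuous_pi fun i => continuous_pi fun j => ?_
  exact F.continuous_map.comp
    ((continuous_apply j).comp ((continuous_apply i).comp continuous_induced_dom))

/-- The induced homomorphism `G₁(C) → G₁(D)`. -/
def mapGOne : GOne C →+ GOne D :=
  QuotientAddGroup.map _ _
    (FreeAbelianGroup.map fun s => ⟨s.n, fun i => F.obj (s.P i), F.mapSS s.x⟩) (by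
      rw [AddSubgroup.closure_le]
      rintro _ (⟨P, x, y, h⟩ | ⟨P, x, y, z, h⟩)
      · refine AddSubgroup.subset_closure ?_
        rw [Set.mem_ofPred_eq, map_sub, FreeAbelianGroup.map_of_apply,
          FreeAbelianGroup.map_of_apply]
        exact GOneRel.path _ _ _ ⟨h.somePath.map F.continuous_mapSS⟩
      · refine AddSubgroup.subset_closure ?_
        rw [Set.mem_ofPred_eq, map_sub, map_sub, FreeAbelianGroup.map_of_apply,
          FreeAbelianGroup.map_of_apply, FreeAbelianGroup.map_of_apply]
        refine GOneRel.sum (fun i => F.obj (P i)) _ _ _ ⟨?_, ?_, ?_, ?_⟩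
        · intro i j
          exact congrArg F.map (h.1 i j)
        · intro i j
          exact congrArg F.map (h.2.1 i j)
        · intro i j
          exact (congrArg F.map (h.2.2.1 i j)).trans F.map_zero
        · intro i j
          exact (congrArg F.map (h.2.2.2 i j)).trans F.map_zero)

/-- The induced homomorphism `K₁(C) → K₁(D)`. -/
def mapKOne : KOne C →+ KOne D :=
  (F.mapGOne.comp (KOne C).subtype).codRestrict (KOne D) (by
    rintro ⟨_, n, P, x, y, rfl⟩
    refine ⟨n, _, F.mapSS x, F.mapSS y, ?_⟩
    change F.mapGOne (GOne.mk C x - GOne.mk C y) = _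
    rw [_root_.map_sub]
    rfl)

end UnitalGradedFunctor

end KOne

/-! ## Functoriality of the dual category in the first variable -/

section Restrict

variable {𝕜 : Type} [RCLike 𝕜] {A A' : GradedCStarCategory.{v} 𝕜} {B : GradedCStarCategory.{u} 𝕜}
  (H : GradedFunctor A'.toGradedStarCategory A.toGradedStarCategory)

/-- The bimodule `E ∘ H`. -/
def Bimodule.restrict (E : Bimodule A B) : Bimodule A' B where
  obj a := E.obj (H.obj a)
  map x := E.map (H.map x)
  map_add x y := by rw [H.map_add, E.map_add]
  map_smul r x := by rw [H.map_smul, E.map_smul]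
  map_comp x y := by rw [H.map_comp, E.map_comp]
  map_adj x := by rw [H.map_adj, E.map_adj]
  map_gr x := by rw [H.map_gr, E.map_gr]

namespace BiOp

variable {E F : Bimodule A B}

/-- The operator `E ∘ H → F ∘ H` with components `T (H a)`. -/
def restrict (T : BiOp E F) : BiOp (E.restrict H) (F.restrict H) :=
  mk' (fun a => T.at' (H.obj a)) ‖T‖ fun a => T.norm_at_le (H.obj a)

theorem norm_restrict_le (T : BiOp E F) : ‖T.restrict H‖ ≤ ‖T‖ :=
  norm_le _ (norm_nonneg _) fun a => T.norm_at_le (H.obj a)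

theorem IsDual.restrict {T : BiOp E F} (hT : T.IsDual) : (T.restrict H).IsDual := by
  intro a a' x
  obtain ⟨h1, h2⟩ := hT _ _ (H.map x)
  refine ⟨h1, ?_⟩
  rw [← H.map_gr] at h2
  exact h2

theorem IsLocallyCompact.restrict {T : BiOp E F} (hT : T.IsLocallyCompact) :
    (T.restrict H).IsLocallyCompact := fun _ _ x => hT _ _ (H.map x)

end BiOp

namespace QDHom

variable {E F : Bimodule A B}

/-- The map induced by `T ↦ T ∘ H` on the quotients. -/
def restrict (x : QDHom E F) : QDHom (E.restrict H) (F.restrict H) :=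
  Quotient.liftOn' x (fun T => mk (T.1.restrict H) (BiOp.IsDual.restrict H T.2)) (by
    intro T T' hT
    rw [Submodule.quotientRel_def] at hT
    refine mk_eq_mk.2 ?_
    exact BiOp.IsLocallyCompact.restrict H (T := (T - T').1) hT)

theorem continuous_restrict :
    Continuous (restrict H : QDHom E F → QDHom (E.restrict H) (F.restrict H)) := by
  have h1 : Continuous fun T : BiOp E F => T.restrict H := by
    refine (LipschitzWith.of_dist_le_mul (K := 1) fun S T => ?_).continuous
    rw [dist_eq_norm, dist_eq_norm, NNReal.coe_one, one_mul]
    exact BiOp.norm_restrict_le H (S - T)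
  have h2 : Continuous fun T : dualHom E F =>
      (⟨T.1.restrict H, BiOp.IsDual.restrict H T.2⟩ : dualHom (E.restrict H) (F.restrict H)) :=
    (h1.comp continuous_subtype_val).subtype_mk _
  exact continuous_quot_lift _ (continuous_quot_mk.comp h2)

end QDHom

/-- The functor `QD(A, B) → QD(A', B)` induced by a graded C*-functor `H : A' → A`. -/
def QD.restrict : UnitalGradedFunctor (QD A B) (QD A' B) where
  obj E := Bimodule.restrict H E
  map x := QDHom.restrict H x
  map_add := by
    intro E F x y
    induction x using QDHom.ind; induction y using QDHom.ind
    rfl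
  map_smul := by
    intro E F r x
    induction x using QDHom.ind
    rfl
  map_comp := by
    intro E F G x y
    induction x using QDHom.ind; induction y using QDHom.ind
    exact congrArg Submodule.Quotient.mk (Subtype.ext (BiOp.ext fun _ => Op.ext fun _ _ => rfl))
  map_adj := by
    intro E F x
    induction x using QDHom.ind
    rfl
  map_gr := by
    intro E F x
    induction x using QDHom.ind
    exact congrArg Submodule.Quotient.mk (Subtype.ext (BiOp.ext fun _ => Op.ext fun _ _ => rfl))
  map_one _ := rfl
  continuous_map := QDHom.continuous_restrict H

end Restrict

/-! ## KK-theory -/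

section KKTheory

variable {𝕜 : Type} [RCLike 𝕜] {A : GradedCStarCategory.{v} 𝕜} {B : GradedCStarCategory.{u} 𝕜}

/-- The operator `F` makes the bimodule `E` a Kasparov `(A, B)`-cycle: `F` has degree `1` and
`x (F - F⋆)`, `x (F² - 1)` and `x F - (-1) ^ deg x • F x` are compact for all morphisms `x`. -/
structure IsCycle (E : Bimodule A B) (F : BiOp E E) : Prop where
  degree : F.gr = -F
  adj : ∀ (a a' : A.Obj) (x : A.Hom a a'),
    Op.comp (E.map x) (F.at' a - (F.at' a).adj) ∈ Op.compact (E.obj a) (E.obj a')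
  sq : ∀ (a a' : A.Obj) (x : A.Hom a a'),
    Op.comp (E.map x) (Op.comp (F.at' a) (F.at' a) - Op.one (E.obj a))
      ∈ Op.compact (E.obj a) (E.obj a')
  comm : ∀ (a a' : A.Obj) (x : A.Hom a a'),
    Op.comp (E.map x) (F.at' a) - Op.comp (F.at' a') (E.map (A.gr x))
      ∈ Op.compact (E.obj a) (E.obj a')

variable (A B) in
/-- Kasparov `(A, B)`-cycles. -/
structure KasparovCycle : Type (max v (u + 1)) where
  E : Bimodule A B
  F : BiOp E E
  isCycle : IsCycle E F

/-- A cycle is degenerate if the operators `x (F - F⋆)`, `x (F² - 1)` and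
`x F - (-1) ^ deg x • F x` vanish. -/
def KasparovCycle.IsDegenerate (c : KasparovCycle A B) : Prop :=
  ∀ (a a' : A.Obj) (x : A.Hom a a'),
    Op.comp (c.E.map x) (c.F.at' a - (c.F.at' a).adj) = 0 ∧
    Op.comp (c.E.map x) (Op.comp (c.F.at' a) (c.F.at' a) - Op.one (c.E.obj a)) = 0 ∧
    Op.comp (c.E.map x) (c.F.at' a) - Op.comp (c.F.at' a') (c.E.map (A.gr x)) = 0

/-- The bimodule `E` is the direct sum of the bimodules `E₁` and `E₂`, with the inclusions `i₁`
and `i₂`: these are isometries of degree `0` which commute with the action of `A` and whose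
ranges are complementary. This determines `E` up to a unique unitary isomorphism of degree `0`
of bimodules that is compatible with the inclusions. -/
structure IsBimoduleSum {E₁ E₂ E : Bimodule A B} (i₁ : BiOp E₁ E) (i₂ : BiOp E₂ E) : Prop where
  degree_left : i₁.gr = i₁
  degree_right : i₂.gr = i₂
  natural_left : ∀ (a a' : A.Obj) (x : A.Hom a a'),
    Op.comp (E.map x) (i₁.at' a) = Op.comp (i₁.at' a') (E₁.map x)
  natural_right : ∀ (a a' : A.Obj) (x : A.Hom a a'),
    Op.comp (E.map x) (i₂.at' a) = Op.comp (i₂.at' a') (E₂.map x)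
  isometry_left : BiOp.comp i₁.adj i₁ = BiOp.one E₁
  isometry_right : BiOp.comp i₂.adj i₂ = BiOp.one E₂
  complementary : BiOp.comp i₁ i₁.adj + BiOp.comp i₂ i₂.adj = BiOp.one E

/-- The cycle `c` is the direct sum of `c₁` and `c₂` (up to isomorphism). -/
def KasparovCycle.IsSum (c₁ c₂ c : KasparovCycle A B) : Prop :=
  ∃ (i₁ : BiOp c₁.E c.E) (i₂ : BiOp c₂.E c.E), IsBimoduleSum i₁ i₂ ∧
    BiOp.comp c.F i₁ = BiOp.comp i₁ c₁.F ∧ BiOp.comp c.F i₂ = BiOp.comp i₂ c₂.F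

/-- An operator homotopy: a norm continuous path of cycles with the same bimodule. -/
def OperatorHomotopic {E : Bimodule A B} (F F' : BiOp E E) : Prop :=
  ∃ γ : Path F F', ∀ t, IsCycle E (γ t)

/-- Two cycles are equivalent if they become operator homotopic after the addition of
degenerate cycles. -/
def KasparovCycle.Equivalent (c₁ c₂ : KasparovCycle A B) : Prop :=
  ∃ d₁ d₂ : KasparovCycle A B, d₁.IsDegenerate ∧ d₂.IsDegenerate ∧
    ∃ (E : Bimodule A B) (F F' : BiOp E E) (h : IsCycle E F) (h' : IsCycle E F'),
      c₁.IsSum d₁ ⟨E, F, h⟩ ∧ c₂.IsSum d₂ ⟨E, F', h'⟩ ∧ OperatorHomotopic F F'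

variable (A B) in
/-- The set `KK(A, B)` of equivalence classes of Kasparov cycles. -/
def KK : Type (max v (u + 1)) := Quot (KasparovCycle.Equivalent (A := A) (B := B))

/-- The class of a cycle. -/
def KK.mk (c : KasparovCycle A B) : KK A B := Quot.mk _ c

/-! ### Functoriality in the first variable -/

variable {A' : GradedCStarCategory.{v} 𝕜}
  (H : GradedFunctor A'.toGradedStarCategory A.toGradedStarCategory)

theorem IsCycle.restrict {E : Bimodule A B} {F : BiOp E E} (h : IsCycle E F) :
    IsCycle (E.restrict H) (F.restrict H) where
  degree := BiOp.ext fun a => congrArg (fun T => BiOp.at' T (H.obj a)) h.degree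
  adj _ _ x := h.adj _ _ (H.map x)
  sq _ _ x := h.sq _ _ (H.map x)
  comm a a' x := by
    have := h.comm _ _ (H.map x)
    rw [← H.map_gr] at this
    exact this

/-- The cycle `(E ∘ H, F)`. -/
def KasparovCycle.restrict (c : KasparovCycle A B) : KasparovCycle A' B :=
  ⟨c.E.restrict H, c.F.restrict H, c.isCycle.restrict H⟩

theorem KasparovCycle.IsDegenerate.restrict {c : KasparovCycle A B} (h : c.IsDegenerate) :
    (c.restrict H).IsDegenerate := by
  intro a a' x
  obtain ⟨h1, h2, h3⟩ := h _ _ (H.map x)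
  rw [← H.map_gr] at h3
  exact ⟨h1, h2, h3⟩

theorem KasparovCycle.IsSum.restrict {c₁ c₂ c : KasparovCycle A B} (h : c₁.IsSum c₂ c) :
    (c₁.restrict H).IsSum (c₂.restrict H) (c.restrict H) := by
  obtain ⟨i₁, i₂, hi, h1, h2⟩ := h
  have key : ∀ {E F : Bimodule A B} {S T : BiOp E F}, S = T → ∀ a : A'.Obj,
      S.at' (H.obj a) = T.at' (H.obj a) := fun h a => by rw [h]
  refine ⟨i₁.restrict H, i₂.restrict H, ⟨?_, ?_, ?_, ?_, ?_, ?_, ?_⟩, ?_, ?_⟩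
  · exact BiOp.ext (key hi.degree_left)
  · exact BiOp.ext (key hi.degree_right)
  · exact fun _ _ x => hi.natural_left _ _ (H.map x)
  · exact fun _ _ x => hi.natural_right _ _ (H.map x)
  · exact BiOp.ext (key hi.isometry_left)
  · exact BiOp.ext (key hi.isometry_right)
  · exact BiOp.ext (key hi.complementary)
  · exact BiOp.ext (key h1)
  · exact BiOp.ext (key h2)

theorem OperatorHomotopic.restrict {E : Bimodule A B} {F F' : BiOp E E}
    (h : OperatorHomotopic F F') : OperatorHomotopic (F.restrict H) (F'.restrict H) := by
  obtain ⟨γ, hγ⟩ := h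
  have hc : Continuous fun T : BiOp E E => T.restrict H := by
    refine (LipschitzWith.of_dist_le_mul (K := 1) fun S T => ?_).continuous
    rw [dist_eq_norm, dist_eq_norm, NNReal.coe_one, one_mul]
    exact BiOp.norm_restrict_le H (S - T)
  exact ⟨γ.map hc, fun t => (hγ t).restrict H⟩

/-- The map `KK(A, B) → KK(A', B)`, `[(E, F)] ↦ [(E ∘ H, F)]`. -/
def KK.restrict : KK A B → KK A' B :=
  Quot.map (fun c => c.restrict H) (by
    rintro c₁ c₂ ⟨d₁, d₂, h1, h2, E, F, F', h, h', h3, h4, h5⟩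
    exact ⟨_, _, h1.restrict H, h2.restrict H, _, _, _, h.restrict H, h'.restrict H,
      h3.restrict H, h4.restrict H, h5.restrict H⟩)

end KKTheory

/-! ## Functoriality in the second variable -/

section Pushforward

variable {𝕜 : Type} [RCLike 𝕜] {A : GradedCStarCategory.{v} 𝕜}
  {B B' : GradedCStarCategory.{u} 𝕜}

/-- The bimodule `E'` is the inner tensor product of `E` with `B'` along the graded C*-functor
`G : B → B'`. The vector `tmul η y` is the elementary tensor `η ⊗ y`; the elementary tensors
span dense subspaces, and
`⟨η ⊗ y, ξ ⊗ z⟩ = y⋆ G(⟨η, ξ⟩) z`, `gr (η ⊗ y) = gr η ⊗ gr y` and `x (η ⊗ y) = x η ⊗ y`.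
This determines `E'` up to a unique unitary isomorphism of degree `0` of bimodules that preserves
elementary tensors; the remaining properties of a tensor product (bilinearity, `η x ⊗ y = η ⊗ G(x) y`,
compatibility with the action of `B'`) follow from the formula for the inner product. -/
structure Pushforward (G : GradedFunctor B.toGradedStarCategory B'.toGradedStarCategory)
    (E : Bimodule A B) (E' : Bimodule A B') where
  tmul : ∀ {a : A.Obj} {b : B.Obj} {c : B'.Obj},
    (E.obj a).X b → B'.Hom c (G.obj b) → (E'.obj a).X c
  inner_tmul : ∀ {a : A.Obj} {b₁ b₂ : B.Obj} {c₁ c₂ : B'.Obj} (η : (E.obj a).X b₁)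
    (y : B'.Hom c₁ (G.obj b₁)) (ξ : (E.obj a).X b₂) (z : B'.Hom c₂ (G.obj b₂)),
    (E'.obj a).inner (tmul η y) (tmul ξ z)
      = B'.comp (B'.adj y) (B'.comp (G.map ((E.obj a).inner η ξ)) z)
  gr_tmul : ∀ {a : A.Obj} {b : B.Obj} {c : B'.Obj} (η : (E.obj a).X b)
    (y : B'.Hom c (G.obj b)), (E'.obj a).gr (tmul η y) = tmul ((E.obj a).gr η) (B'.gr y)
  map_tmul : ∀ {a a' : A.Obj} {b : B.Obj} {c : B'.Obj} (x : A.Hom a a') (η : (E.obj a).X b)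
    (y : B'.Hom c (G.obj b)), (E'.map x).app c (tmul η y) = tmul ((E.map x).app b η) y
  dense : ∀ (a : A.Obj) (c : B'.Obj),
    Dense (Submodule.span 𝕜 {ζ : (E'.obj a).X c | ∃ (b : B.Obj) (η : (E.obj a).X b)
      (y : B'.Hom c (G.obj b)), ζ = tmul η y} : Set ((E'.obj a).X c))

variable {G : GradedFunctor B.toGradedStarCategory B'.toGradedStarCategory}

/-- `T'` is the operator `T ⊗ 1`. -/
def Pushforward.IsTensorOne {E F : Bimodule A B} {E' F' : Bimodule A B'}
    (p : Pushforward G E E') (q : Pushforward G F F') (T : BiOp E F) (T' : BiOp E' F') : Prop :=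
  ∀ (a : A.Obj) (b : B.Obj) (c : B'.Obj) (η : (E.obj a).X b) (y : B'.Hom c (G.obj b)),
    (T'.at' a).app c (p.tmul η y) = q.tmul ((T.at' a).app b η) y

variable (G) in
/-- The cycle `c'` is `(E ⊗ B', F ⊗ 1)`, up to isomorphism, where `c = (E, F)`. -/
def KasparovCycle.IsPushforward (c : KasparovCycle A B) (c' : KasparovCycle A B') : Prop :=
  ∃ p : Pushforward G c.E c'.E, p.IsTensorOne p c.F c'.F

/-- The supersymmetry `x'` of the formal sum of the bimodules `P' i = P i ⊗ B'` is obtained from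
the supersymmetry `x` of the formal sum of the bimodules `P i` by applying the functor
`T ↦ T ⊗ 1` from `QD(A, B)` to `QD(A, B')` to all entries. -/
def SS.IsPushforward {n : ℕ} {P : Fin n → Bimodule A B} {P' : Fin n → Bimodule A B'}
    (p : ∀ i, Pushforward G (P i) (P' i)) (x : SS (QD A B) P) (x' : SS (QD A B') P') : Prop :=
  ∀ i j, ∃ (T : BiOp (P j) (P i)) (hT : T.IsDual) (T' : BiOp (P' j) (P' i)) (hT' : T'.IsDual),
    (p j).IsTensorOne (p i) T T' ∧ x.1 i j = QDHom.mk T hT ∧ x'.1 i j = QDHom.mk T' hT'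

end Pushforward

end

noncomputable section

/-! ## Spectral radius in real Banach spaces -/

section Complexification

/-- The complexification of a real normed space. -/
def Complexified (X : Type*) [NormedAddCommGroup X] [NormedSpace ℝ X] : Type _ := ℂ →L[ℝ] X

namespace Complexified

variable {X : Type*} [NormedAddCommGroup X] [NormedSpace ℝ X]

instance : NormedAddCommGroup (Complexified X) := inferInstanceAs (NormedAddCommGroup (ℂ →L[ℝ] X))

instance [CompleteSpace X] : CompleteSpace (Complexified X) :=
  inferInstanceAs (CompleteSpace (ℂ →L[ℝ] X))

/-- The underlying real linear map. -/
def toLin (f : Complexified X) : ℂ →L[ℝ] X := f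

instance : SMul ℂ (Complexified X) :=
  ⟨fun z f => (toLin f).comp (ContinuousLinearMap.mul ℝ ℂ z)⟩

theorem smul_toLin (z w : ℂ) (f : Complexified X) : toLin (z • f) w = toLin f (z * w) := rfl

theorem add_toLin (f g : Complexified X) (w : ℂ) : toLin (f + g) w = toLin f w + toLin g w := rfl

theorem ext {f g : Complexified X} (h : ∀ w, toLin f w = toLin g w) : f = g :=
  ContinuousLinearMap.ext h

theorem norm_toLin (f : Complexified X) : ‖toLin f‖ = ‖f‖ := rfl

instance : Module ℂ (Complexified X) where
  one_smul f := ext fun w => by rw [smul_toLin, one_mul]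
  mul_smul z z' f := ext fun w => by
    rw [smul_toLin, smul_toLin, smul_toLin]; congr 1; ring
  smul_zero z := ext fun w => rfl
  zero_smul f := ext fun w => by rw [smul_toLin, zero_mul, map_zero]; rfl
  smul_add z f g := ext fun w => rfl
  add_smul z z' f := ext fun w => by
    rw [smul_toLin, add_toLin, smul_toLin, smul_toLin, add_mul, map_add]

instance : NormedSpace ℂ (Complexified X) where
  norm_smul_le z f := by
    refine ContinuousLinearMap.opNorm_le_bound _ (by positivity) fun w => ?_
    refine ((toLin f).le_opNorm (z * w)).trans (le_of_eq ?_)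
    rw [norm_mul, norm_toLin]; ring

/-- The complexification of a bounded operator. -/
def map (T : X →L[ℝ] X) : Complexified X →L[ℂ] Complexified X :=
  LinearMap.mkContinuous
    { toFun := fun f => T.comp (toLin f)
      map_add' := fun _ _ => ext fun _ => T.map_add _ _
      map_smul' := fun _ _ => rfl } ‖T‖ fun f => T.opNorm_comp_le (toLin f)

theorem map_toLin (T : X →L[ℝ] X) (f : Complexified X) (w : ℂ) :
    toLin (map T f) w = T (toLin f w) := rfl

theorem map_mul (S T : X →L[ℝ] X) : map (S * T) = map S * map T := rfl

theorem map_one : map (1 : X →L[ℝ] X) = 1 := rfl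

theorem map_pow (T : X →L[ℝ] X) (n : ℕ) : map (T ^ n) = map T ^ n := by
  induction n with
  | zero => rfl
  | succ n ih => rw [pow_succ, pow_succ, map_mul, ih]

theorem norm_map (T : X →L[ℝ] X) : ‖map T‖ = ‖T‖ := by
  refine le_antisymm (LinearMap.mkContinuous_norm_le _ (norm_nonneg _) _) ?_
  refine ContinuousLinearMap.opNorm_le_bound _ (norm_nonneg _) fun x => ?_
  let f : Complexified X := Complex.reCLM.smulRight x
  have hf : ‖f‖ ≤ ‖x‖ := by
    refine ContinuousLinearMap.opNorm_le_bound _ (norm_nonneg _) fun w => ?_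
    change ‖w.re • x‖ ≤ _
    rw [norm_smul, mul_comm]
    exact mul_le_mul_of_nonneg_left (Complex.abs_re_le_norm w) (norm_nonneg _)
  have h1 : ‖T x‖ ≤ ‖map T f‖ := by
    have h2 := (toLin (map T f)).le_opNorm 1
    rw [map_toLin, norm_one, mul_one] at h2
    have h3 : toLin f 1 = x := by
      change (1 : ℂ).re • x = x
      simp
    rwa [h3] at h2
  exact h1.trans (((map T).le_opNorm f).trans (mul_le_mul_of_nonneg_left hf (norm_nonneg _)))

end Complexified

/-- If the norm of `L` is its spectral radius then the norm is attained at a (complex) point of the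
spectrum of `L`. -/
theorem exists_spectrum_norm_eq {X : Type*} [NormedAddCommGroup X] [NormedSpace ℝ X]
    [CompleteSpace X] [Nontrivial X] (L : X →L[ℝ] X)
    (hL : ∀ n : ℕ, ‖L ^ (2 ^ n)‖ = ‖L‖ ^ (2 ^ n)) :
    ∃ z : ℂ, ‖z‖ = ‖L‖ ∧ ¬IsUnit (L ^ 2 - (2 * z.re) • L + (‖z‖ ^ 2) • (1 : X →L[ℝ] X)) := by
  have : Nontrivial (Complexified X) := by
    obtain ⟨x, hx⟩ := exists_ne (0 : X)
    refine ⟨(Complex.reCLM.smulRight x : ℂ →L[ℝ] X), (0 : ℂ →L[ℝ] X), fun h => hx ?_⟩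
    have := congrArg (fun f : Complexified X => Complexified.toLin f 1) h
    change (1 : ℂ).re • x = 0 at this
    simpa using this
  obtain ⟨z, hz, hr⟩ := spectrum.exists_nnnorm_eq_spectralRadius (Complexified.map L)
  have hrad : spectralRadius ℂ (Complexified.map L) = ‖L‖₊ := by
    have hconst : Filter.Tendsto (fun _n : ℕ => (‖L‖₊ : ℝ≥0∞)) Filter.atTop _ :=
      tendsto_const_nhds
    refine tendsto_nhds_unique ?_ hconst
    convert (spectrum.pow_nnnorm_pow_one_div_tendsto_nhds_spectralRadius
      (Complexified.map L)).comp (tendsto_pow_atTop_atTop_of_one_lt one_lt_two) using 1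
    funext n
    have h1 : ‖Complexified.map L ^ 2 ^ n‖₊ = ‖L‖₊ ^ 2 ^ n := by
      apply NNReal.eq
      rw [coe_nnnorm, ← Complexified.map_pow, Complexified.norm_map, hL]; rfl
    rw [Function.comp_apply, h1, ENNReal.coe_pow, ← ENNReal.rpow_natCast, ← ENNReal.rpow_mul]
    simp
  refine ⟨z, ?_, fun hu => ?_⟩
  · rw [hrad] at hr
    have : ‖z‖₊ = ‖L‖₊ := by exact_mod_cast hr
    exact congrArg NNReal.toReal this
  · apply spectrum.mem_iff.1 hz
    set M := Complexified.map L
    have h1 : IsUnit (Complexified.map (L ^ 2 - (2 * z.re) • L + (‖z‖ ^ 2) • (1 : X →L[ℝ] X))) := by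
      obtain ⟨w, hw⟩ := hu
      refine ⟨⟨Complexified.map w, Complexified.map (w⁻¹ : (X →L[ℝ] X)ˣ), ?_, ?_⟩, congrArg Complexified.map hw⟩
      · rw [← Complexified.map_mul, Units.mul_inv]; rfl
      · rw [← Complexified.map_mul, Units.inv_mul]; rfl
    have h2 : Complexified.map (L ^ 2 - (2 * z.re) • L + (‖z‖ ^ 2) • (1 : X →L[ℝ] X))
        = (algebraMap ℂ _ z - M) * (algebraMap ℂ _ (starRingEnd ℂ z) - M) := by
      have hs : ∀ (r : ℝ) (T : X →L[ℝ] X), Complexified.map (r • T) = (r : ℂ) • Complexified.map T := by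
        intro r T
        refine ContinuousLinearMap.ext fun f => Complexified.ext fun w => ?_
        change r • T (Complexified.toLin f w) = T (Complexified.toLin f (r * w))
        rw [← Complex.real_smul, ContinuousLinearMap.map_smul, ContinuousLinearMap.map_smul]
      have ha : ∀ S T : X →L[ℝ] X, Complexified.map (S + T) = Complexified.map S + Complexified.map T :=
        fun _ _ => rfl
      have hb : ∀ S T : X →L[ℝ] X, Complexified.map (S - T) = Complexified.map S - Complexified.map T :=
        fun _ _ => rfl
      rw [ha, hb, hs, hs, Complexified.map_pow, Complexified.map_one]
      have h3 : ((‖z‖ ^ 2 : ℝ) : ℂ) = z * starRingEnd ℂ z := by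
        rw [Complex.mul_conj, Complex.normSq_eq_norm_sq]
      have h4 : ((2 * z.re : ℝ) : ℂ) = z + starRingEnd ℂ z := by
        rw [Complex.add_conj]
      rw [h3, h4, sub_mul, mul_sub, mul_sub, ← _root_.map_mul, Algebra.algebraMap_eq_smul_one,
        Algebra.algebraMap_eq_smul_one, Algebra.algebraMap_eq_smul_one, smul_mul_assoc, one_mul,
        mul_smul_comm, mul_one, add_smul, sq]
      abel
    rw [h2] at h1
    have hc : Commute (algebraMap ℂ _ z - M) (algebraMap ℂ _ (starRingEnd ℂ z) - M) := by
      apply Commute.sub_left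
      · exact Algebra.commutes z _
      · exact Commute.sub_right (Algebra.commutes (starRingEnd ℂ z) M).symm (Commute.refl M)
    exact (hc.isUnit_mul_iff.1 h1).1

end Complexification

/-! ## Positive morphisms of C*-categories -/

instance GradedStarCategory.realSpace {𝕜 : Type} [RCLike 𝕜] (C : GradedStarCategory.{u, v} 𝕜)
    (a b : C.Obj) : NormedSpace ℝ (C.Hom a b) := NormedSpace.restrictScalars ℝ 𝕜 _

namespace GradedStarCategory

variable {𝕜 : Type} [RCLike 𝕜] (C : GradedStarCategory.{u, v} 𝕜)

theorem real_smul_def {a b : C.Obj} (r : ℝ) (x : C.Hom a b) : r • x = (r : 𝕜) • x := rfl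

theorem real_smul_comp {a b c : C.Obj} (r : ℝ) (x : C.Hom b c) (y : C.Hom a b) :
    C.comp (r • x) y = r • C.comp x y := C.smul_comp _ _ _

theorem comp_real_smul {a b c : C.Obj} (r : ℝ) (x : C.Hom b c) (y : C.Hom a b) :
    C.comp x (r • y) = r • C.comp x y := C.comp_smul _ _ _

theorem adj_real_smul {a b : C.Obj} (r : ℝ) (x : C.Hom a b) : C.adj (r • x) = r • C.adj x := by
  rw [real_smul_def, C.adj_smul, RCLike.conj_ofReal]; rfl

theorem adj_neg {a b : C.Obj} (x : C.Hom a b) : C.adj (-x) = -C.adj x := by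
  rw [← neg_one_smul ℝ x, adj_real_smul, neg_one_smul]

theorem adj_sub {a b : C.Obj} (x y : C.Hom a b) : C.adj (x - y) = C.adj x - C.adj y := by
  rw [sub_eq_add_neg, C.adj_add, adj_neg, ← sub_eq_add_neg]

theorem neg_comp {a b c : C.Obj} (x : C.Hom b c) (y : C.Hom a b) :
    C.comp (-x) y = -C.comp x y := by
  rw [← neg_one_smul ℝ x, real_smul_comp, neg_one_smul]

theorem comp_neg {a b c : C.Obj} (x : C.Hom b c) (y : C.Hom a b) :
    C.comp x (-y) = -C.comp x y := by
  rw [← neg_one_smul ℝ y, comp_real_smul, neg_one_smul]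

theorem sub_comp {a b c : C.Obj} (x y : C.Hom b c) (z : C.Hom a b) :
    C.comp (x - y) z = C.comp x z - C.comp y z := by
  rw [sub_eq_add_neg, C.add_comp, neg_comp, ← sub_eq_add_neg]

theorem comp_sub {a b c : C.Obj} (x : C.Hom b c) (y z : C.Hom a b) :
    C.comp x (y - z) = C.comp x y - C.comp x z := by
  rw [sub_eq_add_neg, C.comp_add, comp_neg, ← sub_eq_add_neg]

theorem gr_neg {a b : C.Obj} (x : C.Hom a b) : C.gr (-x) = -C.gr x := by
  rw [← neg_one_smul 𝕜 x, C.gr_smul, neg_one_smul]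

theorem gr_sub {a b : C.Obj} (x y : C.Hom a b) : C.gr (x - y) = C.gr x - C.gr y := by
  rw [sub_eq_add_neg, C.gr_add, gr_neg, ← sub_eq_add_neg]

theorem sum_comp {ι : Type*} (s : Finset ι) {a b c : C.Obj} (f : ι → C.Hom b c)
    (y : C.Hom a b) : C.comp (∑ i ∈ s, f i) y = ∑ i ∈ s, C.comp (f i) y :=
  map_sum (⟨⟨fun x => C.comp x y, C.zero_comp y⟩, fun _ _ => C.add_comp _ _ _⟩ :
    C.Hom b c →+ C.Hom a c) f s

theorem comp_sum {ι : Type*} (s : Finset ι) {a b c : C.Obj} (x : C.Hom b c)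
    (f : ι → C.Hom a b) : C.comp x (∑ i ∈ s, f i) = ∑ i ∈ s, C.comp x (f i) :=
  map_sum (⟨⟨fun y => C.comp x y, C.comp_zero x⟩, fun _ _ => C.comp_add _ _ _⟩ :
    C.Hom a b →+ C.Hom a c) f s

theorem adj_sum {ι : Type*} (s : Finset ι) {a b : C.Obj} (f : ι → C.Hom a b) :
    C.adj (∑ i ∈ s, f i) = ∑ i ∈ s, C.adj (f i) :=
  map_sum (⟨⟨fun y => C.adj y, C.adj_zero⟩, fun _ _ => C.adj_add _ _⟩ :
    C.Hom a b →+ C.Hom b a) f s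

theorem gr_sum {ι : Type*} (s : Finset ι) {a b : C.Obj} (f : ι → C.Hom a b) :
    C.gr (∑ i ∈ s, f i) = ∑ i ∈ s, C.gr (f i) :=
  map_sum (⟨⟨fun y => C.gr y, C.gr_zero⟩, fun _ _ => C.gr_add _ _⟩ :
    C.Hom a b →+ C.Hom a b) f s

end GradedStarCategory

namespace GradedCStarCategory

variable {𝕜 : Type} [RCLike 𝕜] (C : GradedCStarCategory.{u} 𝕜)

theorem norm_comp_adj_self {a b : C.Obj} (x : C.Hom a b) : ‖C.comp x (C.adj x)‖ = ‖x‖ ^ 2 := by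
  have := C.norm_adj_comp_self (C.adj x)
  rwa [C.adj_adj, C.norm_adj] at this

/-- Left multiplication by a morphism. -/
def lmul {a b : C.Obj} (c : C.Obj) (h : C.Hom a b) : C.Hom c a →L[ℝ] C.Hom c b :=
  LinearMap.mkContinuous
    { toFun := fun x => C.comp h x
      map_add' := fun _ _ => C.comp_add _ _ _
      map_smul' := fun _ _ => C.comp_real_smul _ _ _ } ‖h‖ fun x => C.norm_comp_le h x

@[simp] theorem lmul_apply {a b c : C.Obj} (h : C.Hom a b) (x : C.Hom c a) :
    C.lmul c h x = C.comp h x := rfl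

theorem norm_lmul_le {a b c : C.Obj} (h : C.Hom a b) : ‖C.lmul c h‖ ≤ ‖h‖ :=
  LinearMap.mkContinuous_norm_le _ (norm_nonneg _) _

theorem lmul_comp {a c : C.Obj} (h k : C.Hom a a) :
    C.lmul c (C.comp h k) = C.lmul c h * C.lmul c k :=
  ContinuousLinearMap.ext fun _ => C.assoc _ _ _

theorem norm_pow_two_pow_of_symmetric {a c : C.Obj} (L : C.Hom c a →L[ℝ] C.Hom c a)
    (hL : ∀ x y, C.comp (C.adj (L x)) y = C.comp (C.adj x) (L y)) (n : ℕ) :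
    ‖L ^ (2 ^ n)‖ = ‖L‖ ^ (2 ^ n) := by
  have sq : ∀ L : C.Hom c a →L[ℝ] C.Hom c a,
      (∀ x y, C.comp (C.adj (L x)) y = C.comp (C.adj x) (L y)) → ‖L ^ 2‖ = ‖L‖ ^ 2 := by
    intro L hL
    refine le_antisymm (norm_pow_le' L two_pos) ?_
    have h1 : ‖L‖ ≤ √‖L ^ 2‖ := by
      refine ContinuousLinearMap.opNorm_le_bound _ (Real.sqrt_nonneg _) fun x => ?_
      have h2 : ‖L x‖ ^ 2 ≤ ‖L ^ 2‖ * ‖x‖ ^ 2 := by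
        rw [← C.norm_adj_comp_self, hL]
        refine (C.norm_comp_le _ _).trans ?_
        rw [C.norm_adj]
        have := (L ^ 2).le_opNorm x
        rw [pow_two L] at this ⊢
        have h3 := mul_le_mul_of_nonneg_left this (norm_nonneg x)
        refine h3.trans (le_of_eq (by ring))
      have h4 := Real.sqrt_le_sqrt h2
      rwa [Real.sqrt_sq (norm_nonneg _), Real.sqrt_mul (norm_nonneg _),
        Real.sqrt_sq (norm_nonneg _)] at h4
    calc ‖L‖ ^ 2 ≤ √‖L ^ 2‖ ^ 2 := by gcongr
      _ = _ := Real.sq_sqrt (norm_nonneg _)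
  have sym : ∀ n : ℕ, ∀ x y, C.comp (C.adj ((L ^ n) x)) y = C.comp (C.adj x) ((L ^ n) y) := by
    intro n
    induction n with
    | zero => intro x y; rfl
    | succ n ih =>
      intro x y
      have h1 : (L ^ (n + 1)) x = L ((L ^ n) x) := by rw [pow_succ']; rfl
      have h2 : (L ^ (n + 1)) y = (L ^ n) (L y) := by rw [pow_succ]; rfl
      rw [h1, h2, hL, ih]
  induction n with
  | zero => simp
  | succ n ih => rw [pow_succ, pow_mul, sq _ (sym _), ih, ← pow_mul]

theorem isUnit_add_smul_one_of_isPositive {a : C.Obj} {h : C.Hom a a} (hp : C.IsPositive h)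
    {s : ℝ} (hs : 0 < s) (c : C.Obj) :
    IsUnit (C.lmul c h + s • (1 : C.Hom c a →L[ℝ] C.Hom c a)) := by
  obtain ⟨k, h1, h2⟩ := hp.2 s hs
  rw [← C.real_smul_def] at h1 h2
  have e1 : C.lmul c h = s • C.lmul c k + C.lmul c h * C.lmul c k := by
    conv_lhs => rw [← h1]
    rw [← C.lmul_comp]
    exact ContinuousLinearMap.ext fun x => by simp [C.add_comp, C.real_smul_comp]
  have e2 : C.lmul c h = s • C.lmul c k + C.lmul c k * C.lmul c h := by
    conv_lhs => rw [← h2]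
    rw [← C.lmul_comp]
    exact ContinuousLinearMap.ext fun x => by simp [C.add_comp, C.real_smul_comp]
  set H := C.lmul c h
  set K := C.lmul c k
  refine ⟨⟨H + s • 1, s⁻¹ • (1 - K), ?_, ?_⟩, rfl⟩
  · rw [mul_smul_comm, mul_sub, mul_one, add_mul, smul_mul_assoc, one_mul]
    have : H + s • (1 : C.Hom c a →L[ℝ] C.Hom c a) - (H * K + s • K) = s • 1 := by
      nth_rw 1 [e1]; abel
    rw [this, smul_smul, inv_mul_cancel₀ hs.ne', one_smul]
  · rw [smul_mul_assoc, sub_mul, one_mul, mul_add, mul_smul_comm, mul_one]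
    have : H + s • (1 : C.Hom c a →L[ℝ] C.Hom c a) - (K * H + s • K) = s • 1 := by
      nth_rw 1 [e2]; abel
    rw [this, smul_smul, inv_mul_cancel₀ hs.ne', one_smul]

theorem exists_mem_spectrum {a : C.Obj} [Nontrivial (C.Hom a a)] {h : C.Hom a a}
    (hp : C.IsPositive h) (t : ℝ) :
    ∃ μ ∈ spectrum ℝ (C.lmul a h), 0 ≤ μ ∧ |t - μ| = ‖t • 1 - C.lmul a h‖ := by
  have hh := hp.1
  obtain ⟨z, hz, hu⟩ := exists_spectrum_norm_eq (t • 1 - C.lmul a h)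
    (C.norm_pow_two_pow_of_symmetric _ fun x y => by
      simp only [sub_apply, ContinuousLinearMap.smul_apply,
        ContinuousLinearMap.one_apply, lmul_apply]
      rw [C.adj_sub, C.adj_real_smul, C.adj_comp, hh, C.sub_comp, C.comp_sub, C.real_smul_comp,
        C.comp_real_smul, C.assoc])
  set H := C.lmul a h with hH
  set α := t - z.re with hα
  set β := z.im with hβ
  have hnz : ‖z‖ ^ 2 = z.re ^ 2 + β ^ 2 := by
    rw [← Complex.normSq_eq_norm_sq, Complex.normSq_apply]; ring
  have e : (t • 1 - H) ^ 2 - (2 * z.re) • (t • 1 - H)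
      + (‖z‖ ^ 2) • (1 : C.Hom a a →L[ℝ] C.Hom a a)
      = H * H - (2 * α) • H + (α ^ 2 + β ^ 2) • 1 := by
    rw [hnz, hα, pow_two]
    simp only [sub_mul, mul_sub, smul_mul_assoc, mul_smul_comm, one_mul, mul_one, smul_smul]
    module
  rw [e] at hu
  by_cases hb : β = 0
  · refine ⟨α, ?_, ?_, ?_⟩
    · rw [spectrum.mem_iff]
      intro hu'
      apply hu
      have : H * H - (2 * α) • H + (α ^ 2 + β ^ 2) • 1
          = (algebraMap ℝ (C.Hom a a →L[ℝ] C.Hom a a) α - H)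
            * (algebraMap ℝ (C.Hom a a →L[ℝ] C.Hom a a) α - H) := by
        rw [hb, Algebra.algebraMap_eq_smul_one]
        simp only [sub_mul, mul_sub, smul_mul_assoc, mul_smul_comm, one_mul, mul_one, smul_smul]
        module
      rw [this]
      exact hu'.mul hu'
    · by_contra hneg
      push Not at hneg
      apply hu
      have h1 := C.isUnit_add_smul_one_of_isPositive hp (s := -α) (by linarith) a
      have : H * H - (2 * α) • H + (α ^ 2 + β ^ 2) • 1 = (H + (-α) • 1) * (H + (-α) • 1) := by
        rw [hb]
        simp only [add_mul, mul_add, smul_mul_assoc, mul_smul_comm, one_mul, mul_one, smul_smul]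
        module
      rw [this]
      exact h1.mul h1
    · rw [← hz, hα, sub_sub_cancel]
      have : ‖z‖ ^ 2 = z.re ^ 2 := by rw [hnz, hb]; ring
      rw [← Real.sqrt_sq (norm_nonneg z), this, Real.sqrt_sq_eq_abs]
  · exfalso
    apply hu
    set N := α ^ 2 + β ^ 2 with hN
    have hN0 : 0 < N := by positivity
    set d := α / (β * N) with hd
    set c := (β ^ 2 - α ^ 2) / (β * N) with hc
    set q : C.Hom a a := c • h + d • C.comp h h with hq
    have hqa : C.adj q = q := by
      rw [hq, C.adj_add, C.adj_real_smul, C.adj_real_smul, C.adj_comp, hh]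
    have hu1 := C.isUnit_add_smul_one_of_isPositive (C.positive_adj_comp_self q) one_pos a
    rw [hqa, C.lmul_comp, one_smul] at hu1
    have hQ : C.lmul a q = c • H + d • (H * H) := by
      rw [hH, ← C.lmul_comp, hq]
      exact ContinuousLinearMap.ext fun x => by simp [C.add_comp, C.real_smul_comp]
    set e' := 2 * c * d + 2 * α * d ^ 2 with he'
    have hfac : C.lmul a q * C.lmul a q + 1
        = (d ^ 2 • (H * H) + e' • H + N⁻¹ • 1) * (H * H - (2 * α) • H + N • 1) := by
      rw [hQ]
      simp only [add_mul, mul_add, sub_mul, mul_sub, smul_mul_assoc, mul_smul_comm, one_mul,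
        mul_one, smul_smul, mul_assoc]
      match_scalars <;> (try simp only [he', hd, hc]) <;> field_simp <;> (try rw [hN]) <;>
        (try ring)
    rw [hfac] at hu1
    refine (Commute.isUnit_mul_iff ?_).1 hu1 |>.2
    have c1 : Commute H H := Commute.refl H
    have c2 : Commute (H * H) H := c1.mul_left c1
    have c3 : ∀ (r : ℝ) (T : C.Hom a a →L[ℝ] C.Hom a a), Commute (r • 1) T := fun r T => by
      rw [← Algebra.algebraMap_eq_smul_one]; exact Algebra.commutes r T
    refine Commute.add_right (Commute.sub_right ?_ ?_) (c3 _ _).symm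
    · exact Commute.add_left (Commute.add_left ((Commute.refl _).smul_left _)
        (c2.symm.smul_left _)) (c3 _ _)
    · exact Commute.add_left (Commute.add_left ((c2.smul_left _).smul_right _)
        ((c1.smul_left _).smul_right _)) (c3 _ _)

end GradedCStarCategory

theorem isUnit_smul_one_sub_of_norm_lt {X : Type*} [NormedAddCommGroup X] [NormedSpace ℝ X]
    [CompleteSpace X] {T : X →L[ℝ] X} {r : ℝ} (h : ‖T‖ < r) : IsUnit (r • 1 - T) := by
  have h1 : r ∈ resolventSet ℝ T := by
    apply spectrum.mem_resolventSet_of_norm_lt_mul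
    rw [Real.norm_of_nonneg ((norm_nonneg _).trans h.le)]
    refine lt_of_le_of_lt (mul_le_of_le_one_right (norm_nonneg _) ?_) h
    exact ContinuousLinearMap.norm_id_le
  rw [spectrum.mem_resolventSet_iff, Algebra.algebraMap_eq_smul_one] at h1
  exact h1

/-! ### Approximate square roots -/

/-- The iteration `Y (n + 1) = (K + Y n ^ 2) / 2`, which converges to `1 - √(1 - K)`. -/
def sqrtIter {R : Type*} [Ring R] [Algebra ℝ R] (K : R) : ℕ → R
  | 0 => 0
  | n + 1 => (2⁻¹ : ℝ) • (K + sqrtIter K n * sqrtIter K n)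

section sqrtIter

theorem Commute.sqrtIter_right {R : Type*} [Ring R] [Algebra ℝ R] {K Z : R} (h : Commute Z K)
    (n : ℕ) : Commute Z (sqrtIter K n) := by
  induction n with
  | zero => exact Commute.zero_right _
  | succ n ih => exact (h.add_right (ih.mul_right ih)).smul_right _

theorem sqrtIter_succ_sub {R : Type*} [Ring R] [Algebra ℝ R] (K : R) (n : ℕ) :
    sqrtIter K (n + 2) - sqrtIter K (n + 1) = (2⁻¹ : ℝ) •
      ((sqrtIter K (n + 1) - sqrtIter K n) * (sqrtIter K (n + 1) + sqrtIter K n)) := by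
  have hc : Commute (sqrtIter K (n + 1)) (sqrtIter K n) :=
    ((Commute.refl K).sqrtIter_right (n + 1)).symm.sqrtIter_right n
  have e : sqrtIter K (n + 2) - sqrtIter K (n + 1) = (2⁻¹ : ℝ) •
      ((K + sqrtIter K (n + 1) * sqrtIter K (n + 1)) - (K + sqrtIter K n * sqrtIter K n)) := by
    rw [smul_sub]; rfl
  rw [e, sub_mul, mul_add, mul_add, hc.eq]
  congr 1
  abel

theorem one_sub_sqrtIter_mul_self {R : Type*} [Ring R] [Algebra ℝ R] (K : R) (n : ℕ) :
    (1 - sqrtIter K n) * (1 - sqrtIter K n) - (1 - K)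
      = (2 : ℝ) • (sqrtIter K (n + 1) - sqrtIter K n) := by
  rw [sqrtIter, smul_sub, smul_smul, mul_inv_cancel₀ two_ne_zero, one_smul, two_smul]
  simp only [sub_mul, mul_sub, one_mul, mul_one]
  abel

theorem sqrtIter_one_mem (n : ℕ) : 0 ≤ sqrtIter (1 : ℝ) n ∧ sqrtIter (1 : ℝ) n ≤ 1 := by
  induction n with
  | zero => simp [sqrtIter]
  | succ n ih =>
    rw [sqrtIter, smul_eq_mul]
    constructor <;> nlinarith

theorem sqrtIter_one_mono (n : ℕ) : sqrtIter (1 : ℝ) n ≤ sqrtIter (1 : ℝ) (n + 1) := by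
  rw [sqrtIter, smul_eq_mul]
  nlinarith [sq_nonneg (1 - sqrtIter (1 : ℝ) n)]

theorem tendsto_sqrtIter_one : Filter.Tendsto (sqrtIter (1 : ℝ)) Filter.atTop (nhds 1) := by
  obtain ⟨l, hl⟩ : ∃ l, Filter.Tendsto (sqrtIter (1 : ℝ)) Filter.atTop (nhds l) :=
    ⟨_, tendsto_atTop_ciSup (monotone_nat_of_le_succ sqrtIter_one_mono)
      ⟨1, by rintro _ ⟨n, rfl⟩; exact (sqrtIter_one_mem n).2⟩⟩
  have h1 : Filter.Tendsto (fun n => sqrtIter (1 : ℝ) (n + 1)) Filter.atTop (nhds l) :=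
    hl.comp (Filter.tendsto_add_atTop_nat 1)
  have h2 : Filter.Tendsto (fun n => sqrtIter (1 : ℝ) (n + 1)) Filter.atTop
      (nhds (2⁻¹ * (1 + l * l))) := by
    have := ((hl.mul hl).const_add 1).const_mul (2⁻¹ : ℝ)
    exact this
  have h3 := tendsto_nhds_unique h1 h2
  have h4 : l = 1 := by nlinarith [sq_nonneg (l - 1)]
  rwa [h4] at hl

theorem tendsto_sqrtIter_one_sub : Filter.Tendsto
    (fun n => sqrtIter (1 : ℝ) (n + 1) - sqrtIter (1 : ℝ) n) Filter.atTop (nhds 0) := by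
  have := (tendsto_sqrtIter_one.comp (Filter.tendsto_add_atTop_nat 1)).sub tendsto_sqrtIter_one
  rwa [sub_self] at this

variable {X : Type*} [SeminormedAddCommGroup X] [NormedSpace ℝ X] {K : Module.End ℝ X}

theorem norm_sqrtIter_le (hK : ∀ x, ‖K x‖ ≤ ‖x‖) (n : ℕ) (x : X) :
    ‖sqrtIter K n x‖ ≤ sqrtIter (1 : ℝ) n * ‖x‖ := by
  induction n generalizing x with
  | zero => simp [sqrtIter]
  | succ n ih =>
    have h0 := (sqrtIter_one_mem n).1
    have h1 : sqrtIter K (n + 1) x = (2⁻¹ : ℝ) • (K x + sqrtIter K n (sqrtIter K n x)) := rfl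
    rw [h1, norm_smul, Real.norm_of_nonneg (by norm_num), sqrtIter, smul_eq_mul, mul_assoc]
    gcongr
    calc _ ≤ ‖x‖ + sqrtIter (1 : ℝ) n * (sqrtIter (1 : ℝ) n * ‖x‖) :=
          (norm_add_le _ _).trans (add_le_add (hK x) ((ih _).trans (by gcongr; exact ih x)))
      _ = _ := by ring

theorem norm_sqrtIter_sub_le (hK : ∀ x, ‖K x‖ ≤ ‖x‖) (n : ℕ) (x : X) :
    ‖(sqrtIter K (n + 1) - sqrtIter K n) x‖
      ≤ (sqrtIter (1 : ℝ) (n + 1) - sqrtIter (1 : ℝ) n) * ‖x‖ := by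
  induction n generalizing x with
  | zero =>
    have := norm_sqrtIter_le hK 1 x
    simpa [sqrtIter] using this
  | succ n ih =>
    have h0 := (sqrtIter_one_mem n).1
    have h1 := sqrtIter_one_mono n
    rw [sqrtIter_succ_sub K n, sqrtIter_succ_sub (1 : ℝ) n, LinearMap.smul_apply, norm_smul,
      Real.norm_of_nonneg (by norm_num), smul_eq_mul, mul_assoc, mul_assoc]
    gcongr
    refine (ih _).trans (mul_le_mul_of_nonneg_left ?_ (by linarith))
    rw [LinearMap.add_apply, add_mul]
    exact (norm_add_le _ _).trans
      (add_le_add (norm_sqrtIter_le hK _ _) (norm_sqrtIter_le hK _ _))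

end sqrtIter

namespace GradedStarCategory

variable {𝕜 : Type} [RCLike 𝕜] (C : GradedStarCategory.{u, v} 𝕜)

/-- The morphism part of the iteration `sqrtIter` in the unitization: `κ` and `k` represent the
element `κ + k`. -/
def sqrtIterHom (κ : ℝ) {a : C.Obj} (k : C.Hom a a) : ℕ → C.Hom a a
  | 0 => 0
  | n + 1 => (2⁻¹ : ℝ) • (k + (2 * sqrtIter κ n) • sqrtIterHom κ k n
      + C.comp (sqrtIterHom κ k n) (sqrtIterHom κ k n))

theorem adj_sqrtIterHom (κ : ℝ) {a : C.Obj} {k : C.Hom a a} (hk : C.adj k = k) (n : ℕ) :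
    C.adj (C.sqrtIterHom κ k n) = C.sqrtIterHom κ k n := by
  induction n with
  | zero => exact C.adj_zero
  | succ n ih =>
    rw [sqrtIterHom, adj_real_smul, C.adj_add, C.adj_add, adj_real_smul, C.adj_comp, hk, ih]

theorem sqrtIter_action (κ : ℝ) {a : C.Obj} (k : C.Hom a a) {X : Type*} [AddCommGroup X]
    [Module ℝ X] (Λ : C.Hom a a →ₗ[ℝ] Module.End ℝ X)
    (hΛ : ∀ x y, Λ (C.comp x y) = Λ x * Λ y) (n : ℕ) :
    sqrtIter (κ • 1 + Λ k) n = sqrtIter κ n • 1 + Λ (C.sqrtIterHom κ k n) := by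
  induction n with
  | zero => simp [sqrtIter, sqrtIterHom]
  | succ n ih =>
    rw [sqrtIter, ih, sqrtIterHom, sqrtIter]
    simp only [map_add, map_smul, hΛ, mul_add, add_mul, smul_mul_assoc, mul_smul_comm, one_mul,
      mul_one, smul_smul, smul_eq_mul]
    module

end GradedStarCategory

namespace GradedCStarCategory

variable {𝕜 : Type} [RCLike 𝕜] (C : GradedCStarCategory.{u} 𝕜)

theorem norm_smul_sub_comp_le {a c : C.Obj} {h : C.Hom a a} (hp : C.IsPositive h) {t : ℝ}
    (ht : ‖h‖ ≤ t) (x : C.Hom c a) : ‖t • x - C.comp h x‖ ≤ t * ‖x‖ := by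
  have ht0 : 0 ≤ t := (norm_nonneg _).trans ht
  have key : ∀ y : C.Hom a a, ‖t • y - C.comp h y‖ ≤ t * ‖y‖ := by
    intro y
    rcases subsingleton_or_nontrivial (C.Hom a a) with hs | hs
    · rw [Subsingleton.elim (t • y - C.comp h y) 0, norm_zero]
      positivity
    · obtain ⟨μ, hμ, hμ0, e⟩ := C.exists_mem_spectrum hp t
      have h1 : |μ| ≤ t := ((spectrum.norm_le_norm_of_mem hμ).trans (C.norm_lmul_le h)).trans ht
      rw [abs_of_nonneg hμ0] at h1
      rw [abs_of_nonneg (by linarith)] at e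
      have h2 := (t • (1 : C.Hom a a →L[ℝ] C.Hom a a) - C.lmul a h).le_opNorm y
      rw [← e] at h2
      exact h2.trans (mul_le_mul_of_nonneg_right (by linarith) (norm_nonneg _))
  set w := t • x - C.comp h x with hw
  have e : C.comp w (C.adj w)
      = t • C.comp x (C.adj w) - C.comp h (C.comp x (C.adj w)) := by
    conv_lhs => rw [hw]
    rw [C.sub_comp, C.real_smul_comp, C.assoc]
  have e2 : C.adj (C.comp x (C.adj w))
      = t • C.comp x (C.adj x) - C.comp h (C.comp x (C.adj x)) := by
    rw [C.adj_comp, C.adj_adj, hw, C.sub_comp, C.real_smul_comp, C.assoc]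
  have h1 : ‖w‖ ^ 2 ≤ (t * ‖x‖) ^ 2 := by
    rw [← C.norm_comp_adj_self, e]
    refine (key _).trans ?_
    rw [← C.norm_adj, e2]
    refine (mul_le_mul_of_nonneg_left (key _) ht0).trans ?_
    rw [C.norm_comp_adj_self]
    exact le_of_eq (by ring)
  exact (sq_le_sq₀ (norm_nonneg _) (by positivity)).1 h1

theorem isPositive_of_norm_le {a : C.Obj} {h : C.Hom a a} (hh : C.adj h = h) {t : ℝ}
    (ht : 0 ≤ t) (H : ∀ y : C.Hom a a, ‖t • y - C.comp h y‖ ≤ t * ‖y‖) : C.IsPositive h := by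
  refine ⟨hh, fun s hs => ?_⟩
  have hT : ‖t • (1 : C.Hom a a →L[ℝ] C.Hom a a) - C.lmul a h‖ < s + t :=
    lt_of_le_of_lt (ContinuousLinearMap.opNorm_le_bound _ ht H) (by linarith)
  obtain ⟨w, hw⟩ := isUnit_smul_one_sub_of_norm_lt hT
  set k := (w⁻¹ : (C.Hom a a →L[ℝ] C.Hom a a)ˣ).1 h with hk
  have h1 : s • k + C.comp h k = h := by
    have : w.1 k = h := by
      change (w.1 * (w⁻¹ : (C.Hom a a →L[ℝ] C.Hom a a)ˣ).1) h = h
      rw [Units.mul_inv]; rfl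
    rw [hw] at this
    conv_rhs => rw [← this]
    change _ = (s + t) • k - (t • k - C.comp h k)
    rw [add_smul]; abel
  have h2 : s • C.adj k + C.comp (C.adj k) h = h := by
    have := congrArg C.adj h1
    rwa [C.adj_add, C.adj_real_smul, C.adj_comp, hh] at this
  have h3 : C.comp h k = C.comp (C.adj k) h := by
    have e1 : C.comp (s • C.adj k + C.comp (C.adj k) h) k = C.comp h k := by rw [h2]
    have e2 : C.comp (C.adj k) (s • k + C.comp h k) = C.comp (C.adj k) h := by rw [h1]
    refine e1.symm.trans (Eq.trans ?_ e2)
    rw [C.add_comp, C.comp_add, C.real_smul_comp, C.comp_real_smul, C.assoc]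
  have h4 : C.adj k = k := by
    have : s • C.adj k = s • k := by
      rw [eq_sub_of_add_eq h1, eq_sub_of_add_eq h2, h3]
    exact smul_right_injective _ hs.ne' this
  rw [h4] at h2
  exact ⟨k, h1, h2⟩

theorem isPositive_zero {a : C.Obj} : C.IsPositive (0 : C.Hom a a) :=
  C.isPositive_of_norm_le C.adj_zero le_rfl fun y => by simp [C.zero_comp]

theorem isPositive_add {a : C.Obj} {h k : C.Hom a a} (hh : C.IsPositive h)
    (hk : C.IsPositive k) : C.IsPositive (h + k) := by
  refine C.isPositive_of_norm_le (t := ‖h‖ + ‖k‖) (by rw [C.adj_add, hh.1, hk.1]) (by positivity)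
    fun y => ?_
  have e : (‖h‖ + ‖k‖) • y - C.comp (h + k) y
      = (‖h‖ • y - C.comp h y) + (‖k‖ • y - C.comp k y) := by
    rw [C.add_comp, add_smul]; abel
  rw [e, add_mul]
  exact (norm_add_le _ _).trans (add_le_add (C.norm_smul_sub_comp_le hh le_rfl y)
    (C.norm_smul_sub_comp_le hk le_rfl y))

theorem isPositive_sum {ι : Type*} (s : Finset ι) {a : C.Obj} (h : ι → C.Hom a a)
    (hh : ∀ i ∈ s, C.IsPositive (h i)) : C.IsPositive (∑ i ∈ s, h i) :=
  Finset.sum_induction _ C.IsPositive (fun _ _ => C.isPositive_add) C.isPositive_zero hh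

theorem isPositive_real_smul {a : C.Obj} {h : C.Hom a a} (hh : C.IsPositive h) {r : ℝ}
    (hr : 0 ≤ r) : C.IsPositive (r • h) := by
  refine C.isPositive_of_norm_le (t := r * ‖h‖) (by rw [C.adj_real_smul, hh.1]) (by positivity)
    fun y => ?_
  rw [C.real_smul_comp, mul_smul, ← smul_sub, norm_smul, Real.norm_of_nonneg hr, mul_assoc]
  exact mul_le_mul_of_nonneg_left (C.norm_smul_sub_comp_le hh le_rfl y) hr

theorem isPositive_of_approx {a : C.Obj} {h : C.Hom a a}
    (H : ∀ ε : ℝ, 0 < ε → ∃ k, C.IsPositive k ∧ ‖h - k‖ ≤ ε) : C.IsPositive h := by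
  refine C.isPositive_of_norm_le (t := ‖h‖ + 1) ?_ (by positivity) fun y => ?_
  · rw [← sub_eq_zero, ← norm_le_zero_iff]
    refine le_of_forall_pos_le_add fun ε hε => ?_
    obtain ⟨k, hk, hn⟩ := H (ε / 2) (by positivity)
    have e : C.adj h - h = C.adj (h - k) - (h - k) := by rw [C.adj_sub, hk.1]; abel
    rw [e]
    refine (norm_sub_le _ _).trans ?_
    rw [C.norm_adj]
    linarith
  · refine le_of_forall_pos_le_add fun ε hε => ?_
    obtain ⟨k, hk, hn⟩ := H (min 1 (ε / (‖y‖ + 1))) (by positivity)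
    have hkn : ‖k‖ ≤ ‖h‖ + 1 := by
      have h1 : ‖h - k‖ ≤ 1 := hn.trans (min_le_left _ _)
      have h2 := norm_sub_norm_le k h
      rw [norm_sub_rev] at h2
      linarith
    have e : (‖h‖ + 1) • y - C.comp h y
        = ((‖h‖ + 1) • y - C.comp k y) - C.comp (h - k) y := by rw [C.sub_comp]; abel
    rw [e]
    refine (norm_sub_le _ _).trans (add_le_add (C.norm_smul_sub_comp_le hk hkn y) ?_)
    refine (C.norm_comp_le _ _).trans ?_
    calc ‖h - k‖ * ‖y‖ ≤ ε / (‖y‖ + 1) * ‖y‖ := by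
          gcongr; exact hn.trans (min_le_right _ _)
      _ = ε * (‖y‖ / (‖y‖ + 1)) := by ring
      _ ≤ ε * 1 := by
          gcongr
          rw [div_le_one (by positivity)]
          linarith
      _ = ε := mul_one _

theorem norm_le_norm_lmul {a : C.Obj} (h : C.Hom a a) : ‖h‖ ≤ ‖C.lmul a h‖ := by
  have h1 : ‖h‖ ^ 2 ≤ ‖C.lmul a h‖ * ‖h‖ := by
    rw [← C.norm_comp_adj_self]
    have := (C.lmul a h).le_opNorm (C.adj h)
    rwa [C.norm_adj] at this
  rcases eq_or_lt_of_le (norm_nonneg h) with h0 | h0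
  · rw [← h0]; exact norm_nonneg _
  · rw [sq] at h1
    exact le_of_mul_le_mul_right h1 h0

theorem norm_mem_spectrum {a : C.Obj} {h : C.Hom a a} (hp : C.IsPositive h) (h0 : h ≠ 0) :
    ‖h‖ ∈ spectrum ℝ (C.lmul a h) := by
  have : Nontrivial (C.Hom a a) := ⟨h, 0, h0⟩
  obtain ⟨μ, hμ, hμ0, e⟩ := C.exists_mem_spectrum hp 0
  rw [zero_smul, zero_sub, zero_sub, abs_neg, norm_neg, abs_of_nonneg hμ0] at e
  have : μ = ‖h‖ := e.trans (le_antisymm (C.norm_lmul_le h) (C.norm_le_norm_lmul h))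
  rwa [← this]

theorem norm_le_norm_add_of_isPositive {a : C.Obj} {h k : C.Hom a a} (hh : C.IsPositive h)
    (hk : C.IsPositive k) : ‖h‖ ≤ ‖h + k‖ := by
  by_contra hlt
  push Not at hlt
  have h0 : h ≠ 0 := by
    rintro rfl
    rw [norm_zero] at hlt
    exact absurd hlt (not_lt.2 (norm_nonneg _))
  refine spectrum.mem_iff.1 (C.norm_mem_spectrum hh h0) ?_
  have h1 : ‖‖k‖ • (1 : C.Hom a a →L[ℝ] C.Hom a a) + C.lmul a h‖ < ‖k‖ + ‖h‖ := by
    refine lt_of_le_of_lt (ContinuousLinearMap.opNorm_le_bound _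
      (by positivity : 0 ≤ ‖k‖ + ‖h + k‖) fun y => ?_) (by linarith)
    have e : (‖k‖ • (1 : C.Hom a a →L[ℝ] C.Hom a a) + C.lmul a h) y
        = (‖k‖ • y - C.comp k y) + C.comp (h + k) y := by
      change ‖k‖ • y + C.comp h y = _
      rw [C.add_comp]; abel
    rw [e, add_mul]
    exact (norm_add_le _ _).trans (add_le_add (C.norm_smul_sub_comp_le hk le_rfl y)
      (C.norm_comp_le _ _))
  have h2 := isUnit_smul_one_sub_of_norm_lt h1
  rw [add_smul] at h2
  rw [Algebra.algebraMap_eq_smul_one]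
  convert h2 using 1
  abel

/-- Left multiplication as a linear action. -/
def lmulLin {a : C.Obj} (c : C.Obj) : C.Hom a a →ₗ[ℝ] Module.End ℝ (C.Hom c a) where
  toFun h := (C.lmul c h).toLinearMap
  map_add' _ _ := LinearMap.ext fun _ => C.add_comp _ _ _
  map_smul' _ _ := LinearMap.ext fun _ => C.real_smul_comp _ _ _

theorem isPositive_adj_comp_sub {a c : C.Obj} {k : C.Hom a a} (hk : C.adj k = k) (κ : ℝ)
    (hc : ∀ x : C.Hom c a, ‖κ • x + C.comp k x‖ ≤ ‖x‖) (x : C.Hom c a) :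
    C.IsPositive (C.comp (C.adj x) (x - (κ • x + C.comp k x))) := by
  have hΛ : ∀ h h' : C.Hom a a, C.lmulLin c (C.comp h h') = C.lmulLin c h * C.lmulLin c h' :=
    fun _ _ => LinearMap.ext fun _ => C.assoc _ _ _
  set K : Module.End ℝ (C.Hom c a) := κ • 1 + C.lmulLin c k with hK
  have hK1 : ∀ x, ‖K x‖ ≤ ‖x‖ := hc
  refine C.isPositive_of_approx fun ε hε => ?_
  obtain ⟨n, hn⟩ : ∃ n, 2 * (sqrtIter (1 : ℝ) (n + 1) - sqrtIter (1 : ℝ) n) * (‖x‖ ^ 2) ≤ ε := by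
    have h1 := (tendsto_sqrtIter_one_sub.const_mul 2).mul_const (‖x‖ ^ 2)
    rw [mul_zero, zero_mul] at h1
    exact (h1.eventually (ge_mem_nhds hε)).exists
  set q := C.sqrtIterHom κ k n with hq
  have hqa : C.adj q = q := C.adj_sqrtIterHom κ hk n
  have hY : ∀ y, sqrtIter K n y = sqrtIter κ n • y + C.comp q y := fun y => by
    rw [hK, C.sqrtIter_action κ k (C.lmulLin c) hΛ n]; rfl
  set y := sqrtIter κ n with hy
  set S := x - sqrtIter K n x with hS
  refine ⟨C.comp (C.adj S) S, C.positive_adj_comp_self S, ?_⟩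
  have e : C.comp (C.adj S) S = C.comp (C.adj x) (((1 - sqrtIter K n) * (1 - sqrtIter K n)) x) := by
    have e1 : ((1 - sqrtIter K n) * (1 - sqrtIter K n)) x = S - sqrtIter K n S := rfl
    have e2 : C.adj S = C.adj x - (y • C.adj x + C.comp (C.adj x) q) := by
      rw [hS, hY x, C.adj_sub, C.adj_add, C.adj_real_smul, C.adj_comp, hqa]
    rw [e1, hY S, e2]
    simp only [C.sub_comp, C.comp_sub, C.add_comp, C.comp_add, C.real_smul_comp,
      C.comp_real_smul, C.assoc]
  have e2 : x - (κ • x + C.comp k x) = (1 - K) x := rfl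
  rw [e, e2, ← C.comp_sub, ← LinearMap.sub_apply, ← neg_sub, one_sub_sqrtIter_mul_self,
    LinearMap.neg_apply, C.comp_neg, norm_neg, LinearMap.smul_apply, C.comp_real_smul, norm_smul,
    Real.norm_of_nonneg zero_le_two]
  refine le_trans ?_ hn
  rw [mul_assoc]
  gcongr
  refine (C.norm_comp_le _ _).trans ?_
  rw [C.norm_adj]
  refine (mul_le_mul_of_nonneg_left (norm_sqrtIter_sub_le hK1 n x) (norm_nonneg _)).trans ?_
  exact le_of_eq (by ring)

theorem isPositive_adj_comp_comp {a c : C.Obj} {h : C.Hom a a} (hh : C.IsPositive h)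
    (x : C.Hom c a) : C.IsPositive (C.comp (C.adj x) (C.comp h x)) := by
  set t := ‖h‖ + 1 with ht
  have ht0 : 0 < t := by positivity
  have h1 := C.isPositive_adj_comp_sub (k := -(t⁻¹ • h)) (c := c)
    (by rw [C.adj_neg, C.adj_real_smul, hh.1]) 1 (fun x => by
      have := C.norm_smul_sub_comp_le hh (t := t) (by linarith) x
      have e : (1 : ℝ) • x + C.comp (-(t⁻¹ • h)) x = t⁻¹ • (t • x - C.comp h x) := by
        rw [C.neg_comp, C.real_smul_comp, smul_sub, smul_smul, inv_mul_cancel₀ ht0.ne']; abel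
      rw [e, norm_smul, Real.norm_of_nonneg (by positivity), inv_mul_le_iff₀ ht0]
      exact this) x
  have e : C.comp (C.adj x) (C.comp h x)
      = t • C.comp (C.adj x) (x - ((1 : ℝ) • x + C.comp (-(t⁻¹ • h)) x)) := by
    rw [C.neg_comp, C.real_smul_comp, one_smul, ← C.comp_real_smul]
    congr 1
    rw [sub_add_cancel_left, neg_neg, smul_smul, mul_inv_cancel₀ ht0.ne', one_smul]
  rw [e]
  exact C.isPositive_real_smul h1 ht0.le

theorem isPositive_smul_sub {a c : C.Obj} {h : C.Hom a a} (hh : C.adj h = h) {t : ℝ}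
    (ht0 : 0 < t) (ht : ‖h‖ ≤ t) (x : C.Hom c a) :
    C.IsPositive (t • C.comp (C.adj x) x - C.comp (C.adj x) (C.comp h x)) := by
  have h1 := C.isPositive_adj_comp_sub (k := t⁻¹ • h) (c := c)
    (by rw [C.adj_real_smul, hh]) 0 (fun x => by
      rw [zero_smul, zero_add, C.real_smul_comp, norm_smul, Real.norm_of_nonneg (by positivity),
        inv_mul_le_iff₀ ht0]
      exact (C.norm_comp_le _ _).trans (by gcongr)) x
  have e : t • C.comp (C.adj x) x - C.comp (C.adj x) (C.comp h x)
      = t • C.comp (C.adj x) (x - ((0 : ℝ) • x + C.comp (t⁻¹ • h) x)) := by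
    rw [zero_smul, zero_add, C.real_smul_comp, C.comp_sub, smul_sub, C.comp_real_smul, smul_smul,
      mul_inv_cancel₀ ht0.ne', one_smul]
  rw [e]
  exact C.isPositive_real_smul h1 ht0.le

/-- Approximate right units for a positive morphism. -/
theorem exists_resolvent {a : C.Obj} {h : C.Hom a a} (hh : C.IsPositive h) {ε : ℝ}
    (hε : 0 < ε) : ∃ (s : ℝ) (k : C.Hom a a), 0 < s ∧ s • k + C.comp h k = h ∧
      s • k + C.comp k h = h ∧
      ‖h - C.comp h k - C.comp (C.adj k) (h - C.comp h k)‖ ≤ ε := by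
  obtain ⟨k, hk, hk'⟩ := hh.2 (ε / 6) (by positivity)
  rw [← C.real_smul_def] at hk hk'
  set s := ε / 6 with hs
  have hs0 : 0 < s := by positivity
  have hb : ∀ x : C.Hom a a, ‖C.comp k x‖ ≤ 2 * ‖x‖ := by
    intro x
    set w := x - C.comp k x with hw
    have e1 : s • w + C.comp h w = s • x := by
      rw [hw, smul_sub, C.comp_sub, ← C.assoc, ← C.real_smul_comp]
      have : C.comp h x = C.comp (s • k) x + C.comp (C.comp h k) x := by
        rw [← C.add_comp, hk]
      rw [this]; abel
    have e2 : s • C.comp (C.adj w) w + C.comp (C.adj w) (C.comp h w)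
        = s • C.comp (C.adj w) x := by
      rw [← C.comp_real_smul, ← C.comp_add, e1, C.comp_real_smul]
    have h1 := C.norm_le_norm_add_of_isPositive
      (C.isPositive_real_smul (C.positive_adj_comp_self w) hs0.le)
      (C.isPositive_adj_comp_comp hh w)
    rw [e2, norm_smul, norm_smul, C.norm_adj_comp_self, Real.norm_of_nonneg hs0.le] at h1
    have h2 := le_of_mul_le_mul_left h1 hs0
    have h3 : ‖w‖ * ‖w‖ ≤ ‖w‖ * ‖x‖ := by
      rw [← sq]
      refine h2.trans ((C.norm_comp_le _ _).trans ?_)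
      rw [C.norm_adj]
    have h4 : ‖w‖ ≤ ‖x‖ := by
      rcases eq_or_lt_of_le (norm_nonneg w) with h0 | h0
      · rw [← h0]; exact norm_nonneg _
      · exact le_of_mul_le_mul_left h3 h0
    have e3 : C.comp k x = x - w := by rw [hw]; abel
    rw [e3]
    refine (norm_sub_le _ _).trans ?_
    linarith
  have hkn : ‖k‖ ≤ 2 := by
    have h1 := hb (C.adj k)
    rw [C.norm_comp_adj_self, C.norm_adj] at h1
    nlinarith [norm_nonneg k]
  refine ⟨s, k, hs0, hk, hk', ?_⟩
  have e : h - C.comp h k = s • k := by nth_rw 1 [← hk]; abel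
  rw [e, C.comp_real_smul, ← smul_sub, norm_smul, Real.norm_of_nonneg hs0.le]
  have h1 : ‖k - C.comp (C.adj k) k‖ ≤ 6 := by
    refine (norm_sub_le _ _).trans ?_
    rw [C.norm_adj_comp_self]
    nlinarith [norm_nonneg k]
  calc s * _ ≤ s * 6 := by gcongr
    _ = ε := by rw [hs]; ring

theorem exists_approx_unit {a : C.Obj} {h : C.Hom a a} (hh : C.IsPositive h) {ε : ℝ}
    (hε : 0 < ε) : ∃ k : C.Hom a a,
      ‖h - C.comp h k - C.comp (C.adj k) (h - C.comp h k)‖ ≤ ε := by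
  obtain ⟨_, k, -, -, -, hk⟩ := C.exists_resolvent hh hε
  exact ⟨k, hk⟩

theorem exists_norm_sub_comp_le {a c : C.Obj} (z : C.Hom a c) {ε : ℝ} (hε : 0 < ε) :
    ∃ k : C.Hom a a, ‖z - C.comp z k‖ ≤ ε := by
  obtain ⟨k, hk⟩ := C.exists_approx_unit (C.positive_adj_comp_self z) (sq_pos_of_pos hε)
  refine ⟨k, ?_⟩
  have e : C.comp (C.adj (z - C.comp z k)) (z - C.comp z k)
      = C.comp (C.adj z) z - C.comp (C.comp (C.adj z) z) k
        - C.comp (C.adj k) (C.comp (C.adj z) z - C.comp (C.comp (C.adj z) z) k) := by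
    rw [C.adj_sub, C.adj_comp]
    simp only [C.sub_comp, C.comp_sub, C.assoc]
  rw [← e, C.norm_adj_comp_self] at hk
  exact (sq_le_sq₀ (norm_nonneg _) hε.le).1 hk

end GradedCStarCategory

/-- Graded C*-functors are contractive. -/
theorem GradedFunctor.norm_map_le {𝕜 : Type} [RCLike 𝕜] {C : GradedCStarCategory.{u} 𝕜}
    {D : GradedCStarCategory.{v} 𝕜}
    (G : GradedFunctor C.toGradedStarCategory D.toGradedStarCategory) {a b : C.Obj}
    (x : C.Hom a b) : ‖G.map x‖ ≤ ‖x‖ := by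
  set h := C.comp (C.adj x) x with hh
  have hG : G.map h = D.comp (D.adj (G.map x)) (G.map x) := by rw [hh, G.map_comp, G.map_adj]
  have hp : D.IsPositive (G.map h) := by rw [hG]; exact D.positive_adj_comp_self _
  have key : ‖G.map h‖ ≤ ‖h‖ := by
    by_contra hlt
    push Not at hlt
    set m := ‖G.map h‖ with hm
    have hm0 : 0 < m := lt_of_le_of_lt (norm_nonneg _) hlt
    have h0 : G.map h ≠ 0 := norm_pos_iff.1 hm0
    refine spectrum.mem_iff.1 (D.norm_mem_spectrum hp h0) ?_
    obtain ⟨w, hw⟩ := isUnit_smul_one_sub_of_norm_lt (lt_of_le_of_lt (C.norm_lmul_le (c := a) h) hlt)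
    set k := (w⁻¹ : (C.Hom a a →L[ℝ] C.Hom a a)ˣ).1 h with hk
    have h1 : m • k - C.comp h k = h := by
      have : w.1 k = h := by
        change (w.1 * (w⁻¹ : (C.Hom a a →L[ℝ] C.Hom a a)ˣ).1) h = h
        rw [Units.mul_inv]; rfl
      rw [hw] at this
      exact this
    have h2 : m • C.adj k - C.comp (C.adj k) h = h := by
      have := congrArg C.adj h1
      rwa [C.adj_sub, C.adj_real_smul, C.adj_comp, hh, C.adj_comp, C.adj_adj] at this
    have hsm : ∀ {a b : C.Obj} (r : ℝ) (y : C.Hom a b), G.map (r • y) = r • G.map y :=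
      fun r y => G.map_smul _ _
    have hsub : ∀ {a b : C.Obj} (y z : C.Hom a b), G.map (y - z) = G.map y - G.map z := by
      intro a b y z
      rw [sub_eq_add_neg, G.map_add, ← neg_one_smul ℝ z, hsm, neg_one_smul, ← sub_eq_add_neg]
    have h3 := congrArg G.map h1
    have h4 := congrArg G.map h2
    rw [hsub, hsm, G.map_comp] at h3 h4
    set H := D.lmul (G.obj a) (G.map h)
    have e3 : m • D.lmul (G.obj a) (G.map k) - H * D.lmul (G.obj a) (G.map k) = H := by
      rw [← D.lmul_comp]
      refine ContinuousLinearMap.ext fun y => ?_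
      change m • D.comp (G.map k) y - D.comp (D.comp (G.map h) (G.map k)) y = D.comp (G.map h) y
      rw [← D.real_smul_comp, ← D.sub_comp, h3]
    have e4 : m • D.lmul (G.obj a) (G.map (C.adj k)) - D.lmul (G.obj a) (G.map (C.adj k)) * H
        = H := by
      rw [← D.lmul_comp]
      refine ContinuousLinearMap.ext fun y => ?_
      change m • D.comp (G.map (C.adj k)) y - D.comp (D.comp (G.map (C.adj k)) (G.map h)) y
        = D.comp (G.map h) y
      rw [← D.real_smul_comp, ← D.sub_comp, h4]
    rw [Algebra.algebraMap_eq_smul_one]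
    set K := D.lmul (G.obj a) (G.map k)
    set K' := D.lmul (G.obj a) (G.map (C.adj k))
    have e5 : (m • 1 - H) * (m⁻¹ • (1 + K)) = 1 := by
      rw [mul_smul_comm, sub_mul, mul_add, mul_add, smul_mul_assoc, smul_mul_assoc, one_mul,
        one_mul, mul_one]
      have : m • (1 : D.Hom (G.obj a) (G.obj a) →L[ℝ] D.Hom (G.obj a) (G.obj a)) + m • K
          - (H + H * K) = m • 1 + ((m • K - H * K) - H) := by abel
      rw [this, e3, sub_self, add_zero, smul_smul, inv_mul_cancel₀ hm0.ne', one_smul]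
    have e6 : (m⁻¹ • (1 + K')) * (m • 1 - H) = 1 := by
      rw [smul_mul_assoc, mul_sub, add_mul, add_mul, mul_smul_comm, mul_smul_comm, one_mul,
        one_mul, mul_one]
      have : m • (1 : D.Hom (G.obj a) (G.obj a) →L[ℝ] D.Hom (G.obj a) (G.obj a)) + m • K'
          - (H + K' * H) = m • 1 + ((m • K' - K' * H) - H) := by abel
      rw [this, e4, sub_self, add_zero, smul_smul, inv_mul_cancel₀ hm0.ne', one_smul]
    exact isUnit_iff_exists_and_exists.2 ⟨⟨_, e5⟩, ⟨_, e6⟩⟩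
  rw [hG, D.norm_adj_comp_self, hh, C.norm_adj_comp_self] at key
  exact (sq_le_sq₀ (norm_nonneg _) (norm_nonneg _)).1 key

/-! ## Pre-Hilbert modules and their completions -/

/-- A family of vector spaces with a positive semidefinite `B`-valued inner product. The action
`act` of `B` and the grading `gr` need only be compatible with the inner product. -/
structure PreHilbertModule {𝕜 : Type} [RCLike 𝕜] (B : GradedCStarCategory.{u} 𝕜) :
    Type (u + 1) where
  V : B.Obj → Type u
  [addCommGroup : ∀ b, AddCommGroup (V b)]
  [module : ∀ b, Module 𝕜 (V b)]
  act : ∀ {a b : B.Obj}, V b → B.Hom a b → V a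
  inner : ∀ {a b : B.Obj}, V b → V a → B.Hom a b
  gr : ∀ {b : B.Obj}, V b → V b
  inner_add : ∀ {a b : B.Obj} (η : V b) (ξ ζ : V a), inner η (ξ + ζ) = inner η ξ + inner η ζ
  inner_smul : ∀ {a b : B.Obj} (r : 𝕜) (η : V b) (ξ : V a), inner η (r • ξ) = r • inner η ξ
  inner_act : ∀ {a b c : B.Obj} (η : V c) (ξ : V b) (x : B.Hom a b),
    inner η (act ξ x) = B.comp (inner η ξ) x
  adj_inner : ∀ {a b : B.Obj} (η : V b) (ξ : V a), B.adj (inner η ξ) = inner ξ η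
  inner_self_positive : ∀ {b : B.Obj} (η : V b), B.IsPositive (inner η η)
  gr_gr : ∀ {b : B.Obj} (η : V b), gr (gr η) = η
  inner_gr : ∀ {a b : B.Obj} (η : V b) (ξ : V a), inner (gr η) (gr ξ) = B.gr (inner η ξ)

namespace PreHilbertModule

variable {𝕜 : Type} [RCLike 𝕜] {B : GradedCStarCategory.{u} 𝕜} (P : PreHilbertModule B)

instance (b : B.Obj) : AddCommGroup (P.V b) := P.addCommGroup b

instance (b : B.Obj) : Module 𝕜 (P.V b) := P.module b

theorem inner_zero {a b : B.Obj} (η : P.V b) : P.inner η (0 : P.V a) = 0 := by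
  simpa using P.inner_smul (0 : 𝕜) η (0 : P.V a)

theorem inner_neg {a b : B.Obj} (η : P.V b) (ξ : P.V a) : P.inner η (-ξ) = -P.inner η ξ := by
  rw [← neg_one_smul 𝕜 ξ, P.inner_smul, neg_one_smul]

theorem inner_sub {a b : B.Obj} (η : P.V b) (ξ ζ : P.V a) :
    P.inner η (ξ - ζ) = P.inner η ξ - P.inner η ζ := by
  rw [sub_eq_add_neg, P.inner_add, P.inner_neg, ← sub_eq_add_neg]

theorem add_inner {a b : B.Obj} (η ξ : P.V b) (ζ : P.V a) :
    P.inner (η + ξ) ζ = P.inner η ζ + P.inner ξ ζ := by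
  rw [← P.adj_inner, P.inner_add, B.adj_add, P.adj_inner, P.adj_inner]

theorem smul_inner {a b : B.Obj} (r : 𝕜) (η : P.V b) (ζ : P.V a) :
    P.inner (r • η) ζ = (starRingEnd 𝕜 r) • P.inner η ζ := by
  rw [← P.adj_inner, P.inner_smul, B.adj_smul, P.adj_inner]

theorem neg_inner {a b : B.Obj} (η : P.V b) (ζ : P.V a) : P.inner (-η) ζ = -P.inner η ζ := by
  rw [← P.adj_inner, P.inner_neg, B.adj_neg, P.adj_inner]

theorem sub_inner {a b : B.Obj} (η ξ : P.V b) (ζ : P.V a) :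
    P.inner (η - ξ) ζ = P.inner η ζ - P.inner ξ ζ := by
  rw [sub_eq_add_neg, P.add_inner, P.neg_inner, ← sub_eq_add_neg]

theorem act_inner {a b c : B.Obj} (η : P.V c) (ξ : P.V b) (x : B.Hom a b) :
    P.inner (P.act ξ x) η = B.comp (B.adj x) (P.inner ξ η) := by
  rw [← P.adj_inner, P.inner_act, B.adj_comp, P.adj_inner]

/-- The Cauchy-Schwarz inequality `⟨η, ξ⟩⋆ ⟨η, ξ⟩ ≤ t ⟨ξ, ξ⟩` for `‖⟨η, η⟩‖ ≤ t`. -/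
theorem isPositive_smul_inner_sub {a b : B.Obj} (η : P.V b) (ξ : P.V a) {t : ℝ} (ht0 : 0 < t)
    (ht : ‖P.inner η η‖ ≤ t) :
    B.IsPositive (t • P.inner ξ ξ - B.comp (B.adj (P.inner η ξ)) (P.inner η ξ)) := by
  set x := P.inner η ξ with hx
  set w := (t : 𝕜) • ξ - P.act η x with hw
  have h1 := P.inner_self_positive w
  have h2 := B.isPositive_smul_sub (P.inner_self_positive η).1 ht0 ht x
  have e : P.inner w w = (t * t) • P.inner ξ ξ - (2 * t) • B.comp (B.adj x) x
      + B.comp (B.adj x) (B.comp (P.inner η η) x) := by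
    have e1 : P.inner ξ η = B.adj x := by rw [hx, P.adj_inner]
    rw [hw, P.inner_sub, P.sub_inner, P.sub_inner, P.inner_smul, P.smul_inner, P.inner_act,
      P.smul_inner, P.inner_smul, P.act_inner, P.act_inner, P.inner_act, ← hx, RCLike.conj_ofReal,
      ← B.real_smul_def, ← B.real_smul_def, ← B.real_smul_def, ← B.real_smul_def, e1,
      B.real_smul_comp, smul_smul]
    module
  have h3 := B.isPositive_real_smul (B.isPositive_add h1 h2) (inv_nonneg.2 ht0.le)
  convert h3 using 1
  rw [e]
  match_scalars <;> field_simp <;> ring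

theorem norm_inner_sq_le {a b : B.Obj} (η : P.V b) (ξ : P.V a) :
    ‖P.inner η ξ‖ ^ 2 ≤ ‖P.inner η η‖ * ‖P.inner ξ ξ‖ := by
  refine le_of_forall_pos_le_add fun ε hε => ?_
  set δ := ε / (‖P.inner ξ ξ‖ + 1) with hδ
  have hδ0 : 0 < δ := by positivity
  have h1 := P.isPositive_smul_inner_sub η ξ (t := ‖P.inner η η‖ + δ) (by positivity)
    (by linarith)
  have h2 := B.norm_le_norm_add_of_isPositive (B.positive_adj_comp_self (P.inner η ξ)) h1
  rw [add_sub_cancel, B.norm_adj_comp_self, norm_smul, Real.norm_of_nonneg (by positivity),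
    add_mul] at h2
  refine h2.trans ?_
  gcongr
  rw [hδ, div_mul_eq_mul_div, div_le_iff₀ (by positivity)]
  gcongr
  linarith

/-- The seminorm of a pre-Hilbert module. -/
def seminorm (b : B.Obj) : AddGroupSeminorm (P.V b) where
  toFun η := √‖P.inner η η‖
  map_zero' := by rw [P.inner_zero, norm_zero, Real.sqrt_zero]
  add_le' η ξ := by
    rw [← Real.sqrt_sq (by positivity : 0 ≤ √‖P.inner η η‖ + √‖P.inner ξ ξ‖)]
    apply Real.sqrt_le_sqrt
    have h1 : ‖P.inner η ξ‖ ≤ √‖P.inner η η‖ * √‖P.inner ξ ξ‖ := by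
      rw [← Real.sqrt_mul (norm_nonneg _)]
      exact Real.le_sqrt_of_sq_le (P.norm_inner_sq_le η ξ)
    have h2 : ‖P.inner ξ η‖ = ‖P.inner η ξ‖ := by rw [← P.adj_inner, B.norm_adj]
    have h3 : P.inner (η + ξ) (η + ξ)
        = P.inner η η + P.inner η ξ + (P.inner ξ η + P.inner ξ ξ) := by
      rw [P.add_inner, P.inner_add, P.inner_add]
    rw [h3, add_sq, Real.sq_sqrt (norm_nonneg _), Real.sq_sqrt (norm_nonneg _)]
    have h4 := norm_add_le (P.inner η η + P.inner η ξ) (P.inner ξ η + P.inner ξ ξ)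
    have h5 := norm_add_le (P.inner η η) (P.inner η ξ)
    have h6 := norm_add_le (P.inner ξ η) (P.inner ξ ξ)
    linarith
  neg' η := by rw [P.inner_neg, P.neg_inner, neg_neg]

instance (b : B.Obj) : SeminormedAddCommGroup (P.V b) :=
  (P.seminorm b).toSeminormedAddCommGroup

theorem norm_def {b : B.Obj} (η : P.V b) : ‖η‖ = √‖P.inner η η‖ := rfl

theorem norm_sq {b : B.Obj} (η : P.V b) : ‖η‖ ^ 2 = ‖P.inner η η‖ :=
  Real.sq_sqrt (norm_nonneg _)

instance (b : B.Obj) : NormedSpace 𝕜 (P.V b) where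
  norm_smul_le r η := by
    refine le_of_eq ((sq_eq_sq₀ (norm_nonneg _) (by positivity)).1 ?_)
    rw [P.norm_sq, P.inner_smul, P.smul_inner, norm_smul, norm_smul, RCLike.norm_conj, mul_pow,
      P.norm_sq]
    ring

theorem norm_inner_le {a b : B.Obj} (η : P.V b) (ξ : P.V a) :
    ‖P.inner η ξ‖ ≤ ‖η‖ * ‖ξ‖ := by
  refine (sq_le_sq₀ (norm_nonneg _) (by positivity)).1 ?_
  rw [mul_pow, P.norm_sq, P.norm_sq]
  exact P.norm_inner_sq_le η ξ

theorem norm_act_le {a b : B.Obj} (η : P.V b) (x : B.Hom a b) : ‖P.act η x‖ ≤ ‖η‖ * ‖x‖ := by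
  refine (sq_le_sq₀ (norm_nonneg _) (by positivity)).1 ?_
  rw [P.norm_sq, P.inner_act, P.act_inner, mul_pow, P.norm_sq]
  refine (B.norm_comp_le _ _).trans ?_
  refine (mul_le_mul_of_nonneg_right (B.norm_comp_le _ _) (norm_nonneg _)).trans ?_
  rw [B.norm_adj]
  exact le_of_eq (by ring)

theorem norm_gr {b : B.Obj} (η : P.V b) : ‖P.gr η‖ = ‖η‖ := by
  rw [P.norm_def, P.norm_def, P.inner_gr, B.norm_gr]

theorem inner_gr_right {a b : B.Obj} (η : P.V b) (ξ : P.V a) :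
    P.inner η (P.gr ξ) = B.gr (P.inner (P.gr η) ξ) := by
  rw [← P.inner_gr, P.gr_gr]

open UniformSpace (Completion)

/-- The inclusion into the completion. -/
abbrev ι (b : B.Obj) : P.V b →ₗ[𝕜] Completion (P.V b) :=
  (Completion.toComplₗᵢ (𝕜 := 𝕜) (E := P.V b)).toLinearMap

theorem denseRange_ι (b : B.Obj) : DenseRange (P.ι b) := Completion.denseRange_coe

theorem norm_ι {b : B.Obj} (η : P.V b) : ‖P.ι b η‖ = ‖η‖ := Completion.norm_coe η

theorem ι_eq_of_inner_eq {b : B.Obj} {η ξ : P.V b}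
    (h : ∀ ζ : P.V b, P.inner ζ η = P.inner ζ ξ) : P.ι b η = P.ι b ξ := by
  rw [← sub_eq_zero, ← map_sub, ← norm_eq_zero, P.norm_ι, P.norm_def, P.inner_sub, h, sub_self,
    norm_zero, Real.sqrt_zero]

/-- The inner product of a vector with the vectors of the completion. -/
def innerRight {a b : B.Obj} (η : P.V b) : Completion (P.V a) →L[𝕜] B.Hom a b :=
  LinearMap.extendOfNorm (⟨⟨P.inner η, P.inner_add η⟩, fun r => P.inner_smul r η⟩ :
    P.V a →ₗ[𝕜] B.Hom a b) (P.ι a)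

theorem innerRight_ι {a b : B.Obj} (η : P.V b) (ξ : P.V a) :
    P.innerRight η (P.ι a ξ) = P.inner η ξ :=
  LinearMap.extendOfNorm_eq (P.denseRange_ι a)
    ⟨‖η‖, fun ξ => by rw [P.norm_ι]; exact P.norm_inner_le η ξ⟩ ξ

theorem norm_innerRight_le {a b : B.Obj} (η : P.V b) :
    ‖(P.innerRight η : Completion (P.V a) →L[𝕜] B.Hom a b)‖ ≤ ‖η‖ :=
  LinearMap.opNorm_extendOfNorm_le (P.denseRange_ι a) (norm_nonneg _)
    fun ξ => by rw [P.norm_ι]; exact P.norm_inner_le η ξ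

theorem innerRight_ext {a b : B.Obj} {S T : Completion (P.V a) →L[𝕜] B.Hom a b}
    (h : ∀ ξ, S (P.ι a ξ) = T (P.ι a ξ)) : S = T :=
  ContinuousLinearMap.ext fun ξ => congrFun
    ((P.denseRange_ι a).equalizer S.continuous T.continuous (funext h)) ξ

/-- The inner product of the completion. -/
def innerCompl (a b : B.Obj) :
    Completion (P.V b) →L⋆[𝕜] (Completion (P.V a) →L[𝕜] B.Hom a b) :=
  LinearMap.extendOfNorm (⟨⟨P.innerRight, fun η ξ => P.innerRight_ext fun ζ => by
      change _ = P.innerRight η (P.ι a ζ) + P.innerRight ξ (P.ι a ζ)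
      simp only [innerRight_ι, P.add_inner]⟩, fun r η => P.innerRight_ext fun ζ => by
      change _ = starRingEnd 𝕜 r • P.innerRight η (P.ι a ζ)
      simp only [innerRight_ι, P.smul_inner]⟩ :
    P.V b →ₛₗ[starRingEnd 𝕜] (Completion (P.V a) →L[𝕜] B.Hom a b)) (P.ι b)

theorem innerCompl_ι {a b : B.Obj} (η : P.V b) (ξ : P.V a) :
    P.innerCompl a b (P.ι b η) (P.ι a ξ) = P.inner η ξ := by
  have h : P.innerCompl a b (P.ι b η) = P.innerRight η :=
    LinearMap.extendOfNorm_eq (P.denseRange_ι b)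
      ⟨1, fun η => by rw [P.norm_ι, one_mul]; exact P.norm_innerRight_le η⟩ η
  rw [h, P.innerRight_ι]

theorem continuous_innerCompl (a b : B.Obj) :
    Continuous fun p : Completion (P.V b) × Completion (P.V a) => P.innerCompl a b p.1 p.2 := by
  fun_prop

theorem ind₁ {b : B.Obj} {p : Completion (P.V b) → Prop} (hp : IsClosed {η | p η})
    (h : ∀ η, p (P.ι b η)) (η : Completion (P.V b)) : p η :=
  Completion.induction_on η hp h

theorem ind₂ {a b : B.Obj} {p : Completion (P.V b) → Completion (P.V a) → Prop}
    (hp : IsClosed {x : Completion (P.V b) × Completion (P.V a) | p x.1 x.2})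
    (h : ∀ η ξ, p (P.ι b η) (P.ι a ξ)) (η : Completion (P.V b)) (ξ : Completion (P.V a)) :
    p η ξ :=
  Completion.induction_on₂ η ξ hp h

/-- The action on the completion. -/
def actCompl {a b : B.Obj} (x : B.Hom a b) : Completion (P.V b) →L[𝕜] Completion (P.V a) :=
  LinearMap.extendOfNorm (⟨⟨fun η => P.ι a (P.act η x), fun η ξ => by
      rw [← map_add]
      exact P.ι_eq_of_inner_eq fun ζ => by
        rw [P.inner_add, P.inner_act, P.inner_act, P.inner_act, P.inner_add, B.add_comp]⟩,
      fun r η => by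
      change _ = r • P.ι a (P.act η x)
      rw [← map_smul]
      exact P.ι_eq_of_inner_eq fun ζ => by
        rw [P.inner_smul, P.inner_act, P.inner_act, P.inner_smul, B.smul_comp]⟩ :
    P.V b →ₗ[𝕜] Completion (P.V a)) (P.ι b)

theorem actCompl_ι {a b : B.Obj} (x : B.Hom a b) (η : P.V b) :
    P.actCompl x (P.ι b η) = P.ι a (P.act η x) :=
  LinearMap.extendOfNorm_eq (P.denseRange_ι b)
    ⟨‖x‖, fun η => by
      rw [P.norm_ι, mul_comm]
      exact (P.norm_ι _).le.trans (P.norm_act_le η x)⟩ η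

/-- The grading of the completion. -/
def grCompl (b : B.Obj) : Completion (P.V b) →L[𝕜] Completion (P.V b) :=
  LinearMap.extendOfNorm (⟨⟨fun η => P.ι b (P.gr η), fun η ξ => by
      rw [← map_add]
      exact P.ι_eq_of_inner_eq fun ζ => by
        rw [P.inner_add, P.inner_gr_right, P.inner_gr_right, P.inner_gr_right, P.inner_add,
          B.gr_add]⟩,
      fun r η => by
      change _ = r • P.ι b (P.gr η)
      rw [← map_smul]
      exact P.ι_eq_of_inner_eq fun ζ => by
        rw [P.inner_smul, P.inner_gr_right, P.inner_gr_right, P.inner_smul, B.gr_smul]⟩ :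
    P.V b →ₗ[𝕜] Completion (P.V b)) (P.ι b)

theorem grCompl_ι {b : B.Obj} (η : P.V b) : P.grCompl b (P.ι b η) = P.ι b (P.gr η) :=
  LinearMap.extendOfNorm_eq (P.denseRange_ι b)
    ⟨1, fun η => by
      rw [P.norm_ι, one_mul]
      exact (P.norm_ι _).le.trans (P.norm_gr η).le⟩ η

end PreHilbertModule

theorem GradedCStarCategory.isClosed_isPositive {𝕜 : Type} [RCLike 𝕜]
    (B : GradedCStarCategory.{u} 𝕜) (b : B.Obj) : IsClosed {h : B.Hom b b | B.IsPositive h} := by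
  refine isClosed_of_closure_subset fun h hh => B.isPositive_of_approx fun ε hε => ?_
  obtain ⟨k, hk, hd⟩ := Metric.mem_closure_iff.1 hh ε hε
  exact ⟨k, hk, by rw [← dist_eq_norm]; exact hd.le⟩

theorem GradedCStarCategory.continuous_adj {𝕜 : Type} [RCLike 𝕜]
    (B : GradedCStarCategory.{u} 𝕜) {a b : B.Obj} :
    Continuous (B.adj : B.Hom a b → B.Hom b a) :=
  AddMonoidHomClass.continuous_of_bound (⟨⟨B.adj, B.adj_zero⟩, B.adj_add⟩ :
    B.Hom a b →+ B.Hom b a) 1 fun x => by rw [one_mul]; exact (B.norm_adj x).le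

theorem GradedCStarCategory.continuous_comp_right {𝕜 : Type} [RCLike 𝕜]
    (B : GradedCStarCategory.{u} 𝕜) {a b c : B.Obj} (x : B.Hom a b) :
    Continuous fun y : B.Hom b c => B.comp y x :=
  AddMonoidHomClass.continuous_of_bound (⟨⟨fun y => B.comp y x, B.zero_comp x⟩,
    fun y z => B.add_comp y z x⟩ : B.Hom b c →+ B.Hom a c) ‖x‖ fun y => by
      rw [mul_comm]; exact B.norm_comp_le y x

/-- A Hilbert module from a minimal set of properties. -/
def HilbertModule.ofInner {𝕜 : Type} [RCLike 𝕜] {B : GradedCStarCategory.{u} 𝕜}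
    (X : B.Obj → Type u) [∀ b, NormedAddCommGroup (X b)] [∀ b, NormedSpace 𝕜 (X b)]
    [∀ b, CompleteSpace (X b)] (act : ∀ {a b : B.Obj}, X b → B.Hom a b → X a)
    (inner : ∀ {a b : B.Obj}, X b → X a → B.Hom a b) (gr : ∀ {b : B.Obj}, X b → X b)
    (inner_add : ∀ {a b : B.Obj} (η : X b) (ξ ζ : X a), inner η (ξ + ζ) = inner η ξ + inner η ζ)
    (inner_smul : ∀ {a b : B.Obj} (r : 𝕜) (η : X b) (ξ : X a),
      inner η (r • ξ) = r • inner η ξ)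
    (inner_act : ∀ {a b c : B.Obj} (η : X c) (ξ : X b) (x : B.Hom a b),
      inner η (act ξ x) = B.comp (inner η ξ) x)
    (adj_inner : ∀ {a b : B.Obj} (η : X b) (ξ : X a), B.adj (inner η ξ) = inner ξ η)
    (inner_self_positive : ∀ {b : B.Obj} (η : X b), B.IsPositive (inner η η))
    (norm_sq : ∀ {b : B.Obj} (η : X b), ‖η‖ ^ 2 = ‖inner η η‖)
    (gr_gr : ∀ {b : B.Obj} (η : X b), gr (gr η) = η)
    (inner_gr : ∀ {a b : B.Obj} (η : X b) (ξ : X a), inner (gr η) (gr ξ) = B.gr (inner η ξ))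
    (countably_generated : ∃ Ω : Set (Σ b, X b), Ω.Countable ∧ ∀ a : B.Obj,
      Dense (Submodule.span 𝕜 {ζ : X a | ∃ p ∈ Ω, ∃ x : B.Hom a p.1, ζ = act p.2 x} :
        Set (X a))) : HilbertModule B :=
  have ext : ∀ {b : B.Obj} {η ξ : X b}, (∀ ζ : X b, inner ζ η = inner ζ ξ) → η = ξ := by
    intro b η ξ h
    rw [← sub_eq_zero, ← norm_eq_zero, ← sq_eq_zero_iff, norm_sq, sub_eq_add_neg, inner_add, h,
      ← inner_add, add_neg_cancel]
    have : inner (η + -ξ) (0 : X b) = 0 := by simpa using inner_smul (0 : 𝕜) (η + -ξ) (0 : X b)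
    rw [this, norm_zero]
  have gr_right : ∀ {a b : B.Obj} (η : X b) (ξ : X a),
      inner η (gr ξ) = B.gr (inner (gr η) ξ) := by
    intro a b η ξ
    rw [← inner_gr, gr_gr]
  { X := X
    act := act
    inner := inner
    gr := gr
    add_act := fun η ξ x => ext fun ζ => by
      rw [inner_add, inner_act, inner_act, inner_act, inner_add, B.add_comp]
    act_add := fun η x y => ext fun ζ => by
      rw [inner_add, inner_act, inner_act, inner_act, B.comp_add]
    smul_act := fun r η x => ext fun ζ => by
      rw [inner_smul, inner_act, inner_act, inner_smul, B.smul_comp]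
    act_smul := fun r η x => ext fun ζ => by
      rw [inner_smul, inner_act, inner_act, B.comp_smul]
    act_act := fun η x y => ext fun ζ => by
      rw [inner_act, inner_act, inner_act, B.assoc]
    inner_add := inner_add
    inner_smul := inner_smul
    inner_act := inner_act
    adj_inner := adj_inner
    inner_self_positive := inner_self_positive
    norm_sq := norm_sq
    gr_add := fun η ξ => ext fun ζ => by
      rw [inner_add, gr_right, gr_right, gr_right, inner_add, B.gr_add]
    gr_smul := fun r η => ext fun ζ => by
      rw [inner_smul, gr_right, gr_right, inner_smul, B.gr_smul]
    gr_gr := gr_gr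
    gr_act := fun η x => ext fun ζ => by
      rw [gr_right, inner_act, inner_act, gr_right, B.gr_comp]
    inner_gr := inner_gr
    countably_generated := countably_generated }

namespace PreHilbertModule

open UniformSpace (Completion)

variable {𝕜 : Type} [RCLike 𝕜] {B : GradedCStarCategory.{u} 𝕜} (P : PreHilbertModule B)

/-- The completion is countably generated. -/
def CountablyGenerated : Prop := ∃ Ω : Set (Σ b, P.V b), Ω.Countable ∧ ∀ a : B.Obj,
  Dense (Submodule.span 𝕜 {ζ | ∃ p ∈ Ω, ∃ x : B.Hom a p.1, ζ = P.ι a (P.act p.2 x)} :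
    Set (Completion (P.V a)))

/-- The completion of a countably generated pre-Hilbert module. -/
def completion (hP : P.CountablyGenerated) : HilbertModule B :=
  HilbertModule.ofInner (fun b => Completion (P.V b)) (fun η x => P.actCompl x η)
    (fun {a b} η ξ => P.innerCompl a b η ξ) (fun {b} η => P.grCompl b η)
    (fun η ξ ζ => map_add _ _ _) (fun r η ξ => map_smul _ _ _)
    (fun {a b c} η ξ x => P.ind₂ (p := fun η ξ => P.innerCompl a c η (P.actCompl x ξ)
        = B.comp (P.innerCompl b c η ξ) x)
      (isClosed_eq (by fun_prop) ((B.continuous_comp_right x).comp (P.continuous_innerCompl b c)))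
      (fun η ξ => by rw [actCompl_ι, innerCompl_ι, innerCompl_ι, P.inner_act]) η ξ)
    (fun {a b} η ξ => P.ind₂ (p := fun η ξ => B.adj (P.innerCompl a b η ξ)
        = P.innerCompl b a ξ η)
      (isClosed_eq (B.continuous_adj.comp (P.continuous_innerCompl a b)) (by fun_prop))
      (fun η ξ => by rw [innerCompl_ι, innerCompl_ι, P.adj_inner]) η ξ)
    (fun {b} η => P.ind₁ (p := fun η => B.IsPositive (P.innerCompl b b η η))
      ((B.isClosed_isPositive b).preimage (by fun_prop))
      (fun η => by rw [innerCompl_ι]; exact P.inner_self_positive η) η)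
    (fun {b} η => P.ind₁ (p := fun η => ‖η‖ ^ 2 = ‖P.innerCompl b b η η‖)
      (isClosed_eq (by fun_prop) (by fun_prop))
      (fun η => by rw [innerCompl_ι, P.norm_ι, P.norm_sq]) η)
    (fun {b} η => P.ind₁ (p := fun η => P.grCompl b (P.grCompl b η) = η)
      (isClosed_eq (by fun_prop) (by fun_prop))
      (fun η => by rw [grCompl_ι, grCompl_ι, P.gr_gr]) η)
    (fun {a b} η ξ => P.ind₂ (p := fun η ξ => P.innerCompl a b (P.grCompl b η) (P.grCompl a ξ)
        = B.gr (P.innerCompl a b η ξ))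
      (isClosed_eq (by fun_prop) (B.continuous_gr.comp (P.continuous_innerCompl a b)))
      (fun η ξ => by rw [grCompl_ι, grCompl_ι, innerCompl_ι, innerCompl_ι, P.inner_gr]) η ξ)
    (by
      obtain ⟨Ω, hΩ, h⟩ := hP
      refine ⟨(fun p : Σ b, P.V b => ⟨p.1, P.ι p.1 p.2⟩) '' Ω, hΩ.image _, fun a => ?_⟩
      refine (h a).mono (Submodule.span_mono ?_)
      rintro _ ⟨p, hp, x, rfl⟩
      exact ⟨_, ⟨p, hp, rfl⟩, x, (P.actCompl_ι x p.2).symm⟩)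

end PreHilbertModule

/-! ## Operators defined on generators -/

theorem le_mul_of_sq_le {α : ℕ → ℝ} {m C D : ℝ} (hα : ∀ n, 0 ≤ α n) (hm : 0 ≤ m) (hC : 0 ≤ C)
    (h1 : ∀ n, α n ^ 2 ≤ m * α (n + 1)) (h2 : ∀ n, α n ≤ D * C ^ 2 ^ n) : α 0 ≤ m * C := by
  by_contra hlt
  push Not at hlt
  have h0 : 0 < α 0 := lt_of_le_of_lt (by positivity) hlt
  have hm0 : 0 < m := by
    rcases eq_or_lt_of_le hm with h | h
    · have := h1 0
      rw [← h, zero_mul] at this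
      nlinarith
    · exact h
  have key : ∀ n, m * α 0 ^ 2 ^ n ≤ m ^ 2 ^ n * α n := by
    intro n
    induction n with
    | zero => simp
    | succ n ih =>
      have h3 : (m * α 0 ^ 2 ^ n) ^ 2 ≤ (m ^ 2 ^ n * α n) ^ 2 :=
        pow_le_pow_left₀ (by positivity) ih 2
      have h4 : (m ^ 2 ^ n) ^ 2 * α n ^ 2 ≤ (m ^ 2 ^ n) ^ 2 * (m * α (n + 1)) :=
        mul_le_mul_of_nonneg_left (h1 n) (by positivity)
      refine le_of_mul_le_mul_left ?_ hm0
      rw [pow_succ 2 n, pow_mul, pow_mul]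
      nlinarith
  have hC0 : 0 < C := by
    rcases eq_or_lt_of_le hC with h | h
    · have h3 := h2 0
      rw [← h] at h3
      simp at h3
      linarith
    · exact h
  have hr : 1 < α 0 / (m * C) := (one_lt_div (by positivity)).2 hlt
  obtain ⟨n, hn⟩ := pow_unbounded_of_one_lt (D / m) hr
  have h3 : D / m < (α 0 / (m * C)) ^ 2 ^ n :=
    lt_of_lt_of_le hn (pow_le_pow_right₀ hr.le (Nat.lt_two_pow_self).le)
  rw [div_pow, div_lt_div_iff₀ hm0 (by positivity), mul_pow] at h3
  have h4 := key n
  have h5 : m ^ 2 ^ n * α n ≤ m ^ 2 ^ n * (D * C ^ 2 ^ n) :=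
    mul_le_mul_of_nonneg_left (h2 n) (by positivity)
  nlinarith

namespace HilbertModule

variable {𝕜 : Type} [RCLike 𝕜] {B : GradedCStarCategory.{u} 𝕜}

theorem continuous_inner_right (E : HilbertModule B) {a b : B.Obj} (η : E.X b) :
    Continuous fun ξ : E.X a => E.inner η ξ :=
  AddMonoidHomClass.continuous_of_bound (⟨⟨fun ξ => E.inner η ξ, E.inner_zero η⟩,
    E.inner_add η⟩ : E.X a →+ B.Hom a b) (3 * ‖η‖) fun ξ => E.norm_inner_le η ξ

theorem continuous_inner_left (E : HilbertModule B) {a b : B.Obj} (ξ : E.X a) :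
    Continuous fun η : E.X b => E.inner η ξ := by
  have h := B.continuous_adj.comp (E.continuous_inner_right (a := b) ξ)
  refine h.congr fun η => ?_
  exact E.adj_inner ξ η

/-- The linear map from formal linear combinations of symbols to a Hilbert module. -/
abbrev lin {I : Type*} (E : HilbertModule B) {b : B.Obj} (s : I → E.X b) :
    (I →₀ 𝕜) →ₗ[𝕜] E.X b := Finsupp.linearCombination 𝕜 s

theorem denseRange_lin {I : Type*} (E : HilbertModule B) {b : B.Obj} {s : I → E.X b}
    (hs : Dense (Submodule.span 𝕜 (Set.range s) : Set (E.X b))) : DenseRange (E.lin s) := by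
  rwa [← Finsupp.range_linearCombination, LinearMap.coe_range] at hs

theorem inner_lin_of_inner {I J I' J' : Type*} (E F : HilbertModule B) {a b : B.Obj}
    {s : I → E.X a} {t : I' → E.X b} {s' : J → F.X a} {t' : J' → F.X b} {T : I → J}
    {R : J' → I'} (h : ∀ j i, F.inner (t' j) (s' (T i)) = E.inner (t (R j)) (s i))
    (w : J' →₀ 𝕜) (v : I →₀ 𝕜) :
    F.inner (F.lin t' w) (F.lin s' (Finsupp.lmapDomain 𝕜 𝕜 T v))
      = E.inner (E.lin t (Finsupp.lmapDomain 𝕜 𝕜 R w)) (E.lin s v) := by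
  induction v using Finsupp.induction_linear with
  | zero => simp [F.inner_zero, E.inner_zero]
  | add v v' h h' => simp only [map_add, F.inner_add, E.inner_add, h, h']
  | single i r =>
    induction w using Finsupp.induction_linear with
    | zero => simp [F.zero_inner, E.zero_inner]
    | add v v' h h' => simp only [map_add, F.add_inner, E.add_inner, h, h']
    | single j t =>
      simp [Finsupp.linearCombination_single, Finsupp.mapDomain_single, F.inner_smul,
        E.inner_smul, F.smul_inner, E.smul_inner, h]

theorem norm_lin_iterate_le {I : Type*} (E : HilbertModule B) {b : B.Obj} {s : I → E.X b}
    {K : I → I} {C : ℝ} (hg : ∀ i, ∃ D, ∀ n, ‖s (K^[n] i)‖ ≤ D * C ^ n) (v : I →₀ 𝕜) :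
    ∃ D, ∀ n, ‖E.lin s (Finsupp.lmapDomain 𝕜 𝕜 K^[n] v)‖ ≤ D * C ^ n := by
  induction v using Finsupp.induction_linear with
  | zero => exact ⟨0, by simp⟩
  | add v v' h h' =>
    obtain ⟨D, h⟩ := h
    obtain ⟨D', h'⟩ := h'
    refine ⟨D + D', fun n => ?_⟩
    rw [map_add, map_add, add_mul]
    exact (norm_add_le _ _).trans (add_le_add (h n) (h' n))
  | single i r =>
    obtain ⟨D, h⟩ := hg i
    refine ⟨‖r‖ * D, fun n => ?_⟩
    rw [Finsupp.lmapDomain_apply, Finsupp.mapDomain_single, Finsupp.linearCombination_single,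
      norm_smul, mul_assoc]
    exact mul_le_mul_of_nonneg_left (h n) (norm_nonneg _)

theorem norm_lin_map_le {I J : Type*} (E F : HilbertModule B) {b : B.Obj} {s : I → E.X b}
    {s' : J → F.X b} {T : I → J} {R : J → I}
    (h : ∀ j i, F.inner (s' j) (s' (T i)) = E.inner (s (R j)) (s i)) {C : ℝ} (hC : 0 ≤ C)
    (hg : ∀ i, ∃ D, ∀ n, ‖s ((R ∘ T)^[n] i)‖ ≤ D * C ^ n) (v : I →₀ 𝕜) :
    ‖F.lin s' (Finsupp.lmapDomain 𝕜 𝕜 T v)‖ ≤ √(9 * C) * ‖E.lin s v‖ := by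
  set K : I → I := R ∘ T with hK
  have hsym : ∀ j i, E.inner (s j) (s (K i)) = E.inner (s (K j)) (s i) := by
    intro j i
    have h1 := h (T j) i
    have h2 := h (T i) j
    rw [← E.adj_inner, hK, Function.comp_apply, ← h2, F.adj_inner, h1]
    rfl
  have hsymn : ∀ n j i, E.inner (s j) (s (K^[n] i)) = E.inner (s (K^[n] j)) (s i) := by
    intro n
    induction n with
    | zero => exact fun _ _ => rfl
    | succ n ih =>
      intro j i
      rw [Function.iterate_succ_apply, ih, hsym, ← Function.iterate_succ_apply' K]
  obtain ⟨D, hD⟩ := E.norm_lin_iterate_le hg v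
  set α : ℕ → ℝ := fun n => ‖E.lin s (Finsupp.lmapDomain 𝕜 𝕜 K^[2 ^ n] v)‖ with hα
  have hα1 : ∀ n, α n ^ 2 ≤ (3 * ‖E.lin s v‖) * α (n + 1) := by
    intro n
    have h1 := E.inner_lin_of_inner E (s := s) (t := s) (s' := s) (t' := s) (T := K^[2 ^ n])
      (R := K^[2 ^ n]) (hsymn _) (Finsupp.lmapDomain 𝕜 𝕜 K^[2 ^ n] v) v
    have h2 : Finsupp.lmapDomain 𝕜 𝕜 K^[2 ^ n] (Finsupp.lmapDomain 𝕜 𝕜 K^[2 ^ n] v)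
        = Finsupp.lmapDomain 𝕜 𝕜 K^[2 ^ (n + 1)] v := by
      rw [pow_succ, mul_two, Function.iterate_add, Finsupp.lmapDomain_apply,
        Finsupp.lmapDomain_apply, Finsupp.lmapDomain_apply, Finsupp.mapDomain_comp]
    rw [hα, E.norm_sq, h1, h2]
    refine (E.norm_inner_le _ _).trans (le_of_eq ?_)
    ring
  have h3 := le_mul_of_sq_le (fun n => norm_nonneg _) (by positivity) hC hα1
    (fun n => hD (2 ^ n))
  have h4 : ‖F.lin s' (Finsupp.lmapDomain 𝕜 𝕜 T v)‖ ^ 2 ≤ 9 * C * ‖E.lin s v‖ ^ 2 := by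
    have h5 := E.inner_lin_of_inner F (s := s) (t := s) (s' := s') (t' := s') h
      (Finsupp.lmapDomain 𝕜 𝕜 T v) v
    have h6 : Finsupp.lmapDomain 𝕜 𝕜 R (Finsupp.lmapDomain 𝕜 𝕜 T v)
        = Finsupp.lmapDomain 𝕜 𝕜 K^[2 ^ 0] v := by
      rw [Finsupp.lmapDomain_apply, Finsupp.lmapDomain_apply, Finsupp.lmapDomain_apply,
        ← Finsupp.mapDomain_comp]
      rfl
    rw [F.norm_sq, h5, h6]
    refine (E.norm_inner_le _ _).trans ?_
    have h7 := mul_le_mul_of_nonneg_right h3 (norm_nonneg (E.lin s v))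
    change 3 * α 0 * _ ≤ _
    nlinarith
  refine (sq_le_sq₀ (norm_nonneg _) (by positivity)).1 ?_
  rwa [mul_pow, Real.sq_sqrt (by positivity)]

end HilbertModule

/-- Two maps between the generators of Hilbert modules which are formally adjoint to each other
and satisfy a growth condition define an operator. -/
theorem Op.exists_of_generators {𝕜 : Type} [RCLike 𝕜] {B : GradedCStarCategory.{u} 𝕜}
    (E F : HilbertModule B) {I J : B.Obj → Type*} (s : ∀ b, I b → E.X b) (s' : ∀ b, J b → F.X b)
    (hs : ∀ b, Dense (Submodule.span 𝕜 (Set.range (s b)) : Set (E.X b)))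
    (hs' : ∀ b, Dense (Submodule.span 𝕜 (Set.range (s' b)) : Set (F.X b)))
    (T : ∀ b, I b → J b) (R : ∀ b, J b → I b)
    (h : ∀ a b (j : J b) (i : I a), F.inner (s' b j) (s' a (T a i)) = E.inner (s b (R b j)) (s a i))
    {C : ℝ} (hC : 0 ≤ C) (hg : ∀ b i, ∃ D, ∀ n, ‖s b ((R b ∘ T b)^[n] i)‖ ≤ D * C ^ n) :
    ∃ T' : Op E F, (∀ b i, T'.app b (s b i) = s' b (T b i)) ∧
      (∀ b j, T'.adj.app b (s' b j) = s b (R b j)) ∧ ‖T'‖ ≤ √(9 * C) := by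
  have hT := fun b => E.norm_lin_map_le F (h b b) hC (hg b)
  have hR : ∀ b (w : J b →₀ 𝕜), ‖E.lin (s b) (Finsupp.lmapDomain 𝕜 𝕜 (R b) w)‖
      ≤ 3 * √(9 * C) * ‖F.lin (s' b) w‖ := by
    intro b w
    set η := E.lin (s b) (Finsupp.lmapDomain 𝕜 𝕜 (R b) w) with hη
    have h1 : ‖η‖ ^ 2 ≤ 3 * ‖F.lin (s' b) w‖ * (√(9 * C) * ‖η‖) := by
      rw [E.norm_sq]
      nth_rewrite 1 [hη]
      rw [hη, ← E.inner_lin_of_inner F (s := s b) (t := s b) (s' := s' b) (t' := s' b) (h b b)]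
      refine (F.norm_inner_le _ _).trans ?_
      gcongr
      exact hT b _
    rcases eq_or_lt_of_le (norm_nonneg η) with h0 | h0
    · rw [← h0]; positivity
    · refine le_of_mul_le_mul_left ?_ h0
      nlinarith
  set f : ∀ b, E.X b →L[𝕜] F.X b := fun b =>
    ((F.lin (s' b)).comp (Finsupp.lmapDomain 𝕜 𝕜 (T b))).extendOfNorm (E.lin (s b)) with hf
  set g : ∀ b, F.X b →L[𝕜] E.X b := fun b =>
    ((E.lin (s b)).comp (Finsupp.lmapDomain 𝕜 𝕜 (R b))).extendOfNorm (F.lin (s' b)) with hg'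
  have hfe : ∀ b v, f b (E.lin (s b) v) = F.lin (s' b) (Finsupp.lmapDomain 𝕜 𝕜 (T b) v) :=
    fun b v => LinearMap.extendOfNorm_eq (E.denseRange_lin (hs b)) ⟨_, hT b⟩ v
  have hge : ∀ b v, g b (F.lin (s' b) v) = E.lin (s b) (Finsupp.lmapDomain 𝕜 𝕜 (R b) v) :=
    fun b v => LinearMap.extendOfNorm_eq (F.denseRange_lin (hs' b)) ⟨_, hR b⟩ v
  have hfb : ∀ b ξ, ‖f b ξ‖ ≤ √(9 * C) * ‖ξ‖ := fun b ξ =>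
    ((f b).le_opNorm ξ).trans (mul_le_mul_of_nonneg_right
      (LinearMap.opNorm_extendOfNorm_le (E.denseRange_lin (hs b)) (by positivity) (hT b))
      (norm_nonneg _))
  have hfg : ∀ (a b : B.Obj) (η : F.X b) (ξ : E.X a), F.inner η (f a ξ) = E.inner (g b η) ξ := by
    intro a b η ξ
    refine (E.denseRange_lin (hs a)).induction_on
      (p := fun ξ => F.inner η (f a ξ) = E.inner (g b η) ξ) ξ
      (isClosed_eq ((F.continuous_inner_right η).comp (f a).continuous)
        (E.continuous_inner_right _)) fun v => ?_
    refine (F.denseRange_lin (hs' b)).induction_on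
      (p := fun η => F.inner η (f a (E.lin (s a) v)) = E.inner (g b η) (E.lin (s a) v)) η
      (isClosed_eq (F.continuous_inner_left _)
        ((E.continuous_inner_left _).comp (g b).continuous)) fun w => ?_
    rw [hfe, hge]
    exact E.inner_lin_of_inner F (h a b) w v
  refine ⟨Op.mk' (fun b => f b) (fun b => g b) hfg _ (by positivity) hfb, fun b i => ?_,
    fun b j => ?_, Op.norm_le _ (by positivity) hfb⟩
  · rw [Op.mk'_app]
    simpa using hfe b (Finsupp.single i 1)
  · refine E.ext_inner fun ζ => ?_
    rw [Op.inner_adj_app, Op.mk'_app, ← F.adj_inner, hfg, E.adj_inner]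
    congr 1
    simpa using hge b (Finsupp.single j 1)

/-- Operators that agree on generators are equal. -/
theorem Op.ext_of_generators {𝕜 : Type} [RCLike 𝕜] {B : GradedCStarCategory.{u} 𝕜}
    {E F : HilbertModule B} {I : B.Obj → Type*} {s : ∀ b, I b → E.X b}
    (hs : ∀ b, Dense (Submodule.span 𝕜 (Set.range (s b)) : Set (E.X b))) {S T : Op E F}
    (h : ∀ b i, S.app b (s b i) = T.app b (s b i)) : S = T := by
  refine Op.ext fun b ξ => ?_
  refine (E.denseRange_lin (hs b)).induction_on (p := fun ξ => S.app b ξ = T.app b ξ) ξ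
    (isClosed_eq (S.app b).continuous (T.app b).continuous) fun v => ?_
  induction v using Finsupp.induction_linear with
  | zero => simp
  | add v v' h h' => simp only [map_add, h, h']
  | single i r => simp [h]

/-! ## Modules given by a positive kernel -/

/-- A positive kernel with values in a graded C*-category. -/
structure PositiveKernel {𝕜 : Type} [RCLike 𝕜] (B : GradedCStarCategory.{u} 𝕜) :
    Type (u + 1) where
  I : B.Obj → Type u
  k : ∀ {a b : B.Obj}, I b → I a → B.Hom a b
  act : ∀ {a b : B.Obj}, I b → B.Hom a b → I a
  gr : ∀ {b : B.Obj}, I b → I b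
  k_act : ∀ {a b c : B.Obj} (i : I c) (j : I b) (x : B.Hom a b),
    k i (act j x) = B.comp (k i j) x
  adj_k : ∀ {a b : B.Obj} (i : I b) (j : I a), B.adj (k i j) = k j i
  gr_gr : ∀ {b : B.Obj} (i : I b), gr (gr i) = i
  k_gr : ∀ {a b : B.Obj} (i : I b) (j : I a), k (gr i) (gr j) = B.gr (k i j)
  pos : ∀ {b : B.Obj} (s : Finset (I b)) (r : I b → 𝕜),
    B.IsPositive (∑ i ∈ s, ∑ j ∈ s, (starRingEnd 𝕜 (r i) * r j) • k i j)

namespace PositiveKernel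

open UniformSpace (Completion)

variable {𝕜 : Type} [RCLike 𝕜] {B : GradedCStarCategory.{u} 𝕜} (K : PositiveKernel B)

/-- The formal linear combinations of symbols. -/
def preModule : PreHilbertModule B where
  V b := K.I b →₀ 𝕜
  act v x := v.mapDomain fun i => K.act i x
  inner v w := v.sum fun i r => w.sum fun j t => (starRingEnd 𝕜 r * t) • K.k i j
  gr v := v.mapDomain K.gr
  inner_add v w w' := by
    rw [← Finsupp.sum_add]
    refine Finsupp.sum_congr fun i _ => ?_
    rw [Finsupp.sum_add_index']
    · simp
    · intro j t t'
      rw [mul_add, add_smul]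
  inner_smul r v w := by
    rw [Finsupp.smul_sum]
    refine Finsupp.sum_congr fun i _ => ?_
    rw [Finsupp.sum_smul_index', Finsupp.smul_sum]
    · refine Finsupp.sum_congr fun j _ => ?_
      rw [smul_smul, smul_eq_mul, mul_left_comm]
    · simp
  inner_act v w x := by
    simp only [Finsupp.sum, B.sum_comp, B.smul_comp, ← K.k_act]
    refine Finset.sum_congr rfl fun i _ => ?_
    refine Finsupp.sum_mapDomain_index (h := fun j t => (starRingEnd 𝕜 (v i) * t) • K.k i j) ?_ ?_
    · simp
    · intro j t t'
      rw [mul_add, add_smul]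
  adj_inner v w := by
    simp only [Finsupp.sum, B.adj_sum, B.adj_smul, K.adj_k]
    rw [Finset.sum_comm]
    refine Finset.sum_congr rfl fun i _ => Finset.sum_congr rfl fun j _ => ?_
    rw [map_mul, RCLike.conj_conj, mul_comm]
  inner_self_positive v := K.pos v.support v
  gr_gr v := by
    rw [← Finsupp.mapDomain_comp]
    convert Finsupp.mapDomain_id using 2
    exact funext K.gr_gr
  inner_gr v w := by
    have h1 : ∀ {a b : B.Obj} (v : K.I b →₀ 𝕜) (w : K.I a →₀ 𝕜),
        ((v.mapDomain K.gr).sum fun i r => (w.mapDomain K.gr).sum fun j t =>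
          (starRingEnd 𝕜 r * t) • K.k i j)
        = v.sum fun i r => w.sum fun j t => (starRingEnd 𝕜 r * t) • K.k (K.gr i) (K.gr j) := by
      intro a b v w
      rw [Finsupp.sum_mapDomain_index]
      · refine Finsupp.sum_congr fun i _ => ?_
        rw [Finsupp.sum_mapDomain_index]
        · simp
        · intro j t t'
          rw [mul_add, add_smul]
      · simp
      · intro i r r'
        rw [← Finsupp.sum_add]
        refine Finsupp.sum_congr fun j _ => ?_
        rw [map_add, add_mul, add_smul]
    rw [h1]
    simp only [Finsupp.sum, B.gr_sum, B.gr_smul, K.k_gr]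

/-- The vector given by a symbol. -/
def sym {b : B.Obj} (i : K.I b) : K.preModule.V b := Finsupp.single (M := 𝕜) i 1

/-- The identification of the vectors with linear combinations of symbols. -/
def comb (b : B.Obj) : (K.I b →₀ 𝕜) →ₗ[𝕜] K.preModule.V b :=
  (LinearMap.id : (K.I b →₀ 𝕜) →ₗ[𝕜] (K.I b →₀ 𝕜))

theorem inner_sym {a b : B.Obj} (i : K.I b) (j : K.I a) :
    K.preModule.inner (K.sym i) (K.sym j) = K.k i j := by
  change ((Finsupp.single (M := 𝕜) i 1).sum fun i r => (Finsupp.single (M := 𝕜) j 1).sum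
    fun j t => (starRingEnd 𝕜 r * t) • K.k i j) = _
  rw [Finsupp.sum_single_index, Finsupp.sum_single_index] <;> simp

theorem act_sym {a b : B.Obj} (i : K.I b) (x : B.Hom a b) :
    K.preModule.act (K.sym i) x = K.sym (K.act i x) :=
  Finsupp.mapDomain_single (M := 𝕜) (f := fun i => K.act i x) (a := i) (b := 1)

theorem gr_sym {b : B.Obj} (i : K.I b) : K.preModule.gr (K.sym i) = K.sym (K.gr i) :=
  Finsupp.mapDomain_single (M := 𝕜) (f := K.gr) (a := i) (b := 1)

/-- The vector given by a symbol, in the completion. -/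
def e₀ {b : B.Obj} (i : K.I b) : Completion (K.preModule.V b) := K.preModule.ι b (K.sym i)

theorem inner_e₀ {a b : B.Obj} (i : K.I b) (j : K.I a) :
    K.preModule.innerCompl a b (K.e₀ i) (K.e₀ j) = K.k i j := by
  unfold e₀
  rw [PreHilbertModule.innerCompl_ι, inner_sym]

theorem gr_e₀ {b : B.Obj} (i : K.I b) : K.preModule.grCompl b (K.e₀ i) = K.e₀ (K.gr i) := by
  unfold e₀
  rw [PreHilbertModule.grCompl_ι, gr_sym]

theorem ι_comb {b : B.Obj} (v : K.I b →₀ 𝕜) :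
    K.preModule.ι b (K.comb b v) = Finsupp.linearCombination 𝕜 (K.e₀ (b := b)) v := by
  induction v using Finsupp.induction_linear with
  | zero => rw [map_zero, map_zero, map_zero]
  | add v w h h' => simp only [map_add, h, h']
  | single i r =>
    have h : (Finsupp.single i r : K.I b →₀ 𝕜) = r • Finsupp.single i 1 := by simp
    rw [Finsupp.linearCombination_single, h, map_smul, map_smul]
    rfl

theorem denseRange_comb (b : B.Obj) :
    DenseRange (Finsupp.linearCombination 𝕜 (K.e₀ (b := b))) := by
  refine (K.preModule.denseRange_ι b).mono ?_
  rintro _ ⟨v, rfl⟩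
  exact ⟨v, (K.ι_comb v).symm⟩

theorem dense_e₀ (b : B.Obj) :
    Dense (Submodule.span 𝕜 (Set.range (K.e₀ (b := b))) : Set (Completion (K.preModule.V b))) := by
  rw [← Finsupp.range_linearCombination, LinearMap.coe_range]
  exact K.denseRange_comb b

theorem e₀_ext {b : B.Obj} {v w : Completion (K.preModule.V b)}
    (h : ∀ i : K.I b, K.preModule.innerCompl b b (K.e₀ i) v
      = K.preModule.innerCompl b b (K.e₀ i) w) : v = w := by
  have h1 : ∀ z : Completion (K.preModule.V b),
      K.preModule.innerCompl b b z (v - w) = 0 := by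
    intro z
    refine (K.denseRange_comb b).induction_on
      (p := fun z => K.preModule.innerCompl b b z (v - w) = 0) z
      (isClosed_eq (by fun_prop) continuous_const) fun u => ?_
    induction u using Finsupp.induction_linear with
    | zero => rw [map_zero, map_zero, ContinuousLinearMap.zero_apply]
    | add v v' h h' => simp only [map_add, ContinuousLinearMap.add_apply, h, h', add_zero]
    | single i r =>
      rw [Finsupp.linearCombination_single, map_smulₛₗ, ContinuousLinearMap.smul_apply, map_sub,
        h, sub_self, smul_zero]
  have h2 : ‖v - w‖ ^ 2 = ‖K.preModule.innerCompl b b (v - w) (v - w)‖ :=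
    K.preModule.ind₁ (p := fun η => ‖η‖ ^ 2 = ‖K.preModule.innerCompl b b η η‖)
      (isClosed_eq (by fun_prop) (by fun_prop))
      (fun η => by
        rw [PreHilbertModule.innerCompl_ι, K.preModule.norm_ι, K.preModule.norm_sq]) (v - w)
  rw [h1, norm_zero, sq_eq_zero_iff, norm_eq_zero] at h2
  exact sub_eq_zero.1 h2

/-- The symbols in a countable set generate the module. -/
def Generated : Prop := ∃ Ω : Set (Σ b, K.I b), Ω.Countable ∧ ∀ (a : B.Obj) (i : K.I a),
  K.e₀ i ∈ (Submodule.span 𝕜 {ζ | ∃ p ∈ Ω, ∃ x : B.Hom a p.1,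
    ζ = K.e₀ (K.act p.2 x)}).topologicalClosure

theorem Generated.countablyGenerated {K : PositiveKernel B} (h : K.Generated) :
    K.preModule.CountablyGenerated := by
  obtain ⟨Ω, hΩ, h⟩ := h
  refine ⟨(fun p : Σ b, K.I b => ⟨p.1, K.sym p.2⟩) '' Ω,
    hΩ.image _, fun a => ?_⟩
  rw [Submodule.dense_iff_topologicalClosure_eq_top, eq_top_iff]
  have h1 := Submodule.dense_iff_topologicalClosure_eq_top.1 (K.dense_e₀ a)
  rw [← h1]
  refine Submodule.topologicalClosure_minimal _ ?_ (Submodule.isClosed_topologicalClosure _)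
  rw [Submodule.span_le]
  rintro _ ⟨i, rfl⟩
  refine Submodule.topologicalClosure_mono (Submodule.span_mono ?_) (h a i)
  rintro _ ⟨p, hp, x, rfl⟩
  refine ⟨_, ⟨p, hp, rfl⟩, x, ?_⟩
  rw [act_sym]
  rfl

/-- The Hilbert module given by a kernel. -/
def module (hK : K.Generated) : HilbertModule B := K.preModule.completion hK.countablyGenerated

variable (hK : K.Generated)

/-- The vector given by a symbol. -/
def e {b : B.Obj} (i : K.I b) : (K.module hK).X b := K.e₀ i

theorem inner_e {a b : B.Obj} (i : K.I b) (j : K.I a) :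
    (K.module hK).inner (K.e hK i) (K.e hK j) = K.k i j := K.inner_e₀ i j

theorem gr_e {b : B.Obj} (i : K.I b) : (K.module hK).gr (K.e hK i) = K.e hK (K.gr i) := K.gr_e₀ i

theorem dense_e (b : B.Obj) :
    Dense (Submodule.span 𝕜 (Set.range (K.e hK (b := b))) : Set ((K.module hK).X b)) :=
  K.dense_e₀ b

end PositiveKernel

/-! ## Countable direct sums -/

theorem PositiveKernel.norm_e₀_sq {𝕜 : Type} [RCLike 𝕜] {B : GradedCStarCategory.{u} 𝕜}
    (K : PositiveKernel B) {b : B.Obj} (i : K.I b) : ‖K.e₀ i‖ ^ 2 = ‖K.k i i‖ := by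
  unfold PositiveKernel.e₀
  rw [K.preModule.norm_ι, K.preModule.norm_sq, K.inner_sym]

namespace HilbertModule

variable {𝕜 : Type} [RCLike 𝕜] {B : GradedCStarCategory.{u} 𝕜}

theorem inner_sum (E : HilbertModule B) {ι : Type*} (s : Finset ι) {a b : B.Obj} (η : E.X b)
    (v : ι → E.X a) : E.inner η (∑ i ∈ s, v i) = ∑ i ∈ s, E.inner η (v i) :=
  map_sum (⟨⟨E.inner η, E.inner_zero η⟩, E.inner_add η⟩ : E.X a →+ B.Hom a b) v s

theorem sum_inner (E : HilbertModule B) {ι : Type*} (s : Finset ι) {a b : B.Obj} (η : E.X a)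
    (v : ι → E.X b) : E.inner (∑ i ∈ s, v i) η = ∑ i ∈ s, E.inner (v i) η :=
  map_sum (⟨⟨fun v => E.inner v η, E.zero_inner η⟩, fun v w => E.add_inner v w η⟩ :
    E.X b →+ B.Hom a b) v s

theorem sum_gram (E : HilbertModule B) {ι : Type*} (s : Finset ι) {b : B.Obj} (v : ι → E.X b)
    (r : ι → 𝕜) : ∑ i ∈ s, ∑ j ∈ s, (starRingEnd 𝕜 (r i) * r j) • E.inner (v i) (v j)
      = E.inner (∑ i ∈ s, r i • v i) (∑ i ∈ s, r i • v i) := by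
  rw [E.sum_inner]
  refine Finset.sum_congr rfl fun i _ => ?_
  rw [E.smul_inner, E.inner_sum, Finset.smul_sum]
  refine Finset.sum_congr rfl fun j _ => ?_
  rw [E.inner_smul, smul_smul]

variable {ι : Type} [DecidableEq ι] (E : ι → HilbertModule B)

/-- The component of a homogeneous element of a direct sum. -/
def sumProj (i : ι) {b : B.Obj} (p : Σ j, (E j).X b) : (E i).X b :=
  if h : p.1 = i then h ▸ p.2 else 0

theorem sumProj_self {i : ι} {b : B.Obj} (η : (E i).X b) : sumProj E i ⟨i, η⟩ = η := by
  simp [sumProj]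

theorem sumProj_ne {i j : ι} {b : B.Obj} (η : (E j).X b) (h : j ≠ i) :
    sumProj E i ⟨j, η⟩ = 0 := by
  simp [sumProj, h]

theorem sum_inner_sumProj {a b : B.Obj} (S : Finset ι) (p : Σ j, (E j).X b)
    (q : Σ j, (E j).X a) (hp : p.1 ∈ S) :
    (E p.1).inner p.2 (sumProj E p.1 q)
      = ∑ i ∈ S, (E i).inner (sumProj E i p) (sumProj E i q) := by
  obtain ⟨i, η⟩ := p
  rw [Finset.sum_eq_single_of_mem i hp, sumProj_self]
  intro j _ hj
  rw [sumProj_ne E η hj.symm, (E j).zero_inner]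

/-- The kernel of a direct sum. -/
def sumKernel : PositiveKernel B where
  I b := Σ i, (E i).X b
  k p q := (E p.1).inner p.2 (sumProj E p.1 q)
  act p x := ⟨p.1, (E p.1).act p.2 x⟩
  gr p := ⟨p.1, (E p.1).gr p.2⟩
  k_act := by
    rintro a b c ⟨i, η⟩ ⟨j, ξ⟩ x
    by_cases h : j = i
    · subst h
      simp only [sumProj_self, inner_act]
    · simp only [sumProj_ne E _ h, inner_zero, B.zero_comp]
  adj_k := by
    rintro a b ⟨i, η⟩ ⟨j, ξ⟩
    by_cases h : j = i
    · subst h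
      simp only [sumProj_self, adj_inner]
    · simp only [sumProj_ne E _ h, sumProj_ne E _ (Ne.symm h), inner_zero,
        B.toGradedStarCategory.adj_zero]
  gr_gr := by
    rintro b ⟨i, η⟩
    simp only [HilbertModule.gr_gr]
  k_gr := by
    rintro a b ⟨i, η⟩ ⟨j, ξ⟩
    by_cases h : j = i
    · subst h
      simp only [sumProj_self, inner_gr]
    · simp only [sumProj_ne E _ h, inner_zero, B.gr_zero]
  pos {b} s r := by
    have h : ∑ p ∈ s, ∑ q ∈ s,
        (starRingEnd 𝕜 (r p) * r q) • (E p.1).inner p.2 (sumProj E p.1 q)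
        = ∑ i ∈ s.image Sigma.fst, (E i).inner (∑ p ∈ s, r p • sumProj E i p)
          (∑ p ∈ s, r p • sumProj E i p) := by
      rw [Finset.sum_congr rfl fun i _ => ((E i).sum_gram s (fun p => sumProj E i p) r).symm]
      refine Eq.trans (Finset.sum_congr rfl fun p hp => ?_) Finset.sum_comm
      refine Eq.trans ?_ Finset.sum_comm
      refine Finset.sum_congr rfl fun q _ => ?_
      rw [sum_inner_sumProj E (s.image Sigma.fst) p q (Finset.mem_image_of_mem _ hp),
        Finset.smul_sum]
    rw [h]
    exact B.isPositive_sum _ _ fun i _ => (E i).inner_self_positive _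

/-- A homogeneous element as a symbol of the kernel. -/
def sumSym (i : ι) {b : B.Obj} (η : (E i).X b) : (sumKernel E).I b := (⟨i, η⟩ : Σ i, (E i).X b)

theorem sumKernel_k_self {i : ι} {a b : B.Obj} (η : (E i).X b) (ξ : (E i).X a) :
    (sumKernel E).k (sumSym E i η) (sumSym E i ξ) = (E i).inner η ξ := by
  change (E i).inner η (sumProj E i ⟨i, ξ⟩) = _
  rw [sumProj_self]

theorem sumKernel_k_ne {i j : ι} (h : i ≠ j) {a b : B.Obj} (η : (E i).X b) (ξ : (E j).X a) :
    (sumKernel E).k (sumSym E i η) (sumSym E j ξ) = 0 := by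
  change (E i).inner η (sumProj E i ⟨j, ξ⟩) = _
  rw [sumProj_ne E _ h.symm, inner_zero]

/-- A summand, as a subspace of the completion. -/
def sumLin (i : ι) (b : B.Obj) :
    (E i).X b →L[𝕜] UniformSpace.Completion ((sumKernel E).preModule.V b) :=
  LinearMap.mkContinuous
    { toFun := fun η => (sumKernel E).e₀ (sumSym E i η)
      map_add' := fun η ξ => (sumKernel E).e₀_ext fun p => by
        rw [map_add, PositiveKernel.inner_e₀, PositiveKernel.inner_e₀, PositiveKernel.inner_e₀]
        obtain ⟨j, ζ, rfl⟩ : ∃ j ζ, p = sumSym E j ζ := ⟨p.1, p.2, rfl⟩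
        by_cases h : j = i
        · subst h
          rw [sumKernel_k_self, sumKernel_k_self, sumKernel_k_self, inner_add]
        · rw [sumKernel_k_ne E h, sumKernel_k_ne E h, sumKernel_k_ne E h, add_zero]
      map_smul' := fun r η => (sumKernel E).e₀_ext fun p => by
        rw [map_smul, PositiveKernel.inner_e₀, PositiveKernel.inner_e₀]
        obtain ⟨j, ζ, rfl⟩ : ∃ j ζ, p = sumSym E j ζ := ⟨p.1, p.2, rfl⟩
        by_cases h : j = i
        · subst h
          rw [sumKernel_k_self, sumKernel_k_self, inner_smul]
          rfl
        · rw [sumKernel_k_ne E h, sumKernel_k_ne E h, smul_zero] }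
    1 fun η => by
      rw [one_mul]
      refine ((sq_eq_sq₀ (norm_nonneg _) (norm_nonneg _)).1 ?_).le
      exact ((sumKernel E).norm_e₀_sq _).trans
        ((congrArg norm (sumKernel_k_self E η η)).trans ((E i).norm_sq η).symm)

theorem sumKernel_generated [Countable ι] : (sumKernel E).Generated := by
  choose Ω hΩ hd using fun i => (E i).countably_generated
  refine ⟨⋃ i, (fun p : Σ b, (E i).X b => (⟨p.1, ⟨i, p.2⟩⟩ : Σ b, Σ i, (E i).X b)) '' Ω i,
    Set.countable_iUnion fun i => (hΩ i).image _, ?_⟩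
  rintro a ⟨i, η⟩
  set W := (Submodule.span 𝕜 {ζ | ∃ p ∈ ⋃ i, (fun p : Σ b, (E i).X b =>
      (⟨p.1, ⟨i, p.2⟩⟩ : Σ b, Σ i, (E i).X b)) '' Ω i, ∃ x : B.Hom a p.1,
    ζ = (sumKernel E).e₀ ((sumKernel E).act p.2 x)}).topologicalClosure with hW
  have h1 : Submodule.span 𝕜 {ζ : (E i).X a | ∃ p ∈ Ω i, ∃ x : B.Hom a p.1,
      ζ = (E i).act p.2 x} ≤ W.comap (sumLin E i a).toLinearMap := by
    rw [Submodule.span_le]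
    rintro _ ⟨p, hp, x, rfl⟩
    exact Submodule.le_topologicalClosure _ (Submodule.subset_span
      ⟨_, Set.mem_iUnion.2 ⟨i, p, hp, rfl⟩, x, rfl⟩)
  have h2 : IsClosed (W.comap (sumLin E i a).toLinearMap : Set ((E i).X a)) :=
    (Submodule.isClosed_topologicalClosure _).preimage (sumLin E i a).continuous
  exact h2.closure_subset_iff.2 h1 (hd i a η)

variable [Countable ι]

/-- The direct sum of a countable family of Hilbert modules. -/
def sum : HilbertModule B := (sumKernel E).module (sumKernel_generated E)

/-- The homogeneous elements of a direct sum. -/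
def sumElt {b : B.Obj} (p : Σ i, (E i).X b) : (sum E).X b :=
  (sumKernel E).e (sumKernel_generated E) p

theorem inner_sumElt {a b : B.Obj} (p : Σ i, (E i).X b) (q : Σ i, (E i).X a) :
    (sum E).inner (sumElt E p) (sumElt E q) = (sumKernel E).k p q :=
  (sumKernel E).inner_e _ p q

theorem inner_sumElt_self {i : ι} {a b : B.Obj} (η : (E i).X b) (ξ : (E i).X a) :
    (sum E).inner (sumElt E ⟨i, η⟩) (sumElt E ⟨i, ξ⟩) = (E i).inner η ξ :=
  (inner_sumElt E _ _).trans (sumKernel_k_self E η ξ)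

theorem inner_sumElt_ne {i j : ι} (h : i ≠ j) {a b : B.Obj} (η : (E i).X b) (ξ : (E j).X a) :
    (sum E).inner (sumElt E ⟨i, η⟩) (sumElt E ⟨j, ξ⟩) = 0 :=
  (inner_sumElt E _ _).trans (sumKernel_k_ne E h η ξ)

theorem gr_sumElt {i : ι} {b : B.Obj} (η : (E i).X b) :
    (sum E).gr (sumElt E ⟨i, η⟩) = sumElt E ⟨i, (E i).gr η⟩ :=
  (sumKernel E).gr_e _ _

theorem dense_sumElt (b : B.Obj) :
    Dense (Submodule.span 𝕜 (Set.range (sumElt E (b := b))) : Set ((sum E).X b)) :=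
  (sumKernel E).dense_e _ b

theorem norm_sumElt {i : ι} {b : B.Obj} (η : (E i).X b) : ‖sumElt E ⟨i, η⟩‖ = ‖η‖ := by
  refine (sq_eq_sq₀ (norm_nonneg _) (norm_nonneg _)).1 ?_
  rw [HilbertModule.norm_sq, inner_sumElt_self, ← HilbertModule.norm_sq]

theorem sumElt_zero (i : ι) (b : B.Obj) : sumElt E ⟨i, (0 : (E i).X b)⟩ = 0 := by
  rw [← norm_eq_zero, norm_sumElt, norm_zero]

theorem dense_univ (E : HilbertModule B) (b : B.Obj) :
    Dense (Submodule.span 𝕜 (Set.range (fun η : E.X b => η)) : Set (E.X b)) := by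
  rw [Set.range_id', Submodule.span_univ]
  exact _root_.dense_univ

theorem exists_sumIncl (i : ι) : ∃ T : Op (E i) (sum E),
    (∀ b η, T.app b η = sumElt E ⟨i, η⟩) ∧
    (∀ b p, T.adj.app b (sumElt E p) = sumProj E i p) ∧ ‖T‖ ≤ √(9 * 1) := by
  refine Op.exists_of_generators (E i) (sum E) (fun b η => η) (fun b => sumElt E (b := b))
    (dense_univ (E i)) (dense_sumElt E) (fun b η => ⟨i, η⟩) (fun b p => sumProj E i p) ?_
    zero_le_one ?_
  · rintro a b ⟨j, ξ⟩ η
    by_cases h : j = i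
    · subst h
      rw [inner_sumElt_self, sumProj_self]
    · rw [inner_sumElt_ne E h, sumProj_ne E _ h, zero_inner]
  · intro b η
    refine ⟨‖η‖, fun n => ?_⟩
    have h : (fun p => sumProj E i p) ∘ (fun η : (E i).X b => (⟨i, η⟩ : Σ i, (E i).X b)) = id :=
      funext fun η => sumProj_self E η
    rw [h, Function.iterate_id, one_pow, mul_one, id]

/-- The inclusion of a summand. -/
def sumIncl (i : ι) : Op (E i) (sum E) := (exists_sumIncl E i).choose

theorem sumIncl_app (i : ι) {b : B.Obj} (η : (E i).X b) :
    (sumIncl E i).app b η = sumElt E ⟨i, η⟩ := (exists_sumIncl E i).choose_spec.1 b η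

theorem sumIncl_adj_app (i : ι) {b : B.Obj} (p : Σ i, (E i).X b) :
    (sumIncl E i).adj.app b (sumElt E p) = sumProj E i p :=
  (exists_sumIncl E i).choose_spec.2.1 b p

theorem norm_sumIncl_le (i : ι) : ‖sumIncl E i‖ ≤ √(9 * 1) :=
  (exists_sumIncl E i).choose_spec.2.2

theorem gr_sumIncl (i : ι) : (sumIncl E i).gr = sumIncl E i := Op.ext fun b η => by
  rw [Op.gr_app, sumIncl_app, sumIncl_app, gr_sumElt, HilbertModule.gr_gr]

theorem sumIncl_adj_comp_self (i : ι) :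
    Op.comp (sumIncl E i).adj (sumIncl E i) = Op.one (E i) := Op.ext fun b η => by
  rw [Op.comp_app, sumIncl_app, sumIncl_adj_app, sumProj_self, Op.one_app]

theorem sumIncl_adj_comp_ne {i j : ι} (h : i ≠ j) :
    Op.comp (sumIncl E i).adj (sumIncl E j) = 0 := Op.ext fun b η => by
  rw [Op.comp_app, sumIncl_app, sumIncl_adj_app, sumProj_ne E _ h.symm, Op.zero_app]

variable {E} in
theorem sum_ext {F : HilbertModule B} {S T : Op (sum E) F}
    (h : ∀ i, Op.comp S (sumIncl E i) = Op.comp T (sumIncl E i)) : S = T := by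
  refine Op.ext_of_generators (dense_sumElt E) ?_
  rintro b ⟨i, η⟩
  rw [← sumIncl_app, ← Op.comp_app, h, Op.comp_app]

variable {E} in
theorem exists_sumDiag {F : ι → HilbertModule B} (T : ∀ i, Op (E i) (F i)) {M : ℝ}
    (hT : ∀ i, ‖T i‖ ≤ M) : ∃ T' : Op (sum E) (sum F),
      (∀ i, Op.comp T' (sumIncl E i) = Op.comp (sumIncl F i) (T i)) ∧
      (∀ i, Op.comp T'.adj (sumIncl F i) = Op.comp (sumIncl E i) (T i).adj) ∧
      ‖T'‖ ≤ √(9 * (3 * M * M)) := by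
  rcases isEmpty_or_nonempty ι with hι | ⟨⟨i₀⟩⟩
  · exact ⟨0, fun i => hι.elim i, fun i => hι.elim i, by rw [norm_zero]; positivity⟩
  have hM : 0 ≤ M := (norm_nonneg _).trans (hT i₀)
  obtain ⟨T', h1, h2, h3⟩ := Op.exists_of_generators (sum E) (sum F)
    (fun b => sumElt E (b := b)) (fun b => sumElt F (b := b)) (dense_sumElt E) (dense_sumElt F)
    (fun b p => ⟨p.1, (T p.1).app b p.2⟩) (fun b p => ⟨p.1, (T p.1).adj.app b p.2⟩)
    (by
      rintro a b ⟨j, ξ⟩ ⟨i, η⟩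
      by_cases h : j = i
      · subst h
        rw [inner_sumElt_self, inner_sumElt_self, Op.inner_app]
      · rw [inner_sumElt_ne F h, inner_sumElt_ne E h])
    (C := 3 * M * M) (by positivity) (by
      rintro b ⟨i, η⟩
      refine ⟨‖η‖, fun n => ?_⟩
      have h : ∀ n, ((fun p : Σ i, (F i).X b => (⟨p.1, (T p.1).adj.app b p.2⟩ : Σ i, (E i).X b)) ∘
          fun p : Σ i, (E i).X b => (⟨p.1, (T p.1).app b p.2⟩ : Σ i, (F i).X b))^[n] ⟨i, η⟩
          = ⟨i, (fun η => (T i).adj.app b ((T i).app b η))^[n] η⟩ := by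
        intro n
        induction n with
        | zero => rfl
        | succ n ih =>
          rw [Function.iterate_succ_apply', ih, Function.iterate_succ_apply']
          rfl
      rw [h, norm_sumElt]
      induction n with
      | zero => simp
      | succ n ih =>
        rw [Function.iterate_succ_apply', pow_succ, ← mul_assoc, mul_comm _ (3 * M * M)]
        refine ((T i).adj.norm_app_le b _).trans ?_
        refine (mul_le_mul ((T i).norm_adj_le) ((T i).norm_app_le b _) (norm_nonneg _)
          (by positivity)).trans ?_
        rw [← mul_assoc]
        have := hT i
        gcongr)
  refine ⟨T', fun i => Op.ext fun b η => ?_, fun i => Op.ext fun b η => ?_, h3⟩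
  · rw [Op.comp_app, Op.comp_app, sumIncl_app, sumIncl_app, h1]
  · rw [Op.comp_app, Op.comp_app, sumIncl_app, sumIncl_app, h2]

theorem exists_shift (E : HilbertModule B) : ∃ S : Op (sum fun _ : ℕ => E) (sum fun _ : ℕ => E),
    (∀ n, Op.comp S (sumIncl (fun _ => E) n) = sumIncl (fun _ => E) (n + 1)) ∧ ‖S‖ ≤ √(9 * 1) := by
  obtain ⟨S, h1, h2, h3⟩ := Op.exists_of_generators (sum fun _ : ℕ => E) (sum fun _ : ℕ => E)
    (fun b => sumElt (fun _ => E) (b := b)) (fun b => sumElt (fun _ => E) (b := b))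
    (dense_sumElt _) (dense_sumElt _) (fun b p => ⟨p.1 + 1, p.2⟩)
    (fun b p => match p with
      | ⟨0, _⟩ => ⟨0, 0⟩
      | ⟨n + 1, η⟩ => ⟨n, η⟩)
    (by
      rintro a b ⟨_ | m, ξ⟩ ⟨n, η⟩
      · simp only
        rw [inner_sumElt_ne (fun _ : ℕ => E) (by omega), sumElt_zero (fun _ : ℕ => E),
          zero_inner]
      · simp only
        by_cases h : m = n
        · subst h
          rw [inner_sumElt_self (fun _ : ℕ => E), inner_sumElt_self (fun _ : ℕ => E)]
        · rw [inner_sumElt_ne (fun _ : ℕ => E) (by omega), inner_sumElt_ne (fun _ : ℕ => E) h])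
    zero_le_one (by
      intro b p
      refine ⟨‖sumElt (fun _ => E) p‖, fun n => ?_⟩
      rw [one_pow, mul_one]
      refine le_of_eq (congrArg norm (congrArg _ ?_))
      induction n with
      | zero => rfl
      | succ n ih =>
        rw [Function.iterate_succ_apply', ih]
        rfl)
  refine ⟨S, fun n => Op.ext fun b η => ?_, h3⟩
  rw [Op.comp_app, sumIncl_app, sumIncl_app, h1]

end HilbertModule

/-! ## The category of bimodules and operators -/

section BiCategory

variable {𝕜 : Type} [RCLike 𝕜] (A : GradedCStarCategory.{v} 𝕜) (B : GradedCStarCategory.{u} 𝕜)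

/-- The category of bimodules and operators. -/
def biCategory : UnitalGradedStarCategory.{max v (u + 1), max u v} 𝕜 where
  Obj := Bimodule A B
  Hom E F := BiOp E F
  comp S T := BiOp.comp S T
  adj T := T.adj
  gr T := T.gr
  one E := BiOp.one E
  add_comp := BiOp.add_comp
  comp_add := BiOp.comp_add
  smul_comp := BiOp.smul_comp
  comp_smul := BiOp.comp_smul
  assoc := BiOp.comp_assoc
  adj_add := BiOp.adj_add
  adj_smul := BiOp.adj_smul
  adj_comp := BiOp.adj_comp
  adj_adj := BiOp.adj_adj
  gr_add := BiOp.gr_add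
  gr_smul := BiOp.gr_smul
  gr_gr := BiOp.gr_gr
  gr_comp := BiOp.gr_comp
  gr_adj := BiOp.gr_adj
  one_comp := BiOp.one_comp
  comp_one := BiOp.comp_one

end BiCategory

namespace Op

variable {𝕜 : Type} [RCLike 𝕜] {B : GradedCStarCategory.{u} 𝕜} {E F G : HilbertModule B}

theorem zero_comp (T : Op E F) : comp (0 : Op F G) T = 0 := ext fun b ξ => by simp

theorem comp_zero (T : Op F G) : comp T (0 : Op E F) = 0 := ext fun b ξ => by simp

theorem neg_comp (S : Op F G) (T : Op E F) : comp (-S) T = -comp S T := ext fun b ξ => by simp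

theorem comp_neg (S : Op F G) (T : Op E F) : comp S (-T) = -comp S T := ext fun b ξ => by simp

theorem adj_neg (T : Op E F) : (-T).adj = -T.adj :=
  adj_unique fun b ξ η => by rw [neg_app, neg_app, E.inner_neg, F.neg_inner, inner_adj_app]

end Op

namespace BiOp

variable {𝕜 : Type} [RCLike 𝕜] {A : GradedCStarCategory.{v} 𝕜} {B : GradedCStarCategory.{u} 𝕜}
  {E F G : Bimodule A B}

theorem norm_comp_le (S : BiOp F G) (T : BiOp E F) : ‖comp S T‖ ≤ ‖S‖ * ‖T‖ :=
  norm_le _ (by positivity) fun a => (Op.norm_comp_le _ _).trans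
    (mul_le_mul (S.norm_at_le a) (T.norm_at_le a) (norm_nonneg _) (norm_nonneg _))

theorem norm_gr_le (T : BiOp E F) : ‖T.gr‖ ≤ ‖T‖ :=
  norm_le _ (norm_nonneg _) fun a => (Op.norm_gr_le _).trans (T.norm_at_le a)

theorem zero_comp (T : BiOp E F) : comp (0 : BiOp F G) T = 0 := (biCategory A B).zero_comp T

theorem comp_zero (T : BiOp F G) : comp T (0 : BiOp E F) = 0 := (biCategory A B).comp_zero T

theorem neg_comp (S : BiOp F G) (T : BiOp E F) : comp (-S) T = -comp S T :=
  (biCategory A B).neg_comp S T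

theorem comp_neg (S : BiOp F G) (T : BiOp E F) : comp S (-T) = -comp S T :=
  (biCategory A B).comp_neg S T

theorem adj_zero : (0 : BiOp E F).adj = 0 := (biCategory A B).toGradedStarCategory.adj_zero

theorem adj_neg (T : BiOp E F) : (-T).adj = -T.adj := (biCategory A B).adj_neg T

theorem adj_one : (one E).adj = one E := ext fun _ => Op.adj_one

theorem gr_zero : (0 : BiOp E F).gr = 0 := (biCategory A B).gr_zero

theorem gr_neg (T : BiOp E F) : (-T).gr = -T.gr := (biCategory A B).gr_neg T

theorem sum_comp {ι : Type*} (s : Finset ι) (S : ι → BiOp F G) (T : BiOp E F) :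
    comp (∑ i ∈ s, S i) T = ∑ i ∈ s, comp (S i) T := (biCategory A B).sum_comp s S T

theorem comp_sum {ι : Type*} (s : Finset ι) (S : BiOp F G) (T : ι → BiOp E F) :
    comp S (∑ i ∈ s, T i) = ∑ i ∈ s, comp S (T i) := (biCategory A B).comp_sum s S T

theorem adj_sum {ι : Type*} (s : Finset ι) (T : ι → BiOp E F) :
    (∑ i ∈ s, T i).adj = ∑ i ∈ s, (T i).adj := (biCategory A B).adj_sum s T

/-- The operators of degree `0` which commute with the action of `A`. -/
structure IsIntertwiner (T : BiOp E F) : Prop where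
  degree : T.gr = T
  natural : ∀ (a a' : A.Obj) (x : A.Hom a a'),
    Op.comp (F.map x) (T.at' a) = Op.comp (T.at' a') (E.map x)

theorem IsIntertwiner.one (E : Bimodule A B) : (one E).IsIntertwiner :=
  ⟨gr_one, fun _ _ _ => by rw [one_at, one_at, Op.comp_one, Op.one_comp]⟩

theorem IsIntertwiner.zero : (0 : BiOp E F).IsIntertwiner :=
  ⟨gr_zero, fun _ _ _ => by rw [zero_at, zero_at, Op.comp_zero, Op.zero_comp]⟩

theorem IsIntertwiner.add {S T : BiOp E F} (hS : S.IsIntertwiner) (hT : T.IsIntertwiner) :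
    (S + T).IsIntertwiner :=
  ⟨by rw [gr_add, hS.degree, hT.degree], fun a a' x => by
    rw [add_at, add_at, Op.comp_add, Op.add_comp, hS.natural, hT.natural]⟩

theorem IsIntertwiner.sum {ι : Type*} (s : Finset ι) {T : ι → BiOp E F}
    (hT : ∀ i, (T i).IsIntertwiner) : (∑ i ∈ s, T i).IsIntertwiner :=
  Finset.sum_induction _ IsIntertwiner (fun _ _ => IsIntertwiner.add) IsIntertwiner.zero
    fun i _ => hT i

theorem IsIntertwiner.comp {S : BiOp F G} {T : BiOp E F} (hS : S.IsIntertwiner)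
    (hT : T.IsIntertwiner) : (comp S T).IsIntertwiner :=
  ⟨by rw [gr_comp, hS.degree, hT.degree], fun a a' x => by
    rw [comp_at, comp_at, ← Op.comp_assoc, hS.natural, Op.comp_assoc, hT.natural, Op.comp_assoc]⟩

theorem IsIntertwiner.adj {T : BiOp E F} (hT : T.IsIntertwiner) : T.adj.IsIntertwiner :=
  ⟨by rw [gr_adj, hT.degree], fun a a' x => by
    have h := congrArg Op.adj (hT.natural a' a (A.adj x))
    rw [Op.adj_comp, Op.adj_comp, ← F.map_adj, ← E.map_adj, A.adj_adj] at h
    exact h.symm⟩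

theorem even_of_gr {T : BiOp E F} (h : T.gr = T) : T.even = T := by
  unfold even; rw [h]; module

theorem odd_of_gr {T : BiOp E F} (h : T.gr = T) : T.odd = 0 := by
  unfold odd; rw [h]; module

theorem even_of_gr_neg {T : BiOp E F} (h : T.gr = -T) : T.even = 0 := by
  unfold even; rw [h]; module

theorem odd_of_gr_neg {T : BiOp E F} (h : T.gr = -T) : T.odd = T := by
  unfold odd; rw [h]; module

theorem isDual_of_gr_neg {T : BiOp E F} (h : T.gr = -T)
    (hc : ∀ (a a' : A.Obj) (x : A.Hom a a'),
      Op.comp (F.map x) (T.at' a) - Op.comp (T.at' a') (E.map (A.gr x))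
        ∈ Op.compact (E.obj a) (F.obj a')) : T.IsDual := by
  intro a a' x
  rw [even_of_gr_neg h, odd_of_gr_neg h]
  refine ⟨?_, hc a a' x⟩
  rw [zero_at, zero_at, Op.comp_zero, Op.zero_comp, sub_zero]
  exact zero_mem _

theorem IsIntertwiner.isDual {T : BiOp E F} (hT : T.IsIntertwiner) : T.IsDual := by
  intro a a' x
  rw [even_of_gr hT.degree, odd_of_gr hT.degree]
  constructor
  · rw [hT.natural, sub_self]
    exact zero_mem _
  · rw [zero_at, zero_at, Op.comp_zero, Op.zero_comp, sub_zero]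
    exact zero_mem _

end BiOp

/-! ## Frames -/

/-- The bimodule `E` is the direct sum of the finite family of bimodules `P k`, with the
inclusions `i k`. -/
structure IsFrame {𝕜 : Type} [RCLike 𝕜] {A : GradedCStarCategory.{v} 𝕜}
    {B : GradedCStarCategory.{u} 𝕜} {ι : Type} [Fintype ι] {P : ι → Bimodule A B}
    {E : Bimodule A B} (i : ∀ k, BiOp (P k) E) : Prop where
  intertwiner : ∀ k, (i k).IsIntertwiner
  isometry : ∀ k, BiOp.comp (i k).adj (i k) = BiOp.one (P k)
  orthogonal : ∀ k l, k ≠ l → BiOp.comp (i k).adj (i l) = 0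
  complete : ∑ k, BiOp.comp (i k) (i k).adj = BiOp.one E

/-! ## Direct sums of bimodules -/

namespace Bimodule

variable {𝕜 : Type} [RCLike 𝕜] {A : GradedCStarCategory.{v} 𝕜} {B : GradedCStarCategory.{u} 𝕜}
  {ι : Type} [DecidableEq ι] [Countable ι]

/-- A uniformly bounded family of bimodules. -/
def IsBounded (P : ι → Bimodule A B) : Prop :=
  ∀ (a a' : A.Obj) (x : A.Hom a a'), ∃ M, ∀ i, ‖(P i).map x‖ ≤ M

/-- The action on a direct sum. -/
def sumMap {P : ι → Bimodule A B} (hP : IsBounded P) {a a' : A.Obj} (x : A.Hom a a') :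
    Op (HilbertModule.sum fun i => (P i).obj a) (HilbertModule.sum fun i => (P i).obj a') :=
  (HilbertModule.exists_sumDiag (fun i => (P i).map x) (hP a a' x).choose_spec).choose

theorem sumMap_comp {P : ι → Bimodule A B} (hP : IsBounded P) {a a' : A.Obj} (x : A.Hom a a')
    (i : ι) : Op.comp (sumMap hP x) (HilbertModule.sumIncl _ i)
      = Op.comp (HilbertModule.sumIncl _ i) ((P i).map x) :=
  (HilbertModule.exists_sumDiag (fun i => (P i).map x) (hP a a' x).choose_spec).choose_spec.1 i

theorem sumMap_adj_comp {P : ι → Bimodule A B} (hP : IsBounded P) {a a' : A.Obj}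
    (x : A.Hom a a') (i : ι) : Op.comp (sumMap hP x).adj (HilbertModule.sumIncl _ i)
      = Op.comp (HilbertModule.sumIncl _ i) ((P i).map x).adj :=
  (HilbertModule.exists_sumDiag (fun i => (P i).map x) (hP a a' x).choose_spec).choose_spec.2.1 i

/-- The direct sum of a uniformly bounded countable family of bimodules. -/
def sum (P : ι → Bimodule A B) (hP : IsBounded P) : Bimodule A B where
  obj a := HilbertModule.sum fun i => (P i).obj a
  map x := sumMap hP x
  map_add x y := HilbertModule.sum_ext fun i => by
    rw [Op.add_comp, sumMap_comp, sumMap_comp, sumMap_comp, (P i).map_add, Op.comp_add]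
  map_smul r x := HilbertModule.sum_ext fun i => by
    rw [Op.smul_comp, sumMap_comp, sumMap_comp, (P i).map_smul, Op.comp_smul]
  map_comp x y := HilbertModule.sum_ext fun i => by
    rw [Op.comp_assoc, sumMap_comp, sumMap_comp, ← Op.comp_assoc, sumMap_comp, (P i).map_comp,
      Op.comp_assoc]
  map_adj x := HilbertModule.sum_ext fun i => by
    rw [sumMap_comp, sumMap_adj_comp, (P i).map_adj]
  map_gr x := HilbertModule.sum_ext fun i => by
    rw [sumMap_comp, (P i).map_gr]
    nth_rewrite 2 [← HilbertModule.gr_sumIncl]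
    rw [← Op.gr_comp, sumMap_comp, Op.gr_comp, HilbertModule.gr_sumIncl]

variable {P : ι → Bimodule A B} (hP : IsBounded P)

/-- The inclusion of a summand. -/
def sumIncl (i : ι) : BiOp (P i) (sum P hP) :=
  BiOp.mk' (fun a => HilbertModule.sumIncl (fun i => (P i).obj a) i) _
    fun _ => HilbertModule.norm_sumIncl_le _ i

theorem isIntertwiner_sumIncl (i : ι) : (sumIncl hP i).IsIntertwiner :=
  ⟨BiOp.ext fun a => HilbertModule.gr_sumIncl (fun i => (P i).obj a) i, fun _ _ x => sumMap_comp hP x i⟩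

theorem sumIncl_isometry (i : ι) :
    BiOp.comp (sumIncl hP i).adj (sumIncl hP i) = BiOp.one (P i) :=
  BiOp.ext fun a => HilbertModule.sumIncl_adj_comp_self (fun i => (P i).obj a) i

theorem sumIncl_orthogonal {i j : ι} (h : i ≠ j) :
    BiOp.comp (sumIncl hP i).adj (sumIncl hP j) = 0 :=
  BiOp.ext fun a => HilbertModule.sumIncl_adj_comp_ne (fun i => (P i).obj a) h

theorem sum_ext {F : Bimodule A B} {S T : BiOp (sum P hP) F}
    (h : ∀ i, BiOp.comp S (sumIncl hP i) = BiOp.comp T (sumIncl hP i)) : S = T :=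
  BiOp.ext fun a => HilbertModule.sum_ext fun i => congrArg (fun T => BiOp.at' T a) (h i)

theorem isBounded_of_finite [Finite ι] (P : ι → Bimodule A B) : IsBounded P := by
  intro a a' x
  have := Fintype.ofFinite ι
  exact ⟨∑ i, ‖(P i).map x‖, fun i =>
    Finset.single_le_sum (f := fun i => ‖(P i).map x‖) (fun _ _ => norm_nonneg _)
      (Finset.mem_univ i)⟩

theorem isBounded_const (E : Bimodule A B) : IsBounded fun _ : ι => E :=
  fun _ _ _ => ⟨_, fun _ => le_rfl⟩

theorem isFrame_sumIncl [Fintype ι] : IsFrame (sumIncl hP) where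
  intertwiner := isIntertwiner_sumIncl hP
  isometry := sumIncl_isometry hP
  orthogonal _ _ := sumIncl_orthogonal hP
  complete := sum_ext hP fun i => by
    rw [BiOp.sum_comp, Finset.sum_eq_single_of_mem i (Finset.mem_univ i), BiOp.comp_assoc,
      sumIncl_isometry, BiOp.comp_one, BiOp.one_comp]
    intro j _ hj
    rw [BiOp.comp_assoc, sumIncl_orthogonal hP hj, BiOp.comp_zero]

/-! ### Infinite multiples -/

/-- The direct sum of countably many copies of a bimodule. -/
def infinite (E : Bimodule A B) : Bimodule A B := sum (fun _ : ℕ => E) (isBounded_const E)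

/-- The inclusion of a copy. -/
def infIncl (E : Bimodule A B) (n : ℕ) : BiOp E E.infinite :=
  sumIncl (P := fun _ : ℕ => E) (isBounded_const E) n

theorem inf_ext {E F : Bimodule A B} {S T : BiOp E.infinite F}
    (h : ∀ n, BiOp.comp S (E.infIncl n) = BiOp.comp T (E.infIncl n)) : S = T :=
  sum_ext (P := fun _ : ℕ => E) _ h

theorem inf_ext_at {E : Bimodule A B} {a : A.Obj} {F : HilbertModule B}
    {S T : Op (E.infinite.obj a) F}
    (h : ∀ n, Op.comp S ((E.infIncl n).at' a) = Op.comp T ((E.infIncl n).at' a)) : S = T :=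
  HilbertModule.sum_ext (E := fun _ : ℕ => E.obj a) h

theorem isIntertwiner_infIncl (E : Bimodule A B) (n : ℕ) : (E.infIncl n).IsIntertwiner :=
  isIntertwiner_sumIncl _ n

theorem infIncl_isometry (E : Bimodule A B) (n : ℕ) :
    BiOp.comp (E.infIncl n).adj (E.infIncl n) = BiOp.one E :=
  sumIncl_isometry (P := fun _ : ℕ => E) _ n

theorem infIncl_orthogonal (E : Bimodule A B) {m n : ℕ} (h : m ≠ n) :
    BiOp.comp (E.infIncl m).adj (E.infIncl n) = 0 :=
  sumIncl_orthogonal (P := fun _ : ℕ => E) _ h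

theorem exists_infDiag {E : Bimodule A B} (T : BiOp E E) :
    ∃ T' : BiOp E.infinite E.infinite,
      (∀ n, BiOp.comp T' (E.infIncl n) = BiOp.comp (E.infIncl n) T) ∧
      ∀ n, BiOp.comp T'.adj (E.infIncl n) = BiOp.comp (E.infIncl n) T.adj := by
  choose T' h1 h2 h3 using fun a => HilbertModule.exists_sumDiag (E := fun _ : ℕ => E.obj a)
    (F := fun _ => E.obj a) (fun _ : ℕ => T.at' a) fun _ => T.norm_at_le a
  exact ⟨BiOp.mk' T' _ h3, fun n => BiOp.ext fun a => h1 a n, fun n => BiOp.ext fun a => h2 a n⟩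

theorem exists_infShift (E : Bimodule A B) : ∃ S : BiOp E.infinite E.infinite,
    (∀ n, BiOp.comp S (E.infIncl n) = E.infIncl (n + 1)) ∧ IsBimoduleSum (E.infIncl 0) S := by
  choose S hS hS' using fun a => HilbertModule.exists_shift (E.obj a)
  set T : BiOp E.infinite E.infinite := BiOp.mk' S _ hS' with hT
  have h1 : ∀ n, BiOp.comp T (E.infIncl n) = E.infIncl (n + 1) := fun n => BiOp.ext fun a => hS a n
  have hi : T.IsIntertwiner := by
    refine ⟨inf_ext fun n => ?_, fun a a' x => inf_ext_at fun n => ?_⟩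
    · nth_rewrite 1 [← (E.isIntertwiner_infIncl n).degree]
      rw [← BiOp.gr_comp, h1, (E.isIntertwiner_infIncl _).degree]
    · have e : ∀ a, Op.comp (T.at' a) ((E.infIncl n).at' a) = (E.infIncl (n + 1)).at' a :=
        fun a => hS a n
      rw [Op.comp_assoc, e, (E.isIntertwiner_infIncl _).natural, Op.comp_assoc,
        (E.isIntertwiner_infIncl n).natural, ← Op.comp_assoc, e]
  have h2 : ∀ n, BiOp.comp T.adj (E.infIncl (n + 1)) = E.infIncl n := by
    intro n
    have h : BiOp.comp (E.infIncl (n + 1)).adj T = (E.infIncl n).adj := inf_ext fun k => by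
      rw [BiOp.comp_assoc, h1]
      rcases eq_or_ne n k with rfl | h
      · rw [infIncl_isometry, infIncl_isometry]
      · rw [infIncl_orthogonal E h, infIncl_orthogonal E (by omega)]
    have h' := congrArg BiOp.adj h
    rwa [BiOp.adj_comp, BiOp.adj_adj, BiOp.adj_adj] at h'
  have h3 : BiOp.comp T.adj T = BiOp.one _ := inf_ext fun n => by
    rw [BiOp.comp_assoc, h1, h2, BiOp.one_comp]
  have h4 : BiOp.comp (E.infIncl 0).adj T = 0 := inf_ext fun n => by
    rw [BiOp.comp_assoc, h1, infIncl_orthogonal E (by omega), BiOp.zero_comp]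
  have h5 : BiOp.comp T.adj (E.infIncl 0) = 0 := by
    have := congrArg BiOp.adj h4
    rwa [BiOp.adj_comp, BiOp.adj_adj, BiOp.adj_zero] at this
  refine ⟨T, h1, (E.isIntertwiner_infIncl 0).degree, hi.degree,
    (E.isIntertwiner_infIncl 0).natural, hi.natural, infIncl_isometry E 0, h3, inf_ext fun n => ?_⟩
  rw [BiOp.add_comp, BiOp.comp_assoc, BiOp.comp_assoc, BiOp.one_comp]
  rcases n with _ | n
  · rw [infIncl_isometry, BiOp.comp_one, h5, BiOp.comp_zero, add_zero]
  · rw [infIncl_orthogonal E (by omega), BiOp.comp_zero, zero_add, h2, h1]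

end Bimodule

/-! ## The opposite grading -/

/-- The Hilbert module with the opposite grading. -/
def HilbertModule.op {𝕜 : Type} [RCLike 𝕜] {B : GradedCStarCategory.{u} 𝕜}
    (E : HilbertModule B) : HilbertModule B where
  X := E.X
  act := E.act
  inner := E.inner
  gr η := -E.gr η
  add_act := E.add_act
  act_add := E.act_add
  smul_act := E.smul_act
  act_smul := E.act_smul
  act_act := E.act_act
  inner_add := E.inner_add
  inner_smul := E.inner_smul
  inner_act := E.inner_act
  adj_inner := E.adj_inner
  inner_self_positive := E.inner_self_positive
  norm_sq := E.norm_sq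
  gr_add η ξ := by rw [E.gr_add, neg_add]
  gr_smul r η := by rw [E.gr_smul, smul_neg]
  gr_gr η := by
    rw [← neg_one_smul 𝕜 (E.gr η), E.gr_smul, E.gr_gr, neg_one_smul, neg_neg]
  gr_act η x := by
    rw [E.gr_act, ← neg_one_smul 𝕜 (E.gr η), E.smul_act, neg_one_smul]
  inner_gr η ξ := by rw [E.inner_neg, E.neg_inner, neg_neg, E.inner_gr]
  countably_generated := E.countably_generated

namespace Op

variable {𝕜 : Type} [RCLike 𝕜] {B : GradedCStarCategory.{u} 𝕜}

/-- The identity as an operator of degree `1` to the module with the opposite grading. -/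
def toOp (E : HilbertModule B) : Op E E.op :=
  mk' (F := E.op) (fun _ ξ => ξ) (fun _ ξ => ξ) (fun _ _ _ _ => rfl) 1 zero_le_one
    fun _ ξ => (one_mul ‖ξ‖).ge

theorem toOp_adj_app (E : HilbertModule B) {b : B.Obj} (ξ : E.op.X b) :
    (toOp E).adj.app b ξ = ξ :=
  E.ext_inner fun ζ => by rw [inner_adj_app]; rfl

theorem toOp_adj_comp (E : HilbertModule B) : comp (toOp E).adj (toOp E) = one E :=
  ext fun b ξ => by rw [comp_app, toOp_adj_app]; rfl

theorem toOp_comp_adj (E : HilbertModule B) : comp (toOp E) (toOp E).adj = one E.op :=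
  ext fun b ξ => by rw [comp_app, toOp_adj_app]; rfl

theorem gr_toOp (E : HilbertModule B) : (toOp E).gr = -toOp E := ext fun b ξ => by
  rw [gr_app]
  change -E.gr (E.gr ξ) = -ξ
  rw [E.gr_gr]

end Op

namespace Bimodule

variable {𝕜 : Type} [RCLike 𝕜] {A : GradedCStarCategory.{v} 𝕜} {B : GradedCStarCategory.{u} 𝕜}

/-- The bimodule with the opposite grading. -/
def op (E : Bimodule A B) : Bimodule A B where
  obj a := (E.obj a).op
  map {a a'} x := Op.comp (Op.toOp (E.obj a')) (Op.comp (E.map (A.gr x)) (Op.toOp (E.obj a)).adj)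
  map_add x y := by rw [A.gr_add, E.map_add, Op.add_comp, Op.comp_add]
  map_smul r x := by rw [A.gr_smul, E.map_smul, Op.smul_comp, Op.comp_smul]
  map_comp {a a' a''} x y := by
    rw [A.gr_comp, E.map_comp, Op.comp_assoc, Op.comp_assoc, Op.comp_assoc,
      ← Op.comp_assoc (Op.toOp (E.obj a')).adj, Op.toOp_adj_comp, Op.one_comp]
  map_adj x := by
    rw [A.gr_adj, E.map_adj, Op.adj_comp, Op.adj_comp, Op.adj_adj, Op.comp_assoc]
  map_gr x := by
    rw [Op.gr_comp, Op.gr_comp, Op.gr_toOp, Op.gr_adj, Op.gr_toOp, Op.adj_neg, E.map_gr,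
      Op.comp_neg, Op.comp_neg, Op.neg_comp, neg_neg]

/-- The identity as an operator of degree `1` to the bimodule with the opposite grading. -/
def toOp (E : Bimodule A B) : BiOp E E.op :=
  BiOp.mk' (F := E.op) (fun a => Op.toOp (E.obj a)) 1
    fun _ => Op.norm_le _ zero_le_one fun _ ξ => (one_mul ‖ξ‖).ge

theorem toOp_adj_comp (E : Bimodule A B) : BiOp.comp E.toOp.adj E.toOp = BiOp.one E :=
  BiOp.ext fun _ => Op.toOp_adj_comp _

theorem toOp_comp_adj (E : Bimodule A B) : BiOp.comp E.toOp E.toOp.adj = BiOp.one E.op :=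
  BiOp.ext fun _ => Op.toOp_comp_adj _

theorem gr_toOp (E : Bimodule A B) : E.toOp.gr = -E.toOp := BiOp.ext fun _ => Op.gr_toOp _

theorem map_comp_toOp (E : Bimodule A B) {a a' : A.Obj} (x : A.Hom a a') :
    Op.comp (E.op.map x) (E.toOp.at' a) = Op.comp (E.toOp.at' a') (E.map (A.gr x)) := by
  change Op.comp (Op.comp (Op.toOp (E.obj a')) (Op.comp (E.map (A.gr x)) (Op.toOp (E.obj a)).adj))
    (Op.toOp (E.obj a)) = _
  rw [Op.comp_assoc, Op.comp_assoc, Op.toOp_adj_comp, Op.comp_one]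
  rfl

end Bimodule

/-! ## Direct sums of two bimodules -/

section IsBimoduleSum

variable {𝕜 : Type} [RCLike 𝕜] {A : GradedCStarCategory.{v} 𝕜} {B : GradedCStarCategory.{u} 𝕜}
  {E₁ E₂ E F : Bimodule A B} {i₁ : BiOp E₁ E} {i₂ : BiOp E₂ E}

theorem IsBimoduleSum.symm (h : IsBimoduleSum i₁ i₂) : IsBimoduleSum i₂ i₁ :=
  ⟨h.2, h.1, h.4, h.3, h.6, h.5, by rw [add_comm]; exact h.7⟩

theorem IsBimoduleSum.intertwiner_left (h : IsBimoduleSum i₁ i₂) : i₁.IsIntertwiner :=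
  ⟨h.degree_left, h.natural_left⟩

theorem IsBimoduleSum.intertwiner_right (h : IsBimoduleSum i₁ i₂) : i₂.IsIntertwiner :=
  ⟨h.degree_right, h.natural_right⟩

theorem IsBimoduleSum.of_intertwiner (h1 : i₁.IsIntertwiner) (h2 : i₂.IsIntertwiner)
    (h3 : BiOp.comp i₁.adj i₁ = BiOp.one E₁) (h4 : BiOp.comp i₂.adj i₂ = BiOp.one E₂)
    (h5 : BiOp.comp i₁ i₁.adj + BiOp.comp i₂ i₂.adj = BiOp.one E) : IsBimoduleSum i₁ i₂ :=
  ⟨h1.1, h2.1, h1.2, h2.2, h3, h4, h5⟩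

theorem IsBimoduleSum.orthogonal (h : IsBimoduleSum i₁ i₂) : BiOp.comp i₂.adj i₁ = 0 := by
  have h1 := congrArg (fun T => BiOp.comp (BiOp.comp i₂.adj T) i₁) h.complementary
  simp only [BiOp.comp_add, BiOp.add_comp, BiOp.comp_one, BiOp.comp_assoc, h.isometry_left] at h1
  rw [← BiOp.comp_assoc i₂.adj i₂, h.isometry_right, BiOp.one_comp] at h1
  simpa using h1

theorem IsBimoduleSum.orthogonal' (h : IsBimoduleSum i₁ i₂) : BiOp.comp i₁.adj i₂ = 0 :=
  h.symm.orthogonal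

theorem IsBimoduleSum.eq_add (h : IsBimoduleSum i₁ i₂) (T : BiOp E F) :
    T = BiOp.comp (BiOp.comp T i₁) i₁.adj + BiOp.comp (BiOp.comp T i₂) i₂.adj := by
  rw [BiOp.comp_assoc, BiOp.comp_assoc, ← BiOp.comp_add, h.complementary, BiOp.comp_one]

theorem IsBimoduleSum.ext (h : IsBimoduleSum i₁ i₂) {S T : BiOp E F}
    (h1 : BiOp.comp S i₁ = BiOp.comp T i₁) (h2 : BiOp.comp S i₂ = BiOp.comp T i₂) : S = T := by
  rw [h.eq_add S, h.eq_add T, h1, h2]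

/-- The operator `T₁ ⊕ T₂` on a direct sum. -/
def BiOp.diag (i₁ : BiOp E₁ E) (i₂ : BiOp E₂ E) (T₁ : BiOp E₁ E₁) (T₂ : BiOp E₂ E₂) : BiOp E E :=
  BiOp.comp i₁ (BiOp.comp T₁ i₁.adj) + BiOp.comp i₂ (BiOp.comp T₂ i₂.adj)

theorem IsBimoduleSum.diag_left (h : IsBimoduleSum i₁ i₂) (T₁ : BiOp E₁ E₁) (T₂ : BiOp E₂ E₂) :
    BiOp.comp (BiOp.diag i₁ i₂ T₁ T₂) i₁ = BiOp.comp i₁ T₁ := by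
  rw [BiOp.diag, BiOp.add_comp, BiOp.comp_assoc, BiOp.comp_assoc, h.isometry_left, BiOp.comp_assoc,
    BiOp.comp_assoc, h.orthogonal, BiOp.comp_zero, BiOp.comp_zero, BiOp.comp_one, add_zero]

theorem IsBimoduleSum.diag_right (h : IsBimoduleSum i₁ i₂) (T₁ : BiOp E₁ E₁) (T₂ : BiOp E₂ E₂) :
    BiOp.comp (BiOp.diag i₁ i₂ T₁ T₂) i₂ = BiOp.comp i₂ T₂ := by
  have := h.symm.diag_left T₂ T₁
  rwa [BiOp.diag, add_comm] at this

theorem IsBimoduleSum.eq_diag (h : IsBimoduleSum i₁ i₂) {T : BiOp E E} {T₁ : BiOp E₁ E₁}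
    {T₂ : BiOp E₂ E₂} (h1 : BiOp.comp T i₁ = BiOp.comp i₁ T₁)
    (h2 : BiOp.comp T i₂ = BiOp.comp i₂ T₂) : T = BiOp.diag i₁ i₂ T₁ T₂ :=
  h.ext (h1.trans (h.diag_left _ _).symm) (h2.trans (h.diag_right _ _).symm)

theorem IsBimoduleSum.diag_sub_adj (T₁ : BiOp E₁ E₁) (T₂ : BiOp E₂ E₂) :
    BiOp.diag i₁ i₂ T₁ T₂ - (BiOp.diag i₁ i₂ T₁ T₂).adj
      = BiOp.diag i₁ i₂ (T₁ - T₁.adj) (T₂ - T₂.adj) := by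
  simp only [BiOp.diag, BiOp.adj_add, BiOp.adj_comp, BiOp.adj_adj, BiOp.sub_comp, BiOp.comp_sub,
    BiOp.comp_assoc]
  abel

theorem IsBimoduleSum.diag_sq_sub_one (h : IsBimoduleSum i₁ i₂) (T₁ : BiOp E₁ E₁)
    (T₂ : BiOp E₂ E₂) : BiOp.comp (BiOp.diag i₁ i₂ T₁ T₂) (BiOp.diag i₁ i₂ T₁ T₂) - BiOp.one E
      = BiOp.diag i₁ i₂ (BiOp.comp T₁ T₁ - BiOp.one E₁) (BiOp.comp T₂ T₂ - BiOp.one E₂) := by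
  refine h.eq_diag ?_ ?_
  · rw [BiOp.sub_comp, BiOp.comp_assoc, h.diag_left, ← BiOp.comp_assoc, h.diag_left,
      BiOp.comp_sub, BiOp.comp_assoc, BiOp.one_comp, BiOp.comp_one]
  · rw [BiOp.sub_comp, BiOp.comp_assoc, h.diag_right, ← BiOp.comp_assoc, h.diag_right,
      BiOp.comp_sub, BiOp.comp_assoc, BiOp.one_comp, BiOp.comp_one]

theorem exists_isBimoduleSum (E₁ E₂ : Bimodule A B) :
    ∃ (E : Bimodule A B) (i₁ : BiOp E₁ E) (i₂ : BiOp E₂ E), IsBimoduleSum i₁ i₂ := by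
  let P : Bool → Bimodule A B := fun b => match b with
    | true => E₁
    | false => E₂
  have hP := Bimodule.isBounded_of_finite P
  have h := Bimodule.isFrame_sumIncl hP
  refine ⟨Bimodule.sum P hP, Bimodule.sumIncl hP true, Bimodule.sumIncl hP false,
    IsBimoduleSum.of_intertwiner (h.intertwiner true) (h.intertwiner false) (h.isometry true)
      (h.isometry false) ?_⟩
  have h1 := h.complete
  rwa [Fintype.sum_bool] at h1

variable (A B) in
/-- The zero bimodule. -/
def Bimodule.zero : Bimodule A B :=
  Bimodule.sum (fun i : Empty => i.elim) (Bimodule.isBounded_of_finite _)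

theorem BiOp.eq_zero_of_left (T : BiOp (Bimodule.zero A B) E) : T = 0 :=
  Bimodule.sum_ext (P := fun i : Empty => i.elim) (Bimodule.isBounded_of_finite _)
    fun i => i.elim

theorem isBimoduleSum_zero (E : Bimodule A B) :
    IsBimoduleSum (BiOp.one E) (0 : BiOp (Bimodule.zero A B) E) :=
  IsBimoduleSum.of_intertwiner (BiOp.IsIntertwiner.one E) BiOp.IsIntertwiner.zero
    (by rw [BiOp.comp_one, BiOp.adj_one])
    (by rw [BiOp.comp_zero]; exact (BiOp.eq_zero_of_left _).symm)
    (by rw [BiOp.zero_comp, add_zero, BiOp.one_comp, BiOp.adj_one])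

end IsBimoduleSum

/-! ## Cycles modulo an ideal -/

/-- An ideal of operators between Hilbert modules. -/
structure OpIdeal {𝕜 : Type} [RCLike 𝕜] (B : GradedCStarCategory.{u} 𝕜) : Type (u + 1) where
  mem : ∀ E F : HilbertModule B, Submodule 𝕜 (Op E F)
  comp_mem : ∀ {E F G : HilbertModule B} (S : Op F G) {T : Op E F}, T ∈ mem E F →
    Op.comp S T ∈ mem E G
  mem_comp : ∀ {E F G : HilbertModule B} {S : Op F G} (T : Op E F), S ∈ mem F G →
    Op.comp S T ∈ mem E G

section Cycles

variable {𝕜 : Type} [RCLike 𝕜] {A : GradedCStarCategory.{v} 𝕜} {B : GradedCStarCategory.{u} 𝕜}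

variable (B) in
/-- The ideal of compact operators. -/
def compactIdeal : OpIdeal B where
  mem := Op.compact
  comp_mem S _ hT := Op.comp_compact S hT
  mem_comp T hS := Op.compact_comp hS T

variable (B) in
/-- The zero ideal. -/
def zeroIdeal : OpIdeal B where
  mem _ _ := ⊥
  comp_mem S T hT := by
    rw [Submodule.mem_bot] at hT ⊢
    rw [hT, Op.comp_zero]
  mem_comp T hS := by
    rw [Submodule.mem_bot] at hS ⊢
    rw [hS, Op.zero_comp]

variable {E E₁ E₂ F G : Bimodule A B}

/-- All operators `x T` belong to the ideal. -/
def BiOp.LeftMem (I : OpIdeal B) (T : BiOp E F) : Prop :=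
  ∀ (a a' : A.Obj) (x : A.Hom a a'),
    Op.comp (F.map x) (T.at' a) ∈ I.mem (E.obj a) (F.obj a')

/-- The graded commutators of `T`, as an operator of degree `1`, belong to the ideal. -/
def BiOp.CommMem (I : OpIdeal B) (T : BiOp E F) : Prop :=
  ∀ (a a' : A.Obj) (x : A.Hom a a'),
    Op.comp (F.map x) (T.at' a) - Op.comp (T.at' a') (E.map (A.gr x))
      ∈ I.mem (E.obj a) (F.obj a')

namespace BiOp

variable {I : OpIdeal B}

theorem LeftMem.add {S T : BiOp E F} (hS : S.LeftMem I) (hT : T.LeftMem I) :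
    (S + T).LeftMem I := fun a a' x => by
  rw [add_at, Op.comp_add]
  exact add_mem (hS a a' x) (hT a a' x)

theorem LeftMem.smul {T : BiOp E F} (r : 𝕜) (hT : T.LeftMem I) : (r • T).LeftMem I :=
  fun a a' x => by
  rw [smul_at, Op.comp_smul]
  exact Submodule.smul_mem _ _ (hT a a' x)

theorem LeftMem.zero : (0 : BiOp E F).LeftMem I := fun a a' x => by
  rw [zero_at, Op.comp_zero]
  exact zero_mem _

theorem LeftMem.neg {T : BiOp E F} (hT : T.LeftMem I) : (-T).LeftMem I := fun a a' x => by
  rw [neg_at, Op.comp_neg]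
  exact neg_mem (hT a a' x)

theorem LeftMem.comp_right {S : BiOp F G} (hS : S.LeftMem I) (T : BiOp E F) :
    (comp S T).LeftMem I := fun a a' x => by
  rw [comp_at, ← Op.comp_assoc]
  exact I.mem_comp _ (hS a a' x)

theorem LeftMem.comp_left {S : BiOp F G} (hS : S.IsIntertwiner) {T : BiOp E F}
    (hT : T.LeftMem I) : (comp S T).LeftMem I := fun a a' x => by
  rw [comp_at, ← Op.comp_assoc, hS.natural, Op.comp_assoc]
  exact I.comp_mem _ (hT a a' x)

theorem CommMem.add {S T : BiOp E F} (hS : S.CommMem I) (hT : T.CommMem I) :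
    (S + T).CommMem I := fun a a' x => by
  rw [add_at, add_at, Op.comp_add, Op.add_comp, add_sub_add_comm]
  exact add_mem (hS a a' x) (hT a a' x)

theorem CommMem.smul {T : BiOp E F} (r : 𝕜) (hT : T.CommMem I) : (r • T).CommMem I :=
  fun a a' x => by
  rw [smul_at, smul_at, Op.comp_smul, Op.smul_comp, ← smul_sub]
  exact Submodule.smul_mem _ _ (hT a a' x)

theorem CommMem.neg {T : BiOp E F} (hT : T.CommMem I) : (-T).CommMem I := by
  rw [← neg_one_smul 𝕜 T]
  exact hT.smul _

theorem CommMem.comp_left {S : BiOp F G} (hS : S.IsIntertwiner) {T : BiOp E F}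
    (hT : T.CommMem I) : (comp S T).CommMem I := fun a a' x => by
  rw [comp_at, comp_at, ← Op.comp_assoc, hS.natural, Op.comp_assoc, Op.comp_assoc, ← Op.comp_sub]
  exact I.comp_mem _ (hT a a' x)

theorem CommMem.comp_right {S : BiOp F G} (hS : S.CommMem I) {T : BiOp E F}
    (hT : T.IsIntertwiner) : (comp S T).CommMem I := fun a a' x => by
  rw [comp_at, comp_at, ← Op.comp_assoc, Op.comp_assoc (S.at' a'), ← hT.natural,
    ← Op.comp_assoc, ← Op.sub_comp]
  exact I.mem_comp _ (hS a a' x)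

end BiOp

/-- The conditions on a Kasparov cycle, modulo an ideal. -/
structure IsCycleMod (I : OpIdeal B) (E : Bimodule A B) (F : BiOp E E) : Prop where
  degree : F.gr = -F
  adj : (F - F.adj).LeftMem I
  sq : (BiOp.comp F F - BiOp.one E).LeftMem I
  comm : F.CommMem I

theorem isCycle_iff {F : BiOp E E} : IsCycle E F ↔ IsCycleMod (compactIdeal B) E F :=
  ⟨fun h => ⟨h.1, h.2, h.3, h.4⟩, fun h => ⟨h.1, h.2, h.3, h.4⟩⟩

theorem KasparovCycle.isDegenerate_iff {c : KasparovCycle A B} :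
    c.IsDegenerate ↔ IsCycleMod (zeroIdeal B) c.E c.F :=
  ⟨fun h => ⟨c.isCycle.degree, fun a a' x => (h a a' x).1, fun a a' x => (h a a' x).2.1,
    fun a a' x => (h a a' x).2.2⟩, fun h a a' x => ⟨h.2 a a' x, h.3 a a' x, h.4 a a' x⟩⟩

theorem IsCycleMod.isCycle {F : BiOp E E} (h : IsCycleMod (zeroIdeal B) E F) : IsCycle E F := by
  have key : ∀ {G H : HilbertModule B} {T : Op G H}, T ∈ (zeroIdeal B).mem G H →
      T ∈ Op.compact G H := by
    intro G H T hT
    rw [(Submodule.mem_bot 𝕜).1 hT]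
    exact zero_mem _
  exact ⟨h.1, fun a a' x => key (h.2 a a' x), fun a a' x => key (h.3 a a' x),
    fun a a' x => key (h.4 a a' x)⟩

variable {I : OpIdeal B} {i₁ : BiOp E₁ E} {i₂ : BiOp E₂ E}

theorem IsBimoduleSum.leftMem_diag (h : IsBimoduleSum i₁ i₂) {T₁ : BiOp E₁ E₁} {T₂ : BiOp E₂ E₂}
    (h1 : T₁.LeftMem I) (h2 : T₂.LeftMem I) : (BiOp.diag i₁ i₂ T₁ T₂).LeftMem I :=
  ((h1.comp_right _).comp_left h.intertwiner_left).add
    ((h2.comp_right _).comp_left h.intertwiner_right)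

theorem IsCycleMod.diag (h : IsBimoduleSum i₁ i₂) {F₁ : BiOp E₁ E₁} {F₂ : BiOp E₂ E₂}
    (h1 : IsCycleMod I E₁ F₁) (h2 : IsCycleMod I E₂ F₂) :
    IsCycleMod I E (BiOp.diag i₁ i₂ F₁ F₂) where
  degree := by
    simp only [BiOp.diag, BiOp.gr_add, BiOp.gr_comp, BiOp.gr_adj, h.degree_left, h.degree_right,
      h1.degree, h2.degree, BiOp.neg_comp, BiOp.comp_neg, neg_add]
  adj := by
    rw [IsBimoduleSum.diag_sub_adj]
    exact h.leftMem_diag h1.adj h2.adj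
  sq := by
    rw [h.diag_sq_sub_one]
    exact h.leftMem_diag h1.sq h2.sq
  comm := ((h1.comm.comp_right h.intertwiner_left.adj).comp_left h.intertwiner_left).add
    ((h2.comm.comp_right h.intertwiner_right.adj).comp_left h.intertwiner_right)

theorem IsCycle.diag (h : IsBimoduleSum i₁ i₂) {F₁ : BiOp E₁ E₁} {F₂ : BiOp E₂ E₂}
    (h1 : IsCycle E₁ F₁) (h2 : IsCycle E₂ F₂) : IsCycle E (BiOp.diag i₁ i₂ F₁ F₂) :=
  isCycle_iff.2 (IsCycleMod.diag h (isCycle_iff.1 h1) (isCycle_iff.1 h2))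

namespace KasparovCycle

theorem IsSum.mk_diag {c₁ c₂ : KasparovCycle A B} {E : Bimodule A B} {i₁ : BiOp c₁.E E}
    {i₂ : BiOp c₂.E E} (h : IsBimoduleSum i₁ i₂) :
    c₁.IsSum c₂ ⟨E, BiOp.diag i₁ i₂ c₁.F c₂.F, c₁.isCycle.diag h c₂.isCycle⟩ :=
  ⟨i₁, i₂, h, h.diag_left _ _, h.diag_right _ _⟩

theorem exists_isSum (c₁ c₂ : KasparovCycle A B) : ∃ c, c₁.IsSum c₂ c := by
  obtain ⟨E, i₁, i₂, h⟩ := exists_isBimoduleSum c₁.E c₂.E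
  exact ⟨_, IsSum.mk_diag h⟩

theorem IsSum.symm {c₁ c₂ c : KasparovCycle A B} (h : c₁.IsSum c₂ c) : c₂.IsSum c₁ c := by
  obtain ⟨i₁, i₂, h, h1, h2⟩ := h
  exact ⟨i₂, i₁, h.symm, h2, h1⟩

theorem IsSum.assoc {c₁ c₂ c₃ c₁₂ c : KasparovCycle A B} (h : c₁.IsSum c₂ c₁₂)
    (h' : c₁₂.IsSum c₃ c) {c₂₃ : KasparovCycle A B} (h'' : c₂.IsSum c₃ c₂₃) :
    c₁.IsSum c₂₃ c := by
  obtain ⟨i₁, i₂, hi, hi1, hi2⟩ := h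
  obtain ⟨j₁, j₂, hj, hj1, hj2⟩ := h'
  obtain ⟨k₂, k₃, hk, hk1, hk2⟩ := h''
  have e : ∀ {X Y Z W V : Bimodule A B} {R : BiOp Y X} {S : BiOp X Y} (_ : BiOp.comp R S = BiOp.one X)
      (T : BiOp W X), BiOp.comp R (BiOp.comp S T) = T := fun h T => by
    rw [← BiOp.comp_assoc, h, BiOp.one_comp]
  have e0 : ∀ {X Y Z W : Bimodule A B} {R : BiOp Y Z} {S : BiOp X Y} (_ : BiOp.comp R S = 0)
      (T : BiOp W X), BiOp.comp R (BiOp.comp S T) = 0 := fun h T => by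
    rw [← BiOp.comp_assoc, h, BiOp.zero_comp]
  set m : BiOp c₂₃.E c.E := BiOp.comp j₁ (BiOp.comp i₂ k₂.adj) + BiOp.comp j₂ k₃.adj with hm
  have hm2 : BiOp.comp m k₂ = BiOp.comp j₁ i₂ := by
    rw [hm, BiOp.add_comp, BiOp.comp_assoc, BiOp.comp_assoc, BiOp.comp_assoc, hk.isometry_left,
      hk.orthogonal, BiOp.comp_zero, BiOp.comp_one, add_zero]
  have hm3 : BiOp.comp m k₃ = j₂ := by
    rw [hm, BiOp.add_comp, BiOp.comp_assoc, BiOp.comp_assoc, BiOp.comp_assoc, hk.isometry_right,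
      hk.orthogonal', BiOp.comp_zero, BiOp.comp_zero, BiOp.comp_one, zero_add]
  have hma : m.adj = BiOp.comp k₂ (BiOp.comp i₂.adj j₁.adj) + BiOp.comp k₃ j₂.adj := by
    rw [hm, BiOp.adj_add, BiOp.adj_comp, BiOp.adj_comp, BiOp.adj_comp, BiOp.adj_adj,
      BiOp.adj_adj, BiOp.comp_assoc]
  refine ⟨BiOp.comp j₁ i₁, m, IsBimoduleSum.of_intertwiner
    (hj.intertwiner_left.comp hi.intertwiner_left)
    ((hj.intertwiner_left.comp (hi.intertwiner_right.comp hk.intertwiner_left.adj)).add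
      (hj.intertwiner_right.comp hk.intertwiner_right.adj)) ?_ ?_ ?_, ?_, ?_⟩
  · rw [BiOp.adj_comp, BiOp.comp_assoc, ← BiOp.comp_assoc j₁.adj, hj.isometry_left, BiOp.one_comp,
      hi.isometry_left]
  · refine hk.ext ?_ ?_
    · rw [BiOp.comp_assoc, hm2, hma, BiOp.add_comp, BiOp.comp_assoc, BiOp.comp_assoc,
        ← BiOp.comp_assoc j₁.adj, hj.isometry_left, BiOp.one_comp, hi.isometry_right,
        BiOp.comp_one, BiOp.comp_assoc, ← BiOp.comp_assoc j₂.adj, hj.orthogonal, BiOp.zero_comp,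
        BiOp.comp_zero, add_zero, BiOp.one_comp]
    · rw [BiOp.comp_assoc, hm3, hma, BiOp.add_comp, BiOp.comp_assoc, BiOp.comp_assoc,
        hj.orthogonal', BiOp.comp_zero, BiOp.comp_zero, BiOp.comp_assoc, hj.isometry_right,
        BiOp.comp_one, zero_add, BiOp.one_comp]
  · have e1 : BiOp.comp m m.adj = BiOp.comp j₁ (BiOp.comp (BiOp.comp i₂ i₂.adj) j₁.adj)
        + BiOp.comp j₂ j₂.adj := by
      rw [hma, BiOp.comp_add, ← BiOp.comp_assoc m, hm2, ← BiOp.comp_assoc m, hm3]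
      simp only [BiOp.comp_assoc]
    have e2 : BiOp.comp i₂ i₂.adj = BiOp.one _ - BiOp.comp i₁ i₁.adj := by
      rw [← hi.complementary]; abel
    rw [e1, e2, BiOp.sub_comp, BiOp.one_comp, BiOp.comp_sub, BiOp.adj_comp, ← hj.complementary]
    simp only [BiOp.comp_assoc]
    abel
  · rw [← BiOp.comp_assoc, hj1, BiOp.comp_assoc, hi1, BiOp.comp_assoc]
  · refine hk.ext ?_ ?_
    · rw [BiOp.comp_assoc, hm2, BiOp.comp_assoc, hk1, ← BiOp.comp_assoc m, hm2,
        ← BiOp.comp_assoc, hj1, BiOp.comp_assoc, hi2, BiOp.comp_assoc]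
    · rw [BiOp.comp_assoc, hm3, BiOp.comp_assoc, hk2, ← BiOp.comp_assoc m, hm3, hj2]

theorem IsSum.assoc' {c₁ c₂ c₃ c₂₃ c : KasparovCycle A B} (h : c₂.IsSum c₃ c₂₃)
    (h' : c₁.IsSum c₂₃ c) {c₁₂ : KasparovCycle A B} (h'' : c₁.IsSum c₂ c₁₂) : c₁₂.IsSum c₃ c :=
  (h.symm.assoc h'.symm h''.symm).symm

variable (A B) in
/-- The zero cycle. -/
def zero : KasparovCycle A B :=
  ⟨Bimodule.zero A B, 0, IsCycleMod.isCycle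
    ⟨by rw [BiOp.gr_zero, neg_zero], by rw [BiOp.adj_zero, sub_zero]; exact BiOp.LeftMem.zero,
      by rw [BiOp.eq_zero_of_left (BiOp.comp _ _ - _)]; exact BiOp.LeftMem.zero,
      fun a a' x => by
        rw [BiOp.zero_at, BiOp.zero_at, Op.comp_zero, Op.zero_comp, sub_zero]; exact zero_mem _⟩⟩

theorem isDegenerate_zero : (zero A B).IsDegenerate := isDegenerate_iff.2
  ⟨by rw [zero, BiOp.gr_zero, neg_zero],
    by rw [zero, BiOp.adj_zero, sub_zero]; exact BiOp.LeftMem.zero,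
    by
      have h : BiOp.comp (zero A B).F (zero A B).F - BiOp.one (zero A B).E = 0 :=
        BiOp.eq_zero_of_left _
      rw [h]
      exact BiOp.LeftMem.zero,
    fun a a' x => by
      rw [zero, BiOp.zero_at, BiOp.zero_at, Op.comp_zero, Op.zero_comp, sub_zero]
      exact zero_mem _⟩

theorem isSum_zero (c : KasparovCycle A B) : c.IsSum (zero A B) c :=
  ⟨BiOp.one _, 0, isBimoduleSum_zero c.E, by rw [BiOp.comp_one, BiOp.one_comp],
    by rw [BiOp.comp_zero, BiOp.zero_comp]⟩

theorem IsSum.isDegenerate {c₁ c₂ c : KasparovCycle A B} (h : c₁.IsSum c₂ c)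
    (h1 : c₁.IsDegenerate) (h2 : c₂.IsDegenerate) : c.IsDegenerate := by
  obtain ⟨i₁, i₂, hi, hi1, hi2⟩ := h
  rw [isDegenerate_iff] at *
  rw [hi.eq_diag hi1 hi2]
  exact h1.diag hi h2

theorem IsSum.of_unitary {c c' : KasparovCycle A B} {W : BiOp c.E c'.E} (hW : W.IsIntertwiner)
    (h1 : BiOp.comp W.adj W = BiOp.one _) (h2 : BiOp.comp W W.adj = BiOp.one _)
    (hF : BiOp.comp c'.F W = BiOp.comp W c.F) : c.IsSum (zero A B) c' :=
  ⟨W, 0, IsBimoduleSum.of_intertwiner hW BiOp.IsIntertwiner.zero h1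
    (by rw [BiOp.comp_zero]; exact (BiOp.eq_zero_of_left _).symm)
    (by rw [BiOp.zero_comp, add_zero, h2]), hF, by rw [BiOp.comp_zero, BiOp.zero_comp]⟩

theorem IsSum.unique {c₁ c₂ c c' : KasparovCycle A B} (h : c₁.IsSum c₂ c) (h' : c₁.IsSum c₂ c') :
    c.IsSum (zero A B) c' := by
  obtain ⟨i₁, i₂, hi, hi1, hi2⟩ := h
  obtain ⟨j₁, j₂, hj, hj1, hj2⟩ := h'
  have key : ∀ {c c' : KasparovCycle A B} {i₁ : BiOp c₁.E c.E} {i₂ : BiOp c₂.E c.E}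
      {j₁ : BiOp c₁.E c'.E} {j₂ : BiOp c₂.E c'.E}, IsBimoduleSum i₁ i₂ → IsBimoduleSum j₁ j₂ →
      BiOp.comp (BiOp.comp j₁ i₁.adj + BiOp.comp j₂ i₂.adj).adj
        (BiOp.comp j₁ i₁.adj + BiOp.comp j₂ i₂.adj) = BiOp.one c.E := by
    intro c c' i₁ i₂ j₁ j₂ hi hj
    simp only [BiOp.adj_add, BiOp.adj_comp, BiOp.adj_adj, BiOp.add_comp, BiOp.comp_add,
      BiOp.comp_assoc]
    rw [← BiOp.comp_assoc j₁.adj, ← BiOp.comp_assoc j₁.adj, ← BiOp.comp_assoc j₂.adj,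
      ← BiOp.comp_assoc j₂.adj, hj.isometry_left, hj.isometry_right, hj.orthogonal,
      hj.orthogonal', BiOp.zero_comp, BiOp.zero_comp, BiOp.comp_zero, BiOp.comp_zero,
      BiOp.one_comp, BiOp.one_comp, add_zero, zero_add, hi.complementary]
  have k1 := key hi hj
  have k2 := key hj hi
  have e : (BiOp.comp i₁ j₁.adj + BiOp.comp i₂ j₂.adj)
      = (BiOp.comp j₁ i₁.adj + BiOp.comp j₂ i₂.adj).adj := by
    rw [BiOp.adj_add, BiOp.adj_comp, BiOp.adj_comp, BiOp.adj_adj, BiOp.adj_adj]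
  rw [e, BiOp.adj_adj] at k2
  refine IsSum.of_unitary ((hj.intertwiner_left.comp hi.intertwiner_left.adj).add
    (hj.intertwiner_right.comp hi.intertwiner_right.adj)) k1 k2 (hi.ext ?_ ?_)
  · simp only [BiOp.comp_assoc, BiOp.add_comp, hi1, hi.isometry_left, hi.orthogonal,
      BiOp.comp_zero, BiOp.comp_one, add_zero, hj1]
    rw [← BiOp.comp_assoc i₁.adj, ← BiOp.comp_assoc i₂.adj, hi.isometry_left, hi.orthogonal,
      BiOp.one_comp, BiOp.zero_comp, BiOp.comp_zero, add_zero]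
  · simp only [BiOp.comp_assoc, BiOp.add_comp, hi2, hi.isometry_right, hi.orthogonal',
      BiOp.comp_zero, BiOp.comp_one, zero_add, hj2]
    rw [← BiOp.comp_assoc i₁.adj, ← BiOp.comp_assoc i₂.adj, hi.isometry_right, hi.orthogonal',
      BiOp.one_comp, BiOp.zero_comp, BiOp.comp_zero, zero_add]

end KasparovCycle

/-! ## The group structure of `KK` -/

theorem OperatorHomotopic.refl {E : Bimodule A B} {F : BiOp E E} (h : IsCycle E F) :
    OperatorHomotopic F F := ⟨Path.refl F, fun _ => h⟩

namespace KK

open KasparovCycle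

theorem mk_eq_of_isSum {c d c' : KasparovCycle A B} (hd : d.IsDegenerate) (h : c.IsSum d c') :
    mk c = mk c' :=
  Quot.sound ⟨d, zero A B, hd, isDegenerate_zero, c'.E, c'.F, c'.F, c'.isCycle, c'.isCycle, h,
    isSum_zero c', OperatorHomotopic.refl c'.isCycle⟩

theorem mk_eq_of_homotopic {E : Bimodule A B} {F F' : BiOp E E} (h : IsCycle E F)
    (h' : IsCycle E F') (hF : OperatorHomotopic F F') :
    mk (⟨E, F, h⟩ : KasparovCycle A B) = mk ⟨E, F', h'⟩ :=
  Quot.sound ⟨zero A B, zero A B, isDegenerate_zero, isDegenerate_zero, E, F, F', h, h',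
    isSum_zero _, isSum_zero _, hF⟩

/-- Invariance under the addition of degenerate cycles and under operator homotopy implies
invariance under equivalence. -/
theorem eq_of_equivalent {X : Sort*} {f : KasparovCycle A B → X}
    (h1 : ∀ c d c', d.IsDegenerate → c.IsSum d c' → f c = f c')
    (h2 : ∀ (E : Bimodule A B) (F F' : BiOp E E) (h : IsCycle E F) (h' : IsCycle E F'),
      OperatorHomotopic F F' → f ⟨E, F, h⟩ = f ⟨E, F', h'⟩)
    {c c' : KasparovCycle A B} (h : c.Equivalent c') : f c = f c' := by
  obtain ⟨d₁, d₂, hd1, hd2, E, F, F', h, h', hs, hs', hF⟩ := h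
  rw [h1 _ _ _ hd1 hs, h1 _ _ _ hd2 hs', h2 E F F' h h' hF]

theorem mk_eq_mk_of_isSum {c₁ c₂ c c' : KasparovCycle A B} (h : c₁.IsSum c₂ c)
    (h' : c₁.IsSum c₂ c') : mk c = mk c' :=
  mk_eq_of_isSum isDegenerate_zero (h.unique h')

/-- A direct sum of two cycles. -/
def sumCycle (c₁ c₂ : KasparovCycle A B) : KasparovCycle A B := (exists_isSum c₁ c₂).choose

theorem sumCycle_isSum (c₁ c₂ : KasparovCycle A B) : c₁.IsSum c₂ (sumCycle c₁ c₂) :=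
  (exists_isSum c₁ c₂).choose_spec

theorem continuous_diag {E₁ E₂ E : Bimodule A B} (i₁ : BiOp E₁ E) (i₂ : BiOp E₂ E)
    (T₂ : BiOp E₂ E₂) : Continuous fun T₁ : BiOp E₁ E₁ => BiOp.diag i₁ i₂ T₁ T₂ := by
  unfold BiOp.diag
  refine Continuous.add ?_ continuous_const
  refine (LipschitzWith.of_dist_le_mul (K := ‖i₁‖₊ * ‖i₁.adj‖₊) fun S T => ?_).continuous
  rw [dist_eq_norm, dist_eq_norm, ← BiOp.comp_sub, ← BiOp.sub_comp]
  refine (BiOp.norm_comp_le _ _).trans ?_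
  have := BiOp.norm_comp_le (S - T) i₁.adj
  have h := norm_nonneg i₁
  push_cast
  nlinarith

theorem mk_sumCycle_congr {c c' : KasparovCycle A B} (c₂ : KasparovCycle A B)
    (h : c.Equivalent c') : mk (sumCycle c c₂) = mk (sumCycle c' c₂) := by
  refine eq_of_equivalent (f := fun c => mk (sumCycle c c₂)) ?_ ?_ h
  · intro c d c' hd hs
    have h1 := sumCycle_isSum d c₂
    have h2 := hs.assoc (sumCycle_isSum c' c₂) h1
    exact mk_eq_of_isSum hd (h1.symm.assoc' h2 (sumCycle_isSum c c₂))
  · intro E F F' h h' hF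
    obtain ⟨γ, hγ⟩ := hF
    obtain ⟨E', i₁, i₂, hi⟩ := exists_isBimoduleSum E c₂.E
    have e1 := mk_eq_mk_of_isSum (sumCycle_isSum ⟨E, F, h⟩ c₂)
      (IsSum.mk_diag (c₁ := ⟨E, F, h⟩) hi)
    have e2 := mk_eq_mk_of_isSum (sumCycle_isSum ⟨E, F', h'⟩ c₂)
      (IsSum.mk_diag (c₁ := ⟨E, F', h'⟩) hi)
    change mk _ = mk _
    rw [e1, e2]
    exact mk_eq_of_homotopic _ _ ⟨γ.map (continuous_diag i₁ i₂ c₂.F),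
      fun t => (hγ t).diag hi c₂.isCycle⟩

theorem mk_sumCycle_comm (c₁ c₂ : KasparovCycle A B) :
    mk (sumCycle c₁ c₂) = mk (sumCycle c₂ c₁) :=
  mk_eq_mk_of_isSum (sumCycle_isSum c₁ c₂) (sumCycle_isSum c₂ c₁).symm

/-- The addition of classes of cycles, which is induced by the direct sum. -/
@[reducible] def instAdd : Add (KK A B) := ⟨Quot.lift₂ (fun c₁ c₂ => mk (sumCycle c₁ c₂))
  (fun c c₁ c₂ h => by
    rw [mk_sumCycle_comm c, mk_sumCycle_comm c, mk_sumCycle_congr c h])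
  fun c₁ c₂ c h => mk_sumCycle_congr c h⟩

attribute [local instance] instAdd

theorem mk_sum {c₁ c₂ c : KasparovCycle A B} (h : c₁.IsSum c₂ c) : mk c = mk c₁ + mk c₂ :=
  mk_eq_mk_of_isSum h (sumCycle_isSum c₁ c₂)

/-- The class of the zero cycle. -/
@[reducible] def instZero : Zero (KK A B) := ⟨mk (zero A B)⟩

attribute [local instance] instZero

theorem ind {p : KK A B → Prop} (h : ∀ c, p (mk c)) (k : KK A B) : p k := Quot.ind h k

theorem add_comm' (k l : KK A B) : k + l = l + k := by
  induction k using ind; induction l using ind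
  exact mk_sumCycle_comm _ _

theorem add_zero' (k : KK A B) : k + 0 = k := by
  induction k using ind
  exact (mk_sum (isSum_zero _)).symm

theorem add_assoc' (k l m : KK A B) : k + l + m = k + (l + m) := by
  induction k using ind with | _ c₁ => ?_
  induction l using ind with | _ c₂ => ?_
  induction m using ind with | _ c₃ => ?_
  have h1 := sumCycle_isSum c₁ c₂
  have h2 := sumCycle_isSum (sumCycle c₁ c₂) c₃
  have h3 := sumCycle_isSum c₂ c₃
  rw [← mk_sum h1, ← mk_sum h2, ← mk_sum h3, ← mk_sum (h1.assoc h2 h3)]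

theorem mk_degenerate {d : KasparovCycle A B} (hd : d.IsDegenerate) : mk d = 0 :=
  (mk_eq_of_isSum hd (isSum_zero d).symm).symm

end KK

end Cycles

/-! ## Inverses in `KK` -/

section Inverse

variable {𝕜 : Type} [RCLike 𝕜] {A : GradedCStarCategory.{v} 𝕜} {B : GradedCStarCategory.{u} 𝕜}
  {I : OpIdeal B}

theorem Bimodule.toOp_adj_comp_map (E : Bimodule A B) {a a' : A.Obj} (x : A.Hom a a') :
    Op.comp (E.toOp.adj.at' a') (E.op.map x) = Op.comp (E.map (A.gr x)) (E.toOp.adj.at' a) := by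
  have h := congrArg Op.adj (E.map_comp_toOp (A.adj x))
  rw [Op.adj_comp, Op.adj_comp, ← Bimodule.map_adj, ← Bimodule.map_adj, A.gr_adj, A.adj_adj,
    A.adj_adj] at h
  exact h

theorem Bimodule.map_comp_toOp_adj (E : Bimodule A B) {a a' : A.Obj} (x : A.Hom a a') :
    Op.comp (E.map x) (E.toOp.adj.at' a) = Op.comp (E.toOp.adj.at' a') (E.op.map (A.gr x)) := by
  rw [E.toOp_adj_comp_map, A.gr_gr]

/-- The operator corresponding to `T` on the bimodule with the opposite grading. -/
def BiOp.opConj {E : Bimodule A B} (T : BiOp E E) : BiOp E.op E.op :=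
  BiOp.comp E.toOp (BiOp.comp T E.toOp.adj)

theorem BiOp.LeftMem.opConj {E : Bimodule A B} {T : BiOp E E} (hT : T.LeftMem I) :
    T.opConj.LeftMem I := fun a a' x => by
  rw [BiOp.opConj, comp_at, comp_at, ← Op.comp_assoc, E.map_comp_toOp, Op.comp_assoc,
    ← Op.comp_assoc (E.map _)]
  exact I.comp_mem _ (I.mem_comp _ (hT a a' _))

theorem BiOp.CommMem.opConj {E : Bimodule A B} {T : BiOp E E} (hT : T.CommMem I) :
    T.opConj.CommMem I := fun a a' x => by
  rw [BiOp.opConj, comp_at, comp_at, comp_at, comp_at, ← Op.comp_assoc, E.map_comp_toOp,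
    Op.comp_assoc, ← Op.comp_assoc (E.map _), Op.comp_assoc (E.toOp.at' a'),
    Op.comp_assoc (T.at' a'), E.toOp_adj_comp_map, ← Op.comp_assoc (T.at' a'), ← Op.comp_sub,
    ← Op.sub_comp]
  exact I.comp_mem _ (I.mem_comp _ (hT a a' _))

theorem BiOp.opConj_comp {E : Bimodule A B} (S T : BiOp E E) :
    BiOp.comp S.opConj T.opConj = (BiOp.comp S T).opConj := by
  unfold BiOp.opConj
  rw [comp_assoc, comp_assoc, ← comp_assoc E.toOp.adj, E.toOp_adj_comp, one_comp, comp_assoc]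

theorem IsCycleMod.neg_opConj {E : Bimodule A B} {F : BiOp E E} (h : IsCycleMod I E F) :
    IsCycleMod I E.op (-F.opConj) where
  degree := by
    rw [BiOp.opConj, BiOp.gr_neg, BiOp.gr_comp, BiOp.gr_comp, BiOp.gr_adj, E.gr_toOp, h.degree,
      BiOp.adj_neg]
    simp only [BiOp.neg_comp, BiOp.comp_neg, neg_neg]
  adj := by
    have e : -F.opConj - (-F.opConj).adj = -(F - F.adj).opConj := by
      unfold BiOp.opConj
      rw [BiOp.adj_neg, BiOp.adj_comp, BiOp.adj_comp, BiOp.adj_adj, BiOp.sub_comp, BiOp.comp_sub,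
        BiOp.comp_assoc]
      abel
    rw [e]
    exact h.adj.opConj.neg
  sq := by
    have e : BiOp.comp (-F.opConj) (-F.opConj) - BiOp.one E.op
        = (BiOp.comp F F - BiOp.one E).opConj := by
      rw [BiOp.neg_comp, BiOp.comp_neg, neg_neg, BiOp.opConj_comp]
      unfold BiOp.opConj
      rw [BiOp.sub_comp, BiOp.comp_sub, BiOp.one_comp, E.toOp_comp_adj]
    rw [e]
    exact h.sq.opConj
  comm := h.comm.opConj.neg

variable {E E' : Bimodule A B} {i₁ : BiOp E E'} {i₂ : BiOp E.op E'}

/-- The operator that exchanges the two summands of `E ⊕ E.op`. -/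
def BiOp.swap (i₁ : BiOp E E') (i₂ : BiOp E.op E') : BiOp E' E' :=
  BiOp.comp i₁ (BiOp.comp E.toOp.adj i₂.adj) + BiOp.comp i₂ (BiOp.comp E.toOp i₁.adj)

theorem IsBimoduleSum.swap_left (h : IsBimoduleSum i₁ i₂) :
    BiOp.comp (BiOp.swap i₁ i₂) i₁ = BiOp.comp i₂ E.toOp := by
  rw [BiOp.swap, BiOp.add_comp, BiOp.comp_assoc, BiOp.comp_assoc, h.orthogonal, BiOp.comp_zero,
    BiOp.comp_zero, zero_add, BiOp.comp_assoc, BiOp.comp_assoc, h.isometry_left, BiOp.comp_one]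

theorem IsBimoduleSum.swap_right (h : IsBimoduleSum i₁ i₂) :
    BiOp.comp (BiOp.swap i₁ i₂) i₂ = BiOp.comp i₁ E.toOp.adj := by
  rw [BiOp.swap, BiOp.add_comp, BiOp.comp_assoc, BiOp.comp_assoc, h.isometry_right, BiOp.comp_one,
    BiOp.comp_assoc, BiOp.comp_assoc, h.orthogonal', BiOp.comp_zero, BiOp.comp_zero, add_zero]

theorem IsBimoduleSum.swap_sq (h : IsBimoduleSum i₁ i₂) :
    BiOp.comp (BiOp.swap i₁ i₂) (BiOp.swap i₁ i₂) = BiOp.one E' := by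
  refine h.ext ?_ ?_
  · rw [BiOp.comp_assoc, h.swap_left, ← BiOp.comp_assoc, h.swap_right, BiOp.comp_assoc,
      E.toOp_adj_comp, BiOp.comp_one, BiOp.one_comp]
  · rw [BiOp.comp_assoc, h.swap_right, ← BiOp.comp_assoc, h.swap_left, BiOp.comp_assoc,
      E.toOp_comp_adj, BiOp.comp_one, BiOp.one_comp]

theorem BiOp.swap_adj : (BiOp.swap i₁ i₂).adj = BiOp.swap i₁ i₂ := by
  rw [BiOp.swap, BiOp.adj_add, BiOp.adj_comp, BiOp.adj_comp, BiOp.adj_comp, BiOp.adj_comp,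
    BiOp.adj_adj, BiOp.adj_adj, BiOp.adj_adj, add_comm, BiOp.comp_assoc, BiOp.comp_assoc]

theorem IsBimoduleSum.isCycleMod_swap (h : IsBimoduleSum i₁ i₂) :
    IsCycleMod I E' (BiOp.swap i₁ i₂) where
  degree := by
    rw [BiOp.swap, BiOp.gr_add, BiOp.gr_comp, BiOp.gr_comp, BiOp.gr_comp, BiOp.gr_comp,
      BiOp.gr_adj, BiOp.gr_adj, BiOp.gr_adj, E.gr_toOp, h.degree_left, h.degree_right,
      BiOp.adj_neg]
    simp only [BiOp.neg_comp, BiOp.comp_neg, neg_add]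
  adj := by
    rw [BiOp.swap_adj, sub_self]
    exact BiOp.LeftMem.zero
  sq := by
    rw [h.swap_sq, sub_self]
    exact BiOp.LeftMem.zero
  comm a a' x := by
    have e : Op.comp (E'.map x) ((BiOp.swap i₁ i₂).at' a)
        = Op.comp ((BiOp.swap i₁ i₂).at' a') (E'.map (A.gr x)) := by
      rw [BiOp.swap, BiOp.add_at, BiOp.add_at, Op.comp_add, Op.add_comp]
      simp only [BiOp.comp_at, Op.comp_assoc]
      rw [← h.intertwiner_left.adj.natural, ← h.intertwiner_right.adj.natural]
      simp only [← Op.comp_assoc]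
      rw [h.natural_left, h.natural_right]
      rw [Op.comp_assoc (i₁.at' a'), Op.comp_assoc (i₂.at' a'), E.map_comp_toOp,
        E.map_comp_toOp_adj]
      simp only [Op.comp_assoc]
    rw [e, sub_self]
    exact zero_mem _

theorem IsBimoduleSum.swap_anticomm (h : IsBimoduleSum i₁ i₂) (F : BiOp E E) :
    BiOp.comp (BiOp.swap i₁ i₂) (BiOp.diag i₁ i₂ F (-F.opConj))
      = -BiOp.comp (BiOp.diag i₁ i₂ F (-F.opConj)) (BiOp.swap i₁ i₂) := by
  have e1 : BiOp.comp E.toOp F = BiOp.comp F.opConj E.toOp := by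
    rw [BiOp.opConj, BiOp.comp_assoc, BiOp.comp_assoc, E.toOp_adj_comp, BiOp.comp_one]
  have e2 : BiOp.comp E.toOp.adj F.opConj = BiOp.comp F E.toOp.adj := by
    rw [BiOp.opConj, ← BiOp.comp_assoc, E.toOp_adj_comp, BiOp.one_comp]
  refine h.ext ?_ ?_
  · rw [BiOp.comp_assoc, h.diag_left, ← BiOp.comp_assoc, h.swap_left, BiOp.neg_comp,
      BiOp.comp_assoc, BiOp.comp_assoc, h.swap_left, ← BiOp.comp_assoc _ i₂, h.diag_right,
      BiOp.comp_assoc, e1, BiOp.neg_comp, BiOp.comp_neg, neg_neg]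
  · rw [BiOp.comp_assoc, h.diag_right, ← BiOp.comp_assoc, h.swap_right, BiOp.neg_comp,
      BiOp.comp_assoc, BiOp.comp_assoc, h.swap_right, ← BiOp.comp_assoc _ i₁, h.diag_left,
      BiOp.comp_assoc, BiOp.comp_neg, e2, BiOp.comp_neg]

/-- Rotation of a cycle into an anticommuting one. -/
theorem IsCycleMod.rotate {F G : BiOp E E} (hF : IsCycleMod I E F) (hG : IsCycleMod I E G)
    (h : BiOp.comp G F = -BiOp.comp F G) {r s : ℝ} (hrs : r ^ 2 + s ^ 2 = 1) :
    IsCycleMod I E ((r : 𝕜) • F + (s : 𝕜) • G) where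
  degree := by
    rw [BiOp.gr_add, BiOp.gr_smul, BiOp.gr_smul, hF.degree, hG.degree]
    module
  adj := by
    have e : (r : 𝕜) • F + (s : 𝕜) • G - ((r : 𝕜) • F + (s : 𝕜) • G).adj
        = (r : 𝕜) • (F - F.adj) + (s : 𝕜) • (G - G.adj) := by
      rw [BiOp.adj_add, BiOp.adj_smul, BiOp.adj_smul, RCLike.conj_ofReal, RCLike.conj_ofReal]
      module
    rw [e]
    exact (hF.adj.smul _).add (hG.adj.smul _)
  sq := by
    have hrs' : (r : 𝕜) ^ 2 + (s : 𝕜) ^ 2 = 1 := by exact_mod_cast congrArg (fun t : ℝ => (t : 𝕜)) hrs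
    have e : BiOp.comp ((r : 𝕜) • F + (s : 𝕜) • G) ((r : 𝕜) • F + (s : 𝕜) • G) - BiOp.one E
        = ((r : 𝕜) ^ 2) • (BiOp.comp F F - BiOp.one E)
          + ((s : 𝕜) ^ 2) • (BiOp.comp G G - BiOp.one E) := by
      simp only [BiOp.comp_add, BiOp.add_comp, BiOp.comp_smul, BiOp.smul_comp, h]
      have e1 : BiOp.one E = ((r : 𝕜) ^ 2 + (s : 𝕜) ^ 2) • BiOp.one E := by rw [hrs', one_smul]
      rw [e1]
      simp only [smul_sub, smul_smul]
      have e2 : ∀ t : 𝕜, t * ((r : 𝕜) ^ 2 + (s : 𝕜) ^ 2) = t := fun t => by rw [hrs', mul_one]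
      rw [e2, e2]
      module
    rw [e]
    exact (hF.sq.smul _).add (hG.sq.smul _)
  comm := (hF.comm.smul _).add (hG.comm.smul _)

theorem operatorHomotopic_of_anticomm {F G : BiOp E E} (hF : IsCycle E F) (hG : IsCycle E G)
    (h : BiOp.comp G F = -BiOp.comp F G) : OperatorHomotopic F G := by
  refine ⟨⟨⟨fun t => (Real.cos (Real.pi / 2 * t) : 𝕜) • F + (Real.sin (Real.pi / 2 * t) : 𝕜) • G,
    ?_⟩, ?_, ?_⟩, fun t => isCycle_iff.2 ((isCycle_iff.1 hF).rotate (isCycle_iff.1 hG) h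
      (Real.cos_sq_add_sin_sq _))⟩
  · have h1 : Continuous fun t : unitInterval => (Real.cos (Real.pi / 2 * t) : 𝕜) :=
      RCLike.continuous_ofReal.comp (by fun_prop)
    have h2 : Continuous fun t : unitInterval => (Real.sin (Real.pi / 2 * t) : 𝕜) :=
      RCLike.continuous_ofReal.comp (by fun_prop)
    exact (h1.smul continuous_const).add (h2.smul continuous_const)
  · simp
  · simp

namespace KK

open KasparovCycle

attribute [local instance] instAdd instZero

theorem exists_neg (k : KK A B) : ∃ l : KK A B, l + k = 0 := by
  induction k using ind with | _ c => ?_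
  obtain ⟨E, i₁, i₂, h⟩ := exists_isBimoduleSum c.E c.E.op
  have hn : IsCycle c.E.op (-c.F.opConj) := isCycle_iff.2 (isCycle_iff.1 c.isCycle).neg_opConj
  have hd : IsCycleMod (zeroIdeal B) E (BiOp.swap i₁ i₂) := h.isCycleMod_swap
  refine ⟨mk ⟨_, _, hn⟩, ?_⟩
  rw [add_comm', ← mk_sum (IsSum.mk_diag (c₂ := ⟨_, _, hn⟩) h),
    mk_eq_of_homotopic _ hd.isCycle (operatorHomotopic_of_anticomm (c.isCycle.diag h hn)
      hd.isCycle (h.swap_anticomm c.F))]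
  exact mk_degenerate (isDegenerate_iff.2 hd)

instance : AddCommGroup (KK A B) where
  add := (· + ·)
  zero := 0
  neg k := (exists_neg k).choose
  nsmul := nsmulRec
  zsmul := @zsmulRec _ instZero instAdd ⟨fun k => (exists_neg k).choose⟩ nsmulRec
  add_assoc := add_assoc'
  zero_add k := by rw [add_comm', add_zero']
  add_zero := add_zero'
  add_comm := add_comm'
  neg_add_cancel k := (exists_neg k).choose_spec

/-- Restriction as a homomorphism. -/
def restrictHom {A' : GradedCStarCategory.{v} 𝕜}
    (H : GradedFunctor A'.toGradedStarCategory A.toGradedStarCategory) : KK A B →+ KK A' B where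
  toFun := KK.restrict H
  map_zero' := mk_degenerate (isDegenerate_zero.restrict H)
  map_add' k l := by
    induction k using ind with | _ c₁ => ?_
    induction l using ind with | _ c₂ => ?_
    have h := sumCycle_isSum c₁ c₂
    rw [← mk_sum h]
    exact mk_sum (h.restrict H)

end KK

end Inverse

/-! ## Lifting of paths -/

/-- The composition with a continuous linear map on spaces of continuous functions. -/
theorem exists_lift_of_quotient {𝕜 X : Type*} [RCLike 𝕜] [NormedAddCommGroup X] [NormedSpace 𝕜 X]
    [CompleteSpace X] (Y : Submodule 𝕜 X) [IsClosed (Y : Set X)]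
    (γ : C(unitInterval, X ⧸ Y)) : ∃ Γ : C(unitInterval, X), ∀ t, Y.mkQ (Γ t) = γ t := by
  letI : NormedSpace ℝ X := NormedSpace.restrictScalars ℝ 𝕜 X
  have hnorm : ∀ v : X, ‖Y.mkQ v‖ ≤ ‖v‖ := fun v => Submodule.Quotient.norm_mk_le Y v
  have hcont : Continuous Y.mkQ := AddMonoidHomClass.continuous_of_bound Y.mkQ 1 fun v => by
    rw [one_mul]; exact hnorm v
  let q : C(unitInterval, X) → C(unitInterval, X ⧸ Y) := fun f => ⟨fun t => Y.mkQ (f t),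
    hcont.comp f.continuous⟩
  have approx : ∀ g : C(unitInterval, X ⧸ Y), ∃ f : C(unitInterval, X),
      ‖f‖ ≤ 2 * ‖g‖ ∧ ‖g - q f‖ ≤ 1 / 2 * ‖g‖ := by
    intro g
    rcases eq_or_lt_of_le (norm_nonneg g) with h0 | h0
    · refine ⟨0, by rw [← h0]; simp, ?_⟩
      have h : q 0 = 0 := ContinuousMap.ext fun t => map_zero Y.mkQ
      rw [h, sub_zero, ← h0, mul_zero]
    have hconv : ∀ t, Convex ℝ {v : X | ‖v‖ ≤ 2 * ‖g‖ ∧ ‖g t - Y.mkQ v‖ ≤ 1 / 2 * ‖g‖} := by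
      intro t v hv w hw r s hr hs hrs
      have e1 : Y.mkQ (r • v + s • w) = (r : 𝕜) • Y.mkQ v + (s : 𝕜) • Y.mkQ w := by
        rw [← map_smul, ← map_smul, ← map_add]
        congr 1
      have e2 : g t - Y.mkQ (r • v + s • w)
          = (r : 𝕜) • (g t - Y.mkQ v) + (s : 𝕜) • (g t - Y.mkQ w) := by
        have h : g t = ((r : 𝕜) + (s : 𝕜)) • g t := by
          rw [← RCLike.ofReal_add, hrs, RCLike.ofReal_one, one_smul]
        rw [e1]
        nth_rewrite 1 [h]
        module
      constructor
      · refine (norm_add_le _ _).trans ?_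
        rw [norm_smul, norm_smul, Real.norm_of_nonneg hr, Real.norm_of_nonneg hs]
        have := mul_le_mul_of_nonneg_left hv.1 hr
        have := mul_le_mul_of_nonneg_left hw.1 hs
        calc _ ≤ (r + s) * (2 * ‖g‖) := by linarith
          _ = _ := by rw [hrs, one_mul]
      · rw [e2]
        refine (norm_add_le _ _).trans ?_
        rw [norm_smul, norm_smul, RCLike.norm_ofReal, RCLike.norm_ofReal, abs_of_nonneg hr,
          abs_of_nonneg hs]
        have := mul_le_mul_of_nonneg_left hv.2 hr
        have := mul_le_mul_of_nonneg_left hw.2 hs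
        calc _ ≤ (r + s) * (1 / 2 * ‖g‖) := by linarith
          _ = _ := by rw [hrs, one_mul]
    obtain ⟨f, hf⟩ := exists_continuous_forall_mem_convex_of_local_const hconv (by
      intro t
      obtain ⟨v, hv, hvn⟩ := Submodule.Quotient.norm_mk_lt (S := Y) (g t) h0
      have hv' : Y.mkQ v = g t := hv
      have hU : ∀ᶠ s in nhds t, ‖g s - g t‖ < 1 / 2 * ‖g‖ := by
        have h1 : Filter.Tendsto (fun s => ‖g s - g t‖) (nhds t) (nhds ‖g t - g t‖) :=
          ((g.continuous.sub continuous_const).norm).tendsto t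
        rw [sub_self, norm_zero] at h1
        exact h1.eventually_lt_const (by positivity)
      refine ⟨v, hU.mono fun s hs => ⟨?_, ?_⟩⟩
      · have := g.norm_coe_le_norm t
        linarith
      · rw [hv']
        exact hs.le)
    refine ⟨f, (ContinuousMap.norm_le _ (by positivity)).2 fun t => (hf t).1,
      (ContinuousMap.norm_le _ (by positivity)).2 fun t => (hf t).2⟩
  choose f hf1 hf2 using approx
  let r : ℕ → C(unitInterval, X ⧸ Y) := fun n => Nat.rec γ (fun _ g => g - q (f g)) n
  have hr : ∀ n, r (n + 1) = r n - q (f (r n)) := fun n => rfl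
  have hrn : ∀ n, ‖r n‖ ≤ (1 / 2) ^ n * ‖γ‖ := by
    intro n
    induction n with
    | zero => simp [r]
    | succ n ih =>
      rw [hr, pow_succ]
      have := hf2 (r n)
      nlinarith
  have hs : Summable fun n => f (r n) := by
    refine Summable.of_norm_bounded (g := fun n => (1 / 2 : ℝ) ^ n * (2 * ‖γ‖))
      ((summable_geometric_of_lt_one (by norm_num) (by norm_num)).mul_right _) fun n => ?_
    have := hf1 (r n)
    have := hrn n
    nlinarith
  refine ⟨∑' n, f (r n), fun t => ?_⟩
  have h1 : ∀ N, Y.mkQ ((∑ n ∈ Finset.range N, f (r n)) t) = γ t - r N t := by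
    intro N
    induction N with
    | zero => simp [r]
    | succ N ih =>
      rw [Finset.sum_range_succ, ContinuousMap.add_apply, map_add, ih, hr]
      change _ = γ t - (r N t - Y.mkQ (f (r N) t))
      abel
  have h2 : Filter.Tendsto (fun N => Y.mkQ ((∑ n ∈ Finset.range N, f (r n)) t)) Filter.atTop
      (nhds (Y.mkQ ((∑' n, f (r n)) t))) :=
    (hcont.tendsto _).comp (((ContinuousEvalConst.continuous_eval_const t).tendsto _).comp
      hs.hasSum.tendsto_sum_nat)
  have h3 : Filter.Tendsto (fun N => γ t - r N t) Filter.atTop (nhds (γ t - 0)) := by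
    refine tendsto_const_nhds.sub (squeeze_zero_norm (a := fun n => (1 / 2) ^ n * ‖γ‖)
      (fun n => ((r n).norm_coe_le_norm t).trans (hrn n)) ?_)
    simpa using (tendsto_pow_atTop_nhds_zero_of_lt_one (r := (1 / 2 : ℝ)) (by norm_num)
      (by norm_num)).mul_const ‖γ‖
  simp only [h1] at h2
  rw [sub_zero] at h3
  exact tendsto_nhds_unique h2 h3

/-! ## Completeness of the spaces of operators -/

section Complete

variable {𝕜 : Type} [RCLike 𝕜] {A : GradedCStarCategory.{v} 𝕜} {B : GradedCStarCategory.{u} 𝕜}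

instance Op.completeSpace (E F : HilbertModule B) : CompleteSpace (Op E F) := by
  have h : IsClosed (opSubmodule E F : Set (lp (fun b => E.X b →L[𝕜] F.X b) ∞)) := by
    refine isSeqClosed_iff_isClosed.1 ?_
    intro T T₀ hT hT₀
    let S : ℕ → Op E F := fun n => ⟨T n, hT n⟩
    have hS : CauchySeq fun n => (S n).adj := by
      refine Metric.cauchySeq_iff'.2 fun ε hε => ?_
      obtain ⟨N, hN⟩ := Metric.cauchySeq_iff'.1 hT₀.cauchySeq (ε / 4) (by positivity)
      refine ⟨N, fun n hn => ?_⟩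
      rw [dist_eq_norm, ← Op.adj_sub]
      have h1 := Op.norm_adj_le (S n - S N)
      have h2 : ‖S n - S N‖ < ε / 4 := by
        have := hN n hn
        rw [dist_eq_norm] at this
        exact this
      linarith
    have hc : ∀ b (η : F.X b), ∃ ζ, Filter.Tendsto (fun n => (S n).adj.app b η) Filter.atTop
        (nhds ζ) := by
      intro b η
      refine cauchySeq_tendsto_of_complete (Metric.cauchySeq_iff'.2 fun ε hε => ?_)
      obtain ⟨N, hN⟩ := Metric.cauchySeq_iff'.1 hS (ε / (‖η‖ + 1)) (by positivity)
      refine ⟨N, fun n hn => ?_⟩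
      rw [dist_eq_norm, ← Op.sub_app]
      refine (Op.norm_app_le _ _ _).trans_lt ?_
      have h1 := hN n hn
      rw [dist_eq_norm, lt_div_iff₀ (by positivity)] at h1
      have := norm_nonneg ((S n).adj - (S N).adj)
      nlinarith
    choose R hR using hc
    refine ⟨R, fun a b η ξ => ?_⟩
    have h1 : Filter.Tendsto (fun n => F.inner η ((S n).app a ξ)) Filter.atTop
        (nhds (F.inner η (T₀ a ξ))) := by
      refine ((F.continuous_inner_right η).tendsto _).comp ?_
      have h2 : Filter.Tendsto (fun n => ‖T n - T₀‖ * ‖ξ‖) Filter.atTop (nhds (0 * ‖ξ‖)) := by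
        refine Filter.Tendsto.mul_const _ ?_
        exact tendsto_iff_norm_sub_tendsto_zero.1 hT₀
      rw [zero_mul] at h2
      refine tendsto_iff_norm_sub_tendsto_zero.2 (squeeze_zero (fun _ => norm_nonneg _)
        (fun n => ?_) h2)
      exact ((T n - T₀) a).le_opNorm ξ |>.trans (mul_le_mul_of_nonneg_right
        (lp.norm_apply_le_norm ENNReal.top_ne_zero _ a) (norm_nonneg _))
    have h3 : Filter.Tendsto (fun n => E.inner ((S n).adj.app b η) ξ) Filter.atTop
        (nhds (E.inner (R b η) ξ)) :=
      ((E.continuous_inner_left ξ).tendsto _).comp (hR b η)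
    refine tendsto_nhds_unique (h1.congr fun n => ?_) h3
    exact Op.inner_app _ _ _
  exact h.isComplete.completeSpace_coe

instance BiOp.completeSpace (E F : Bimodule A B) : CompleteSpace (BiOp E F) :=
  inferInstanceAs (CompleteSpace (lp (fun a => Op (E.obj a) (F.obj a)) ∞))

namespace BiOp

variable {E F G : Bimodule A B}

theorem continuous_gr : Continuous (gr : BiOp E F → BiOp E F) :=
  AddMonoidHomClass.continuous_of_bound (⟨⟨gr, gr_zero⟩, gr_add⟩ : BiOp E F →+ BiOp E F) 1
    fun T => by rw [one_mul]; exact T.norm_gr_le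

theorem continuous_even : Continuous (even : BiOp E F → BiOp E F) :=
  Continuous.const_smul (continuous_id.add continuous_gr) (2⁻¹ : 𝕜)

theorem continuous_odd : Continuous (odd : BiOp E F → BiOp E F) :=
  Continuous.const_smul (continuous_id.sub continuous_gr) (2⁻¹ : 𝕜)

theorem continuous_leftMul_at {a a' : A.Obj} (S : Op (F.obj a) (F.obj a')) :
    Continuous fun T : BiOp E F => Op.comp S (T.at' a) :=
  AddMonoidHomClass.continuous_of_bound (⟨⟨fun T => Op.comp S (T.at' a), Op.comp_zero S⟩,
    fun T T' => Op.comp_add S _ _⟩ : BiOp E F →+ Op (E.obj a) (F.obj a')) ‖S‖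
    fun T => (Op.norm_comp_le _ _).trans
      (mul_le_mul_of_nonneg_left (T.norm_at_le a) (norm_nonneg _))

theorem continuous_rightMul_at {a a' : A.Obj} (S : Op (E.obj a) (E.obj a')) :
    Continuous fun T : BiOp E F => Op.comp (T.at' a') S :=
  AddMonoidHomClass.continuous_of_bound (⟨⟨fun T => Op.comp (T.at' a') S, Op.zero_comp S⟩,
    fun T T' => Op.add_comp _ _ S⟩ : BiOp E F →+ Op (E.obj a) (F.obj a')) ‖S‖
    fun T => by
      rw [mul_comm]
      exact (Op.norm_comp_le _ _).trans
        (mul_le_mul_of_nonneg_right (T.norm_at_le a') (norm_nonneg _))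

end BiOp

instance dualHom.completeSpace (E F : Bimodule A B) : CompleteSpace (dualHom E F) := by
  have h : IsClosed (dualHom E F : Set (BiOp E F)) := by
    have e : (dualHom E F : Set (BiOp E F)) = ⋂ (a : A.Obj) (a' : A.Obj) (x : A.Hom a a'),
        {T | Op.comp (F.map x) (T.even.at' a) - Op.comp (T.even.at' a') (E.map x)
          ∈ Op.compact (E.obj a) (F.obj a')} ∩
        {T | Op.comp (F.map x) (T.odd.at' a) - Op.comp (T.odd.at' a') (E.map (A.gr x))
          ∈ Op.compact (E.obj a) (F.obj a')} := by
      ext T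
      simp only [Set.mem_iInter]
      rfl
    rw [e]
    refine isClosed_iInter fun a => isClosed_iInter fun a' => isClosed_iInter fun x =>
      (Op.isClosed_compact.preimage ?_).inter (Op.isClosed_compact.preimage ?_)
    · exact ((BiOp.continuous_leftMul_at _).comp BiOp.continuous_even).sub
        ((BiOp.continuous_rightMul_at _).comp BiOp.continuous_even)
    · exact ((BiOp.continuous_leftMul_at _).comp BiOp.continuous_odd).sub
        ((BiOp.continuous_rightMul_at _).comp BiOp.continuous_odd)
  exact h.isComplete.completeSpace_coe

end Complete

/-! ## Supersymmetries in a unital graded category -/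

section Supersymmetry

variable {𝕜 : Type} [RCLike 𝕜]

namespace UnitalGradedStarCategory

section Basic

variable (C : UnitalGradedStarCategory.{u, v} 𝕜)

theorem adj_one (a : C.Obj) : C.adj (C.one a) = C.one a := by
  have h : C.adj (C.adj (C.one a)) = C.adj (C.one a) := by
    conv_lhs => rw [← C.one_comp (C.adj (C.one a)), C.adj_comp, C.adj_adj, C.one_comp]
  rw [← h, C.adj_adj]

theorem gr_one (a : C.Obj) : C.gr (C.one a) = C.one a := by
  have h : C.gr (C.gr (C.one a)) = C.gr (C.one a) := by
    conv_lhs => rw [← C.one_comp (C.gr (C.one a)), C.gr_comp, C.gr_gr, C.comp_one]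
  rw [← h, C.gr_gr]

/-- Odd self-adjoint square roots of the identity. -/
structure IsSupersymmetry {a : C.Obj} (x : C.Hom a a) : Prop where
  gr : C.gr x = -x
  adj : C.adj x = x
  sq : C.comp x x = C.one a

/-- Unitary morphisms of degree `0`. -/
structure IsEvenUnitary {a b : C.Obj} (w : C.Hom a b) : Prop where
  gr : C.gr w = w
  adj_comp_self : C.comp (C.adj w) w = C.one a
  comp_adj_self : C.comp w (C.adj w) = C.one b

/-- The object `c` is the direct sum of `a` and `b`. -/
structure IsDirectSum {a b c : C.Obj} (i : C.Hom a c) (j : C.Hom b c) : Prop where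
  gr_left : C.gr i = i
  gr_right : C.gr j = j
  isometry_left : C.comp (C.adj i) i = C.one a
  isometry_right : C.comp (C.adj j) j = C.one b
  complementary : C.comp i (C.adj i) + C.comp j (C.adj j) = C.one c

/-- The morphism `w x w⋆`. -/
def conj {a b : C.Obj} (w : C.Hom a b) (x : C.Hom a a) : C.Hom b b :=
  C.comp w (C.comp x (C.adj w))

/-- The block diagonal morphism. -/
def block {a b c : C.Obj} (i : C.Hom a c) (j : C.Hom b c) (x : C.Hom a a) (y : C.Hom b b) :
    C.Hom c c :=
  C.conj i x + C.conj j y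

variable {C}

theorem IsEvenUnitary.cancel_left {a b c : C.Obj} {w : C.Hom a b} (h : C.IsEvenUnitary w)
    (x : C.Hom c a) : C.comp (C.adj w) (C.comp w x) = x := by
  rw [← C.assoc, h.adj_comp_self, C.one_comp]

theorem IsEvenUnitary.isSupersymmetry {a b : C.Obj} {w : C.Hom a b} (h : C.IsEvenUnitary w)
    {x : C.Hom a a} (hx : C.IsSupersymmetry x) : C.IsSupersymmetry (C.conj w x) where
  gr := by
    unfold conj
    rw [C.gr_comp, C.gr_comp, C.gr_adj, h.gr, hx.gr, C.neg_comp, C.comp_neg]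
  adj := by
    unfold conj
    rw [C.adj_comp, C.adj_comp, C.adj_adj, hx.adj, C.assoc]
  sq := by
    unfold conj
    rw [C.assoc, C.assoc, h.cancel_left, ← C.assoc x, hx.sq, C.one_comp, h.comp_adj_self]

namespace IsDirectSum

variable {a b c : C.Obj} {i : C.Hom a c} {j : C.Hom b c} (h : C.IsDirectSum i j)
include h

theorem orthogonal : C.comp (C.adj i) j = 0 := by
  have h1 : C.comp (C.adj i) (C.comp i (C.adj i) + C.comp j (C.adj j)) = C.adj i := by
    rw [h.complementary, C.comp_one]
  rw [C.comp_add, ← C.assoc, h.isometry_left, C.one_comp, add_eq_left, ← C.assoc] at h1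
  rw [← C.comp_one (C.comp (C.adj i) j), ← h.isometry_right, ← C.assoc, h1, C.zero_comp]

theorem orthogonal' : C.comp (C.adj j) i = 0 := by
  rw [← C.adj_adj (C.comp (C.adj j) i), C.adj_comp, C.adj_adj, h.orthogonal, C.adj_zero]

theorem cancel_left {d : C.Obj} (x : C.Hom d a) : C.comp (C.adj i) (C.comp i x) = x := by
  rw [← C.assoc, h.isometry_left, C.one_comp]

theorem cancel_right {d : C.Obj} (x : C.Hom d b) : C.comp (C.adj j) (C.comp j x) = x := by
  rw [← C.assoc, h.isometry_right, C.one_comp]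

theorem cancel_orthogonal {d : C.Obj} (x : C.Hom d b) : C.comp (C.adj i) (C.comp j x) = 0 := by
  rw [← C.assoc, h.orthogonal, C.zero_comp]

theorem cancel_orthogonal' {d : C.Obj} (x : C.Hom d a) :
    C.comp (C.adj j) (C.comp i x) = 0 := by
  rw [← C.assoc, h.orthogonal', C.zero_comp]

theorem isSupersymmetry {x : C.Hom a a} {y : C.Hom b b} (hx : C.IsSupersymmetry x)
    (hy : C.IsSupersymmetry y) : C.IsSupersymmetry (C.block i j x y) where
  gr := by
    unfold block conj
    simp only [C.gr_add, C.gr_comp, C.gr_adj, h.gr_left, h.gr_right, hx.gr, hy.gr, C.neg_comp,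
      C.comp_neg, neg_add]
  adj := by
    unfold block conj
    simp only [C.adj_add, C.adj_comp, C.adj_adj, hx.adj, hy.adj, C.assoc]
  sq := by
    unfold block conj
    simp only [C.add_comp, C.comp_add, C.assoc, h.cancel_left, h.cancel_right,
      h.cancel_orthogonal, h.cancel_orthogonal', C.comp_zero, add_zero, zero_add]
    rw [← C.assoc x, hx.sq, ← C.assoc y, hy.sq, C.one_comp, C.one_comp, h.complementary]

theorem isEvenUnitary {d : C.Obj} {i' : C.Hom a d} {j' : C.Hom b d} (h' : C.IsDirectSum i' j') :
    C.IsEvenUnitary (C.comp i' (C.adj i) + C.comp j' (C.adj j)) where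
  gr := by
    simp only [C.gr_add, C.gr_comp, C.gr_adj, h.gr_left, h.gr_right, h'.gr_left, h'.gr_right]
  adj_comp_self := by
    simp only [C.adj_add, C.adj_comp, C.adj_adj, C.add_comp, C.comp_add, C.assoc, h'.cancel_left,
      h'.cancel_right, h'.cancel_orthogonal, h'.cancel_orthogonal', C.comp_zero, add_zero,
      zero_add, h.complementary]
  comp_adj_self := by
    simp only [C.adj_add, C.adj_comp, C.adj_adj, C.add_comp, C.comp_add, C.assoc, h.cancel_left,
      h.cancel_right, h.cancel_orthogonal, h.cancel_orthogonal', C.comp_zero, add_zero,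
      zero_add, h'.complementary]

theorem conj_block {d : C.Obj} (i' : C.Hom a d) (j' : C.Hom b d) (x : C.Hom a a)
    (y : C.Hom b b) :
    C.conj (C.comp i' (C.adj i) + C.comp j' (C.adj j)) (C.block i j x y)
      = C.block i' j' x y := by
  unfold block conj
  simp only [C.adj_add, C.adj_comp, C.adj_adj, C.add_comp, C.comp_add, C.assoc, h.cancel_left,
    h.cancel_right, h.cancel_orthogonal, h.cancel_orthogonal', C.comp_zero, add_zero,
    zero_add]

theorem adj_comp_block_comp (x : C.Hom a a) (y : C.Hom b b) :
    C.comp (C.adj i) (C.comp (C.block i j x y) i) = x := by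
  unfold block conj
  simp only [C.add_comp, C.comp_add, C.assoc, h.cancel_left, h.isometry_left, h.orthogonal',
    h.cancel_orthogonal, C.comp_zero, add_zero, C.comp_one]

theorem adj_comp_block_comp_right (x : C.Hom a a) (y : C.Hom b b) :
    C.comp (C.adj j) (C.comp (C.block i j x y) j) = y := by
  unfold block conj
  simp only [C.add_comp, C.comp_add, C.assoc, h.cancel_right, h.isometry_right, h.orthogonal,
    h.cancel_orthogonal', C.comp_zero, zero_add, C.comp_one]

theorem adj_comp_block_comp_mixed (x : C.Hom a a) (y : C.Hom b b) :
    C.comp (C.adj i) (C.comp (C.block i j x y) j) = 0 := by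
  unfold block conj
  simp only [C.add_comp, C.comp_add, C.assoc, h.cancel_left, h.isometry_right, h.orthogonal,
    h.cancel_orthogonal, C.comp_zero, add_zero]

theorem adj_comp_block_comp_mixed' (x : C.Hom a a) (y : C.Hom b b) :
    C.comp (C.adj j) (C.comp (C.block i j x y) i) = 0 := by
  unfold block conj
  simp only [C.add_comp, C.comp_add, C.assoc, h.cancel_right, h.isometry_left, h.orthogonal',
    h.cancel_orthogonal', C.comp_zero, add_zero]

end IsDirectSum

/-- The rotation by the angle `θ` in the plane of a complex structure `J`. -/
def rotation {a : C.Obj} (D J : C.Hom a a) (θ : ℝ) : C.Hom a a :=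
  ((Real.cos θ ^ 2 : ℝ) : 𝕜) • D
    + ((Real.cos θ * Real.sin θ : ℝ) : 𝕜) • (C.comp J D - C.comp D J)
    - ((Real.sin θ ^ 2 : ℝ) : 𝕜) • C.comp J (C.comp D J)

theorem isSupersymmetry_rotation {a : C.Obj} {D J : C.Hom a a} (hD : C.IsSupersymmetry D)
    (hJ : C.gr J = J) (hJa : C.adj J = -J) (hJ2 : C.comp J J = -C.one a) (θ : ℝ) :
    C.IsSupersymmetry (rotation D J θ) := by
  let w : C.Hom a a := ((Real.cos θ : ℝ) : 𝕜) • C.one a + ((Real.sin θ : ℝ) : 𝕜) • J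
  have hw' : C.adj w = ((Real.cos θ : ℝ) : 𝕜) • C.one a - ((Real.sin θ : ℝ) : 𝕜) • J := by
    simp only [w, C.adj_add, C.adj_smul, RCLike.conj_ofReal, C.adj_one, hJa, smul_neg,
      sub_eq_add_neg]
  have key : (((Real.cos θ : ℝ) : 𝕜) * ((Real.cos θ : ℝ) : 𝕜))
      + (((Real.sin θ : ℝ) : 𝕜) * ((Real.sin θ : ℝ) : 𝕜)) = 1 := by
    rw [← RCLike.ofReal_mul, ← RCLike.ofReal_mul, ← RCLike.ofReal_add, ← sq, ← sq,
      Real.cos_sq_add_sin_sq, RCLike.ofReal_one]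
  have hw : C.IsEvenUnitary w := by
    refine ⟨?_, ?_, ?_⟩
    · simp only [w, C.gr_add, C.gr_smul, C.gr_one, hJ]
    · rw [hw']
      simp only [w, C.comp_add, C.sub_comp, C.smul_comp, C.comp_smul, C.comp_one, C.one_comp, hJ2,
        smul_neg, smul_smul]
      conv_rhs => rw [← one_smul 𝕜 (C.one a), ← key]
      module
    · rw [hw']
      simp only [w, C.comp_sub, C.add_comp, C.smul_comp, C.comp_smul, C.comp_one, C.one_comp, hJ2,
        smul_neg, smul_smul]
      conv_rhs => rw [← one_smul 𝕜 (C.one a), ← key]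
      module
  have e : rotation D J θ = C.conj w D := by
    unfold conj rotation
    rw [hw']
    simp only [w, C.comp_sub, C.add_comp, C.smul_comp, C.comp_smul, C.comp_one, C.one_comp]
    push_cast
    module
  rw [e]
  exact hw.isSupersymmetry hD

theorem continuous_rotation {a : C.Obj} (D J : C.Hom a a) : Continuous (rotation D J) := by
  unfold rotation
  fun_prop

end Basic

/-! ## The additive completion -/

section Mat

variable (C : UnitalGradedStarCategory.{u, v} 𝕜)

theorem adj_oneMatrix {n : ℕ} (P : Fin n → C.Obj) (i j : Fin n) :
    C.adj (C.oneMatrix P i j) = C.oneMatrix P j i := by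
  unfold oneMatrix
  by_cases h : j = i
  · subst h
    simpa using C.adj_one _
  · rw [dif_neg h, dif_neg (Ne.symm h), C.adj_zero]

theorem gr_oneMatrix {n : ℕ} (P : Fin n → C.Obj) (i j : Fin n) :
    C.gr (C.oneMatrix P i j) = C.oneMatrix P i j := by
  unfold oneMatrix
  by_cases h : j = i
  · subst h
    simpa using C.gr_one _
  · rw [dif_neg h, C.gr_zero]

theorem sum_oneMatrix_comp {n : ℕ} (P : Fin n → C.Obj) {a : C.Obj} (w : ∀ k, C.Hom a (P k))
    (i : Fin n) : ∑ k, C.comp (C.oneMatrix P i k) (w k) = w i := by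
  rw [Finset.sum_eq_single i]
  · unfold oneMatrix
    simpa using C.one_comp _
  · intro k _ hk
    rw [C.oneMatrix_of_ne P hk, C.zero_comp]
  · exact fun h => absurd (Finset.mem_univ i) h

theorem sum_comp_oneMatrix {n : ℕ} (P : Fin n → C.Obj) {a : C.Obj} (w : ∀ k, C.Hom (P k) a)
    (i : Fin n) : ∑ k, C.comp (w k) (C.oneMatrix P k i) = w i := by
  rw [Finset.sum_eq_single i]
  · unfold oneMatrix
    simpa using C.comp_one _
  · intro k _ hk
    rw [C.oneMatrix_of_ne P (Ne.symm hk), C.comp_zero]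
  · exact fun h => absurd (Finset.mem_univ i) h

/-- The category of formal finite sums of objects and matrices of morphisms. -/
def mat : UnitalGradedStarCategory.{u, v} 𝕜 where
  Obj := Σ n : ℕ, Fin n → C.Obj
  Hom X Y := ∀ (i : Fin Y.1) (j : Fin X.1), C.Hom (X.2 j) (Y.2 i)
  comp x y := fun i j => ∑ k, C.comp (x i k) (y k j)
  adj x := fun i j => C.adj (x j i)
  gr x := fun i j => C.gr (x i j)
  one X := C.oneMatrix X.2
  add_comp x y z := by
    funext i j
    simp only [Pi.add_apply, C.add_comp, Finset.sum_add_distrib]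
  comp_add x y z := by
    funext i j
    simp only [Pi.add_apply, C.comp_add, Finset.sum_add_distrib]
  smul_comp r x y := by
    funext i j
    simp only [Pi.smul_apply, C.smul_comp, Finset.smul_sum]
  comp_smul r x y := by
    funext i j
    simp only [Pi.smul_apply, C.comp_smul, Finset.smul_sum]
  assoc x y z := by
    funext i j
    simp only [C.comp_sum, C.sum_comp, C.assoc]
    exact Finset.sum_comm
  adj_add x y := by
    funext i j
    exact C.adj_add _ _
  adj_smul r x := by
    funext i j
    exact C.adj_smul _ _
  adj_comp x y := by
    funext i j
    simp only [C.adj_sum, C.adj_comp]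
  adj_adj x := by
    funext i j
    exact C.adj_adj _
  gr_add x y := by
    funext i j
    exact C.gr_add _ _
  gr_smul r x := by
    funext i j
    exact C.gr_smul _ _
  gr_gr x := by
    funext i j
    exact C.gr_gr _
  gr_comp x y := by
    funext i j
    simp only [C.gr_sum, C.gr_comp]
  gr_adj x := by
    funext i j
    exact C.gr_adj _
  one_comp x := by
    funext i j
    exact C.sum_oneMatrix_comp _ (fun k => x k j) i
  comp_one x := by
    funext i j
    exact C.sum_comp_oneMatrix _ (fun k => x i k) j

variable {C}

/-- The supersymmetry of a formal sum with a given matrix. -/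
def IsSupersymmetry.toSS {X : C.mat.Obj} {x : C.mat.Hom X X} (hx : C.mat.IsSupersymmetry x) :
    SS C X.2 :=
  ⟨x, fun i j => congrFun (congrFun hx.gr i) j, fun i j => congrFun (congrFun hx.adj i) j,
    fun i j => congrFun (congrFun hx.sq i) j⟩

theorem isSupersymmetry_of_SS {n : ℕ} {P : Fin n → C.Obj} (x : SS C P) :
    C.mat.IsSupersymmetry (a := ⟨n, P⟩) x.1 :=
  ⟨funext fun i => funext fun j => x.2.1 i j, funext fun i => funext fun j => x.2.2.1 i j,
    funext fun i => funext fun j => x.2.2.2 i j⟩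

/-- The class in `G₁` of a supersymmetry of a formal sum. -/
def IsSupersymmetry.cl {X : C.mat.Obj} {x : C.mat.Hom X X} (hx : C.mat.IsSupersymmetry x) :
    GOne C :=
  GOne.mk C hx.toSS

theorem _root_.GOne.mk_eq_of_joined {n : ℕ} {P : Fin n → C.Obj} {x y : SS C P} (h : Joined x y) :
    GOne.mk C x = GOne.mk C y := by
  have h1 : (QuotientAddGroup.mk (FreeAbelianGroup.of ⟨n, P, x⟩
      - FreeAbelianGroup.of ⟨n, P, y⟩) : GOne C) = 0 :=
    (QuotientAddGroup.eq_zero_iff _).2 (AddSubgroup.subset_closure (GOneRel.path P x y h))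
  rw [QuotientAddGroup.mk_sub, sub_eq_zero] at h1
  exact h1

theorem IsSupersymmetry.cl_eq_of_path {X : C.mat.Obj} {x y : C.mat.Hom X X}
    (hx : C.mat.IsSupersymmetry x) (hy : C.mat.IsSupersymmetry y) (γ : ℝ → C.mat.Hom X X)
    (hγ : Continuous γ) (hs : ∀ t, C.mat.IsSupersymmetry (γ t)) (h0 : γ 0 = x) (h1 : γ 1 = y) :
    hx.cl = hy.cl := by
  refine GOne.mk_eq_of_joined ⟨⟨⟨fun t => (hs t).toSS, ?_⟩, ?_, ?_⟩⟩
  · exact continuous_induced_rng.2 (hγ.comp continuous_subtype_val)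
  · exact Subtype.ext h0
  · exact Subtype.ext h1

theorem IsSupersymmetry.cl_rotation {X : C.mat.Obj} {D J : C.mat.Hom X X}
    (hD : C.mat.IsSupersymmetry D) (hJ : C.mat.gr J = J) (hJa : C.mat.adj J = -J)
    (hJ2 : C.mat.comp J J = -C.mat.one X) {D' : C.mat.Hom X X} (hD' : C.mat.IsSupersymmetry D')
    (h : D' = -C.mat.comp J (C.mat.comp D J)) : hD.cl = hD'.cl := by
  refine hD.cl_eq_of_path hD' (fun t => rotation D J (t * (Real.pi / 2)))
    ((continuous_rotation D J).comp (by fun_prop))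
    (fun t => isSupersymmetry_rotation hD hJ hJa hJ2 _) ?_ ?_
  · simp [rotation]
  · rw [h]
    simp [rotation]

theorem exists_directSum (X Y : C.mat.Obj) : ∃ (Z : C.mat.Obj) (i : C.mat.Hom X Z)
    (j : C.mat.Hom Y Z) (h : C.mat.IsDirectSum i j),
    ∀ (x : C.mat.Hom X X) (y : C.mat.Hom Y Y) (hx : C.mat.IsSupersymmetry x)
      (hy : C.mat.IsSupersymmetry y), (h.isSupersymmetry hx hy).cl = hx.cl + hy.cl := by
  obtain ⟨m, P⟩ := X
  obtain ⟨n, Q⟩ := Y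
  obtain ⟨R, hP, hQ⟩ : ∃ R : Fin (m + n) → C.Obj,
      P = (fun i => R (Fin.castAdd n i)) ∧ Q = fun i => R (Fin.natAdd m i) :=
    ⟨Fin.append P Q, by funext i; simp, by funext i; simp⟩
  subst hP hQ
  let X : C.mat.Obj := ⟨m, fun i => R (Fin.castAdd n i)⟩
  let Y : C.mat.Obj := ⟨n, fun i => R (Fin.natAdd m i)⟩
  let Z : C.mat.Obj := ⟨m + n, R⟩
  let i : C.mat.Hom X Z := fun k l => C.oneMatrix R k (Fin.castAdd n l)
  let j : C.mat.Hom Y Z := fun k l => C.oneMatrix R k (Fin.natAdd m l)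
  have hi : ∀ {W : C.mat.Obj} (w : C.mat.Hom W Z) (k : Fin m) (l : Fin W.1),
      C.mat.comp (C.mat.adj i) w k l = w (Fin.castAdd n k) l := by
    intro W w k l
    refine Eq.trans ?_ (C.sum_oneMatrix_comp R (fun k => w k l) (Fin.castAdd n k))
    change ∑ p, C.comp (C.adj (C.oneMatrix R p (Fin.castAdd n k))) (w p l) = _
    simp only [C.adj_oneMatrix]
  have hj : ∀ {W : C.mat.Obj} (w : C.mat.Hom W Z) (k : Fin n) (l : Fin W.1),
      C.mat.comp (C.mat.adj j) w k l = w (Fin.natAdd m k) l := by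
    intro W w k l
    refine Eq.trans ?_ (C.sum_oneMatrix_comp R (fun k => w k l) (Fin.natAdd m k))
    change ∑ p, C.comp (C.adj (C.oneMatrix R p (Fin.natAdd m k))) (w p l) = _
    simp only [C.adj_oneMatrix]
  have hi' : ∀ {W : C.mat.Obj} (w : C.mat.Hom Z W) (k : Fin W.1) (l : Fin m),
      C.mat.comp w i k l = w k (Fin.castAdd n l) :=
    fun w k l => C.sum_comp_oneMatrix R (fun p => w k p) (Fin.castAdd n l)
  have hj' : ∀ {W : C.mat.Obj} (w : C.mat.Hom Z W) (k : Fin W.1) (l : Fin n),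
      C.mat.comp w j k l = w k (Fin.natAdd m l) :=
    fun w k l => C.sum_comp_oneMatrix R (fun p => w k p) (Fin.natAdd m l)
  have h : C.mat.IsDirectSum i j := by
    refine ⟨?_, ?_, ?_, ?_, ?_⟩
    · funext k l
      exact C.gr_oneMatrix _ _ _
    · funext k l
      exact C.gr_oneMatrix _ _ _
    · funext k l
      rw [hi]
      exact C.oneMatrix_of_injective R _ (Fin.castAdd_injective m n) k l
    · funext k l
      rw [hj]
      exact C.oneMatrix_of_injective R _ (Fin.natAdd_injective n m) k l
    · funext k l
      refine Eq.trans ?_ (C.sum_oneMatrix_comp R (fun p => C.oneMatrix R p l) k)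
      rw [Fin.sum_univ_add]
      change ∑ p, C.comp (C.oneMatrix R k (Fin.castAdd n p))
          (C.adj (C.oneMatrix R l (Fin.castAdd n p)))
        + ∑ p, C.comp (C.oneMatrix R k (Fin.natAdd m p))
          (C.adj (C.oneMatrix R l (Fin.natAdd m p))) = _
      simp only [C.adj_oneMatrix]
  refine ⟨Z, i, j, h, fun x y hx hy => ?_⟩
  refine GOne.mk_sum (x := hx.toSS) (y := hy.toSS) ⟨?_, ?_, ?_, ?_⟩
  · intro k l
    have := congrFun (congrFun (h.adj_comp_block_comp x y) k) l
    rw [hi, hi'] at this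
    exact this
  · intro k l
    have := congrFun (congrFun (h.adj_comp_block_comp_right x y) k) l
    rw [hj, hj'] at this
    exact this
  · intro k l
    have := congrFun (congrFun (h.adj_comp_block_comp_mixed x y) k) l
    rw [hi, hj'] at this
    exact this
  · intro k l
    have := congrFun (congrFun (h.adj_comp_block_comp_mixed' x y) k) l
    rw [hj, hi'] at this
    exact this

theorem IsSupersymmetry.cl_congr {X : C.mat.Obj} {x y : C.mat.Hom X X}
    (hx : C.mat.IsSupersymmetry x) (hy : C.mat.IsSupersymmetry y) (h : x = y) :
    hx.cl = hy.cl := by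
  subst h
  rfl

theorem IsEvenUnitary.cl_sub_cl {X Y : C.mat.Obj} {w : C.mat.Hom X Y}
    (hw : C.mat.IsEvenUnitary w) {x y : C.mat.Hom X X} (hx : C.mat.IsSupersymmetry x)
    (hy : C.mat.IsSupersymmetry y) :
    (hw.isSupersymmetry hx).cl - (hw.isSupersymmetry hy).cl = hx.cl - hy.cl := by
  obtain ⟨Z, i, j, h, hcl⟩ := exists_directSum X Y
  have h1 := hcl _ _ hx (hw.isSupersymmetry hy)
  have h2 := hcl _ _ hy (hw.isSupersymmetry hx)
  have h3 := (h.isSupersymmetry hx (hw.isSupersymmetry hy)).cl_rotation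
    (J := C.mat.comp j (C.mat.comp w (C.mat.adj i))
      - C.mat.comp i (C.mat.comp (C.mat.adj w) (C.mat.adj j))) ?_ ?_ ?_
    (h.isSupersymmetry hy (hw.isSupersymmetry hx)) ?_
  · rw [h1, h2] at h3
    rw [sub_eq_sub_iff_add_eq_add, add_comm, h3, add_comm]
  · simp only [C.mat.gr_sub, C.mat.gr_comp, C.mat.gr_adj, h.gr_left, h.gr_right, hw.gr]
  · simp only [C.mat.adj_sub, C.mat.adj_comp, C.mat.adj_adj, C.mat.assoc, neg_sub]
  · have hw2 : ∀ {W : C.mat.Obj} (z : C.mat.Hom W Y),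
        C.mat.comp w (C.mat.comp (C.mat.adj w) z) = z := by
      intro W z
      rw [← C.mat.assoc, hw.comp_adj_self, C.mat.one_comp]
    simp only [C.mat.sub_comp, C.mat.comp_sub, C.mat.assoc, h.cancel_left,
      h.cancel_right, h.cancel_orthogonal, h.cancel_orthogonal', C.mat.comp_zero, hw.cancel_left,
      hw2, sub_zero, zero_sub]
    rw [← h.complementary]
    abel
  · have hw2 : ∀ {W : C.mat.Obj} (z : C.mat.Hom W Y),
        C.mat.comp w (C.mat.comp (C.mat.adj w) z) = z := by
      intro W z
      rw [← C.mat.assoc, hw.comp_adj_self, C.mat.one_comp]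
    unfold block conj
    simp only [C.mat.sub_comp, C.mat.comp_sub, C.mat.add_comp, C.mat.comp_add, C.mat.assoc,
      h.cancel_left, h.cancel_right, h.cancel_orthogonal, h.cancel_orthogonal',
      C.mat.comp_zero, hw.cancel_left, hw2, sub_zero, zero_sub, add_zero, zero_add]
    abel

theorem IsDirectSum.cl_sub_cl {X Y Z : C.mat.Obj} {i : C.mat.Hom X Z} {j : C.mat.Hom Y Z}
    (h : C.mat.IsDirectSum i j) {x x' : C.mat.Hom X X} {y y' : C.mat.Hom Y Y}
    (hx : C.mat.IsSupersymmetry x) (hx' : C.mat.IsSupersymmetry x')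
    (hy : C.mat.IsSupersymmetry y) (hy' : C.mat.IsSupersymmetry y') :
    (h.isSupersymmetry hx hy).cl - (h.isSupersymmetry hx' hy').cl
      = hx.cl - hx'.cl + (hy.cl - hy'.cl) := by
  obtain ⟨W, i₀, j₀, h₀, hcl⟩ := exists_directSum X Y
  have h1 := (h₀.isEvenUnitary h).cl_sub_cl (h₀.isSupersymmetry hx hy)
    (h₀.isSupersymmetry hx' hy')
  rw [hcl _ _ hx hy, hcl _ _ hx' hy'] at h1
  have e1 := IsSupersymmetry.cl_congr ((h₀.isEvenUnitary h).isSupersymmetry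
    (h₀.isSupersymmetry hx hy)) (h.isSupersymmetry hx hy) (h₀.conj_block i j x y)
  have e2 := IsSupersymmetry.cl_congr ((h₀.isEvenUnitary h).isSupersymmetry
    (h₀.isSupersymmetry hx' hy')) (h.isSupersymmetry hx' hy') (h₀.conj_block i j x' y')
  rw [← e1, ← e2, h1]
  abel

end Mat

end UnitalGradedStarCategory

end Supersymmetry

/-! ## Frames of formal sums -/

section Frames

variable {𝕜 : Type} [RCLike 𝕜]

namespace UnitalGradedStarCategory

variable {C : UnitalGradedStarCategory.{u, v} 𝕜}

/-- An object as a formal sum. -/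
def single (a : C.Obj) : C.mat.Obj := ⟨1, fun _ => a⟩

/-- A morphism as a matrix. -/
def scalar {a b : C.Obj} (x : C.Hom a b) : C.mat.Hom (single a) (single b) := fun _ _ => x

theorem scalar_comp {a b c : C.Obj} (x : C.Hom b c) (y : C.Hom a b) :
    C.mat.comp (scalar x) (scalar y) = scalar (C.comp x y) := by
  funext i j
  exact Fin.sum_univ_one fun _ => C.comp x y

theorem one_single (a : C.Obj) : C.mat.one (single a) = scalar (C.one a) := by
  have h : ∀ i j : Fin 1, C.oneMatrix (fun _ : Fin 1 => a) i j = C.one a := by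
    intro i j
    obtain rfl : j = i := Subsingleton.elim _ _
    simp [oneMatrix]
  exact funext fun i => funext fun j => h i j

theorem IsSupersymmetry.scalar {a : C.Obj} {x : C.Hom a a} (hx : C.IsSupersymmetry x) :
    C.mat.IsSupersymmetry (scalar x) :=
  ⟨funext fun _ => funext fun _ => hx.gr, funext fun _ => funext fun _ => hx.adj, by
    rw [scalar_comp, hx.sq, one_single]⟩

theorem IsDirectSum.scalar {a b c : C.Obj} {i : C.Hom a c} {j : C.Hom b c}
    (h : C.IsDirectSum i j) : C.mat.IsDirectSum (scalar i) (scalar j) :=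
  ⟨funext fun _ => funext fun _ => h.gr_left, funext fun _ => funext fun _ => h.gr_right, by
    change C.mat.comp (UnitalGradedStarCategory.scalar (C.adj i)) _ = _
    rw [scalar_comp, h.isometry_left, one_single], by
    change C.mat.comp (UnitalGradedStarCategory.scalar (C.adj j)) _ = _
    rw [scalar_comp, h.isometry_right, one_single], by
    change C.mat.comp _ (UnitalGradedStarCategory.scalar (C.adj i))
      + C.mat.comp _ (UnitalGradedStarCategory.scalar (C.adj j)) = _
    rw [scalar_comp, scalar_comp, one_single, ← h.complementary]
    rfl⟩

/-- The class in `G₁` of a supersymmetry of an object. -/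
def IsSupersymmetry.kClass {a : C.Obj} {x : C.Hom a a} (hx : C.IsSupersymmetry x) : GOne C :=
  hx.scalar.cl

theorem IsSupersymmetry.kClass_eq_of_path {a : C.Obj} {x y : C.Hom a a}
    (hx : C.IsSupersymmetry x) (hy : C.IsSupersymmetry y) (γ : unitInterval → C.Hom a a)
    (hγ : Continuous γ) (hs : ∀ t, C.IsSupersymmetry (γ t)) (h0 : γ 0 = x) (h1 : γ 1 = y) :
    hx.kClass = hy.kClass := by
  refine GOne.mk_eq_of_joined ⟨⟨⟨fun t => (hs t).scalar.toSS, ?_⟩, ?_, ?_⟩⟩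
  · exact continuous_induced_rng.2 (continuous_pi fun _ => continuous_pi fun _ => hγ)
  · exact Subtype.ext (congrArg (UnitalGradedStarCategory.scalar (C := C)) h0)
  · exact Subtype.ext (congrArg (UnitalGradedStarCategory.scalar (C := C)) h1)

theorem IsSupersymmetry.kClass_sub_mem {a : C.Obj} {x y : C.Hom a a}
    (hx : C.IsSupersymmetry x) (hy : C.IsSupersymmetry y) : hx.kClass - hy.kClass ∈ KOne C :=
  ⟨_, _, hx.scalar.toSS, hy.scalar.toSS, rfl⟩

theorem IsDirectSum.kClass_sub_kClass {a b c : C.Obj} {i : C.Hom a c} {j : C.Hom b c}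
    (h : C.IsDirectSum i j) {x x' : C.Hom a a} {y y' : C.Hom b b} (hx : C.IsSupersymmetry x)
    (hx' : C.IsSupersymmetry x') (hy : C.IsSupersymmetry y) (hy' : C.IsSupersymmetry y') :
    (h.isSupersymmetry hx hy).kClass - (h.isSupersymmetry hx' hy').kClass
      = hx.kClass - hx'.kClass + (hy.kClass - hy'.kClass) := by
  have e : ∀ (z : C.Hom a a) (z' : C.Hom b b),
      C.mat.block (UnitalGradedStarCategory.scalar i) (UnitalGradedStarCategory.scalar j)
        (UnitalGradedStarCategory.scalar z) (UnitalGradedStarCategory.scalar z')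
        = UnitalGradedStarCategory.scalar (C.block i j z z') := by
    intro z z'
    have e1 : ∀ (z : C.Hom a a), C.mat.conj (UnitalGradedStarCategory.scalar i)
        (UnitalGradedStarCategory.scalar z)
          = UnitalGradedStarCategory.scalar (C.conj i z) := by
      intro z
      unfold conj
      rw [← scalar_comp, ← scalar_comp]
      rfl
    have e2 : ∀ (z : C.Hom b b), C.mat.conj (UnitalGradedStarCategory.scalar j)
        (UnitalGradedStarCategory.scalar z)
          = UnitalGradedStarCategory.scalar (C.conj j z) := by
      intro z
      unfold conj
      rw [← scalar_comp, ← scalar_comp]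
      rfl
    unfold block
    rw [e1, e2]
    rfl
  rw [IsSupersymmetry.kClass, IsSupersymmetry.kClass, IsSupersymmetry.kClass, IsSupersymmetry.kClass,
    IsSupersymmetry.kClass, IsSupersymmetry.kClass,
    ← h.scalar.cl_sub_cl hx.scalar hx'.scalar hy.scalar hy'.scalar,
    IsSupersymmetry.cl_congr _ (h.scalar.isSupersymmetry hx.scalar hy.scalar) (e x y).symm,
    IsSupersymmetry.cl_congr _ (h.scalar.isSupersymmetry hx'.scalar hy'.scalar) (e x' y').symm]

/-- The object `c` is the direct sum of a finite family of objects. -/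
structure IsFrame {n : ℕ} {P : Fin n → C.Obj} {c : C.Obj} (i : ∀ k, C.Hom (P k) c) : Prop where
  gr : ∀ k, C.gr (i k) = i k
  isometry : ∀ k, C.comp (C.adj (i k)) (i k) = C.one (P k)
  orthogonal : ∀ k l, k ≠ l → C.comp (C.adj (i k)) (i l) = 0
  complete : ∑ k, C.comp (i k) (C.adj (i k)) = C.one c

/-- The row matrix of a family. -/
def row {n : ℕ} {P : Fin n → C.Obj} {c : C.Obj} (i : ∀ k, C.Hom (P k) c) :
    C.mat.Hom ⟨n, P⟩ (single c) := fun _ k => i k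

theorem IsFrame.isEvenUnitary {n : ℕ} {P : Fin n → C.Obj} {c : C.Obj} {i : ∀ k, C.Hom (P k) c}
    (h : C.IsFrame i) : C.mat.IsEvenUnitary (row i) := by
  refine ⟨funext fun _ => funext fun k => h.gr k, ?_, ?_⟩
  · funext k l
    refine (Fin.sum_univ_one fun _ => C.comp (C.adj (i k)) (i l)).trans ?_
    change C.comp (C.adj (i k)) (i l) = C.oneMatrix P k l
    unfold oneMatrix
    by_cases hkl : l = k
    · subst hkl
      rw [dif_pos rfl]
      exact h.isometry l
    · rw [dif_neg hkl]
      exact h.orthogonal k l (Ne.symm hkl)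
  · rw [one_single]
    funext _ _
    exact h.complete

/-- The morphism of a direct sum with a given matrix. -/
def assemble {n : ℕ} {P : Fin n → C.Obj} {c : C.Obj} (i : ∀ k, C.Hom (P k) c)
    (x : ∀ k l, C.Hom (P l) (P k)) : C.Hom c c :=
  ∑ k, ∑ l, C.comp (i k) (C.comp (x k l) (C.adj (i l)))

theorem conj_row {n : ℕ} {P : Fin n → C.Obj} {c : C.Obj} (i : ∀ k, C.Hom (P k) c)
    (x : ∀ k l, C.Hom (P l) (P k)) :
    C.mat.conj (row i) (x : C.mat.Hom ⟨n, P⟩ ⟨n, P⟩) = scalar (assemble i x) := by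
  funext _ _
  exact Finset.sum_congr (s₁ := (Finset.univ : Finset (Fin n))) rfl fun k _ =>
    C.comp_sum Finset.univ (i k) fun l => C.comp (x k l) (C.adj (i l))

theorem IsFrame.isSupersymmetry_assemble {n : ℕ} {P : Fin n → C.Obj} {c : C.Obj}
    {i : ∀ k, C.Hom (P k) c} (h : C.IsFrame i) (x : SS C P) :
    C.IsSupersymmetry (assemble i x.1) := by
  have h1 := h.isEvenUnitary.isSupersymmetry (isSupersymmetry_of_SS x)
  rw [conj_row] at h1
  refine ⟨congrFun (congrFun h1.gr (0 : Fin 1)) (0 : Fin 1),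
    congrFun (congrFun h1.adj (0 : Fin 1)) (0 : Fin 1), ?_⟩
  have h2 := h1.sq
  rw [scalar_comp, one_single] at h2
  exact congrFun (congrFun h2 (0 : Fin 1)) (0 : Fin 1)

theorem IsFrame.kClass_sub_kClass {n : ℕ} {P : Fin n → C.Obj} {c : C.Obj}
    {i : ∀ k, C.Hom (P k) c} (h : C.IsFrame i) (x y : SS C P) {x' y' : C.Hom c c}
    (hx' : C.IsSupersymmetry x') (hy' : C.IsSupersymmetry y') (ex : x' = assemble i x.1)
    (ey : y' = assemble i y.1) :
    hx'.kClass - hy'.kClass = GOne.mk C x - GOne.mk C y := by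
  subst ex ey
  have h1 := h.isEvenUnitary.cl_sub_cl (isSupersymmetry_of_SS x) (isSupersymmetry_of_SS y)
  refine Eq.trans ?_ h1
  rw [IsSupersymmetry.kClass, IsSupersymmetry.kClass,
    IsSupersymmetry.cl_congr hx'.scalar _ (conj_row i x.1).symm,
    IsSupersymmetry.cl_congr hy'.scalar _ (conj_row i y.1).symm]

end UnitalGradedStarCategory

end Frames

/-! ## Cycles and supersymmetries -/

section CycleClass

variable {𝕜 : Type} [RCLike 𝕜] {A : GradedCStarCategory.{v} 𝕜} {B : GradedCStarCategory.{u} 𝕜}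
  {E F G : Bimodule A B}

open UnitalGradedStarCategory

theorem IsCycle.isDual {T : BiOp E E} (h : IsCycle E T) : T.IsDual :=
  BiOp.isDual_of_gr_neg h.degree h.comm

theorem IsCycle.isLocallyCompact_sub_adj {T : BiOp E E} (h : IsCycle E T) :
    (T - T.adj).IsLocallyCompact := by
  intro a a' x
  refine ⟨?_, h.adj a a' x⟩
  have h1 := Op.adj_compact (h.adj a' a (A.adj x))
  rw [Op.adj_comp, ← E.map_adj, A.adj_adj, Op.adj_sub, Op.adj_adj, ← neg_sub, Op.neg_comp] at h1
  exact neg_mem_iff.1 h1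

theorem BiOp.IsLocallyCompact.neg {T : BiOp E F} (h : T.IsLocallyCompact) :
    (-T).IsLocallyCompact := by
  intro a a' x
  rw [neg_at, neg_at, Op.neg_comp, Op.comp_neg]
  exact ⟨neg_mem (h a a' x).1, neg_mem (h a a' x).2⟩

theorem BiOp.IsLocallyCompact.add {S T : BiOp E F} (h : S.IsLocallyCompact)
    (h' : T.IsLocallyCompact) : (S + T).IsLocallyCompact := by
  intro a a' x
  rw [add_at, add_at, Op.add_comp, Op.comp_add]
  exact ⟨add_mem (h a a' x).1 (h' a a' x).1, add_mem (h a a' x).2 (h' a a' x).2⟩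

theorem IsCycle.isLocallyCompact_sq_sub_one {T : BiOp E E} (h : IsCycle E T) :
    (BiOp.comp T T - BiOp.one E).IsLocallyCompact := by
  intro a a' x
  refine ⟨?_, h.sq a a' x⟩
  have h0 := h.isLocallyCompact_sub_adj
  have h2 : (BiOp.comp T.adj T.adj - BiOp.comp T T).IsLocallyCompact := by
    have e : BiOp.comp T.adj T.adj - BiOp.comp T T
        = -(BiOp.comp T.adj (T - T.adj) + BiOp.comp (T - T.adj) T) := by
      rw [BiOp.comp_sub, BiOp.sub_comp]
      abel
    rw [e]
    exact ((h0.comp_left h.isDual.adj).add (h0.comp_right h.isDual)).neg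
  have h3 := add_mem (h2 a' a (A.adj x)).2 (h.sq a' a (A.adj x))
  rw [← Op.comp_add] at h3
  have h1 := Op.adj_compact h3
  rw [Op.adj_comp, ← E.map_adj, A.adj_adj] at h1
  have e : ((BiOp.comp T.adj T.adj - BiOp.comp T T).at' a'
      + (Op.comp (T.at' a') (T.at' a') - Op.one (E.obj a'))).adj
      = (BiOp.comp T T - BiOp.one E).at' a' := by
    rw [BiOp.sub_at, BiOp.comp_at, BiOp.comp_at, sub_add_sub_cancel, Op.adj_sub, Op.adj_comp,
      BiOp.adj_at, Op.adj_adj, Op.adj_one]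
    rfl
  rw [e] at h1
  exact h1

theorem IsCycle.isSupersymmetry {T : BiOp E E} (h : IsCycle E T) :
    (QD A B).IsSupersymmetry (a := E) (QDHom.mk T h.isDual) where
  gr := by
    change QDHom.mk T.gr _ = QDHom.mk (-T) (by rw [← h.degree]; exact h.isDual.gr)
    congr 1
    exact h.degree
  adj := QDHom.mk_eq_mk.2 (by
    rw [← neg_sub]
    exact h.isLocallyCompact_sub_adj.neg)
  sq := QDHom.mk_eq_mk.2 h.isLocallyCompact_sq_sub_one

theorem IsCycle.of_isSupersymmetry {T : BiOp E E} (hT : T.IsDual) (hg : T.gr = -T)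
    (h : (QD A B).IsSupersymmetry (a := E) (QDHom.mk T hT)) : IsCycle E T where
  degree := hg
  adj a a' x := by
    have h1 := (QDHom.mk_eq_mk.1 h.adj).neg a a' x
    rw [neg_sub] at h1
    exact h1.2
  sq a a' x := ((QDHom.mk_eq_mk (hS := hT.comp hT) (hT := BiOp.IsDual.one E)).1 h.sq a a' x).2
  comm a a' x := by
    have h1 := (hT a a' x).2
    rwa [BiOp.odd_of_gr_neg hg] at h1

theorem BiOp.gr_odd (T : BiOp E F) : T.odd.gr = -T.odd := by
  refine ext fun a => ?_
  simp only [odd, smul_at, sub_at, gr_at, neg_at, Op.gr_smul, Op.gr_sub, Op.gr_gr]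
  module

theorem BiOp.IsDual.odd {T : BiOp E F} (hT : T.IsDual) : T.odd.IsDual := by
  refine isDual_of_gr_neg T.gr_odd fun a a' x => (hT a a' x).2

theorem QDHom.mk_odd {T : BiOp E F} (hT : T.IsDual)
    (h : (mk T hT).gr = -mk T hT) :
    mk T.odd hT.odd = mk T hT := by
  have h1 : mk T.odd hT.odd = (2⁻¹ : 𝕜) • (mk T hT - (mk T hT).gr) := rfl
  rw [h1, h]
  module

theorem exists_isCycle_of_isSupersymmetry {x : QDHom E E}
    (hx : (QD A B).IsSupersymmetry (a := E) x) :
    ∃ (T : BiOp E E) (h : IsCycle E T), QDHom.mk T h.isDual = x := by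
  induction x using QDHom.ind with
  | h T hT =>
    have h1 := QDHom.mk_odd hT hx.gr
    refine ⟨T.odd, IsCycle.of_isSupersymmetry hT.odd T.gr_odd ?_, h1⟩
    rw [h1]
    exact hx

theorem operatorHomotopic_of_path {S T : BiOp E E} (hS : IsCycle E S) (hT : IsCycle E T)
    (γ : unitInterval → QDHom E E) (hγ : Continuous γ)
    (hs : ∀ t, (QD A B).IsSupersymmetry (a := E) (γ t)) (h0 : γ 0 = QDHom.mk S hS.isDual)
    (h1 : γ 1 = QDHom.mk T hT.isDual) : OperatorHomotopic S T := by
  have : IsClosed ((locallyCompactHom E E : Submodule 𝕜 (dualHom E E)) : Set (dualHom E E)) :=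
    isClosed_locallyCompactHom E E
  obtain ⟨Γ, hΓ⟩ := exists_lift_of_quotient (𝕜 := 𝕜) (locallyCompactHom E E) ⟨γ, hγ⟩
  let S' : dualHom E E := ⟨S, hS.isDual⟩
  let T' : dualHom E E := ⟨T, hT.isDual⟩
  let Δ : unitInterval → dualHom E E := fun t =>
    Γ t + ((1 - t : ℝ) : 𝕜) • (S' - Γ 0) + ((t : ℝ) : 𝕜) • (T' - Γ 1)
  have hΔ : Continuous Δ := by
    refine (Γ.continuous.add ?_).add ?_
    · exact Continuous.smul (f := fun t : unitInterval => ((1 - t : ℝ) : 𝕜))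
        (RCLike.continuous_ofReal.comp (continuous_const.sub continuous_subtype_val))
        continuous_const
    · exact Continuous.smul (f := fun t : unitInterval => ((t : ℝ) : 𝕜))
        (RCLike.continuous_ofReal.comp continuous_subtype_val) continuous_const
  have e0 : (locallyCompactHom E E).mkQ (S' - Γ 0) = 0 := by
    rw [map_sub, hΓ]
    exact sub_eq_zero.2 h0.symm
  have e1 : (locallyCompactHom E E).mkQ (T' - Γ 1) = 0 := by
    rw [map_sub, hΓ]
    exact sub_eq_zero.2 h1.symm
  have hmk : ∀ t, QDHom.mk (Δ t).1 (Δ t).2 = γ t := by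
    intro t
    have : (locallyCompactHom E E).mkQ (Δ t) = γ t := by
      rw [map_add, map_add, map_smul, map_smul, e0, e1, smul_zero, smul_zero, add_zero, add_zero]
      exact hΓ t
    exact this
  have hsym : ∀ t, IsCycle E (Δ t).1.odd := by
    intro t
    have h2 := hs t
    rw [← hmk t] at h2
    refine IsCycle.of_isSupersymmetry (BiOp.IsDual.odd (Δ t).2) (BiOp.gr_odd _) ?_
    rw [QDHom.mk_odd (Δ t).2 h2.gr]
    exact h2
  refine ⟨⟨⟨fun t => (Δ t).1.odd, BiOp.continuous_odd.comp (continuous_subtype_val.comp hΔ)⟩,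
    ?_, ?_⟩, hsym⟩
  · have : Δ 0 = S' := by simp [Δ]
    change (Δ 0).1.odd = S
    rw [this]
    exact BiOp.odd_of_gr_neg hS.degree
  · have : Δ 1 = T' := by simp [Δ]
    change (Δ 1).1.odd = T
    rw [this]
    exact BiOp.odd_of_gr_neg hT.degree

theorem QDHom.continuous_comp_left (x : QDHom F G) :
    Continuous fun y : QDHom E F => QDHom.comp x y := by
  induction x using QDHom.ind with
  | h S hS =>
    have h1 : Continuous fun T : BiOp E F => BiOp.comp S T :=
      AddMonoidHomClass.continuous_of_bound (⟨⟨fun T => BiOp.comp S T, BiOp.comp_zero S⟩,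
        BiOp.comp_add S⟩ : BiOp E F →+ BiOp E G) ‖S‖ fun T => BiOp.norm_comp_le S T
    have h2 : Continuous fun T : dualHom E F =>
        (⟨BiOp.comp S T.1, BiOp.IsDual.comp hS T.2⟩ : dualHom E G) :=
      (h1.comp continuous_subtype_val).subtype_mk _
    exact continuous_quot_lift _ (continuous_quot_mk.comp h2)

theorem QDHom.continuous_comp_right (x : QDHom E F) :
    Continuous fun y : QDHom F G => QDHom.comp y x := by
  induction x using QDHom.ind with
  | h S hS =>
    have h1 : Continuous fun T : BiOp F G => BiOp.comp T S :=
      AddMonoidHomClass.continuous_of_bound (⟨⟨fun T => BiOp.comp T S, BiOp.zero_comp S⟩,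
        fun T T' => BiOp.add_comp T T' S⟩ : BiOp F G →+ BiOp E G) ‖S‖ fun T => by
          rw [mul_comm]
          exact BiOp.norm_comp_le T S
    have h2 : Continuous fun T : dualHom F G =>
        (⟨BiOp.comp T.1 S, BiOp.IsDual.comp T.2 hS⟩ : dualHom E G) :=
      (h1.comp continuous_subtype_val).subtype_mk _
    exact continuous_quot_lift _ (continuous_quot_mk.comp h2)

end CycleClass

namespace UnitalGradedStarCategory

variable {𝕜 : Type} [RCLike 𝕜] {C : UnitalGradedStarCategory.{u, v} 𝕜}

theorem conj_assemble {n : ℕ} {P : Fin n → C.Obj} {a b : C.Obj} (w : C.Hom a b)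
    (i : ∀ k, C.Hom (P k) a) (x : ∀ k l, C.Hom (P l) (P k)) :
    C.conj w (assemble i x) = assemble (fun k => C.comp w (i k)) x := by
  unfold conj assemble
  simp only [C.sum_comp, C.comp_sum, C.adj_comp, C.assoc]

theorem assemble_block {m n : ℕ} {P : Fin (m + n) → C.Obj} {a b c : C.Obj} (w : C.Hom a c)
    (w' : C.Hom b c) (i : ∀ k, C.Hom (P (Fin.castAdd n k)) a)
    (j : ∀ k, C.Hom (P (Fin.natAdd m k)) b) (f : ∀ k, C.Hom (P k) c)
    (hi : ∀ k, f (Fin.castAdd n k) = C.comp w (i k))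
    (hj : ∀ k, f (Fin.natAdd m k) = C.comp w' (j k)) {x : SS C fun i => P (Fin.castAdd n i)}
    {y : SS C fun i => P (Fin.natAdd m i)} {z : SS C P} (hz : IsBlockSum C P x y z) :
    assemble f z.1 = C.block w w' (assemble i x.1) (assemble j y.1) := by
  unfold block
  rw [conj_assemble, conj_assemble]
  unfold assemble
  simp only [Fin.sum_univ_add, hz.1, hz.2.1, hz.2.2.1, hz.2.2.2, hi, hj, C.zero_comp, C.comp_zero,
    Finset.sum_const_zero, add_zero, zero_add]

end UnitalGradedStarCategory

section Represents

variable {𝕜 : Type} [RCLike 𝕜] {A : GradedCStarCategory.{v} 𝕜} {B : GradedCStarCategory.{u} 𝕜}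
  {E F G : Bimodule A B}

open UnitalGradedStarCategory

theorem QDHom.mk_congr {S T : BiOp E F} (h : S = T) (hS : S.IsDual) (hT : T.IsDual) :
    mk S hS = mk T hT := by
  subst h
  rfl

theorem QDHom.sum_mk {ι : Type*} (s : Finset ι) (T : ι → BiOp E F) (hT : ∀ i, (T i).IsDual)
    (h : (∑ i ∈ s, T i).IsDual) : ∑ i ∈ s, mk (T i) (hT i) = mk (∑ i ∈ s, T i) h := by
  have h1 : ∑ i ∈ s, mk (T i) (hT i)
      = (locallyCompactHom E F).mkQ (∑ i ∈ s, (⟨T i, hT i⟩ : dualHom E F)) :=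
    (map_sum (locallyCompactHom E F).mkQ (fun i => (⟨T i, hT i⟩ : dualHom E F)) s).symm
  rw [h1]
  refine congrArg (locallyCompactHom E F).mkQ (Subtype.ext ?_)
  exact AddSubmonoidClass.coe_finsetSum _ _

/-- The class of an intertwiner in `QD(A, B)`. -/
def BiOp.IsIntertwiner.toQD {T : BiOp E F} (hT : T.IsIntertwiner) : QDHom E F :=
  QDHom.mk T hT.isDual

theorem IsFrame.toQD {n : ℕ} {P : Fin n → Bimodule A B} {i : ∀ k, BiOp (P k) E}
    (h : _root_.IsFrame i) :
    (QD A B).IsFrame (P := P) (c := E) fun k => (h.intertwiner k).toQD where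
  gr k := QDHom.mk_congr (h.intertwiner k).degree _ _
  isometry k := QDHom.mk_congr (h.isometry k) _ _
  orthogonal k l hkl := QDHom.mk_congr (h.orthogonal k l hkl)
    ((h.intertwiner k).adj.comp (h.intertwiner l)).isDual BiOp.IsIntertwiner.zero.isDual
  complete := (QDHom.sum_mk _ _ (fun k => ((h.intertwiner k).comp (h.intertwiner k).adj).isDual)
    (by rw [h.complete]; exact BiOp.IsDual.one E)).trans (QDHom.mk_congr h.complete _ _)

theorem IsBimoduleSum.toQD {i : BiOp E G} {j : BiOp F G} (h : IsBimoduleSum i j) :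
    (QD A B).IsDirectSum (a := E) (b := F) (c := G) h.intertwiner_left.toQD
      h.intertwiner_right.toQD where
  gr_left := QDHom.mk_congr h.intertwiner_left.degree _ _
  gr_right := QDHom.mk_congr h.intertwiner_right.degree _ _
  isometry_left := QDHom.mk_congr h.isometry_left _ _
  isometry_right := QDHom.mk_congr h.isometry_right _ _
  complementary := QDHom.mk_congr h.complementary
    (by rw [h.complementary]; exact BiOp.IsDual.one G) (BiOp.IsDual.one G)

/-- The bimodule of the cycle `c` is the direct sum of the bimodules `P k`, and `x` is the class
of the matrix of its operator. -/
def KasparovCycle.Represents (c : KasparovCycle A B) {n : ℕ} {P : Fin n → Bimodule A B}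
    (x : SS (QD A B) P) : Prop :=
  ∃ (i : ∀ k, BiOp (P k) c.E) (h : _root_.IsFrame i), QDHom.mk c.F c.isCycle.isDual
    = assemble (C := QD A B) (P := P) (c := c.E) (fun k => (h.intertwiner k).toQD) x.1

theorem exists_isCycle_assemble {n : ℕ} {P : Fin n → Bimodule A B} {i : ∀ k, BiOp (P k) E}
    (h : _root_.IsFrame i) (x : SS (QD A B) P) : ∃ (T : BiOp E E) (hT : IsCycle E T),
      QDHom.mk T hT.isDual
        = assemble (C := QD A B) (P := P) (c := E) (fun k => (h.intertwiner k).toQD) x.1 :=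
  exists_isCycle_of_isSupersymmetry (h.toQD.isSupersymmetry_assemble x)

theorem exists_frame {n : ℕ} (P : Fin n → Bimodule A B) :
    ∃ (E : Bimodule A B) (i : ∀ k, BiOp (P k) E), _root_.IsFrame i :=
  ⟨_, _, Bimodule.isFrame_sumIncl (Bimodule.isBounded_of_finite P)⟩

theorem exists_represents {n : ℕ} {P : Fin n → Bimodule A B} (x : SS (QD A B) P) :
    ∃ c : KasparovCycle A B, c.Represents x := by
  obtain ⟨E, i, h⟩ := exists_frame P
  obtain ⟨T, hT, e⟩ := exists_isCycle_assemble h x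
  exact ⟨⟨E, T, hT⟩, i, h, e⟩

section Unitary

variable {n : ℕ} {P : Fin n → Bimodule A B} {i : ∀ k, BiOp (P k) E} {j : ∀ k, BiOp (P k) F}

/-- The operator mapping a frame to another one. -/
def frameMap (i : ∀ k, BiOp (P k) E) (j : ∀ k, BiOp (P k) F) : BiOp E F :=
  ∑ k, BiOp.comp (j k) (i k).adj

theorem frameMap_adj : (frameMap i j).adj = frameMap j i := by
  unfold frameMap
  rw [BiOp.adj_sum]
  exact Finset.sum_congr rfl fun k _ => by rw [BiOp.adj_comp, BiOp.adj_adj]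

theorem frameMap_comp (h : _root_.IsFrame i) (k : Fin n) :
    BiOp.comp (frameMap i j) (i k) = j k := by
  unfold frameMap
  rw [BiOp.sum_comp, Finset.sum_eq_single_of_mem k (Finset.mem_univ k), BiOp.comp_assoc,
    h.isometry, BiOp.comp_one]
  intro l _ hl
  rw [BiOp.comp_assoc, h.orthogonal l k hl, BiOp.comp_zero]

theorem frameMap_comp_frameMap (h : _root_.IsFrame i) (h' : _root_.IsFrame j) :
    BiOp.comp (frameMap j i) (frameMap i j) = BiOp.one E := by
  conv_lhs => rw [frameMap.eq_def i j]
  rw [BiOp.comp_sum, ← h.complete]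
  exact Finset.sum_congr rfl fun k _ => by rw [← BiOp.comp_assoc, frameMap_comp h']

theorem isIntertwiner_frameMap (h : _root_.IsFrame i) (h' : _root_.IsFrame j) :
    (frameMap i j).IsIntertwiner :=
  BiOp.IsIntertwiner.sum _ fun k => (h'.intertwiner k).comp (h.intertwiner k).adj

theorem IsFrame.exists_unitary (h : _root_.IsFrame i) (h' : _root_.IsFrame j) :
    ∃ W : BiOp E F, W.IsIntertwiner ∧ BiOp.comp W.adj W = BiOp.one E ∧
      BiOp.comp W W.adj = BiOp.one F ∧ ∀ k, BiOp.comp W (i k) = j k :=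
  ⟨frameMap i j, isIntertwiner_frameMap h h',
    by rw [frameMap_adj, frameMap_comp_frameMap h h'],
    by rw [frameMap_adj, frameMap_comp_frameMap h' h], frameMap_comp h⟩

end Unitary

theorem IsCycle.conj {T : BiOp E E} (hT : IsCycle E T) {W : BiOp E F} (hW : W.IsIntertwiner)
    (h1 : BiOp.comp W.adj W = BiOp.one E) (h2 : BiOp.comp W W.adj = BiOp.one F) :
    IsCycle F (BiOp.comp W (BiOp.comp T W.adj)) := by
  obtain ⟨h3, h4, h5, h6⟩ := isCycle_iff.1 hT
  refine isCycle_iff.2 ⟨?_, ?_, ?_, ?_⟩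
  · rw [BiOp.gr_comp, BiOp.gr_comp, BiOp.gr_adj, hW.degree, h3, BiOp.neg_comp, BiOp.comp_neg]
  · have e : BiOp.comp W (BiOp.comp T W.adj) - (BiOp.comp W (BiOp.comp T W.adj)).adj
        = BiOp.comp W (BiOp.comp (T - T.adj) W.adj) := by
      rw [BiOp.adj_comp, BiOp.adj_comp, BiOp.adj_adj, BiOp.comp_assoc, BiOp.sub_comp,
        BiOp.comp_sub]
    rw [e]
    exact (h4.comp_right _).comp_left hW
  · have e : BiOp.comp (BiOp.comp W (BiOp.comp T W.adj)) (BiOp.comp W (BiOp.comp T W.adj))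
          - BiOp.one F = BiOp.comp W (BiOp.comp (BiOp.comp T T - BiOp.one E) W.adj) := by
      rw [BiOp.sub_comp, BiOp.comp_sub, BiOp.one_comp, h2, BiOp.comp_assoc, BiOp.comp_assoc,
        ← BiOp.comp_assoc W.adj, h1, BiOp.one_comp, BiOp.comp_assoc T]
    rw [e]
    exact (h5.comp_right _).comp_left hW
  · exact (h6.comp_right hW.adj).comp_left hW

theorem continuous_assemble {n : ℕ} {P : Fin n → (QD A B).Obj} {E : (QD A B).Obj}
    (i : ∀ k, (QD A B).Hom (P k) E) :
    Continuous fun x : ∀ k l, (QD A B).Hom (P l) (P k) => assemble i x := by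
  refine continuous_finsetSum _ fun k _ => continuous_finsetSum _ fun l _ => ?_
  exact (QDHom.continuous_comp_left (i k)).comp
    ((QDHom.continuous_comp_right ((QD A B).adj (i l))).comp
      ((continuous_apply l).comp (continuous_apply k)))

theorem KasparovCycle.Represents.mk_eq {n : ℕ} {P : Fin n → (QD A B).Obj}
    {x y : SS (QD A B) P} (hxy : Joined x y) {c c' : KasparovCycle A B} (h : c.Represents x)
    (h' : c'.Represents y) : KK.mk c = KK.mk c' := by
  obtain ⟨i, hi, e⟩ := h
  obtain ⟨j, hj, e'⟩ := h'
  obtain ⟨W, hW, h1, h2, hWi⟩ := hi.exists_unitary hj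
  have hc := c.isCycle.conj hW h1 h2
  have e1 : KK.mk c = KK.mk ⟨c'.E, _, hc⟩ :=
    KK.mk_eq_of_isSum KasparovCycle.isDegenerate_zero (KasparovCycle.IsSum.of_unitary hW h1 h2 (by
      change BiOp.comp (BiOp.comp W (BiOp.comp c.F W.adj)) W = _
      rw [BiOp.comp_assoc, BiOp.comp_assoc, h1, BiOp.comp_one]))
  rw [e1]
  have e2 : QDHom.mk _ hc.isDual = assemble (C := QD A B) (P := P) (c := c'.E)
      (fun k => (hj.intertwiner k).toQD) x.1 := by
    have e3 : QDHom.mk _ hc.isDual = (QD A B).conj (a := c.E) (b := c'.E) hW.toQD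
      (QDHom.mk c.F c.isCycle.isDual) := rfl
    have e4 : ∀ k, (QD A B).comp (a := P k) (b := c.E) (c := c'.E) hW.toQD
        (hi.intertwiner k).toQD = (hj.intertwiner k).toQD := fun k =>
      QDHom.mk_congr (hWi k) _ _
    rw [e3, e]
    refine (conj_assemble (C := QD A B) (P := P) (a := c.E) (b := c'.E) hW.toQD _ x.1).trans ?_
    exact congrArg (fun f => assemble (C := QD A B) (P := P) (c := c'.E) f x.1) (funext e4)
  obtain ⟨γ⟩ := hxy
  refine KK.mk_eq_of_homotopic hc c'.isCycle (operatorHomotopic_of_path hc c'.isCycle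
    (fun t => assemble (C := QD A B) (P := P) (c := c'.E) (fun k => (hj.intertwiner k).toQD)
      (γ t).1) ?_ (fun t => hj.toQD.isSupersymmetry_assemble (γ t)) ?_ ?_)
  · have h3 : ∀ (Q : (QD A B).Obj) (f : ∀ k, (QD A B).Hom (P k) Q),
        Continuous fun t => assemble f (γ t).1 := fun Q f =>
      (continuous_assemble f).comp (continuous_induced_dom.comp γ.continuous)
    exact h3 c'.E _
  · rw [e2, γ.source]
  · rw [e', γ.target]

theorem KasparovCycle.Represents.isSum {m n : ℕ} {P : Fin (m + n) → Bimodule A B}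
    {x : SS (QD A B) fun i => P (Fin.castAdd n i)} {y : SS (QD A B) fun i => P (Fin.natAdd m i)}
    {z : SS (QD A B) P} (hz : IsBlockSum (QD A B) P x y z) {c c' d : KasparovCycle A B}
    (h : c.Represents x) (h' : c'.Represents y) (hd : c.IsSum c' d) : d.Represents z := by
  obtain ⟨i, hi, e⟩ := h
  obtain ⟨j, hj, e'⟩ := h'
  obtain ⟨i₁, i₂, hs, hF1, hF2⟩ := hd
  let f : ∀ k, BiOp (P k) d.E := fun k => Fin.addCases (motive := fun k => BiOp (P k) d.E)
    (fun k => BiOp.comp i₁ (i k)) (fun k => BiOp.comp i₂ (j k)) k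
  have fl : ∀ k, f (Fin.castAdd n k) = BiOp.comp i₁ (i k) := fun k => Fin.addCases_left _
  have fr : ∀ k, f (Fin.natAdd m k) = BiOp.comp i₂ (j k) := fun k => Fin.addCases_right _
  have hf : _root_.IsFrame f := by
    refine ⟨fun k => ?_, fun k => ?_, fun k l hkl => ?_, ?_⟩
    · induction k using Fin.addCases with
      | left k => rw [fl]; exact hs.intertwiner_left.comp (hi.intertwiner k)
      | right k => rw [fr]; exact hs.intertwiner_right.comp (hj.intertwiner k)
    · induction k using Fin.addCases with
      | left k =>
        rw [fl, BiOp.adj_comp, BiOp.comp_assoc, ← BiOp.comp_assoc i₁.adj, hs.isometry_left,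
          BiOp.one_comp, hi.isometry]
      | right k =>
        rw [fr, BiOp.adj_comp, BiOp.comp_assoc, ← BiOp.comp_assoc i₂.adj, hs.isometry_right,
          BiOp.one_comp, hj.isometry]
    · induction k using Fin.addCases with
      | left k =>
        induction l using Fin.addCases with
        | left l =>
          rw [fl, fl, BiOp.adj_comp, BiOp.comp_assoc, ← BiOp.comp_assoc i₁.adj, hs.isometry_left,
            BiOp.one_comp, hi.orthogonal k l fun h => hkl (by rw [h])]
        | right l =>
          rw [fl, fr, BiOp.adj_comp, BiOp.comp_assoc, ← BiOp.comp_assoc i₁.adj, hs.orthogonal',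
            BiOp.zero_comp, BiOp.comp_zero]
      | right k =>
        induction l using Fin.addCases with
        | left l =>
          rw [fl, fr, BiOp.adj_comp, BiOp.comp_assoc, ← BiOp.comp_assoc i₂.adj, hs.orthogonal,
            BiOp.zero_comp, BiOp.comp_zero]
        | right l =>
          rw [fr, fr, BiOp.adj_comp, BiOp.comp_assoc, ← BiOp.comp_assoc i₂.adj,
            hs.isometry_right, BiOp.one_comp, hj.orthogonal k l fun h => hkl (by rw [h])]
    · rw [Fin.sum_univ_add]
      simp only [fl, fr, BiOp.adj_comp, BiOp.comp_assoc]
      rw [← BiOp.comp_sum, ← BiOp.comp_sum]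
      simp only [← BiOp.comp_assoc]
      rw [← BiOp.sum_comp, ← BiOp.sum_comp, hi.complete, hj.complete, BiOp.one_comp,
        BiOp.one_comp, hs.complementary]
  have el : ∀ k, (hf.intertwiner (Fin.castAdd n k)).toQD
      = (QD A B).comp (a := P (Fin.castAdd n k)) (b := c.E) (c := d.E) hs.intertwiner_left.toQD
        (hi.intertwiner k).toQD := fun k => QDHom.mk_congr (fl k) _ _
  have er : ∀ k, (hf.intertwiner (Fin.natAdd m k)).toQD
      = (QD A B).comp (a := P (Fin.natAdd m k)) (b := c'.E) (c := d.E) hs.intertwiner_right.toQD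
        (hj.intertwiner k).toQD := fun k => QDHom.mk_congr (fr k) _ _
  have ed : QDHom.mk d.F d.isCycle.isDual = (QD A B).block (a := c.E) (b := c'.E) (c := d.E)
      hs.intertwiner_left.toQD hs.intertwiner_right.toQD (QDHom.mk c.F c.isCycle.isDual)
      (QDHom.mk c'.F c'.isCycle.isDual) :=
    QDHom.mk_congr (hs.eq_diag hF1 hF2) _ (c.isCycle.diag hs c'.isCycle).isDual
  refine ⟨f, hf, ?_⟩
  rw [ed, e, e']
  exact (assemble_block (C := QD A B) (P := P) (a := c.E) (b := c'.E) (c := d.E)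
    hs.intertwiner_left.toQD hs.intertwiner_right.toQD _ _ _ el er hz).symm

end Represents

section Index

variable {𝕜 : Type} [RCLike 𝕜] {A : GradedCStarCategory.{v} 𝕜} {B : GradedCStarCategory.{u} 𝕜}
  {E F G : Bimodule A B}

open UnitalGradedStarCategory

/-! ## The homomorphism from `G₁` to `KK` -/

/-- The homomorphism `⟨x⟩ ↦ [(E, F)]` where `(E, F)` is a cycle representing `x`. -/
def GOne.toKK : GOne (QD A B) →+ KK A B :=
  QuotientAddGroup.lift _
    (FreeAbelianGroup.lift fun s => KK.mk (exists_represents (P := s.P) s.x).choose) (by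
      rw [AddSubgroup.closure_le]
      rintro _ (⟨P, x, y, h⟩ | ⟨P, x, y, z, h⟩)
      · change FreeAbelianGroup.lift _ _ = _
        rw [map_sub, FreeAbelianGroup.lift_apply_of, FreeAbelianGroup.lift_apply_of, sub_eq_zero]
        exact KasparovCycle.Represents.mk_eq h (exists_represents (P := P) x).choose_spec
          (exists_represents (P := P) y).choose_spec
      · change FreeAbelianGroup.lift _ _ = _
        rw [map_sub, map_sub, FreeAbelianGroup.lift_apply_of, FreeAbelianGroup.lift_apply_of,
          FreeAbelianGroup.lift_apply_of, sub_sub, sub_eq_zero]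
        obtain ⟨d, hd⟩ := KasparovCycle.exists_isSum
          (exists_represents (P := fun i => P (Fin.castAdd _ i)) x).choose
          (exists_represents (P := fun i => P (Fin.natAdd _ i)) y).choose
        refine Eq.trans ?_ (KK.mk_sum hd)
        exact KasparovCycle.Represents.mk_eq (Joined.refl z)
          (exists_represents (P := P) z).choose_spec
          (KasparovCycle.Represents.isSum h (exists_represents _).choose_spec
            (exists_represents _).choose_spec hd))

theorem GOne.toKK_mk {n : ℕ} {P : Fin n → (QD A B).Obj} {x : SS (QD A B) P}
    {c : KasparovCycle A B} (h : c.Represents x) : GOne.toKK (GOne.mk _ x) = KK.mk c := by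
  have h1 : GOne.toKK (GOne.mk _ x) = KK.mk (exists_represents (P := P) x).choose :=
    FreeAbelianGroup.lift_apply_of _ _
  rw [h1]
  exact KasparovCycle.Represents.mk_eq (Joined.refl x)
    (exists_represents (P := P) x).choose_spec h

/-! ## The class of a cycle -/

/-- The class in `G₁` of the operator of a cycle. -/
def IsCycle.kClass {T : BiOp E E} (h : IsCycle E T) : GOne (QD A B) := h.isSupersymmetry.kClass

theorem IsCycle.kClass_sub_mem {S T : BiOp E E} (hS : IsCycle E S) (hT : IsCycle E T) :
    hS.kClass - hT.kClass ∈ KOne (QD A B) :=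
  hS.isSupersymmetry.kClass_sub_mem hT.isSupersymmetry

theorem isFrame_one (E : Bimodule A B) : _root_.IsFrame (P := fun _ : Fin 1 => E)
    fun _ => BiOp.one E where
  intertwiner _ := BiOp.IsIntertwiner.one E
  isometry _ := by rw [BiOp.adj_one, BiOp.comp_one]
  orthogonal k l h := absurd (Subsingleton.elim k l) h
  complete := by rw [Fin.sum_univ_one, BiOp.adj_one, BiOp.comp_one]

theorem IsCycle.toKK_kClass {T : BiOp E E} (h : IsCycle E T) :
    GOne.toKK h.kClass = KK.mk ⟨E, T, h⟩ := by
  refine GOne.toKK_mk ⟨_, isFrame_one E, ?_⟩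
  refine Eq.symm ((Fin.sum_univ_one _).trans ((Fin.sum_univ_one _).trans ?_))
  refine QDHom.mk_congr (S := BiOp.comp (BiOp.one E) (BiOp.comp T (BiOp.one E).adj)) ?_
    ((BiOp.IsDual.one E).comp (h.isDual.comp (BiOp.IsDual.one E).adj)) _
  rw [BiOp.one_comp, BiOp.adj_one, BiOp.comp_one]

theorem IsBimoduleSum.kClass_sub_kClass {i : BiOp E G} {j : BiOp F G} (h : IsBimoduleSum i j)
    {S S' : BiOp E E} {T T' : BiOp F F} (hS : IsCycle E S) (hS' : IsCycle E S')
    (hT : IsCycle F T) (hT' : IsCycle F T') :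
    (hS.diag h hT).kClass - (hS'.diag h hT').kClass
      = hS.kClass - hS'.kClass + (hT.kClass - hT'.kClass) :=
  h.toQD.kClass_sub_kClass hS.isSupersymmetry hS'.isSupersymmetry hT.isSupersymmetry
    hT'.isSupersymmetry

theorem OperatorHomotopic.kClass_eq {S T : BiOp E E} (hS : IsCycle E S) (hT : IsCycle E T)
    (h : OperatorHomotopic S T) : hS.kClass = hT.kClass := by
  obtain ⟨γ, hγ⟩ := h
  refine IsSupersymmetry.kClass_eq_of_path hS.isSupersymmetry hT.isSupersymmetry
    (fun t => QDHom.mk (γ t) (hγ t).isDual) ?_ (fun t => (hγ t).isSupersymmetry)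
    (QDHom.mk_congr γ.source _ _) (QDHom.mk_congr γ.target _ _)
  have h1 : Continuous fun t => (⟨γ t, (hγ t).isDual⟩ : dualHom E E) :=
    γ.continuous.subtype_mk _
  exact continuous_quot_mk.comp h1

theorem IsCycle.kClass_congr {S T : BiOp E E} (hS : IsCycle E S) (hT : IsCycle E T)
    (h : S = T) : hS.kClass = hT.kClass := by
  subst h
  rfl

/-! ## Degenerate cycles -/

theorem IsCycleMod.infinite {T : BiOp E E} (h : IsCycleMod (zeroIdeal B) E T)
    {T' : BiOp E.infinite E.infinite}
    (h1 : ∀ n, BiOp.comp T' (E.infIncl n) = BiOp.comp (E.infIncl n) T)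
    (h2 : ∀ n, BiOp.comp T'.adj (E.infIncl n) = BiOp.comp (E.infIncl n) T.adj) :
    IsCycleMod (zeroIdeal B) E.infinite T' := by
  have hi := E.isIntertwiner_infIncl
  have hz : ∀ (T : BiOp E.infinite E.infinite) (S : BiOp E E),
      (∀ n, BiOp.comp T (E.infIncl n) = BiOp.comp (E.infIncl n) S) →
      S.LeftMem (zeroIdeal B) → T.LeftMem (zeroIdeal B) := by
    intro T S hTS hS a a' x
    have : Op.comp (E.infinite.map x) (T.at' a) = 0 := by
      refine Bimodule.inf_ext_at fun n => ?_
      have h3 : Op.comp (T.at' a) ((E.infIncl n).at' a) = Op.comp ((E.infIncl n).at' a) (S.at' a) :=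
        congrArg (fun T => BiOp.at' T a) (hTS n)
      have h4 : Op.comp (E.map x) (S.at' a) = 0 := hS a a' x
      rw [Op.comp_assoc, h3, ← Op.comp_assoc, (hi n).natural, Op.comp_assoc, h4, Op.comp_zero,
        Op.zero_comp]
    exact this
  refine ⟨?_, ?_, ?_, ?_⟩
  · refine Bimodule.inf_ext fun n => ?_
    have h3 := congrArg BiOp.gr (h1 n)
    rw [BiOp.gr_comp, BiOp.gr_comp, (hi n).degree, h.degree] at h3
    rw [h3, BiOp.neg_comp, h1, BiOp.comp_neg]
  · refine hz _ _ (fun n => ?_) h.adj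
    rw [BiOp.sub_comp, h1, h2, BiOp.comp_sub]
  · refine hz _ _ (fun n => ?_) h.sq
    rw [BiOp.sub_comp, BiOp.comp_assoc, h1, ← BiOp.comp_assoc, h1, BiOp.comp_sub, BiOp.one_comp,
      BiOp.comp_one, BiOp.comp_assoc]
  · intro a a' x
    have h3 : ∀ a n, Op.comp (T'.at' a) ((E.infIncl n).at' a)
        = Op.comp ((E.infIncl n).at' a) (T.at' a) := fun a n =>
      congrArg (fun T => BiOp.at' T a) (h1 n)
    have : Op.comp (E.infinite.map x) (T'.at' a) - Op.comp (T'.at' a') (E.infinite.map (A.gr x))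
        = 0 := by
      refine Bimodule.inf_ext_at fun n => ?_
      have h4 : Op.comp (E.map x) (T.at' a) - Op.comp (T.at' a') (E.map (A.gr x)) = 0 :=
        h.comm a a' x
      rw [Op.sub_comp, Op.comp_assoc, h3, Op.comp_assoc, (hi n).natural, ← Op.comp_assoc,
        (hi n).natural, ← Op.comp_assoc, h3, Op.comp_assoc, Op.comp_assoc, ← Op.comp_sub, h4,
        Op.comp_zero, Op.zero_comp]
    exact this

theorem kClass_eq_of_degenerate {S T : BiOp E E} (hS : IsCycleMod (zeroIdeal B) E S)
    (hT : IsCycleMod (zeroIdeal B) E T) : hS.isCycle.kClass = hT.isCycle.kClass := by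
  obtain ⟨S', hS1, hS2⟩ := Bimodule.exists_infDiag S
  obtain ⟨T', hT1, hT2⟩ := Bimodule.exists_infDiag T
  obtain ⟨V, hV, hs⟩ := E.exists_infShift
  have hS' := hS.infinite hS1 hS2
  have hT' := hT.infinite hT1 hT2
  have comm : ∀ (R : BiOp E E) (R' : BiOp E.infinite E.infinite),
      (∀ n, BiOp.comp R' (E.infIncl n) = BiOp.comp (E.infIncl n) R) →
      BiOp.comp R' V = BiOp.comp V R' := by
    intro R R' hR
    refine Bimodule.inf_ext fun n => ?_
    rw [BiOp.comp_assoc, hV, hR, BiOp.comp_assoc, hR, ← BiOp.comp_assoc, hV]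
  have h1 := hs.kClass_sub_kClass hS.isCycle hT.isCycle hS'.isCycle hT'.isCycle
  rw [IsCycle.kClass_congr (hS.isCycle.diag hs hS'.isCycle) hS'.isCycle
      (hs.eq_diag (hS1 0) (comm S S' hS1)).symm,
    IsCycle.kClass_congr (hT.isCycle.diag hs hT'.isCycle) hT'.isCycle
      (hs.eq_diag (hT1 0) (comm T T' hT1)).symm, right_eq_add, sub_eq_zero] at h1
  exact h1

theorem exists_absorbing (E : Bimodule A B) : ∃ d : KasparovCycle A B, d.IsDegenerate ∧
    ∃ (k : BiOp E d.E) (l : BiOp d.E d.E), IsBimoduleSum k l := by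
  obtain ⟨D, i, j, h⟩ := exists_isBimoduleSum E.infinite E.infinite.op
  obtain ⟨V, -, hs⟩ := E.exists_infShift
  have hd : IsCycleMod (zeroIdeal B) D (BiOp.swap i j) := h.isCycleMod_swap
  refine ⟨⟨D, BiOp.swap i j, hd.isCycle⟩, KasparovCycle.isDegenerate_iff.2 hd,
    BiOp.comp i (E.infIncl 0), BiOp.comp i (BiOp.comp V i.adj) + BiOp.comp j j.adj, ?_⟩
  have hi := h.intertwiner_left
  have hj := h.intertwiner_right
  have ii : ∀ {X : Bimodule A B} (T : BiOp X E.infinite),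
      BiOp.comp i.adj (BiOp.comp i T) = T := fun T => by
    rw [← BiOp.comp_assoc, h.isometry_left, BiOp.one_comp]
  have jj : ∀ {X : Bimodule A B} (T : BiOp X E.infinite.op),
      BiOp.comp j.adj (BiOp.comp j T) = T := fun T => by
    rw [← BiOp.comp_assoc, h.isometry_right, BiOp.one_comp]
  have ij : ∀ {X : Bimodule A B} (T : BiOp X E.infinite.op),
      BiOp.comp i.adj (BiOp.comp j T) = 0 := fun T => by
    rw [← BiOp.comp_assoc, h.orthogonal', BiOp.zero_comp]
  have ji : ∀ {X : Bimodule A B} (T : BiOp X E.infinite),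
      BiOp.comp j.adj (BiOp.comp i T) = 0 := fun T => by
    rw [← BiOp.comp_assoc, h.orthogonal, BiOp.zero_comp]
  have vv : ∀ {X : Bimodule A B} (T : BiOp X E.infinite),
      BiOp.comp V.adj (BiOp.comp V T) = T := fun T => by
    rw [← BiOp.comp_assoc, hs.isometry_right, BiOp.one_comp]
  refine IsBimoduleSum.of_intertwiner (hi.comp hs.intertwiner_left)
    ((hi.comp (hs.intertwiner_right.comp hi.adj)).add (hj.comp hj.adj)) ?_ ?_ ?_
  · rw [BiOp.adj_comp, BiOp.comp_assoc, ii, hs.isometry_left]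
  · simp only [BiOp.adj_add, BiOp.adj_comp, BiOp.adj_adj, BiOp.add_comp, BiOp.comp_add,
      BiOp.comp_assoc, ii, jj, ij, ji, vv, BiOp.comp_zero, add_zero, zero_add]
    exact h.complementary
  · simp only [BiOp.adj_add, BiOp.adj_comp, BiOp.adj_adj, BiOp.add_comp, BiOp.comp_add,
      BiOp.comp_assoc, ii, jj, ij, ji, BiOp.comp_zero, add_zero, zero_add]
    rw [← add_assoc, ← BiOp.comp_add, ← BiOp.comp_assoc V, ← BiOp.comp_assoc (E.infIncl 0),
      ← BiOp.add_comp, hs.complementary, BiOp.one_comp, h.complementary]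

/-! ## The index map -/

/-- The difference `g` is the class of `c ⊕ d` minus that of a degenerate cycle on the same
bimodule, where `d` is degenerate. -/
def KasparovCycle.IsIndex (c : KasparovCycle A B) (g : GOne (QD A B)) : Prop :=
  ∃ (d q : KasparovCycle A B) (e : BiOp q.E q.E) (he : IsCycleMod (zeroIdeal B) q.E e),
    d.IsDegenerate ∧ c.IsSum d q ∧ g = q.isCycle.kClass - he.isCycle.kClass

theorem KasparovCycle.IsIndex.unique {c : KasparovCycle A B} {g g' : GOne (QD A B)}
    (h : c.IsIndex g) (h' : c.IsIndex g') : g = g' := by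
  have key : ∀ {q d r : KasparovCycle A B} {e : BiOp q.E q.E} {f : BiOp r.E r.E}
      (he : IsCycleMod (zeroIdeal B) q.E e) (hf : IsCycleMod (zeroIdeal B) r.E f),
      d.IsDegenerate → q.IsSum d r → q.isCycle.kClass - he.isCycle.kClass
        = r.isCycle.kClass - hf.isCycle.kClass := by
    rintro q d r e f he hf hd ⟨i, j, hs, h1, h2⟩
    have h3 := hs.kClass_sub_kClass q.isCycle he.isCycle d.isCycle d.isCycle
    rw [sub_self, add_zero] at h3
    rw [← h3, IsCycle.kClass_congr r.isCycle (q.isCycle.diag hs d.isCycle) (hs.eq_diag h1 h2),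
      kClass_eq_of_degenerate hf (IsCycleMod.diag hs he (isDegenerate_iff.1 hd))]
  obtain ⟨d, q, e, he, hd, hq, rfl⟩ := h
  obtain ⟨d', q', e', he', hd', hq', rfl⟩ := h'
  obtain ⟨r, hr⟩ := exists_isSum q d'
  obtain ⟨s, hs⟩ := exists_isSum d d'
  obtain ⟨i, j, hij, h1, h2⟩ := id hr
  have hf := IsCycleMod.diag hij he (isDegenerate_iff.1 hd')
  rw [key he hf hd' hr, key he' hf hd (IsSum.assoc' hs.symm (hq.assoc hr hs) hq')]

theorem KasparovCycle.exists_isIndex (c : KasparovCycle A B) : ∃ g, c.IsIndex g := by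
  obtain ⟨d, hd, k, l, h⟩ := exists_absorbing c.E
  exact ⟨_, d, ⟨d.E, _, c.isCycle.diag h d.isCycle⟩, d.F, isDegenerate_iff.1 hd, hd,
    IsSum.mk_diag h, rfl⟩

/-- The index of a cycle. -/
def KasparovCycle.index (c : KasparovCycle A B) : GOne (QD A B) := c.exists_isIndex.choose

theorem KasparovCycle.isIndex_index (c : KasparovCycle A B) : c.IsIndex c.index :=
  c.exists_isIndex.choose_spec

theorem KasparovCycle.index_mem (c : KasparovCycle A B) : c.index ∈ KOne (QD A B) := by
  obtain ⟨d, q, e, he, hd, hq, h⟩ := c.isIndex_index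
  rw [h]
  exact q.isCycle.kClass_sub_mem he.isCycle

theorem KasparovCycle.toKK_index (c : KasparovCycle A B) : GOne.toKK c.index = KK.mk c := by
  obtain ⟨d, q, e, he, hd, hq, h⟩ := c.isIndex_index
  rw [h, map_sub, IsCycle.toKK_kClass, IsCycle.toKK_kClass,
    KK.mk_degenerate (d := ⟨q.E, e, he.isCycle⟩) (isDegenerate_iff.2 he), sub_zero]
  exact (KK.mk_eq_of_isSum hd hq).symm

theorem KasparovCycle.index_sub_index {S T : BiOp E E} (hS : IsCycle E S) (hT : IsCycle E T) :
    index ⟨E, S, hS⟩ - index ⟨E, T, hT⟩ = hS.kClass - hT.kClass := by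
  obtain ⟨d, hd, k, l, h⟩ := exists_absorbing E
  have h1 : ∀ {S : BiOp E E} (hS : IsCycle E S), index ⟨E, S, hS⟩
      = (hS.diag h d.isCycle).kClass - d.isCycle.kClass := fun hS =>
    (isIndex_index _).unique ⟨d, ⟨d.E, _, hS.diag h d.isCycle⟩, d.F, isDegenerate_iff.1 hd, hd,
      IsSum.mk_diag h, rfl⟩
  rw [h1 hS, h1 hT, sub_sub_sub_cancel_right, h.kClass_sub_kClass hS hT d.isCycle d.isCycle, sub_self,
    add_zero]

theorem KasparovCycle.Equivalent.index_eq {c c' : KasparovCycle A B} (h : c.Equivalent c') :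
    c.index = c'.index := by
  refine KK.eq_of_equivalent ?_ ?_ h
  · intro c d c' hd hs
    obtain ⟨d', q, e, he, hd', hq, h⟩ := c'.isIndex_index
    obtain ⟨s, hs'⟩ := exists_isSum d d'
    exact c.isIndex_index.unique ⟨s, q, e, he, hs'.isDegenerate hd hd', hs.assoc hq hs', h⟩
  · intro E S T hS hT h
    rw [← sub_eq_zero, index_sub_index, h.kClass_eq hS hT, sub_self]

/-! ## The isomorphism -/

variable (A B) in
/-- The restriction of `G₁ → KK` to `K₁`. -/
def KOne.toKK : KOne (QD A B) →+ KK A B := GOne.toKK.comp (KOne (QD A B)).subtype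

theorem KOne.exists_eq (k : KOne (QD A B)) : ∃ (E : Bimodule A B) (S T : BiOp E E)
    (hS : IsCycle E S) (hT : IsCycle E T), k.1 = hS.kClass - hT.kClass := by
  obtain ⟨_, n, P, x, y, rfl⟩ := k
  obtain ⟨E, i, h⟩ := exists_frame (A := A) (B := B) P
  obtain ⟨S, hS, eS⟩ := exists_isCycle_assemble h x
  obtain ⟨T, hT, eT⟩ := exists_isCycle_assemble h y
  exact ⟨E, S, T, hS, hT, (h.toQD.kClass_sub_kClass x y hS.isSupersymmetry hT.isSupersymmetry
    eS eT).symm⟩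

theorem KOne.toKK_bijective : Function.Bijective (KOne.toKK A B) := by
  constructor
  · refine (injective_iff_map_eq_zero _).2 fun k hk => ?_
    obtain ⟨E, S, T, hS, hT, h⟩ := KOne.exists_eq k
    have h1 : GOne.toKK k.1 = 0 := hk
    rw [h, map_sub, IsCycle.toKK_kClass, IsCycle.toKK_kClass, sub_eq_zero] at h1
    have h2 : KasparovCycle.index ⟨E, S, hS⟩ = KasparovCycle.index ⟨E, T, hT⟩ :=
      congrArg (Quot.lift KasparovCycle.index fun _ _ => KasparovCycle.Equivalent.index_eq) h1
    refine Subtype.ext ?_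
    rw [h, ← KasparovCycle.index_sub_index, h2, sub_self]
    rfl
  · intro k
    induction k using KK.ind with
    | h c => exact ⟨⟨c.index, c.index_mem⟩, c.toKK_index⟩

variable (A B) in
/-- The isomorphism `K₁ QD(A, B) ≃ KK(A, B)`. -/
def KOne.equivKK : KOne (QD A B) ≃+ KK A B :=
  AddEquiv.ofBijective (KOne.toKK A B) KOne.toKK_bijective

theorem KOne.equivKK_of_kClass {S T : BiOp E E} (hS : IsCycle E S) (hT : IsCycle E T)
    {k : KOne (QD A B)} (h : k.1 = hS.kClass - hT.kClass) :
    KOne.equivKK A B k = KK.mk ⟨E, S, hS⟩ - KK.mk ⟨E, T, hT⟩ := by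
  change GOne.toKK k.1 = _
  rw [h, map_sub, IsCycle.toKK_kClass, IsCycle.toKK_kClass]

end Index

/-! ### Positivity of Gram matrices -/

section Gram

variable {𝕜 : Type} [RCLike 𝕜] {B B' : GradedCStarCategory.{u} 𝕜}

theorem HilbertModule.inner_act_act (E : HilbertModule B) {a b c d : B.Obj} (η : E.X c) (ξ : E.X d)
    (x : B.Hom a c) (y : B.Hom b d) : E.inner (E.act η x) (E.act ξ y)
      = B.comp (B.adj x) (B.comp (E.inner η ξ) y) := by
  rw [E.inner_act, ← E.adj_inner, E.inner_act, B.adj_comp, E.adj_inner, B.assoc]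

theorem HilbertModule.act_inner (E : HilbertModule B) {a b c : B.Obj} (η : E.X c) (ξ : E.X b)
    (x : B.Hom a c) : E.inner (E.act η x) ξ = B.comp (B.adj x) (E.inner η ξ) := by
  rw [← E.adj_inner, E.inner_act, B.adj_comp, E.adj_inner]

theorem HilbertModule.exists_approx_orthogonal (E : HilbertModule B) {ι : Type*} {b : ι → B.Obj}
    (η : ∀ i, E.X (b i)) (n : ι) {δ : ℝ} (hδ : 0 < δ) :
    ∃ (t : ℝ) (u : ∀ i, B.Hom (b i) (b n)) (η' : ∀ i, E.X (b i)), 0 < t ∧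
      (∀ i j, E.inner (η i) (η j) = E.inner (η' i) (η' j)
        + (2 * t) • B.comp (B.adj (u i)) (u j)
        + B.comp (B.adj (u i)) (B.comp (E.inner (η n) (η n)) (u j))) ∧
      (∀ i, ‖η' i‖ ≤ ‖η i‖) ∧ ‖η' n‖ ≤ δ := by
  set h := E.inner (η n) (η n) with hh
  have hp : B.IsPositive h := E.inner_self_positive _
  obtain ⟨t, k, ht, h1, h2, h3⟩ := B.exists_resolvent hp (sq_pos_of_pos hδ)
  set N : ∀ i, B.Hom (b i) (b n) := fun i => E.inner (η n) (η i) with hN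
  set u : ∀ i, B.Hom (b i) (b n) := fun i => t⁻¹ • (N i - B.comp k (N i)) with hu
  have hun : u n = k := by
    rw [hu]
    dsimp only
    rw [show N n = h from rfl, sub_eq_of_eq_add h2.symm, smul_smul, inv_mul_cancel₀ ht.ne',
      one_smul]
  have hui : ∀ i, t • u i + B.comp h (u i) = N i := by
    intro i
    have e : B.comp h (N i) = t • B.comp k (N i) + B.comp h (B.comp k (N i)) := by
      conv_lhs => rw [← h1]
      rw [B.add_comp, B.real_smul_comp, B.assoc]
    rw [hu]
    dsimp only
    rw [B.comp_real_smul, B.comp_sub, e, add_sub_cancel_right, smul_smul, smul_smul,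
      inv_mul_cancel₀ ht.ne', mul_inv_cancel₀ ht.ne', one_smul, one_smul, sub_add_cancel]
  have hN' : ∀ i, E.inner (η i) (η n) = t • B.adj (u i) + B.comp (B.adj (u i)) h := by
    intro i
    rw [← E.adj_inner, ← show N i = E.inner (η n) (η i) from rfl, ← hui, B.adj_add,
      B.adj_real_smul, B.adj_comp, hp.1]
  have key : ∀ i j, E.inner (η i) (η j)
      = E.inner (η i - E.act (η n) (u i)) (η j - E.act (η n) (u j))
        + (2 * t) • B.comp (B.adj (u i)) (u j) + B.comp (B.adj (u i)) (B.comp h (u j)) := by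
    intro i j
    rw [E.inner_sub, E.sub_inner, E.sub_inner, E.inner_act_act, E.inner_act, E.act_inner, hN' i,
      ← show N j = E.inner (η n) (η j) from rfl, ← hui j, B.add_comp, B.comp_add,
      B.real_smul_comp, B.comp_real_smul, B.assoc, two_mul, add_smul, ← hh]
    abel
  refine ⟨t, u, fun i => η i - E.act (η n) (u i), ht, key, fun i => ?_, ?_⟩
  · refine (sq_le_sq₀ (norm_nonneg _) (norm_nonneg _)).1 ?_
    rw [E.norm_sq, E.norm_sq, key i i, add_assoc]
    exact B.norm_le_norm_add_of_isPositive (E.inner_self_positive _) (B.isPositive_add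
      (B.isPositive_real_smul (B.positive_adj_comp_self _) (by positivity))
      (B.isPositive_adj_comp_comp hp _))
  · refine (sq_le_sq₀ (norm_nonneg _) hδ.le).1 ?_
    beta_reduce
    rw [E.norm_sq, hun]
    refine le_trans (le_of_eq ?_) h3
    rw [E.inner_sub, E.sub_inner, E.sub_inner, E.inner_act_act, E.inner_act, E.act_inner, ← hh,
      B.comp_sub]
    congr 1
    abel

variable (G : GradedFunctor B.toGradedStarCategory B'.toGradedStarCategory)

theorem GradedFunctor.map_real_smul {a b : B.Obj} (r : ℝ) (x : B.Hom a b) :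
    G.map (r • x) = r • G.map x := G.map_smul _ _

theorem GradedFunctor.isPositive_map {a : B.Obj} {h : B.Hom a a} (hh : B.IsPositive h) :
    B'.IsPositive (G.map h) := by
  refine ⟨by rw [← G.map_adj, hh.1], fun t ht => ?_⟩
  obtain ⟨k, h1, h2⟩ := hh.2 t ht
  refine ⟨G.map k, ?_, ?_⟩
  · rw [← G.map_smul, ← G.map_comp, ← G.map_add, h1]
  · rw [← G.map_smul, ← G.map_comp, ← G.map_add, h2]

theorem HilbertModule.isPositive_gram (E : HilbertModule B) {ι : Type*} [DecidableEq ι]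
    (s : Finset ι) {b : ι → B.Obj} (η : ∀ i, E.X (b i)) {c : B'.Obj}
    (y : ∀ i, B'.Hom c (G.obj (b i))) :
    B'.IsPositive (∑ i ∈ s, ∑ j ∈ s,
      B'.comp (B'.adj (y i)) (B'.comp (G.map (E.inner (η i) (η j))) (y j))) := by
  induction s using Finset.induction generalizing η with
  | empty => exact B'.isPositive_zero
  | insert n s hn ih =>
    refine B'.isPositive_of_approx fun ε hε => ?_
    set M : ℝ := ∑ j ∈ insert n s, 3 * ‖y n‖ * ‖η j‖ * ‖y j‖ with hM
    have hM0 : 0 ≤ M := Finset.sum_nonneg fun _ _ => by positivity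
    obtain ⟨t, u, η', ht, key, hle, hδ⟩ := E.exists_approx_orthogonal η n
      (δ := ε / (2 * M + 1)) (by positivity)
    set h := E.inner (η n) (η n)
    set w : B'.Hom c (G.obj (b n)) := ∑ i ∈ insert n s, B'.comp (G.map (u i)) (y i) with hw
    set f : ι → ι → B'.Hom c c := fun i j =>
      B'.comp (B'.adj (y i)) (B'.comp (G.map (E.inner (η' i) (η' j))) (y j)) with hf
    have e1 : ∑ i ∈ insert n s, ∑ j ∈ insert n s,
        B'.comp (B'.adj (y i)) (B'.comp (G.map (E.inner (η i) (η j))) (y j))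
        = ∑ i ∈ insert n s, ∑ j ∈ insert n s, f i j
          + ((2 * t) • B'.comp (B'.adj w) w + B'.comp (B'.adj w) (B'.comp (G.map h) w)) := by
      have e2 : ∀ z : B'.Hom c (G.obj (b n)), B'.comp (B'.adj w) z
          = ∑ i ∈ insert n s, B'.comp (B'.adj (y i)) (B'.comp (B'.adj (G.map (u i))) z) := by
        intro z
        rw [hw, B'.adj_sum, B'.sum_comp]
        exact Finset.sum_congr rfl fun i _ => by rw [B'.adj_comp, B'.assoc]
      rw [e2, e2, Finset.smul_sum, ← Finset.sum_add_distrib, ← Finset.sum_add_distrib]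
      refine Finset.sum_congr rfl fun i _ => ?_
      have e3 : ∀ z : B'.Hom (G.obj (b n)) (G.obj (b i)), B'.comp (B'.adj (y i)) (B'.comp z w)
          = ∑ j ∈ insert n s, B'.comp (B'.adj (y i)) (B'.comp z (B'.comp (G.map (u j)) (y j))) := by
        intro z
        rw [hw, B'.comp_sum, B'.comp_sum]
      rw [e3, ← B'.assoc (B'.adj (G.map (u i))), e3, Finset.smul_sum, ← Finset.sum_add_distrib,
        ← Finset.sum_add_distrib]
      refine Finset.sum_congr rfl fun j _ => ?_
      rw [key i j, G.map_add, G.map_add, G.map_real_smul, G.map_comp, G.map_comp, G.map_comp,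
        G.map_adj, B'.add_comp, B'.add_comp, B'.comp_add, B'.comp_add, B'.real_smul_comp,
        B'.comp_real_smul]
      simp only [B'.assoc, hf, add_assoc]
    refine ⟨∑ i ∈ s, ∑ j ∈ s, f i j
      + ((2 * t) • B'.comp (B'.adj w) w + B'.comp (B'.adj w) (B'.comp (G.map h) w)), ?_, ?_⟩
    · exact B'.isPositive_add (ih η') (B'.isPositive_add
        (B'.isPositive_real_smul (B'.positive_adj_comp_self _) (by positivity))
        (B'.isPositive_adj_comp_comp (G.isPositive_map (E.inner_self_positive _)) _))
    · have hb : ∀ j, ‖f n j‖ ≤ 3 * ‖y n‖ * ‖η j‖ * ‖y j‖ * (ε / (2 * M + 1)) ∧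
          ‖f j n‖ ≤ 3 * ‖y n‖ * ‖η j‖ * ‖y j‖ * (ε / (2 * M + 1)) := by
        have hfn : ∀ i j, ‖f i j‖ ≤ ‖y i‖ * (3 * ‖η' i‖ * ‖η' j‖ * ‖y j‖) := by
          intro i j
          refine (B'.norm_comp_le _ _).trans ?_
          rw [B'.norm_adj]
          gcongr
          refine (B'.norm_comp_le _ _).trans ?_
          gcongr
          exact (G.norm_map_le _).trans (E.norm_inner_le _ _)
        intro j
        constructor
        · calc _ ≤ ‖y n‖ * (3 * (ε / (2 * M + 1)) * ‖η j‖ * ‖y j‖) :=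
              (hfn n j).trans (by gcongr; exact hle j)
            _ = _ := by ring
        · calc _ ≤ ‖y j‖ * (3 * ‖η j‖ * (ε / (2 * M + 1)) * ‖y n‖) :=
              (hfn j n).trans (by gcongr; exact hle j)
            _ = _ := by ring
      have e4 : ∑ i ∈ insert n s, ∑ j ∈ insert n s, f i j - ∑ i ∈ s, ∑ j ∈ s, f i j
          = ∑ j ∈ insert n s, f n j + ∑ i ∈ s, f i n := by
        rw [Finset.sum_insert hn]
        simp only [Finset.sum_insert hn, Finset.sum_add_distrib]
        abel
      rw [e1, add_sub_add_right_eq_sub, e4]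
      have h5 : ‖∑ j ∈ insert n s, f n j‖ ≤ M * (ε / (2 * M + 1)) := by
        rw [hM, Finset.sum_mul]
        exact norm_sum_le_of_le _ fun j _ => (hb j).1
      have h6 : ‖∑ i ∈ s, f i n‖ ≤ M * (ε / (2 * M + 1)) := by
        rw [hM, Finset.sum_mul]
        refine (norm_sum_le_of_le _ fun j _ => (hb j).2).trans ?_
        refine Finset.sum_le_sum_of_subset_of_nonneg (Finset.subset_insert _ _) fun _ _ _ => ?_
        positivity
      calc _ ≤ M * (ε / (2 * M + 1)) + M * (ε / (2 * M + 1)) :=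
            (norm_add_le _ _).trans (add_le_add h5 h6)
        _ = (2 * M) / (2 * M + 1) * ε := by ring
        _ ≤ 1 * ε := by
            gcongr
            rw [div_le_one (by positivity)]
            linarith
        _ = ε := one_mul ε

end Gram

/-! ## Inner tensor products -/

/-- The Hilbert module `E'` is the inner tensor product of `E` with `B'` along `G`. -/
structure HilbertModule.Tensor {𝕜 : Type} [RCLike 𝕜] {B B' : GradedCStarCategory.{u} 𝕜}
    (G : GradedFunctor B.toGradedStarCategory B'.toGradedStarCategory) (E : HilbertModule B)
    (E' : HilbertModule B') where
  tmul : ∀ {b : B.Obj} {c : B'.Obj}, E.X b → B'.Hom c (G.obj b) → E'.X c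
  inner_tmul : ∀ {b₁ b₂ : B.Obj} {c₁ c₂ : B'.Obj} (η : E.X b₁) (y : B'.Hom c₁ (G.obj b₁))
    (ξ : E.X b₂) (z : B'.Hom c₂ (G.obj b₂)), E'.inner (tmul η y) (tmul ξ z)
      = B'.comp (B'.adj y) (B'.comp (G.map (E.inner η ξ)) z)
  gr_tmul : ∀ {b : B.Obj} {c : B'.Obj} (η : E.X b) (y : B'.Hom c (G.obj b)),
    E'.gr (tmul η y) = tmul (E.gr η) (B'.gr y)
  dense : ∀ c : B'.Obj, Dense (Submodule.span 𝕜 {ζ : E'.X c | ∃ (b : B.Obj) (η : E.X b)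
      (y : B'.Hom c (G.obj b)), ζ = tmul η y} : Set (E'.X c))

namespace HilbertModule

variable {𝕜 : Type} [RCLike 𝕜] {B B' : GradedCStarCategory.{u} 𝕜}
  (G : GradedFunctor B.toGradedStarCategory B'.toGradedStarCategory) (E : HilbertModule B)

/-! ### Existence -/

theorem norm_tensor_le {b : B.Obj} {c : B'.Obj} (η : E.X b) (y : B'.Hom c (G.obj b)) :
    ‖B'.comp (B'.adj y) (B'.comp (G.map (E.inner η η)) y)‖ ≤ (‖η‖ * ‖y‖) ^ 2 := by
  calc _ ≤ ‖B'.adj y‖ * (‖E.inner η η‖ * ‖y‖) := by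
        refine (B'.norm_comp_le _ _).trans ?_
        gcongr
        refine (B'.norm_comp_le _ _).trans ?_
        gcongr
        exact G.norm_map_le _
    _ = _ := by rw [B'.norm_adj, ← E.norm_sq]; ring

/-- The kernel that defines the inner tensor product. -/
def tensorKernel : PositiveKernel B' where
  I c := Σ b : B.Obj, E.X b × B'.Hom c (G.obj b)
  k i j := B'.comp (B'.adj i.2.2) (B'.comp (G.map (E.inner i.2.1 j.2.1)) j.2.2)
  act i x := ⟨i.1, i.2.1, B'.comp i.2.2 x⟩
  gr i := ⟨i.1, E.gr i.2.1, B'.gr i.2.2⟩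
  k_act i j x := by simp only [B'.assoc]
  adj_k i j := by
    rw [B'.adj_comp, B'.adj_comp, B'.adj_adj, ← G.map_adj, E.adj_inner, B'.assoc]
  gr_gr i := by rw [E.gr_gr, B'.gr_gr]
  k_gr i j := by rw [B'.gr_comp, B'.gr_comp, B'.gr_adj, E.inner_gr, G.map_gr]
  pos {c} s r := by
    classical
    have h := E.isPositive_gram G s (fun i => i.2.1) (c := c) (fun i => r i • i.2.2)
    convert h using 1
    refine Finset.sum_congr rfl fun i _ => Finset.sum_congr rfl fun j _ => ?_
    rw [B'.adj_smul, B'.smul_comp, B'.comp_smul, B'.comp_smul, mul_smul]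

/-- The symbol of an elementary tensor. -/
def tensorSym {b : B.Obj} {c : B'.Obj} (η : E.X b) (y : B'.Hom c (G.obj b)) :
    (tensorKernel G E).I c :=
  (⟨b, η, y⟩ : Σ b : B.Obj, E.X b × B'.Hom c (G.obj b))

theorem innerCompl_tensorSym {b₁ b₂ : B.Obj} {c₁ c₂ : B'.Obj} (η : E.X b₁)
    (y : B'.Hom c₁ (G.obj b₁)) (ξ : E.X b₂) (z : B'.Hom c₂ (G.obj b₂)) :
    (tensorKernel G E).preModule.innerCompl c₂ c₁ ((tensorKernel G E).e₀ (tensorSym G E η y))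
      ((tensorKernel G E).e₀ (tensorSym G E ξ z))
      = B'.comp (B'.adj y) (B'.comp (G.map (E.inner η ξ)) z) :=
  (tensorKernel G E).inner_e₀ _ _

/-- Elementary tensors in the completion of the kernel, as a bilinear map. -/
def tensorLin (b : B.Obj) (c : B'.Obj) : E.X b →L[𝕜] B'.Hom c (G.obj b) →L[𝕜]
    UniformSpace.Completion ((tensorKernel G E).preModule.V c) :=
  LinearMap.mkContinuous₂ (LinearMap.mk₂ 𝕜
    (fun η y => (tensorKernel G E).e₀ (tensorSym G E η y))
    (fun η ξ y => (tensorKernel G E).e₀_ext fun ⟨b', ζ, z⟩ => by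
      rw [map_add]
      refine (innerCompl_tensorSym G E _ _ _ _).trans (.trans ?_ (congrArg₂ (· + ·)
        (innerCompl_tensorSym G E _ _ _ _).symm (innerCompl_tensorSym G E _ _ _ _).symm))
      rw [E.inner_add, G.map_add, B'.add_comp, B'.comp_add])
    (fun r η y => (tensorKernel G E).e₀_ext fun ⟨b', ζ, z⟩ => by
      rw [map_smul]
      refine (innerCompl_tensorSym G E _ _ _ _).trans (.trans ?_ (congrArg (r • ·)
        (innerCompl_tensorSym G E _ _ _ _).symm))
      rw [E.inner_smul, G.map_smul, B'.smul_comp, B'.comp_smul])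
    (fun η y y' => (tensorKernel G E).e₀_ext fun ⟨b', ζ, z⟩ => by
      rw [map_add]
      refine (innerCompl_tensorSym G E _ _ _ _).trans (.trans ?_ (congrArg₂ (· + ·)
        (innerCompl_tensorSym G E _ _ _ _).symm (innerCompl_tensorSym G E _ _ _ _).symm))
      rw [B'.comp_add, B'.comp_add])
    (fun r η y => (tensorKernel G E).e₀_ext fun ⟨b', ζ, z⟩ => by
      rw [map_smul]
      refine (innerCompl_tensorSym G E _ _ _ _).trans (.trans ?_ (congrArg (r • ·)
        (innerCompl_tensorSym G E _ _ _ _).symm))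
      rw [B'.comp_smul, B'.comp_smul])) 1 fun η y => by
    refine (sq_le_sq₀ (norm_nonneg _) (by positivity)).1 ?_
    rw [LinearMap.mk₂_apply, PositiveKernel.norm_e₀_sq, one_mul]
    exact norm_tensor_le G E η y

theorem tensorLin_act {a b : B.Obj} {c : B'.Obj} (η : E.X b) (x : B.Hom a b)
    (y : B'.Hom c (G.obj a)) :
    tensorLin G E a c (E.act η x) y = tensorLin G E b c η (B'.comp (G.map x) y) := by
  refine (tensorKernel G E).e₀_ext fun ⟨b', ζ, z⟩ => ?_
  refine (innerCompl_tensorSym G E _ _ _ _).trans (.trans ?_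
    (innerCompl_tensorSym G E _ _ _ _).symm)
  rw [E.inner_act, G.map_comp, B'.assoc]

theorem _root_.GradedCStarCategory.exists_norm_comp_sub_lt {C : GradedCStarCategory.{u} 𝕜}
    {a : C.Obj} {e : ℕ → C.Hom a a}
    (he : ∀ (x : C.Hom a a) (ε : ℝ), 0 < ε →
      (∃ n, ‖C.comp x (e n) - x‖ < ε) ∧ (∃ n, ‖C.comp (e n) x - x‖ < ε))
    {c : C.Obj} (z : C.Hom c a) {ε : ℝ} (hε : 0 < ε) :
    ∃ n, ∃ w : C.Hom c a, ‖C.comp (e n) w - z‖ < ε := by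
  obtain ⟨k, hk⟩ := C.exists_norm_sub_comp_le (C.adj z) (half_pos hε)
  obtain ⟨n, hn⟩ := (he (C.adj k) (ε / (2 * (‖z‖ + 1))) (by positivity)).2
  refine ⟨n, C.comp (C.adj k) z, ?_⟩
  have h0 : C.comp (e n) (C.comp (C.adj k) z) - z
      = C.comp (C.comp (e n) (C.adj k) - C.adj k) z - C.adj (C.adj z - C.comp (C.adj z) k) := by
    rw [C.sub_comp, C.assoc, C.adj_sub, C.adj_comp, C.adj_adj]
    abel
  have h1 : ‖C.comp (C.comp (e n) (C.adj k) - C.adj k) z‖ < ε / 2 := by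
    refine (C.norm_comp_le _ _).trans_lt ?_
    calc _ ≤ ε / (2 * (‖z‖ + 1)) * ‖z‖ := by gcongr
      _ < ε / (2 * (‖z‖ + 1)) * (‖z‖ + 1) := by gcongr; linarith
      _ = ε / 2 := by field_simp
  rw [h0]
  refine (norm_sub_le _ _).trans_lt ?_
  rw [C.norm_adj]
  linarith

theorem tensorKernel_generated (hB' : B'.SigmaUnital) : (tensorKernel G E).Generated := by
  obtain ⟨Ω, hΩ, hd⟩ := E.countably_generated
  choose e he using hB'
  set Ω' : Set (Σ c, (tensorKernel G E).I c) := ⋃ n : ℕ, (fun p : Σ b, E.X b =>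
    ⟨G.obj p.1, tensorSym G E p.2 (e (G.obj p.1) n)⟩) '' Ω with hΩ'
  refine ⟨Ω', Set.countable_iUnion fun n => hΩ.image _, ?_⟩
  rintro c ⟨b, η, y⟩
  set W := (Submodule.span 𝕜 {ζ | ∃ p ∈ Ω', ∃ x : B'.Hom c p.1,
    ζ = (tensorKernel G E).e₀ ((tensorKernel G E).act p.2 x)}).topologicalClosure with hW
  have hWc := Submodule.isClosed_topologicalClosure (Submodule.span 𝕜 {ζ | ∃ p ∈ Ω',
    ∃ x : B'.Hom c p.1, ζ = (tensorKernel G E).e₀ ((tensorKernel G E).act p.2 x)})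
  rw [← hW] at hWc
  have h1 : ∀ p ∈ Ω, ∀ z : B'.Hom c (G.obj p.1), tensorLin G E p.1 c p.2 z ∈ W := by
    intro p hp z
    have h3 : IsClosed {z : B'.Hom c (G.obj p.1) | tensorLin G E p.1 c p.2 z ∈ W} :=
      hWc.preimage (tensorLin G E p.1 c p.2).continuous
    have h4 : {z | ∃ n w, z = B'.comp (e (G.obj p.1) n) w} ⊆
        {z : B'.Hom c (G.obj p.1) | tensorLin G E p.1 c p.2 z ∈ W} := by
      rintro _ ⟨n, w, rfl⟩
      exact Submodule.le_topologicalClosure _ (Submodule.subset_span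
        ⟨_, Set.mem_iUnion.2 ⟨n, p, hp, rfl⟩, w, rfl⟩)
    refine h3.closure_subset_iff.2 h4 (Metric.mem_closure_iff.2 fun ε hε => ?_)
    obtain ⟨n, w, h⟩ := GradedCStarCategory.exists_norm_comp_sub_lt (he (G.obj p.1)) z hε
    exact ⟨_, ⟨n, w, rfl⟩, by rwa [dist_comm, dist_eq_norm]⟩
  have h2 : IsClosed {η : E.X b | tensorLin G E b c η y ∈ W} :=
    hWc.preimage ((tensorLin G E b c).continuous.clm_apply continuous_const)
  have h3 : (Submodule.span 𝕜 {ζ : E.X b | ∃ p ∈ Ω, ∃ x : B.Hom b p.1, ζ = E.act p.2 x} :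
      Set (E.X b)) ⊆ {η : E.X b | tensorLin G E b c η y ∈ W} := by
    have : Submodule.span 𝕜 {ζ : E.X b | ∃ p ∈ Ω, ∃ x : B.Hom b p.1, ζ = E.act p.2 x}
        ≤ W.comap ((tensorLin G E b c).flip y).toLinearMap := by
      rw [Submodule.span_le]
      rintro _ ⟨p, hp, x, rfl⟩
      change tensorLin G E b c (E.act p.2 x) y ∈ W
      rw [tensorLin_act]
      exact h1 p hp _
    exact this
  exact h2.closure_subset_iff.2 h3 (hd b η)

/-- The inner tensor product of `E` with `B'`. -/
def tensor (hB' : B'.SigmaUnital) : HilbertModule B' :=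
  (tensorKernel G E).module (tensorKernel_generated G E hB')

/-- The inner tensor product is an inner tensor product. -/
def tensorTensor (hB' : B'.SigmaUnital) : Tensor G E (tensor G E hB') where
  tmul η y := (tensorKernel G E).e (tensorKernel_generated G E hB') (tensorSym G E η y)
  inner_tmul _ _ _ _ := (tensorKernel G E).inner_e _ _ _
  gr_tmul _ _ := (tensorKernel G E).gr_e _ _
  dense c := by
    refine ((tensorKernel G E).dense_e (tensorKernel_generated G E hB') c).mono
      (Submodule.span_mono ?_)
    rintro _ ⟨⟨b, η, y⟩, rfl⟩
    exact ⟨b, η, y, rfl⟩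

end HilbertModule

/-! ### Elementary tensors -/

namespace HilbertModule.Tensor

variable {𝕜 : Type} [RCLike 𝕜] {B B' : GradedCStarCategory.{u} 𝕜}
  {G : GradedFunctor B.toGradedStarCategory B'.toGradedStarCategory} {E F : HilbertModule B}
  {E' F' : HilbertModule B'} (t : Tensor G E E') (q : Tensor G F F')

theorem dense_range (c : B'.Obj) : Dense (Submodule.span 𝕜 (Set.range
    fun i : Σ b : B.Obj, E.X b × B'.Hom c (G.obj b) => t.tmul i.2.1 i.2.2) : Set (E'.X c)) := by
  refine (t.dense c).mono (Submodule.span_mono ?_)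
  rintro _ ⟨b, η, y, rfl⟩
  exact ⟨⟨b, η, y⟩, rfl⟩

theorem ext_tmul {c : B'.Obj} {v w : E'.X c} (h : ∀ (b : B.Obj) (η : E.X b)
    (y : B'.Hom c (G.obj b)), E'.inner (t.tmul η y) v = E'.inner (t.tmul η y) w) : v = w := by
  refine E'.ext_inner fun ζ => ?_
  refine (t.dense c).induction (P := fun ζ => E'.inner ζ v = E'.inner ζ w) (fun ζ hζ => ?_)
    (isClosed_eq (E'.continuous_inner_left v) (E'.continuous_inner_left w)) ζ
  induction hζ using Submodule.span_induction with
  | mem _ h' =>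
    obtain ⟨b, η, y, rfl⟩ := h'
    exact h b η y
  | zero => rw [E'.zero_inner, E'.zero_inner]
  | add x y _ _ h h' => rw [E'.add_inner, E'.add_inner, h, h']
  | smul r x _ h => rw [E'.smul_inner, E'.smul_inner, h]

theorem add_tmul {b : B.Obj} {c : B'.Obj} (η ξ : E.X b) (y : B'.Hom c (G.obj b)) :
    t.tmul (η + ξ) y = t.tmul η y + t.tmul ξ y := t.ext_tmul fun b' ζ z => by
  rw [E'.inner_add, t.inner_tmul, t.inner_tmul, t.inner_tmul, E.inner_add, G.map_add,
    B'.add_comp, B'.comp_add]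

theorem smul_tmul {b : B.Obj} {c : B'.Obj} (r : 𝕜) (η : E.X b) (y : B'.Hom c (G.obj b)) :
    t.tmul (r • η) y = r • t.tmul η y := t.ext_tmul fun b' ζ z => by
  rw [E'.inner_smul, t.inner_tmul, t.inner_tmul, E.inner_smul, G.map_smul, B'.smul_comp,
    B'.comp_smul]

theorem act_tmul {a b : B.Obj} {c : B'.Obj} (η : E.X b) (x : B.Hom a b) (y : B'.Hom c (G.obj a)) :
    t.tmul (E.act η x) y = t.tmul η (B'.comp (G.map x) y) := t.ext_tmul fun b' ζ z => by
  rw [t.inner_tmul, t.inner_tmul, E.inner_act, G.map_comp, B'.assoc]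

theorem tmul_act {b : B.Obj} {c d : B'.Obj} (η : E.X b) (y : B'.Hom c (G.obj b)) (z : B'.Hom d c) :
    E'.act (t.tmul η y) z = t.tmul η (B'.comp y z) := t.ext_tmul fun b' ζ w => by
  rw [E'.inner_act, t.inner_tmul, t.inner_tmul, B'.assoc, B'.assoc]

theorem norm_tmul_le {b : B.Obj} {c : B'.Obj} (η : E.X b) (y : B'.Hom c (G.obj b)) :
    ‖t.tmul η y‖ ≤ ‖η‖ * ‖y‖ := by
  refine (sq_le_sq₀ (norm_nonneg _) (by positivity)).1 ?_
  rw [E'.norm_sq, t.inner_tmul]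
  exact norm_tensor_le G E η y

/-! ### Operators -/

theorem op_ext {H : HilbertModule B'} {S T : Op E' H}
    (h : ∀ (b : B.Obj) (c : B'.Obj) (η : E.X b) (y : B'.Hom c (G.obj b)),
      S.app c (t.tmul η y) = T.app c (t.tmul η y)) : S = T :=
  Op.ext_of_generators (I := fun c => Σ b : B.Obj, E.X b × B'.Hom c (G.obj b))
    (s := fun _ i => t.tmul i.2.1 i.2.2) t.dense_range fun c i => h i.1 c i.2.1 i.2.2

theorem exists_map (T : Op E F) : ∃ T' : Op E' F',
    (∀ (b : B.Obj) (c : B'.Obj) (η : E.X b) (y : B'.Hom c (G.obj b)),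
      T'.app c (t.tmul η y) = q.tmul (T.app b η) y) ∧ ‖T'‖ ≤ 6 * ‖T‖ := by
  obtain ⟨T', h1, -, h3⟩ := Op.exists_of_generators E' F'
    (I := fun c => Σ b : B.Obj, E.X b × B'.Hom c (G.obj b))
    (J := fun c => Σ b : B.Obj, F.X b × B'.Hom c (G.obj b))
    (fun _ i => t.tmul i.2.1 i.2.2) (fun _ i => q.tmul i.2.1 i.2.2) t.dense_range q.dense_range
    (fun c i => ⟨i.1, T.app i.1 i.2.1, i.2.2⟩) (fun c i => ⟨i.1, T.adj.app i.1 i.2.1, i.2.2⟩)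
    (fun a b j i => by rw [t.inner_tmul, q.inner_tmul, Op.inner_app])
    (C := 3 * ‖T‖ * ‖T‖) (by positivity) (by
      rintro c ⟨b, η, y⟩
      refine ⟨‖η‖ * ‖y‖, fun n => ?_⟩
      obtain ⟨ξ, hξ, hn⟩ : ∃ ξ : E.X b, (((fun i : Σ b : B.Obj, F.X b × B'.Hom c (G.obj b) =>
          (⟨i.1, T.adj.app i.1 i.2.1, i.2.2⟩ : Σ b : B.Obj, E.X b × B'.Hom c (G.obj b))) ∘
          (fun i => ⟨i.1, T.app i.1 i.2.1, i.2.2⟩))^[n] ⟨b, η, y⟩) = ⟨b, ξ, y⟩ ∧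
          ‖ξ‖ ≤ ‖η‖ * (3 * ‖T‖ * ‖T‖) ^ n := by
        induction n with
        | zero => exact ⟨η, rfl, by simp⟩
        | succ n ih =>
          obtain ⟨ξ, h1, h2⟩ := ih
          refine ⟨T.adj.app b (T.app b ξ), ?_, ?_⟩
          · rw [Function.iterate_succ_apply', h1]
            rfl
          · calc _ ≤ 3 * ‖T‖ * (‖T‖ * ‖ξ‖) := (T.adj.norm_app_le b _).trans (by
                  gcongr
                  · exact T.norm_adj_le
                  · exact T.norm_app_le b _)
              _ ≤ 3 * ‖T‖ * (‖T‖ * (‖η‖ * (3 * ‖T‖ * ‖T‖) ^ n)) := by gcongr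
              _ = _ := by ring
      rw [hξ]
      calc _ ≤ ‖ξ‖ * ‖y‖ := t.norm_tmul_le _ _
        _ ≤ ‖η‖ * (3 * ‖T‖ * ‖T‖) ^ n * ‖y‖ := by gcongr
        _ = _ := by ring)
  refine ⟨T', fun b c η y => h1 c ⟨b, η, y⟩, h3.trans (Real.sqrt_le_iff.2 ⟨by positivity, ?_⟩)⟩
  nlinarith [sq_nonneg ‖T‖]

/-- The operator `T ⊗ 1`. -/
def map (T : Op E F) : Op E' F' := (t.exists_map q T).choose

theorem map_tmul (T : Op E F) {b : B.Obj} {c : B'.Obj} (η : E.X b) (y : B'.Hom c (G.obj b)) :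
    (t.map q T).app c (t.tmul η y) = q.tmul (T.app b η) y :=
  (t.exists_map q T).choose_spec.1 b c η y

theorem norm_map_le (T : Op E F) : ‖t.map q T‖ ≤ 6 * ‖T‖ := (t.exists_map q T).choose_spec.2

theorem map_add (S T : Op E F) : t.map q (S + T) = t.map q S + t.map q T :=
  t.op_ext fun b c η y => by
    rw [Op.add_app, map_tmul, map_tmul, map_tmul, Op.add_app, q.add_tmul]

theorem map_smul (r : 𝕜) (T : Op E F) : t.map q (r • T) = r • t.map q T :=
  t.op_ext fun b c η y => by
    rw [Op.smul_app, map_tmul, map_tmul, Op.smul_app, q.smul_tmul]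

theorem map_zero : t.map q (0 : Op E F) = 0 := by
  simpa using t.map_smul q 0 (0 : Op E F)

theorem map_sub (S T : Op E F) : t.map q (S - T) = t.map q S - t.map q T := by
  rw [eq_sub_iff_add_eq, ← map_add, sub_add_cancel]

theorem map_one : t.map t (Op.one E) = Op.one E' :=
  t.op_ext fun b c η y => by rw [map_tmul]; rfl

theorem map_comp {H : HilbertModule B} {H' : HilbertModule B'} (r : Tensor G H H') (S : Op F H)
    (T : Op E F) : t.map r (Op.comp S T) = Op.comp (q.map r S) (t.map q T) :=
  t.op_ext fun b c η y => by
    rw [Op.comp_app, map_tmul, map_tmul, map_tmul, Op.comp_app]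

theorem map_adj (T : Op E F) : q.map t T.adj = (t.map q T).adj :=
  q.op_ext fun b c η y => t.ext_tmul fun b' ξ z => by
    rw [map_tmul, Op.inner_adj_app, map_tmul, t.inner_tmul, q.inner_tmul, Op.inner_adj_app]

theorem map_gr (T : Op E F) : t.map q T.gr = (t.map q T).gr :=
  t.op_ext fun b c η y => by
    rw [map_tmul, Op.gr_app, Op.gr_app, t.gr_tmul, map_tmul, q.gr_tmul, B'.gr_gr]

end HilbertModule.Tensor

section RankOne

variable {𝕜 : Type} [RCLike 𝕜] {B B' : GradedCStarCategory.{u} 𝕜}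

/-- The rank one operator `ζ ↦ η ⟨ξ, ζ⟩`. -/
def Op.rankOne {E F : HilbertModule B} {c : B.Obj} (η : F.X c) (ξ : E.X c) : Op E F :=
  Op.mk' (fun _ ζ => F.act η (E.inner ξ ζ)) (fun _ ζ => E.act ξ (F.inner η ζ))
    (fun a b ζ θ => by rw [F.inner_act, E.act_inner, F.adj_inner])
    (‖η‖ * (3 * ‖ξ‖)) (by positivity) fun b ζ => (F.norm_act_le _ _).trans (by
      rw [mul_assoc]
      gcongr
      exact E.norm_inner_le _ _)

theorem Op.rankOne_app {E F : HilbertModule B} {c : B.Obj} (η : F.X c) (ξ : E.X c) {b : B.Obj}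
    (ζ : E.X b) : (Op.rankOne η ξ).app b ζ = F.act η (E.inner ξ ζ) := rfl

theorem Op.norm_rankOne_le {E F : HilbertModule B} {c : B.Obj} (η : F.X c) (ξ : E.X c) :
    ‖Op.rankOne η ξ‖ ≤ 3 * ‖ξ‖ * ‖η‖ :=
  Op.norm_le _ (by positivity) fun b ζ => by
    rw [Op.rankOne_app]
    refine (F.norm_act_le _ _).trans ?_
    have := E.norm_inner_le ξ ζ
    calc _ ≤ ‖η‖ * (3 * ‖ξ‖ * ‖ζ‖) := by gcongr
      _ = _ := by ring

theorem Op.rankOne_sub {E F : HilbertModule B} {c : B.Obj} (η η' : F.X c) (ξ : E.X c) :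
    Op.rankOne (η - η') ξ = Op.rankOne η ξ - Op.rankOne η' ξ := Op.ext fun b ζ => by
  rw [Op.sub_app, Op.rankOne_app, Op.rankOne_app, Op.rankOne_app, sub_eq_add_neg, F.add_act,
    ← neg_one_smul 𝕜 η', F.smul_act, neg_one_smul, ← sub_eq_add_neg]

theorem Op.rankOne_mem_compact {E F : HilbertModule B} {c : B.Obj} (η : F.X c) (ξ : E.X c) :
    Op.rankOne η ξ ∈ Op.compact E F := fun ε hε =>
  ⟨_, Submodule.subset_span ⟨c, η, ξ, rfl⟩, fun b ζ => by
    rw [Op.rankOne_app, sub_self, norm_zero]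
    positivity⟩

theorem HilbertModule.exists_norm_sub_act_le (E : HilbertModule B) {b : B.Obj} (η : E.X b) {ε : ℝ}
    (hε : 0 < ε) : ∃ k : B.Hom b b, ‖η - E.act η k‖ ≤ ε := by
  obtain ⟨k, hk⟩ := B.exists_approx_unit (E.inner_self_positive η) (sq_pos_of_pos hε)
  refine ⟨k, (sq_le_sq₀ (norm_nonneg _) hε.le).1 ?_⟩
  rw [E.norm_sq]
  refine le_trans (le_of_eq ?_) hk
  rw [E.inner_sub, E.sub_inner, E.sub_inner, E.inner_act_act, E.inner_act, E.act_inner, B.comp_sub]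
  congr 1
  abel

end RankOne

namespace HilbertModule.Tensor

variable {𝕜 : Type} [RCLike 𝕜] {B B' : GradedCStarCategory.{u} 𝕜}
  {G : GradedFunctor B.toGradedStarCategory B'.toGradedStarCategory} {E F : HilbertModule B}
  {E' F' : HilbertModule B'} (t : Tensor G E E') (q : Tensor G F F')

theorem map_mem_compact_of_approx {T : Op E F} (H : ∀ ε : ℝ, 0 < ε → ∃ R : Op E F,
    t.map q R ∈ Op.compact E' F' ∧ ‖T - R‖ ≤ ε) : t.map q T ∈ Op.compact E' F' := by
  refine Op.isClosed_compact.closure_subset (Metric.mem_closure_iff.2 fun ε hε => ?_)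
  obtain ⟨R, hR, h⟩ := H (ε / 7) (by positivity)
  refine ⟨_, hR, ?_⟩
  rw [dist_eq_norm, ← map_sub]
  have := t.norm_map_le q (T - R)
  linarith

theorem map_rankOne_mem_compact {c : B.Obj} (η : F.X c) (ξ : E.X c) :
    t.map q (Op.rankOne η ξ) ∈ Op.compact E' F' := by
  refine t.map_mem_compact_of_approx q fun ε hε => ?_
  set δ := ε / (3 * ‖ξ‖ + 1) with hδ
  have hδ0 : 0 < δ := by positivity
  obtain ⟨k, hk⟩ := F.exists_norm_sub_act_le η (half_pos hδ0)
  obtain ⟨l, hl⟩ := F.exists_norm_sub_act_le (F.act η k) (half_pos hδ0)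
  refine ⟨Op.rankOne (F.act (F.act η k) l) ξ, ?_, ?_⟩
  · have e : t.map q (Op.rankOne (F.act (F.act η k) l) ξ)
        = Op.rankOne (q.tmul η (G.map k)) (t.tmul ξ (G.map (B.adj l))) :=
      t.op_ext fun b d ζ y => by
        rw [map_tmul, Op.rankOne_app, Op.rankOne_app, t.inner_tmul, q.act_tmul, q.act_tmul,
          q.act_tmul, q.tmul_act, ← G.map_adj, B.adj_adj]
    rw [e]
    exact Op.rankOne_mem_compact _ _
  · rw [← Op.rankOne_sub]
    refine (Op.norm_rankOne_le _ _).trans ?_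
    have h1 : ‖η - F.act (F.act η k) l‖ ≤ δ := by
      rw [← sub_add_sub_cancel η (F.act η k)]
      exact (norm_add_le _ _).trans (by linarith)
    calc _ ≤ 3 * ‖ξ‖ * δ := by gcongr
      _ = (3 * ‖ξ‖) / (3 * ‖ξ‖ + 1) * ε := by rw [hδ]; ring
      _ ≤ 1 * ε := by
          gcongr
          rw [div_le_one (by positivity)]
          linarith
      _ = ε := one_mul ε

theorem map_mem_compact {T : Op E F} (hT : T ∈ Op.compact E F) :
    t.map q T ∈ Op.compact E' F' := by
  refine t.map_mem_compact_of_approx q fun ε hε => ?_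
  obtain ⟨S, hS, h⟩ := hT ε hε
  obtain ⟨R, hR, hRS⟩ : ∃ R : Op E F, t.map q R ∈ Op.compact E' F' ∧
      ∀ b ζ, R.app b ζ = S b ζ := by
    clear h
    induction hS using Submodule.span_induction with
    | mem S hS =>
      obtain ⟨c, η, ξ, rfl⟩ := hS
      exact ⟨Op.rankOne η ξ, t.map_rankOne_mem_compact q η ξ, fun _ _ => rfl⟩
    | zero => exact ⟨0, by rw [map_zero]; exact zero_mem _, fun _ _ => rfl⟩
    | add S S' _ _ h h' =>
      obtain ⟨R, h1, h2⟩ := h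
      obtain ⟨R', h1', h2'⟩ := h'
      exact ⟨R + R', by rw [map_add]; exact add_mem h1 h1', fun b ζ => by
        rw [Op.add_app, h2, h2']; rfl⟩
    | smul r S _ h =>
      obtain ⟨R, h1, h2⟩ := h
      exact ⟨r • R, by rw [map_smul]; exact Submodule.smul_mem _ _ h1, fun b ζ => by
        rw [Op.smul_app, h2]; rfl⟩
  exact ⟨R, hR, Op.norm_le _ hε.le fun b ζ => by rw [Op.sub_app, hRS]; exact h b ζ⟩

end HilbertModule.Tensor

/-! ### Tensor products of bimodules -/

namespace Pushforward

variable {𝕜 : Type} [RCLike 𝕜] {A : GradedCStarCategory.{v} 𝕜}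
  {B B' : GradedCStarCategory.{u} 𝕜} {G : GradedFunctor B.toGradedStarCategory
  B'.toGradedStarCategory} {E F H : Bimodule A B} {E' F' H' : Bimodule A B'}
  (p : Pushforward G E E') (q : Pushforward G F F') (r : Pushforward G H H')

/-- The tensor products of Hilbert modules in a tensor product of bimodules. -/
def tensorAt (a : A.Obj) : HilbertModule.Tensor G (E.obj a) (E'.obj a) :=
  ⟨p.tmul, p.inner_tmul, p.gr_tmul, p.dense a⟩

theorem map_eq {a a' : A.Obj} (x : A.Hom a a') :
    E'.map x = (p.tensorAt a).map (p.tensorAt a') (E.map x) :=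
  (p.tensorAt a).op_ext fun b c η y => by
    rw [HilbertModule.Tensor.map_tmul]
    exact p.map_tmul x η y

/-- The operator `T ⊗ 1`. -/
def map (T : BiOp E F) : BiOp E' F' :=
  BiOp.mk' (fun a => (p.tensorAt a).map (q.tensorAt a) (T.at' a)) (6 * ‖T‖) fun a =>
    ((p.tensorAt a).norm_map_le _ _).trans (by gcongr; exact T.norm_at_le a)

theorem map_at (T : BiOp E F) (a : A.Obj) :
    (p.map q T).at' a = (p.tensorAt a).map (q.tensorAt a) (T.at' a) := rfl

theorem norm_map_le (T : BiOp E F) : ‖p.map q T‖ ≤ 6 * ‖T‖ :=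
  BiOp.norm_le _ (by positivity) fun a =>
    ((p.tensorAt a).norm_map_le _ _).trans (by gcongr; exact T.norm_at_le a)

theorem isTensorOne_map (T : BiOp E F) : p.IsTensorOne q T (p.map q T) := fun a _ _ η y =>
  (p.tensorAt a).map_tmul (q.tensorAt a) (T.at' a) η y

variable {p q} in
theorem IsTensorOne.eq_map {T : BiOp E F} {T' : BiOp E' F'} (h : p.IsTensorOne q T T') :
    T' = p.map q T :=
  BiOp.ext fun a => (p.tensorAt a).op_ext fun b c η y => by
    rw [map_at, HilbertModule.Tensor.map_tmul]
    exact h a b c η y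

theorem map_add (S T : BiOp E F) : p.map q (S + T) = p.map q S + p.map q T :=
  BiOp.ext fun _ => HilbertModule.Tensor.map_add _ _ _ _

theorem map_sub (S T : BiOp E F) : p.map q (S - T) = p.map q S - p.map q T :=
  BiOp.ext fun _ => HilbertModule.Tensor.map_sub _ _ _ _

theorem map_smul (s : 𝕜) (T : BiOp E F) : p.map q (s • T) = s • p.map q T :=
  BiOp.ext fun _ => HilbertModule.Tensor.map_smul _ _ _ _

theorem map_neg (T : BiOp E F) : p.map q (-T) = -p.map q T := by
  rw [← neg_one_smul 𝕜 T, map_smul, neg_one_smul]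

theorem map_one : p.map p (BiOp.one E) = BiOp.one E' :=
  BiOp.ext fun _ => HilbertModule.Tensor.map_one _

theorem map_comp (S : BiOp F H) (T : BiOp E F) :
    p.map r (BiOp.comp S T) = BiOp.comp (q.map r S) (p.map q T) :=
  BiOp.ext fun _ => HilbertModule.Tensor.map_comp _ _ _ _ _

theorem map_adj (T : BiOp E F) : q.map p T.adj = (p.map q T).adj :=
  BiOp.ext fun _ => HilbertModule.Tensor.map_adj _ _ _

theorem map_gr (T : BiOp E F) : p.map q T.gr = (p.map q T).gr :=
  BiOp.ext fun _ => HilbertModule.Tensor.map_gr _ _ _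

theorem map_even (T : BiOp E F) : (p.map q T).even = p.map q T.even := by
  rw [BiOp.even, BiOp.even, map_smul, map_add, map_gr]

theorem map_odd (T : BiOp E F) : (p.map q T).odd = p.map q T.odd := by
  rw [BiOp.odd, BiOp.odd, map_smul, map_sub, map_gr]

variable {p q} in
theorem _root_.BiOp.IsDual.map {T : BiOp E F} (hT : T.IsDual) : (p.map q T).IsDual := by
  intro a a' x
  obtain ⟨h1, h2⟩ := hT a a' x
  rw [map_even, map_odd, map_at, map_at, map_at, map_at, p.map_eq, p.map_eq, q.map_eq]
  simp only [← HilbertModule.Tensor.map_comp, ← HilbertModule.Tensor.map_sub]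
  exact ⟨HilbertModule.Tensor.map_mem_compact _ _ h1, HilbertModule.Tensor.map_mem_compact _ _ h2⟩

variable {p q} in
theorem _root_.BiOp.IsLocallyCompact.map {T : BiOp E F} (hT : T.IsLocallyCompact) :
    (p.map q T).IsLocallyCompact := by
  intro a a' x
  obtain ⟨h1, h2⟩ := hT a a' x
  rw [map_at, map_at, p.map_eq, q.map_eq]
  simp only [← HilbertModule.Tensor.map_comp]
  exact ⟨HilbertModule.Tensor.map_mem_compact _ _ h1, HilbertModule.Tensor.map_mem_compact _ _ h2⟩

variable {p q} in
theorem _root_.BiOp.IsIntertwiner.map {T : BiOp E F} (hT : T.IsIntertwiner) :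
    (p.map q T).IsIntertwiner where
  degree := by rw [← map_gr, hT.degree]
  natural a a' x := by
    rw [map_at, map_at, p.map_eq, q.map_eq, ← HilbertModule.Tensor.map_comp,
      ← HilbertModule.Tensor.map_comp, hT.natural]

variable {p} in
theorem _root_.IsCycleMod.map {I : OpIdeal B} {I' : OpIdeal B'}
    (hI : ∀ {E F : HilbertModule B} {E' F' : HilbertModule B'} (t : HilbertModule.Tensor G E E')
      (q : HilbertModule.Tensor G F F') {T : Op E F}, T ∈ I.mem E F → t.map q T ∈ I'.mem E' F')
    {T : BiOp E E} (hT : IsCycleMod I E T) : IsCycleMod I' E' (p.map p T) where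
  degree := by rw [← map_gr, hT.degree, map_neg]
  adj a a' x := by
    rw [← map_adj, ← map_sub, map_at, p.map_eq, ← HilbertModule.Tensor.map_comp]
    exact hI _ _ (hT.adj a a' x)
  sq a a' x := by
    rw [← map_comp, ← map_one p, ← map_sub, map_at, p.map_eq, ← HilbertModule.Tensor.map_comp]
    exact hI _ _ (hT.sq a a' x)
  comm a a' x := by
    rw [map_at, map_at, p.map_eq, p.map_eq, ← HilbertModule.Tensor.map_comp,
      ← HilbertModule.Tensor.map_comp, ← HilbertModule.Tensor.map_sub]
    exact hI _ _ (hT.comm a a' x)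

variable {p} in
theorem _root_.IsCycle.map {T : BiOp E E} (hT : IsCycle E T) : IsCycle E' (p.map p T) :=
  isCycle_iff.2 ((isCycle_iff.1 hT).map fun t q _ h => t.map_mem_compact q h)

variable {p} in
theorem _root_.IsCycleMod.map_zero {T : BiOp E E} (hT : IsCycleMod (zeroIdeal B) E T) :
    IsCycleMod (zeroIdeal B') E' (p.map p T) :=
  hT.map fun t q T h => by
    rw [show T = 0 from h, HilbertModule.Tensor.map_zero]
    exact zero_mem _

variable {p q r} in
theorem _root_.IsBimoduleSum.map {i : BiOp E H} {j : BiOp F H} (h : IsBimoduleSum i j) :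
    IsBimoduleSum (p.map r i) (q.map r j) :=
  IsBimoduleSum.of_intertwiner h.intertwiner_left.map h.intertwiner_right.map
    (by rw [← map_adj, ← map_comp, h.isometry_left, map_one])
    (by rw [← map_adj, ← map_comp, h.isometry_right, map_one])
    (by rw [← map_adj, ← map_adj, ← map_comp, ← map_comp, ← map_add, h.complementary, map_one])

/-! ### Uniqueness -/

variable {E'' : Bimodule A B'} (p' : Pushforward G E E'')

/-- The unitary isomorphism between two tensor products. -/
def unitary : BiOp E' E'' := p.map p' (BiOp.one E)

theorem isIntertwiner_unitary : (p.unitary p').IsIntertwiner :=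
  (BiOp.IsIntertwiner.one E).map

theorem unitary_adj : (p.unitary p').adj = p'.unitary p := by
  rw [unitary, ← map_adj, BiOp.adj_one, unitary]

theorem unitary_comp_unitary : BiOp.comp (p'.unitary p) (p.unitary p') = BiOp.one E' := by
  rw [unitary, unitary, ← map_comp, BiOp.comp_one, map_one]

theorem unitary_adj_comp_unitary : BiOp.comp (p.unitary p').adj (p.unitary p') = BiOp.one E' := by
  rw [unitary_adj, unitary_comp_unitary]

theorem unitary_comp_unitary_adj : BiOp.comp (p.unitary p') (p.unitary p').adj = BiOp.one E'' := by
  rw [unitary_adj, unitary_comp_unitary]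

theorem unitary_comp_map (T : BiOp F E) :
    BiOp.comp (p.unitary p') (q.map p T) = q.map p' T := by
  rw [unitary, ← map_comp, BiOp.one_comp]

theorem map_comp_unitary (T : BiOp E F) :
    BiOp.comp (p'.map q T) (p.unitary p') = p.map q T := by
  rw [unitary, ← map_comp, BiOp.comp_one]

theorem conj_unitary {F'' : Bimodule A B'} (q' : Pushforward G F F'') (T : BiOp E F) :
    BiOp.comp (q.unitary q') (BiOp.comp (p.map q T) (p.unitary p').adj) = p'.map q' T := by
  rw [unitary_adj, map_comp_unitary, unitary_comp_map]

end Pushforward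

/-! ### Existence -/

section Existence

variable {𝕜 : Type} [RCLike 𝕜] {A : GradedCStarCategory.{v} 𝕜}
  {B B' : GradedCStarCategory.{u} 𝕜} (G : GradedFunctor B.toGradedStarCategory
  B'.toGradedStarCategory) (hB' : B'.SigmaUnital)

/-- The inner tensor product of a bimodule with `B'`. -/
def Bimodule.push (E : Bimodule A B) : Bimodule A B' where
  obj a := HilbertModule.tensor G (E.obj a) hB'
  map x := ((E.obj _).tensorTensor G hB').map ((E.obj _).tensorTensor G hB') (E.map x)
  map_add x y := by rw [E.map_add, HilbertModule.Tensor.map_add]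
  map_smul r x := by rw [E.map_smul, HilbertModule.Tensor.map_smul]
  map_comp x y := by rw [E.map_comp, HilbertModule.Tensor.map_comp]
  map_adj x := by rw [E.map_adj, HilbertModule.Tensor.map_adj]
  map_gr x := by rw [E.map_gr, HilbertModule.Tensor.map_gr]

/-- It is an inner tensor product. -/
def Bimodule.pushforward (E : Bimodule A B) : Pushforward G E (E.push G hB') where
  tmul {a} _ _ η y := ((E.obj a).tensorTensor G hB').tmul η y
  inner_tmul {a} _ _ _ _ := ((E.obj a).tensorTensor G hB').inner_tmul
  gr_tmul {a} _ _ := ((E.obj a).tensorTensor G hB').gr_tmul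
  map_tmul _ _ _ := HilbertModule.Tensor.map_tmul _ _ _ _ _
  dense a := ((E.obj a).tensorTensor G hB').dense

end Existence

section Diagonal

namespace UnitalGradedStarCategory

variable {𝕜 : Type} [RCLike 𝕜] {C : UnitalGradedStarCategory.{u, v} 𝕜} {n : ℕ}
  {P P' : Fin n → C.Obj}

theorem oneMatrix_self (P : Fin n → C.Obj) (i : Fin n) : C.oneMatrix P i i = C.one (P i) := by
  simp [oneMatrix]

/-- A diagonal matrix. -/
def diagonal (w : ∀ i, C.Hom (P i) (P' i)) : C.mat.Hom ⟨n, P⟩ ⟨n, P'⟩ :=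
  fun i j => C.comp (w i) (C.oneMatrix P i j)

theorem diagonal_comp (w : ∀ i, C.Hom (P i) (P' i)) {X : C.mat.Obj} (x : C.mat.Hom X ⟨n, P⟩)
    (i : Fin n) (j : Fin X.1) : C.mat.comp (diagonal w) x i j = C.comp (w i) (x i j) := by
  change ∑ k, C.comp (C.comp (w i) (C.oneMatrix P i k)) (x k j) = _
  simp only [C.assoc]
  rw [← C.comp_sum, C.sum_oneMatrix_comp]

theorem adj_diagonal (w : ∀ i, C.Hom (P i) (P' i)) (i j : Fin n) :
    C.mat.adj (diagonal w) i j = C.comp (C.oneMatrix P i j) (C.adj (w j)) := by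
  change C.adj (C.comp (w j) (C.oneMatrix P j i)) = _
  rw [C.adj_comp, C.adj_oneMatrix]

theorem comp_adj_diagonal (w : ∀ i, C.Hom (P i) (P' i)) {X : C.mat.Obj}
    (x : C.mat.Hom ⟨n, P⟩ X) (i : Fin X.1) (j : Fin n) :
    C.mat.comp x (C.mat.adj (diagonal w)) i j = C.comp (x i j) (C.adj (w j)) := by
  change ∑ k, C.comp (x i k) (C.mat.adj (diagonal w) k j) = _
  simp only [adj_diagonal, ← C.assoc]
  rw [← C.sum_comp, C.sum_comp_oneMatrix]

theorem isEvenUnitary_diagonal {w : ∀ i, C.Hom (P i) (P' i)} (hw : ∀ i, C.IsEvenUnitary (w i)) :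
    C.mat.IsEvenUnitary (diagonal w) where
  gr := funext fun i => funext fun j => by
    change C.gr (C.comp (w i) (C.oneMatrix P i j)) = _
    rw [C.gr_comp, (hw i).gr, C.gr_oneMatrix]
    rfl
  adj_comp_self := funext fun i => funext fun j => by
    change ∑ k, C.comp (C.mat.adj (diagonal w) i k) (C.comp (w k) (C.oneMatrix P k j)) = _
    simp only [adj_diagonal, C.assoc, (hw _).cancel_left]
    exact C.sum_oneMatrix_comp _ (fun k => C.oneMatrix P k j) i
  comp_adj_self := funext fun i => funext fun j => by
    refine (diagonal_comp w (C.mat.adj (diagonal w)) i j).trans ?_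
    rw [adj_diagonal]
    change _ = C.oneMatrix P' i j
    by_cases h : j = i
    · subst h
      rw [oneMatrix_self, oneMatrix_self, C.one_comp, (hw j).comp_adj_self]
    · rw [C.oneMatrix_of_ne P h, C.oneMatrix_of_ne P' h, C.zero_comp, C.comp_zero]

theorem GOne.mk_sub_mk_of_isEvenUnitary {w : ∀ i, C.Hom (P i) (P' i)}
    (hw : ∀ i, C.IsEvenUnitary (w i)) (x y : SS C P) (x' y' : SS C P')
    (hx : ∀ i j, x'.1 i j = C.comp (w i) (C.comp (x.1 i j) (C.adj (w j))))
    (hy : ∀ i j, y'.1 i j = C.comp (w i) (C.comp (y.1 i j) (C.adj (w j)))) :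
    GOne.mk C x' - GOne.mk C y' = GOne.mk C x - GOne.mk C y := by
  have h1 := (isEvenUnitary_diagonal hw).cl_sub_cl (isSupersymmetry_of_SS x)
    (isSupersymmetry_of_SS y)
  have h2 : ∀ (z : SS C P) (z' : SS C P'),
      (∀ i j, z'.1 i j = C.comp (w i) (C.comp (z.1 i j) (C.adj (w j)))) →
      z'.1 = C.mat.conj (a := ⟨n, P⟩) (b := ⟨n, P'⟩) (diagonal w) z.1 := by
    intro z z' hz
    funext i j
    refine (hz i j).trans (Eq.symm ((diagonal_comp w (C.mat.comp (a := ⟨n, P'⟩) (b := ⟨n, P⟩)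
      z.1 (C.mat.adj (diagonal w))) i j).trans ?_))
    exact congrArg (C.comp (w i)) (comp_adj_diagonal w (X := ⟨n, P⟩) z.1 i j)
  have h3 := (isSupersymmetry_of_SS x').cl_congr
    ((isEvenUnitary_diagonal hw).isSupersymmetry (isSupersymmetry_of_SS x)) (h2 x x' hx)
  have h4 := (isSupersymmetry_of_SS y').cl_congr
    ((isEvenUnitary_diagonal hw).isSupersymmetry (isSupersymmetry_of_SS y)) (h2 y y' hy)
  rw [← h3, ← h4] at h1
  exact h1

end UnitalGradedStarCategory

end Diagonal

/-! ## Functoriality in the second variable -/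

section Push

variable {𝕜 : Type} [RCLike 𝕜] {A : GradedCStarCategory.{v} 𝕜}
  {B B' : GradedCStarCategory.{u} 𝕜} {G : GradedFunctor B.toGradedStarCategory
  B'.toGradedStarCategory} {E F H : Bimodule A B} {E' F' H' : Bimodule A B'}

/-- The map induced by `T ↦ T ⊗ 1` on the quotients. -/
def QDHom.tensor (p : Pushforward G E E') (q : Pushforward G F F') (x : QDHom E F) :
    QDHom E' F' :=
  Quotient.liftOn' x (fun T => mk (p.map q T.1) (BiOp.IsDual.map T.2)) (by
    intro T T' hT
    rw [Submodule.quotientRel_def] at hT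
    refine mk_eq_mk.2 ?_
    have := BiOp.IsLocallyCompact.map (p := p) (q := q) (T := (T - T').1) hT
    rwa [Submodule.coe_sub, Pushforward.map_sub] at this)

theorem QDHom.continuous_tensor (p : Pushforward G E E') (q : Pushforward G F F') :
    Continuous (tensor p q) := by
  have h1 : Continuous fun T : BiOp E F => p.map q T := by
    refine (LipschitzWith.of_dist_le_mul (K := 6) fun S T => ?_).continuous
    rw [dist_eq_norm, dist_eq_norm, ← Pushforward.map_sub]
    exact p.norm_map_le q (S - T)
  have h2 : Continuous fun T : dualHom E F =>
      (⟨p.map q T.1, BiOp.IsDual.map T.2⟩ : dualHom E' F') :=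
    (h1.comp continuous_subtype_val).subtype_mk _
  exact continuous_quot_lift _ (continuous_quot_mk.comp h2)

variable (G) in
/-- The functor `QD(A, B) → QD(A, B')` induced by a graded C*-functor `G : B → B'`. -/
def QD.push (hB' : B'.SigmaUnital) : UnitalGradedFunctor (QD A B) (QD A B') where
  obj E := Bimodule.push G hB' E
  map x := QDHom.tensor (Bimodule.pushforward G hB' _) (Bimodule.pushforward G hB' _) x
  map_add := by
    intro E F x y
    induction x using QDHom.ind; induction y using QDHom.ind
    exact QDHom.mk_congr (Pushforward.map_add _ _ _ _) _ _
  map_smul := by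
    intro E F r x
    induction x using QDHom.ind
    exact QDHom.mk_congr (Pushforward.map_smul _ _ _ _) _ _
  map_comp := by
    intro E F H x y
    induction x using QDHom.ind; induction y using QDHom.ind
    exact QDHom.mk_congr (Pushforward.map_comp _ _ _ _ _) _ _
  map_adj := by
    intro E F x
    induction x using QDHom.ind
    exact QDHom.mk_congr (Pushforward.map_adj _ _ _) _ _
  map_gr := by
    intro E F x
    induction x using QDHom.ind
    exact QDHom.mk_congr (Pushforward.map_gr _ _ _) _ _
  map_one _ := QDHom.mk_congr (Pushforward.map_one _) _ _
  continuous_map := QDHom.continuous_tensor _ _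

theorem isEvenUnitary_unitary {E'' : Bimodule A B'} (p : Pushforward G E E')
    (p' : Pushforward G E E'') :
    (QD A B').IsEvenUnitary (a := E') (b := E'') (p.isIntertwiner_unitary p').toQD where
  gr := QDHom.mk_congr (p.isIntertwiner_unitary p').degree _ _
  adj_comp_self := QDHom.mk_congr (p.unitary_adj_comp_unitary p') _ _
  comp_adj_self := QDHom.mk_congr (p.unitary_comp_unitary_adj p') _ _

variable (hB' : B'.SigmaUnital)

theorem isPushforward_mapSS {n : ℕ} {P : Fin n → Bimodule A B} (x : SS (QD A B) P) :
    SS.IsPushforward (fun i => (P i).pushforward G hB') x ((QD.push G hB').mapSS x) := by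
  intro i j
  obtain ⟨T, hT, h⟩ : ∃ (T : BiOp (P j) (P i)) (hT : T.IsDual), x.1 i j = QDHom.mk T hT := by
    generalize x.1 i j = y
    induction y using QDHom.ind with
    | _ T hT => exact ⟨T, hT, rfl⟩
  exact ⟨T, hT, _, hT.map, Pushforward.isTensorOne_map _ _ T, h,
    congrArg (QDHom.tensor ((P j).pushforward G hB') ((P i).pushforward G hB')) h⟩

theorem mapGOne_push_sub {n : ℕ} {P : Fin n → Bimodule A B} {P' : Fin n → Bimodule A B'}
    {p : ∀ i, Pushforward G (P i) (P' i)} {x y : SS (QD A B) P} {x' y' : SS (QD A B') P'}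
    (hx : SS.IsPushforward p x x') (hy : SS.IsPushforward p y y') :
    GOne.mk (QD A B') x' - GOne.mk (QD A B') y'
      = (QD.push G hB').mapGOne (GOne.mk (QD A B) x - GOne.mk (QD A B) y) := by
  rw [map_sub]
  have key : ∀ {z : SS (QD A B) P} {z' : SS (QD A B') P'}, SS.IsPushforward p z z' → ∀ i j,
      z'.1 i j = (QD A B').comp (a := P' j) (b := (P i).push G hB') (c := P' i)
        (((P i).pushforward G hB').isIntertwiner_unitary (p i)).toQD
        ((QD A B').comp (a := P' j) (b := (P j).push G hB') (c := (P i).push G hB')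
          (((QD.push G hB').mapSS z).1 i j)
          ((QD A B').adj (((P j).pushforward G hB').isIntertwiner_unitary (p j)).toQD)) := by
    intro z z' hz i j
    obtain ⟨T, hT, T', hT', h1, h2, h3⟩ := hz i j
    have h4 : ((QD.push G hB').mapSS z).1 i j
        = QDHom.mk (((P j).pushforward G hB').map ((P i).pushforward G hB') T) hT.map :=
      congrArg (QDHom.tensor ((P j).pushforward G hB') ((P i).pushforward G hB')) h2
    rw [h3, h4]
    exact QDHom.mk_congr (h1.eq_map.trans (Pushforward.conj_unitary _ _ _ _ T).symm) _ _
  exact UnitalGradedStarCategory.GOne.mk_sub_mk_of_isEvenUnitary (C := QD A B')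
    (P := fun i => (P i).push G hB') (P' := P')
    (fun i => isEvenUnitary_unitary ((P i).pushforward G hB') (p i))
    ((QD.push G hB').mapSS x) ((QD.push G hB').mapSS y) x' y' (key hx) (key hy)

variable (G) in
/-- The cycle `(E ⊗ B', F ⊗ 1)`. -/
def KasparovCycle.push (c : KasparovCycle A B) : KasparovCycle A B' :=
  ⟨c.E.push G hB', (c.E.pushforward G hB').map (c.E.pushforward G hB') c.F, c.isCycle.map⟩

theorem KasparovCycle.isPushforward_push (c : KasparovCycle A B) :
    c.IsPushforward G (c.push G hB') :=
  ⟨c.E.pushforward G hB', Pushforward.isTensorOne_map _ _ _⟩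

theorem KasparovCycle.IsPushforward.mk_eq {c : KasparovCycle A B} {c' : KasparovCycle A B'}
    (h : c.IsPushforward G c') : KK.mk (c.push G hB') = KK.mk c' := by
  obtain ⟨p, hp⟩ := h
  refine KK.mk_eq_of_isSum KasparovCycle.isDegenerate_zero (KasparovCycle.IsSum.of_unitary
    ((c.E.pushforward G hB').isIntertwiner_unitary p) ?_ ?_ ?_)
  · exact Pushforward.unitary_adj_comp_unitary _ _
  · exact Pushforward.unitary_comp_unitary_adj _ _
  · rw [hp.eq_map]
    exact (Pushforward.map_comp_unitary _ _ _ _).trans (Pushforward.unitary_comp_map _ _ _ _).symm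

theorem KasparovCycle.IsSum.push {c₁ c₂ c : KasparovCycle A B} (h : c₁.IsSum c₂ c) :
    (c₁.push G hB').IsSum (c₂.push G hB') (c.push G hB') := by
  obtain ⟨i, j, hs, h1, h2⟩ := h
  refine ⟨_, _, hs.map (p := c₁.E.pushforward G hB') (q := c₂.E.pushforward G hB')
    (r := c.E.pushforward G hB'), ?_, ?_⟩
  · exact (Pushforward.map_comp _ _ _ _ _).symm.trans
      ((congrArg _ h1).trans (Pushforward.map_comp _ _ _ _ _))
  · exact (Pushforward.map_comp _ _ _ _ _).symm.trans
      ((congrArg _ h2).trans (Pushforward.map_comp _ _ _ _ _))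

theorem KasparovCycle.IsDegenerate.push {c : KasparovCycle A B} (h : c.IsDegenerate) :
    (c.push G hB').IsDegenerate :=
  KasparovCycle.isDegenerate_iff.2 (KasparovCycle.isDegenerate_iff.1 h).map_zero

theorem mapGOne_push_kClass {T : BiOp E E} (hT : IsCycle E T) :
    (QD.push G hB').mapGOne hT.kClass = (hT.map (p := E.pushforward G hB')).kClass := rfl

theorem KasparovCycle.IsIndex.push {c : KasparovCycle A B} {g : GOne (QD A B)}
    (h : c.IsIndex g) : (c.push G hB').IsIndex ((QD.push G hB').mapGOne g) := by
  obtain ⟨d, q, e, he, hd, hs, rfl⟩ := h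
  refine ⟨d.push G hB', q.push G hB', _, he.map_zero (p := q.E.pushforward G hB'), hd.push hB',
    hs.push hB', ?_⟩
  rw [map_sub, mapGOne_push_kClass, mapGOne_push_kClass]
  rfl

theorem KOne.equivKK_index (c : KasparovCycle A B) :
    KOne.equivKK A B ⟨c.index, c.index_mem⟩ = KK.mk c := c.toKK_index

variable (G) in
/-- The map `KK(A, B) → KK(A, B')`, `[(E, F)] ↦ [(E ⊗ B', F ⊗ 1)]`. -/
def KK.push (k : KK A B) : KK A B' :=
  KOne.equivKK A B' ((QD.push G hB').mapKOne ((KOne.equivKK A B).symm k))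

theorem KasparovCycle.IsPushforward.push_mk {c : KasparovCycle A B} {c' : KasparovCycle A B'}
    (h : c.IsPushforward G c') : KK.push G hB' (KK.mk c) = KK.mk c' := by
  rw [← h.mk_eq hB', ← KOne.equivKK_index c, ← KOne.equivKK_index (c.push G hB'), KK.push,
    AddEquiv.symm_apply_apply]
  refine congrArg _ (Subtype.ext ?_)
  exact (c.isIndex_index.push hB').unique (c.push G hB').isIndex_index

end Push

section Restrict

variable {𝕜 : Type} [RCLike 𝕜] {A A' : GradedCStarCategory.{v} 𝕜} {B : GradedCStarCategory.{u} 𝕜}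
  (H : GradedFunctor A'.toGradedStarCategory A.toGradedStarCategory)

theorem KOne.equivKK_mapKOne_restrict (k : KOne (QD A B)) :
    KOne.equivKK A' B ((QD.restrict H).mapKOne k) = KK.restrict H (KOne.equivKK A B k) := by
  obtain ⟨E, S, T, hS, hT, h⟩ := KOne.exists_eq k
  rw [KOne.equivKK_of_kClass hS hT h, KOne.equivKK_of_kClass (hS.restrict H) (hT.restrict H)]
  · exact (map_sub (KK.restrictHom H) (KK.mk ⟨E, S, hS⟩) (KK.mk ⟨E, T, hT⟩)).symm
  · change (QD.restrict H).mapGOne k.1 = _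
    rw [h, map_sub]
    rfl

end Restrict

end

theorem mainTheorem3 {𝕜 : Type} [RCLike 𝕜] :
    ∃ (grp : ∀ (A : GradedCStarCategory.{v} 𝕜) (B : GradedCStarCategory.{u} 𝕜),
        AddCommGroup (KK A B))
      (Φ : ∀ (A : GradedCStarCategory.{v} 𝕜) (B : GradedCStarCategory.{u} 𝕜),
        A.SigmaUnital → B.SigmaUnital → (letI := grp A B; KOne (QD A B) ≃+ KK A B)),
      -- the group structure of `KK(A, B)` is the one given by the direct sum of cycles
      (∀ (A : GradedCStarCategory.{v} 𝕜) (B : GradedCStarCategory.{u} 𝕜)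
        (c₁ c₂ : KasparovCycle A B),
        (∃ c, c₁.IsSum c₂ c) ∧
        ∀ c, c₁.IsSum c₂ c → (letI := grp A B; KK.mk c = KK.mk c₁ + KK.mk c₂)) ∧
      -- naturality in the first variable
      (∀ (A A' : GradedCStarCategory.{v} 𝕜) (B : GradedCStarCategory.{u} 𝕜)
        (hA : A.SigmaUnital) (hA' : A'.SigmaUnital) (hB : B.SigmaUnital)
        (H : GradedFunctor A'.toGradedStarCategory A.toGradedStarCategory) (k : KOne (QD A B)),
        Φ A' B hA' hB ((QD.restrict H).mapKOne k) = KK.restrict H (Φ A B hA hB k)) ∧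
      -- naturality in the second variable
      (∀ (A : GradedCStarCategory.{v} 𝕜) (B B' : GradedCStarCategory.{u} 𝕜)
        (hA : A.SigmaUnital) (hB : B.SigmaUnital) (hB' : B'.SigmaUnital)
        (G : GradedFunctor B.toGradedStarCategory B'.toGradedStarCategory),
        ∃ (gK : KOne (QD A B) →+ KOne (QD A B')) (gKK : KK A B → KK A B'),
          -- `gK` is the homomorphism induced by `E ↦ E ⊗ B'` and `T ↦ T ⊗ 1`
          (∀ (n : ℕ) (P : Fin n → Bimodule A B), ∃ (P' : Fin n → Bimodule A B')
            (p : ∀ i, Pushforward G (P i) (P' i)), ∀ x : SS (QD A B) P,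
              ∃ x' : SS (QD A B') P', SS.IsPushforward p x x') ∧
          (∀ (n : ℕ) (P : Fin n → Bimodule A B) (P' : Fin n → Bimodule A B')
            (p : ∀ i, Pushforward G (P i) (P' i)) (x y : SS (QD A B) P)
            (x' y' : SS (QD A B') P'), SS.IsPushforward p x x' → SS.IsPushforward p y y' →
              gK (KOne.diff (QD A B) x y) = KOne.diff (QD A B') x' y') ∧
          -- `gKK` is the map `[(E, F)] ↦ [(E ⊗ B', F ⊗ 1)]`
          (∀ c : KasparovCycle A B, ∃ c', c.IsPushforward G c') ∧
          (∀ (c : KasparovCycle A B) (c' : KasparovCycle A B'), c.IsPushforward G c' →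
            gKK (KK.mk c) = KK.mk c') ∧
          ∀ k : KOne (QD A B), Φ A B' hA hB' (gK k) = gKK (Φ A B hA hB k)) :=
  ⟨fun _ _ => inferInstance, fun A B _ _ => KOne.equivKK A B,
    fun _ _ c₁ c₂ => ⟨KasparovCycle.exists_isSum c₁ c₂, fun _ h => KK.mk_sum h⟩,
    fun _ _ _ _ _ _ H k => KOne.equivKK_mapKOne_restrict H k,
    fun _ _ _ _ _ hB' G => ⟨(QD.push G hB').mapKOne, KK.push G hB',
      fun _ P => ⟨_, fun i => (P i).pushforward G hB', fun x => ⟨_, isPushforward_mapSS hB' x⟩⟩,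
      fun _ _ _ _ _ _ _ _ hx hy => Subtype.ext (mapGOne_push_sub hB' hx hy).symm,
      fun c => ⟨_, c.isPushforward_push hB'⟩, fun _ _ h => h.push_mk hB',
      fun k => congrArg (fun k => KOne.equivKK _ _ ((QD.push G hB').mapKOne k))
        ((KOne.equivKK _ _).symm_apply_apply k).symm⟩⟩
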